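/- **Setting.** Let $M$ be a smooth surface, $n=2=p+q$, and let $g_0=\varepsilon_1(dx^1)^2+\varepsilon_2(dx^2)^2$, $\varepsilon_i=\pm1$, be the flat metric of signature $(p,q)$ on $\mathbb R^2$. With $x_i=\varepsilon_i x^i$, let $\mathrm o(p+1,q+1)$ be the Lie algebra of vector fields on $\mathbb R^2$ spanned by $\partial_i$, $x_i\partial_j-x_j\partial_i$, $x^i\partial_i$ and $x_jx^j\partial_i-2x_ix^j\partial_j$. Let $M$ carry a flat conformal structure: an atlas $\mathcal A$ of charts $\varphi:U_\varphi\to\mathbb R^2$ ("adapted charts") whose coordinate changes locally carry $\mathrm o(p+1,q+1)$ to itself. Let $\mathrm g$ be a pseudo-Riemannian metric on $M$ in the conformal class: for every $\varphi\in\mathcal A$ one has $\mathrm g=F^{-1}\varphi^*g_0$ on $U_\varphi$ with $F>0$. Let $\lambda,\mu\in\mathbb R$ and $\delta=\mu-\lambda$. $\mathcal F_\lambda$ is the space of smooth $\lambda$-densities on $M$; $\mathcal S^2_\delta$ is the space of symbols $P_2^{ij}\xi_i\xi_j+P_1^i\xi_i+P_0$ (symmetric contravariant tensor fields of degree $\le2$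 with values in the $\delta$-densities); $\mathcal D^2_{\lambda,\mu}$ is the space of differential operators $\mathcal F_\lambda\to\mathcal F_\mu$ of order $\le 2$. A linear map $\mathcal Q:\mathcal S^2_\delta\to\mathcal D^2_{\lambda,\mu}$ is *conformally equivariant* if, over every open subset of every adapted chart domain, it intertwines the Lie derivatives $L_X^\delta$ on symbols and $A\mapsto L_X^\mu A-AL_X^\lambda$ on operators, for all $X\in\mathrm o(p+1,q+1)$ (read in the adapted chart). It *preserves the principal symbol* if, for every symbol $P$ of degree $\le k$ $(k=0,1,2)$, $\mathcal Q(P)$ has order $\le k$ and its coefficient of order $k$ is $P_k$. **Theorem.** Suppose $\delta\notin\{\frac2n,\frac{n+2}{2n},1,\frac{n+1}n,\frac{n+2}n\}$ with $n=2$, i.e. $\delta\notin\{1,\frac32,2\}$. Then there is a linear isomorphism $\mathcal Q_{\lambda,\mu}:\mathcal S^2_\delta\to\mathcal D^2_{\lambda,\mu}$ that is conformally equivariant and preserves the principal symbol. It is the only conformally equivariant linear map that preserves the principal symbol (and if some adapted chart maps all of $M$ onto a convex open subset of $\mathbb R^2$, it is so even among the linear maps that are only required to be equivariant over all of $M$).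 For $P=P^{ij}\xi_i\xi_j$, on the domain of each $\varphi\in\mathcal A$ and in arbitrary local coordinates, $$ \begin{aligned} \mathcal Q_{\lambda,\mu}(P)={}&P^{ij}\nabla_i\nabla_j+\big(\beta_1\nabla_iP^{ij}+\beta_2\,\mathrm g^{ij}\mathrm g_{k\ell}\nabla_iP^{k\ell}\big)\nabla_j+\beta_3\nabla_i\nabla_j(P^{ij})+\beta_4\,\mathrm g^{ij}\mathrm g_{k\ell}\nabla_i\nabla_j(P^{k\ell})\\ &+\frac{4\lambda(\mu-1)}{2\delta-3}\Big(-S(\varphi)_{ij}P^{ij}+\frac1{8(\delta-1)}R\,\mathrm g_{ij}P^{ij}\Big). \end{aligned} $$ Here $\nabla$ is the Levi-Civita connection of $\mathrm g$, extended to densities (for $\phi\in\mathcal F_\lambda$, $\nabla_i\phi=\partial_i\phi-\lambda\Gamma^j_{ij}\phi$) and to tensor densities; $R$ is the scalar curvature of $\mathrm g$ (positive on round spheres); $$S(\varphi)=\frac1{2F}\nabla dF-\frac3{4F^2}\,dF\otimes dF+\frac1{8F^2}\,\mathrm g^{-1}(dF,dF)\,\mathrm g$$ is the (Osgood–Stowe/Carne)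 Schwarzian derivative of $\varphi$, where $\varphi^*g_0=F\mathrm g$; and, with $n=2$, $$\beta_1=\frac{2(n\lambda+1)}{2+n(1-\delta)},\qquad \beta_2=\frac{n(\lambda+\mu-1)}{(2+n(1-\delta))(2-n\delta)},\qquad \beta_3=\frac{n\lambda(n\lambda+1)}{(1+n(1-\delta))(2+n(1-\delta))},$$ $$\beta_4=\frac{n\lambda\big(n^2\mu(2-\lambda-\mu)+2(n\lambda+1)^2-n(n+1)\big)}{(1+n(1-\delta))(2+n(1-\delta))(2+n(1-2\delta))(2-n\delta)}.$$ -/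

import Mathlib

open scoped Manifold ContDiff Topology

noncomputable section

namespace ConfQuant

/-! ### Charts of a surface -/

/-- The model plane `ℝ²`. -/
abbrev Plane : Type := EuclideanSpace ℝ (Fin 2)

/-- The partial derivative `∂ᵢ u`. -/
def pd (i : Fin 2) (u : Plane → ℝ) (x : Plane) : ℝ :=
  fderiv ℝ u x (EuclideanSpace.single i 1)

/-- The local coordinate systems of the surface `M`: all charts of its maximal smooth atlas. -/
abbrev Chart (M : Type*) [TopologicalSpace M] [ChartedSpace Plane M] : Type _ :=
  {e : OpenPartialHomeomorph M Plane // e ∈ IsManifold.maximalAtlas (𝓡 2) ∞ M}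

section Surface

variable {M : Type*} [TopologicalSpace M] [ChartedSpace Plane M]

/-- The part of the coordinate domain of `e` on which the change of coordinates from `e` to `e'`
is defined. -/
def overlap (e e' : Chart M) : Set Plane := (e.1.symm.trans e'.1).source

/-- The change of coordinates from `e` to `e'`. -/
def transition (e e' : Chart M) (x : Plane) : Plane := e'.1 (e.1.symm x)

/-- The Jacobian matrix `Jᵃᵢ = ∂yᵃ/∂xⁱ` of the change of coordinates `x ↦ y` from `e` to `e'`. -/
def jac (e e' : Chart M) (x : Plane) : Matrix (Fin 2) (Fin 2) ℝ :=
  Matrix.of fun a i => pd i (fun z => transition e e' z a) x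

/-! ### Densities, symbols and metrics

Tensor fields are given by their components in all charts, smooth on the coordinate domain and
subject to the transformation law. Outside the coordinate domain the components are set to `0`,
so that two fields are equal exactly when they have the same components. -/

variable (M) in
/-- Tensor densities of degree `w`, `φ = f |dx¹ ∧ dx²|ʷ`. -/
def Density (w : ℝ) : Submodule ℝ (Chart M → Plane → ℝ) where
  carrier := {f |
    (∀ e, ContDiffOn ℝ ∞ (f e) e.1.target) ∧
    (∀ e, ∀ x ∉ e.1.target, f e x = 0) ∧
    (∀ e e', ∀ x ∈ overlap e e',
      f e x = |(jac e e' x).det| ^ w * f e' (transition e e' x))}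
  zero_mem' := ⟨fun _ => contDiffOn_const, fun _ _ _ => rfl, fun _ _ _ _ => by simp⟩
  add_mem' := by
    rintro f g ⟨hf₁, hf₂, hf₃⟩ ⟨hg₁, hg₂, hg₃⟩
    refine ⟨fun e => (hf₁ e).add (hg₁ e), fun e x hx => ?_, fun e e' x hx => ?_⟩
    · simp [hf₂ e x hx, hg₂ e x hx]
    · simp only [Pi.add_apply, hf₃ e e' x hx, hg₃ e e' x hx]
      ring
  smul_mem' := by
    rintro c f ⟨hf₁, hf₂, hf₃⟩
    refine ⟨fun e => (hf₁ e).const_smul c, fun e x hx => ?_, fun e e' x hx => ?_⟩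
    · simp [hf₂ e x hx]
    · simp only [Pi.smul_apply, smul_eq_mul, hf₃ e e' x hx]
      ring

variable (M) in
/-- Symbols `Pⁱ ξᵢ`, homogeneous of degree one, with values in the densities of degree `w`. -/
def Symbol₁ (w : ℝ) : Submodule ℝ (Chart M → Plane → Fin 2 → ℝ) where
  carrier := {P |
    (∀ e i, ContDiffOn ℝ ∞ (fun x => P e x i) e.1.target) ∧
    (∀ e, ∀ x ∉ e.1.target, ∀ i, P e x i = 0) ∧
    (∀ e e', ∀ x ∈ overlap e e', ∀ a,
      ∑ i, jac e e' x a i * P e x i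
        = |(jac e e' x).det| ^ w * P e' (transition e e' x) a)}
  zero_mem' := ⟨fun _ _ => contDiffOn_const, fun _ _ _ _ => rfl, fun _ _ _ _ _ => by simp⟩
  add_mem' := by
    rintro f g ⟨hf₁, hf₂, hf₃⟩ ⟨hg₁, hg₂, hg₃⟩
    refine ⟨fun e i => (hf₁ e i).add (hg₁ e i), fun e x hx i => ?_, fun e e' x hx a => ?_⟩
    · simp [hf₂ e x hx, hg₂ e x hx]
    · simp only [Pi.add_apply, mul_add, Finset.sum_add_distrib, hf₃ e e' x hx, hg₃ e e' x hx]
  smul_mem' := by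
    rintro c f ⟨hf₁, hf₂, hf₃⟩
    refine ⟨fun e i => (hf₁ e i).const_smul c, fun e x hx i => ?_, fun e e' x hx a => ?_⟩
    · simp [hf₂ e x hx]
    · have h := congrArg (c * ·) (hf₃ e e' x hx a)
      simp only [Finset.mul_sum] at h
      simp only [Pi.smul_apply, smul_eq_mul]
      rw [mul_left_comm, ← h]
      exact Finset.sum_congr rfl fun i _ => by ring

variable (M) in
/-- Symbols `Pⁱʲ ξᵢ ξⱼ`, homogeneous of degree two, with values in the densities of degree `w`. -/
def Symbol₂ (w : ℝ) : Submodule ℝ (Chart M → Plane → Matrix (Fin 2) (Fin 2) ℝ) where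
  carrier := {P |
    (∀ e i j, ContDiffOn ℝ ∞ (fun x => P e x i j) e.1.target) ∧
    (∀ e, ∀ x ∉ e.1.target, ∀ i j, P e x i j = 0) ∧
    (∀ e x i j, P e x i j = P e x j i) ∧
    (∀ e e', ∀ x ∈ overlap e e', ∀ a b,
      ∑ i, ∑ j, jac e e' x a i * jac e e' x b j * P e x i j
        = |(jac e e' x).det| ^ w * P e' (transition e e' x) a b)}
  zero_mem' := ⟨fun _ _ _ => contDiffOn_const, fun _ _ _ _ _ => rfl, fun _ _ _ _ => rfl,
    fun _ _ _ _ _ _ => by simp⟩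
  add_mem' := by
    rintro f g ⟨hf₁, hf₂, hf₃, hf₄⟩ ⟨hg₁, hg₂, hg₃, hg₄⟩
    refine ⟨fun e i j => (hf₁ e i j).add (hg₁ e i j), fun e x hx i j => ?_,
      fun e x i j => ?_, fun e e' x hx a b => ?_⟩
    · simp [hf₂ e x hx, hg₂ e x hx]
    · simp [hf₃ e x i j, hg₃ e x i j]
    · simp only [Pi.add_apply, Matrix.add_apply, mul_add, Finset.sum_add_distrib,
        hf₄ e e' x hx, hg₄ e e' x hx]
  smul_mem' := by
    rintro c f ⟨hf₁, hf₂, hf₃, hf₄⟩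
    refine ⟨fun e i j => (hf₁ e i j).const_smul c, fun e x hx i j => ?_,
      fun e x i j => ?_, fun e e' x hx a b => ?_⟩
    · simp [hf₂ e x hx]
    · simp [hf₃ e x i j]
    · have h := congrArg (c * ·) (hf₄ e e' x hx a b)
      simp only [Finset.mul_sum] at h
      simp only [Pi.smul_apply, Matrix.smul_apply, smul_eq_mul]
      rw [mul_left_comm, ← h]
      exact Finset.sum_congr rfl fun i _ => Finset.sum_congr rfl fun j _ => by ring

variable (M) in
/-- The space `𝒮²_w` of symbols `P₂ⁱʲ ξᵢ ξⱼ + P₁ⁱ ξᵢ + P₀` of degree at most two, with values in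
the densities of degree `w`. -/
abbrev Symbol (w : ℝ) : Type _ := Symbol₂ M w × Symbol₁ M w × Density M w

variable (M) in
/-- Pseudo-Riemannian metrics on the surface. -/
structure Metric where
  comp : Chart M → Plane → Matrix (Fin 2) (Fin 2) ℝ
  smooth : ∀ e i j, ContDiffOn ℝ ∞ (fun x => comp e x i j) e.1.target
  symm : ∀ e, ∀ x ∈ e.1.target, ∀ i j, comp e x i j = comp e x j i
  nondegenerate : ∀ e, ∀ x ∈ e.1.target, (comp e x).det ≠ 0
  transform : ∀ e e', ∀ x ∈ overlap e e', ∀ i j,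
    comp e x i j
      = ∑ a, ∑ b, jac e e' x a i * jac e e' x b j * comp e' (transition e e' x) a b

/-! ### Differential operators of order at most two -/

/-- In the coordinates `e`, the operator `A` is `a₂ⁱʲ ∂ᵢ ∂ⱼ + a₁ⁱ ∂ᵢ + a₀`, with smooth
coefficients and `a₂` symmetric. -/
def HasExpr {l m : ℝ} (A : Density M l →ₗ[ℝ] Density M m) (e : Chart M)
    (a₂ : Plane → Matrix (Fin 2) (Fin 2) ℝ) (a₁ : Plane → Fin 2 → ℝ) (a₀ : Plane → ℝ) : Prop :=
  (∀ i j, ContDiffOn ℝ ∞ (fun x => a₂ x i j) e.1.target) ∧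
  (∀ i, ContDiffOn ℝ ∞ (fun x => a₁ x i) e.1.target) ∧
  ContDiffOn ℝ ∞ a₀ e.1.target ∧
  (∀ x ∈ e.1.target, ∀ i j, a₂ x i j = a₂ x j i) ∧
  ∀ f : Density M l, ∀ x ∈ e.1.target,
    (A f).1 e x = ∑ i, ∑ j, a₂ x i j * pd i (pd j (f.1 e)) x
      + ∑ i, a₁ x i * pd i (f.1 e) x + a₀ x * f.1 e x

variable (M) in
/-- The space `𝒟²_{l,m}` of differential operators of order at most two from densities of degree
`l` to densities of degree `m`. -/
def DiffOp₂ (l m : ℝ) : Submodule ℝ (Density M l →ₗ[ℝ] Density M m) where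
  carrier := {A | ∀ e, ∃ a₂ a₁ a₀, HasExpr A e a₂ a₁ a₀}
  zero_mem' := fun _ => ⟨0, 0, 0, fun _ _ => contDiffOn_const, fun _ => contDiffOn_const,
    contDiffOn_const, fun _ _ _ _ => rfl, fun _ _ _ => by simp⟩
  add_mem' := by
    intro A B hA hB e
    obtain ⟨a₂, a₁, a₀, h₂, h₁, h₀, hs, h⟩ := hA e
    obtain ⟨b₂, b₁, b₀, k₂, k₁, k₀, ks, k⟩ := hB e
    refine ⟨a₂ + b₂, a₁ + b₁, a₀ + b₀, fun i j => (h₂ i j).add (k₂ i j),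
      fun i => (h₁ i).add (k₁ i), h₀.add k₀, fun x hx i j => ?_, fun f x hx => ?_⟩
    · simp [hs x hx i j, ks x hx i j]
    · have e₁ : ((A + B) f).1 e x = (A f).1 e x + (B f).1 e x := rfl
      rw [e₁, h f x hx, k f x hx]
      simp only [Pi.add_apply, Matrix.add_apply, add_mul, Finset.sum_add_distrib]
      ring
  smul_mem' := by
    intro c A hA e
    obtain ⟨a₂, a₁, a₀, h₂, h₁, h₀, hs, h⟩ := hA e
    refine ⟨c • a₂, c • a₁, c • a₀, fun i j => (h₂ i j).const_smul c,
      fun i => (h₁ i).const_smul c, h₀.const_smul c, fun x hx i j => ?_, fun f x hx => ?_⟩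
    · simp [hs x hx i j]
    · have e₁ : ((c • A) f).1 e x = c * (A f).1 e x := rfl
      rw [e₁, h f x hx]
      simp only [Pi.smul_apply, Matrix.smul_apply, smul_eq_mul, mul_add, Finset.mul_sum, mul_assoc]

/-- The map `Q` preserves the principal symbol at each order: the principal symbol of `Q(P)` is the
highest-order component of `P`, for symbols `P` of degree at most two, one and zero. -/
def PreservesSymbol {l m w : ℝ} (Q : Symbol M w →ₗ[ℝ] DiffOp₂ M l m) : Prop :=
  ∀ (P : Symbol M w) (e : Chart M),
    (∃ a₁ a₀, HasExpr (Q P).1 e (P.1.1 e) a₁ a₀) ∧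
    (P.1 = 0 → ∃ a₀, HasExpr (Q P).1 e 0 (P.2.1.1 e) a₀) ∧
    (P.1 = 0 → P.2.1 = 0 → HasExpr (Q P).1 e 0 0 (P.2.2.1 e))

end Surface

/-! ### Lie derivatives in coordinates -/

/-- The divergence `∂ₖ Xᵏ`. -/
def divergence (X : Plane → Fin 2 → ℝ) (x : Plane) : ℝ := ∑ k, pd k (fun z => X z k) x

/-- The Lie derivative of densities of degree `w`. -/
def lie₀ (w : ℝ) (X : Plane → Fin 2 → ℝ) (f : Plane → ℝ) (x : Plane) : ℝ :=
  ∑ k, X x k * pd k f x + w * divergence X x * f x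

/-- The Lie derivative of symbols `Pⁱ ξᵢ` of weight `w`. -/
def lie₁ (w : ℝ) (X : Plane → Fin 2 → ℝ) (P : Plane → Fin 2 → ℝ) (x : Plane) (i : Fin 2) : ℝ :=
  ∑ k, X x k * pd k (fun z => P z i) x - ∑ k, pd k (fun z => X z i) x * P x k
    + w * divergence X x * P x i

/-- The Lie derivative of symbols `Pⁱʲ ξᵢ ξⱼ` of weight `w`. -/
def lie₂ (w : ℝ) (X : Plane → Fin 2 → ℝ) (P : Plane → Matrix (Fin 2) (Fin 2) ℝ) (x : Plane)
    (i j : Fin 2) : ℝ :=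
  ∑ k, X x k * pd k (fun z => P z i j) x
    - ∑ k, pd k (fun z => X z i) x * P x k j - ∑ k, pd k (fun z => X z j) x * P x i k
    + w * divergence X x * P x i j

/-! ### The conformal Lie algebra and flat conformal structures

The flat metric is `g₀ = diag(ε₀, ε₁)` with `εᵢ = ±1`, and `xᵢ = εᵢ xⁱ`. -/

/-- The vector field `Xᵢ = ∂ᵢ`. -/
def translationField (i : Fin 2) : Plane → Fin 2 → ℝ := fun _ => Pi.single i 1

/-- The vector field `Xᵢⱼ = xᵢ ∂ⱼ - xⱼ ∂ᵢ`. -/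
def rotationField (ε : Fin 2 → ℝ) (i j : Fin 2) : Plane → Fin 2 → ℝ :=
  fun x => (ε i * x i) • Pi.single j 1 - (ε j * x j) • Pi.single i 1

/-- The vector field `X₀ = xⁱ ∂ᵢ`. -/
def homothetyField : Plane → Fin 2 → ℝ := fun x k => x k

/-- The vector field `X̄ᵢ = xⱼ xʲ ∂ᵢ - 2 xᵢ xʲ ∂ⱼ`. -/
def inversionField (ε : Fin 2 → ℝ) (i : Fin 2) : Plane → Fin 2 → ℝ :=
  fun x => (∑ j, ε j * x j * x j) • Pi.single i 1 - (2 * (ε i * x i)) • (fun k => x k)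

/-- The conformal Lie algebra `o(p+1,q+1)` of vector fields on the plane. -/
def confAlg (ε : Fin 2 → ℝ) : Submodule ℝ (Plane → Fin 2 → ℝ) :=
  Submodule.span ℝ (Set.range translationField ∪ Set.range (fun p : Fin 2 × Fin 2 =>
    rotationField ε p.1 p.2) ∪ {homothetyField} ∪ Set.range (inversionField ε))

section Surface

variable {M : Type*} [TopologicalSpace M] [ChartedSpace Plane M]

/-- A flat conformal structure, given by a set `𝒜` of adapted charts: they cover the surface, and
the changes of adapted coordinates locally carry the fields of `o(p+1,q+1)` to fields of
`o(p+1,q+1)`. -/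
def IsConfAtlas (ε : Fin 2 → ℝ) (𝒜 : Set (Chart M)) : Prop :=
  (∀ p : M, ∃ c ∈ 𝒜, p ∈ c.1.source) ∧
  ∀ c ∈ 𝒜, ∀ c' ∈ 𝒜, ∀ X ∈ confAlg ε, ∀ x ∈ overlap c c', ∃ Y ∈ confAlg ε,
    ∀ᶠ z in 𝓝 x, ∀ a, Y (transition c c' z) a = ∑ i, jac c c' z a i * X z i

/-- `g = F⁻¹ φ^* g₀` with `F > 0` on the domain of the chart `φ`; the components of `φ^* g₀` in the
coordinates `e` are `∑ₐ εₐ ∂ᵢφᵃ ∂ⱼφᵃ`. -/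
def Uniformizes (ε : Fin 2 → ℝ) (g : Metric M) (φ : Chart M) (F : M → ℝ) : Prop :=
  (∀ p ∈ φ.1.source, 0 < F p) ∧
  ∀ e : Chart M, ∀ x ∈ overlap e φ, ∀ i j,
    g.comp e x i j = (F (e.1.symm x))⁻¹ * ∑ a, ε a * jac e φ x a i * jac e φ x a j

/-- The map `Q` intertwines, over the part `V` of the domain of the adapted chart `c`, the actions
of `o(p+1,q+1)` on symbols and on differential operators. That is, over `V`,
`Q(L_X P) = L_X ∘ Q(P) - Q(P) ∘ L_X`, where `P'` and `f'` are equal to `L_X P` and `L_X f`. -/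
def EquivariantOn (ε : Fin 2 → ℝ) {l m w : ℝ} (Q : Symbol M w →ₗ[ℝ] DiffOp₂ M l m)
    (c : Chart M) (V : Set Plane) : Prop :=
  ∀ X ∈ confAlg ε, ∀ (P P' : Symbol M w) (f f' : Density M l),
    (∀ x ∈ V, ∀ i j, P'.1.1 c x i j = lie₂ w X (P.1.1 c) x i j) →
    (∀ x ∈ V, ∀ i, P'.2.1.1 c x i = lie₁ w X (P.2.1.1 c) x i) →
    (∀ x ∈ V, P'.2.2.1 c x = lie₀ w X (P.2.2.1 c) x) →
    (∀ x ∈ V, f'.1 c x = lie₀ l X (f.1 c) x) →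
    ∀ x ∈ V, ((Q P').1 f).1 c x
      = lie₀ m X (((Q P).1 f).1 c) x - ((Q P).1 f').1 c x

/-- Conformal equivariance: `Q` intertwines the local actions of `o(p+1,q+1)` defined by the adapted
charts, over every open subset of their domains. -/
def ConfEquivariant (ε : Fin 2 → ℝ) (𝒜 : Set (Chart M)) {l m w : ℝ}
    (Q : Symbol M w →ₗ[ℝ] DiffOp₂ M l m) : Prop :=
  ∀ c ∈ 𝒜, ∀ V ⊆ c.1.target, IsOpen V → EquivariantOn ε Q c V

end Surface

/-! ### Covariant derivatives, curvature and Schwarzian derivative in coordinates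

`G` denotes the components of the metric. -/

/-- The Christoffel symbols `Γᵏᵢⱼ`. -/
def christoffel (G : Plane → Matrix (Fin 2) (Fin 2) ℝ) (k i j : Fin 2) (x : Plane) : ℝ :=
  (1 / 2) * ∑ l, (G x)⁻¹ k l *
    (pd i (fun z => G z l j) x + pd j (fun z => G z l i) x - pd l (fun z => G z i j) x)

/-- `Γᵢ = Γʲᵢⱼ`. -/
def christoffelTrace (G : Plane → Matrix (Fin 2) (Fin 2) ℝ) (i : Fin 2) (x : Plane) : ℝ :=
  ∑ j, christoffel G j i j x

/-- `∇ᵢ f`, for a density `f` of degree `w`. -/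
def covD (G : Plane → Matrix (Fin 2) (Fin 2) ℝ) (w : ℝ) (f : Plane → ℝ) (i : Fin 2)
    (x : Plane) : ℝ :=
  pd i f x - w * christoffelTrace G i x * f x

/-- `∇ᵢ ∇ⱼ f`, for a density `f` of degree `w`. -/
def covDD (G : Plane → Matrix (Fin 2) (Fin 2) ℝ) (w : ℝ) (f : Plane → ℝ) (i j : Fin 2)
    (x : Plane) : ℝ :=
  pd i (covD G w f j) x - ∑ k, christoffel G k i j x * covD G w f k x
    - w * christoffelTrace G i x * covD G w f j x

/-- `∇ₖ Pⁱʲ`, for a symbol `P` of weight `w`. -/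
def covP (G : Plane → Matrix (Fin 2) (Fin 2) ℝ) (w : ℝ) (P : Plane → Matrix (Fin 2) (Fin 2) ℝ)
    (k i j : Fin 2) (x : Plane) : ℝ :=
  pd k (fun z => P z i j) x + ∑ s, christoffel G i k s x * P x s j
    + ∑ s, christoffel G j k s x * P x i s - w * christoffelTrace G k x * P x i j

/-- `∇ᵢ ∇ⱼ Pᵏʳ`, for a symbol `P` of weight `w`. -/
def covPP (G : Plane → Matrix (Fin 2) (Fin 2) ℝ) (w : ℝ) (P : Plane → Matrix (Fin 2) (Fin 2) ℝ)
    (i j k r : Fin 2) (x : Plane) : ℝ :=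
  pd i (covP G w P j k r) x - ∑ s, christoffel G s i j x * covP G w P s k r x
    + ∑ s, christoffel G k i s x * covP G w P j s r x
    + ∑ s, christoffel G r i s x * covP G w P j k s x
    - w * christoffelTrace G i x * covP G w P j k r x

/-- The Ricci tensor `Rᵢⱼ`. -/
def ricci (G : Plane → Matrix (Fin 2) (Fin 2) ℝ) (i j : Fin 2) (x : Plane) : ℝ :=
  ∑ k, (pd k (christoffel G k i j) x - pd j (christoffel G k i k) x
    + ∑ s, (christoffel G k k s x * christoffel G s i j x
      - christoffel G k j s x * christoffel G s i k x))

/-- The scalar curvature `R = gⁱʲ Rᵢⱼ` (positive on round spheres). -/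
def scalarCurvature (G : Plane → Matrix (Fin 2) (Fin 2) ℝ) (x : Plane) : ℝ :=
  ∑ i, ∑ j, (G x)⁻¹ i j * ricci G i j x

/-- The components of the Schwarzian derivative
`S(φ) = (1/2F) ∇dF - (3/4F²) dF ⊗ dF + (1/8F²) g⁻¹(dF,dF) g` of `φ`, where `φ^* g₀ = F g`. -/
def schwarzian (G : Plane → Matrix (Fin 2) (Fin 2) ℝ) (F : Plane → ℝ) (i j : Fin 2)
    (x : Plane) : ℝ :=
  1 / (2 * F x) * (pd i (pd j F) x - ∑ k, christoffel G k i j x * pd k F x)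
    - 3 / (4 * F x ^ 2) * (pd i F x * pd j F x)
    + 1 / (8 * F x ^ 2) * (∑ k, ∑ r, (G x)⁻¹ k r * pd k F x * pd r F x) * G x i j

/-! ### The coefficients, in dimension `n`, and the formula -/

def β₁ (n l m : ℝ) : ℝ := 2 * (n * l + 1) / (2 + n * (1 - (m - l)))

def β₂ (n l m : ℝ) : ℝ :=
  n * (l + m - 1) / ((2 + n * (1 - (m - l))) * (2 - n * (m - l)))

def β₃ (n l m : ℝ) : ℝ :=
  n * l * (n * l + 1) / ((1 + n * (1 - (m - l))) * (2 + n * (1 - (m - l))))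

def β₄ (n l m : ℝ) : ℝ :=
  n * l * (n ^ 2 * m * (2 - l - m) + 2 * (n * l + 1) ^ 2 - n * (n + 1)) /
    ((1 + n * (1 - (m - l))) * (2 + n * (1 - (m - l))) * (2 + n * (1 - 2 * (m - l)))
      * (2 - n * (m - l)))

/-- The right-hand side of the explicit formula on surfaces, in coordinates: the value at `x` of the
operator attached to `Pⁱʲ ξᵢ ξⱼ` applied to the `l`-density `f`. -/
def surfaceFormula (l m : ℝ) (G : Plane → Matrix (Fin 2) (Fin 2) ℝ) (F : Plane → ℝ)
    (P : Plane → Matrix (Fin 2) (Fin 2) ℝ) (f : Plane → ℝ) (x : Plane) : ℝ :=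
  ∑ i, ∑ j, P x i j * covDD G l f i j x
    + ∑ j, (β₁ 2 l m * ∑ i, covP G (m - l) P i i j x
        + β₂ 2 l m * ∑ i, ∑ k, ∑ r, (G x)⁻¹ i j * G x k r * covP G (m - l) P i k r x)
      * covD G l f j x
    + (β₃ 2 l m * ∑ i, ∑ j, covPP G (m - l) P i j i j x
        + β₄ 2 l m * ∑ i, ∑ j, ∑ k, ∑ r,
            (G x)⁻¹ i j * G x k r * covPP G (m - l) P i j k r x
        + 4 * l * (m - 1) / (2 * (m - l) - 3) *
          (-(∑ i, ∑ j, schwarzian G F i j x * P x i j)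
            + 1 / (8 * ((m - l) - 1)) * scalarCurvature G x * ∑ i, ∑ j, G x i j * P x i j))
      * f x

end ConfQuant

end

open scoped Manifold ContDiff Topology

noncomputable section

namespace ConfQuant


/-! ### Calculus of partial derivatives -/

/-! Existence. In an adapted chart the metric is F⁻¹g₀. There the right-hand side of the formula
does not depend on F: all terms containing derivatives of log F cancel, thanks to the Schwarzian and
curvature corrections, and the flat operator `flatA`, built from partial derivatives with constant
coefficients, remains (`IsConfConn.quant`). The flat operator is equivariant because a conformal
field X differentiates to a dilation plus a rotation: translations, rotations and the dilation cause
no defect, and the inversions contribute only terms linear in the constant gradient of div X, which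
vanish by four relations between the β's (`flatA_lie`). Symbols of degree one are treated by
`flatA₁_lie`.

To glue, the formula must make sense on all of M. It is natural under arbitrary changes of
coordinates (`FrameChange.quant_eq`), once the Schwarzian derivative is a tensor that does not
depend on the adapted chart. That independence is `schwarzian_unique`. A transition ψ between
adapted charts satisfies ψ^*g₀ = h g₀, and in dimension two this alone says little. But ψ carries
the translations and the dilation to quadratic fields, and the divergences of these fields give an
overdetermined system for log h, which says that its flat Schwarzian vanishes (`conformal_factor`).

Uniqueness. The difference D of two solutions lowers the order. Equivariance under X = 0 makes D
local. Equivariance under the fields that vanish at a point x₀ makes the leading remaining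
coefficient of D(P) at x₀ an invariant linear functional of P. Nothing is assumed about the
continuity of such functionals. The dilation about x₀ makes them homogeneous, and a homogeneous
functional of degree k that vanishes on the forms of degree k vanishes on all smooth functions: by
Hadamard's lemma and the solvability of (E+1)z = w for the Euler field E, every function of higher
vanishing order lies in the image of E-k. The finitely many values on forms are killed by rotations
and inversions when δ is not 1, 3/2 or 2 (`invariant_functional₁_eq_zero`,
`invariant_vector_functional₂_eq_zero`, `invariant_functional₂_eq_zero`).

Bijectivity is triangularity with respect to the order (`PreservesSymbol.bijective`).

All tensor computations take place in the ring `Sf U` of smooth functions on an open set with its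
two commuting derivations. There they become polynomial identities, and `Sf.ev` carries them back to
values at points. -/

lemma pd_congr {i : Fin 2} {u v : Plane → ℝ} {x : Plane} (h : u =ᶠ[𝓝 x] v) :
    pd i u x = pd i v x := by
  rw [pd, pd, h.fderiv_eq]

lemma pd_congr_on {i : Fin 2} {u v : Plane → ℝ} {U : Set Plane} (hU : IsOpen U)
    (h : ∀ y ∈ U, u y = v y) {x : Plane} (hx : x ∈ U) : pd i u x = pd i v x :=
  pd_congr (Filter.eventually_of_mem (hU.mem_nhds hx) h)

lemma pd_add {i : Fin 2} {u v : Plane → ℝ} {x : Plane} (hu : DifferentiableAt ℝ u x)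
    (hv : DifferentiableAt ℝ v x) : pd i (fun y => u y + v y) x = pd i u x + pd i v x := by
  simp only [pd]
  rw [fderiv_fun_add hu hv]; rfl

lemma pd_mul {i : Fin 2} {u v : Plane → ℝ} {x : Plane} (hu : DifferentiableAt ℝ u x)
    (hv : DifferentiableAt ℝ v x) :
    pd i (fun y => u y * v y) x = u x * pd i v x + v x * pd i u x := by
  simp only [pd]
  rw [fderiv_fun_mul hu hv]; rfl

lemma pd_const (i : Fin 2) (c : ℝ) (x : Plane) : pd i (fun _ => c) x = 0 := by
  simp [pd]

lemma pd_const_mul {i : Fin 2} {u : Plane → ℝ} {x : Plane} (c : ℝ)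
    (hu : DifferentiableAt ℝ u x) : pd i (fun y => c * u y) x = c * pd i u x := by
  rw [pd_mul (differentiableAt_const c) hu, pd_const]; ring

lemma pd_coord (i j : Fin 2) (x : Plane) :
    pd i (fun y : Plane => y j) x = if i = j then 1 else 0 := by
  have : (fun y : Plane => y j) = (EuclideanSpace.proj j : Plane →L[ℝ] ℝ) := rfl
  rw [pd, this, ContinuousLinearMap.fderiv]
  simp [eq_comm]

lemma contDiffOn_pd {u : Plane → ℝ} {U : Set Plane} (hU : IsOpen U) (hu : ContDiffOn ℝ ∞ u U)
    (i : Fin 2) : ContDiffOn ℝ ∞ (pd i u) U :=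
  (hu.fderiv_of_isOpen hU (m := ∞) (by simp)).clm_apply contDiffOn_const

lemma differentiableAt_of_contDiffOn {u : Plane → ℝ} {U : Set Plane} (hU : IsOpen U)
    (hu : ContDiffOn ℝ ∞ u U) {x : Plane} (hx : x ∈ U) : DifferentiableAt ℝ u x :=
  (hu.contDiffAt (hU.mem_nhds hx)).differentiableAt (by simp)

lemma pd_comm {u : Plane → ℝ} {U : Set Plane} (hU : IsOpen U) (hu : ContDiffOn ℝ ∞ u U)
    {x : Plane} (hx : x ∈ U) (i j : Fin 2) : pd i (pd j u) x = pd j (pd i u) x := by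
  have hs : ContDiffAt ℝ ∞ u x := hu.contDiffAt (hU.mem_nhds hx)
  have hsym := (hs.of_le (m := 2) (WithTop.coe_le_coe.2 le_top)).isSymmSndFDerivAt (by simp)
  have hd : DifferentiableAt ℝ (fderiv ℝ u) x :=
    (hs.fderiv_right (m := 1) (WithTop.coe_le_coe.2 le_top)).differentiableAt one_ne_zero
  have key : ∀ a b : Fin 2, pd a (pd b u) x
      = fderiv ℝ (fderiv ℝ u) x (EuclideanSpace.single a 1) (EuclideanSpace.single b 1) := by
    intro a b
    have : pd b u = fun y => fderiv ℝ u y (EuclideanSpace.single b 1) := rfl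
    rw [pd, this, fderiv_clm_apply hd (differentiableAt_const _)]
    simp
  rw [key, key]
  exact hsym _ _

lemma fderiv_eq_sum_pd (u : Plane → ℝ) (x v : Plane) :
    fderiv ℝ u x v = ∑ a, v a * pd a u x := by
  have hv : v = ∑ a, v a • (EuclideanSpace.single a 1 : Plane) := by
    ext k; fin_cases k <;> simp [Fin.sum_univ_two]
  conv_lhs => rw [hv]
  simp [pd]

lemma pd_comp {ψ : Plane → Plane} {v : Plane → ℝ} {x : Plane} (i : Fin 2)
    (hv : DifferentiableAt ℝ v (ψ x)) (hψ : DifferentiableAt ℝ ψ x) :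
    pd i (fun z => v (ψ z)) x = ∑ a, pd i (fun z => ψ z a) x * pd a v (ψ x) := by
  have h1 : fderiv ℝ (fun z => v (ψ z)) x = (fderiv ℝ v (ψ x)).comp (fderiv ℝ ψ x) :=
    fderiv_comp x hv hψ
  have h2 : ∀ a, fderiv ℝ (fun z => ψ z a) x (EuclideanSpace.single i 1)
      = (fderiv ℝ ψ x (EuclideanSpace.single i 1)) a := by
    intro a
    have := ((EuclideanSpace.proj a : Plane →L[ℝ] ℝ).hasFDerivAt.comp x hψ.hasFDerivAt).fderiv
    have h3 : ((EuclideanSpace.proj a : Plane →L[ℝ] ℝ) ∘ ψ) = fun z => ψ z a := rfl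
    rw [h3] at this
    rw [this]; rfl
  rw [pd, h1, ContinuousLinearMap.comp_apply, fderiv_eq_sum_pd]
  simp only [pd, h2]

/-! ### The ring of smooth functions on an open set -/

/-- Smooth functions on the open set `U`, as a subalgebra of all functions. -/
def smoothSubalgebra (U : TopologicalSpace.Opens Plane) : Subalgebra ℝ (U → ℝ) where
  carrier := {u | ∃ v : Plane → ℝ, ContDiffOn ℝ ∞ v U ∧ ∀ x : U, u x = v x}
  mul_mem' := by
    rintro a b ⟨u, hu, h⟩ ⟨v, hv, k⟩
    exact ⟨fun x => u x * v x, hu.mul hv, fun x => by simp [h, k]⟩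
  add_mem' := by
    rintro a b ⟨u, hu, h⟩ ⟨v, hv, k⟩
    exact ⟨fun x => u x + v x, hu.add hv, fun x => by simp [h, k]⟩
  algebraMap_mem' c := ⟨fun _ => c, contDiffOn_const, fun _ => rfl⟩

/-- The ring of smooth functions on the open set `U`. -/
def Sf (U : TopologicalSpace.Opens Plane) : Type := smoothSubalgebra U

instance (U : TopologicalSpace.Opens Plane) : CommRing (Sf U) :=
  inferInstanceAs (CommRing (smoothSubalgebra U))

instance (U : TopologicalSpace.Opens Plane) : Algebra ℝ (Sf U) :=
  inferInstanceAs (Algebra ℝ (smoothSubalgebra U))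

namespace Sf

variable {U V : TopologicalSpace.Opens Plane}

/-- The restriction to `U` of a function that is smooth on `U`. -/
def mk (v : Plane → ℝ) (hv : ContDiffOn ℝ ∞ v U) : Sf U := ⟨fun x => v x, v, hv, fun _ => rfl⟩

/-- An extension to the plane. -/
def rep (u : Sf U) : Plane → ℝ := u.2.choose

lemma contDiffOn_rep (u : Sf U) : ContDiffOn ℝ ∞ (rep u) U := u.2.choose_spec.1

/-- Evaluation at a point. -/
def ev (x : U) : Sf U →ₐ[ℝ] ℝ := (Pi.evalAlgHom ℝ (fun _ : U => ℝ) x).comp (smoothSubalgebra U).val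

lemma ev_rep (u : Sf U) (x : U) : ev x u = (rep u) x := u.2.choose_spec.2 x

lemma ev_mk (v : Plane → ℝ) (hv : ContDiffOn ℝ ∞ v U) (x : U) : ev x (mk v hv) = v x := rfl

/-- Elements are functions on U only, so values outside U, where coordinate expressions carry no
information, never obstruct an equality. -/
lemma ext_ev {u v : Sf U} (h : ∀ x, ev x u = ev x v) : u = v := Subtype.ext (funext h)

lemma mk_eq_mk {u v : Plane → ℝ} {hu : ContDiffOn ℝ ∞ u U} {hv : ContDiffOn ℝ ∞ v U}
    (h : ∀ x ∈ U, u x = v x) : mk u hu = mk v hv := ext_ev fun x => h x x.2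

lemma mk_rep (u : Sf U) : mk (rep u) (contDiffOn_rep u) = u :=
  ext_ev fun x => (ev_rep u x).symm

lemma ev_algebraMap (x : U) (c : ℝ) : ev x (algebraMap ℝ (Sf U) c) = c := rfl

/-- The partial derivatives. -/
def d (i : Fin 2) : Derivation ℝ (Sf U) (Sf U) :=
  Derivation.mk'
    { toFun := fun u => mk (pd i (rep u)) (contDiffOn_pd U.2 (contDiffOn_rep u) i)
      map_add' := fun u v => ext_ev fun x => by
        have h := pd_congr_on (i := i) U.2 (u := rep (u + v)) (v := fun y => (rep u) y + (rep v) y)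
          (fun y hy => by
            have := ev_rep (u + v) ⟨y, hy⟩
            rw [map_add, ev_rep, ev_rep] at this
            exact this.symm) x.2
        rw [map_add, ev_mk, ev_mk, ev_mk, h]
        exact pd_add (differentiableAt_of_contDiffOn U.2 (contDiffOn_rep u) x.2)
          (differentiableAt_of_contDiffOn U.2 (contDiffOn_rep v) x.2)
      map_smul' := fun c u => ext_ev fun x => by
        have h := pd_congr_on (i := i) U.2 (u := rep (c • u)) (v := fun y => c * (rep u) y)
          (fun y hy => by
            have := ev_rep (c • u) ⟨y, hy⟩
            rw [map_smul, ev_rep] at this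
            exact this.symm) x.2
        rw [RingHom.id_apply, map_smul, ev_mk, ev_mk, h]
        exact pd_const_mul c (differentiableAt_of_contDiffOn U.2 (contDiffOn_rep u) x.2) }
    (fun u v => ext_ev fun x => by
        have h := pd_congr_on (i := i) U.2 (u := rep (u * v)) (v := fun y => (rep u) y * (rep v) y)
          (fun y hy => by
            have := ev_rep (u * v) ⟨y, hy⟩
            rw [map_mul, ev_rep, ev_rep] at this
            exact this.symm) x.2
        simp only [smul_eq_mul, map_add, map_mul, LinearMap.coe_mk, AddHom.coe_mk, ev_mk]
        rw [h, ev_rep u, ev_rep v]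
        exact pd_mul (differentiableAt_of_contDiffOn U.2 (contDiffOn_rep u) x.2)
          (differentiableAt_of_contDiffOn U.2 (contDiffOn_rep v) x.2))

lemma d_mk (i : Fin 2) (v : Plane → ℝ) (hv : ContDiffOn ℝ ∞ v U) :
    d i (mk v hv) = mk (pd i v) (contDiffOn_pd U.2 hv i) :=
  mk_eq_mk (hu := contDiffOn_pd U.2 (contDiffOn_rep (mk v hv)) i) fun x hx =>
    pd_congr_on U.2 (fun y hy => by
    have := ev_rep (mk v hv) ⟨y, hy⟩
    rw [ev_mk] at this
    exact this.symm) hx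

/-- The bridge between calculus and algebra: v need only agree with u on the open set U, so any
coordinate expression may be differentiated through its algebraic counterpart, without a separate
smoothness argument. -/
lemma ev_d (i : Fin 2) (v : Plane → ℝ) (u : Sf U) (h : ∀ y : U, v y = ev y u) (x : U) :
    pd i v x = ev x (d i u) := by
  have : ev x (d i u) = pd i (rep u) x := rfl
  rw [this]
  exact pd_congr_on U.2 (fun y hy => by rw [h ⟨y, hy⟩, ev_rep]) x.2

lemma d_comm (i j : Fin 2) (u : Sf U) : d i (d j u) = d j (d i u) := by
  rw [← mk_rep u]
  simp only [d_mk]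
  exact mk_eq_mk fun x hx => pd_comm U.2 (contDiffOn_rep u) hx i j

/-- The pull-back of smooth functions. -/
def comap (ψ : Plane → Plane) (hψ : ContDiffOn ℝ ∞ ψ U) (hm : Set.MapsTo ψ U V) :
    Sf V →ₐ[ℝ] Sf U where
  toFun v := mk (fun x => (rep v) (ψ x)) ((contDiffOn_rep v).comp hψ hm)
  map_one' := ext_ev fun x => by
    rw [ev_mk, map_one, ← ev_rep 1 ⟨ψ x, hm x.2⟩, map_one]
  map_mul' u v := ext_ev fun x => by
    rw [ev_mk, map_mul, ev_mk, ev_mk, ← ev_rep _ ⟨ψ x, hm x.2⟩, map_mul, ev_rep, ev_rep]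
  map_zero' := ext_ev fun x => by
    rw [ev_mk, map_zero, ← ev_rep 0 ⟨ψ x, hm x.2⟩, map_zero]
  map_add' u v := ext_ev fun x => by
    rw [ev_mk, map_add, ev_mk, ev_mk, ← ev_rep _ ⟨ψ x, hm x.2⟩, map_add, ev_rep, ev_rep]
  commutes' c := ext_ev fun x => by
    rw [ev_mk, ev_algebraMap, ← ev_rep _ ⟨ψ x, hm x.2⟩, ev_algebraMap]

lemma ev_comap (ψ : Plane → Plane) (hψ : ContDiffOn ℝ ∞ ψ U) (hm : Set.MapsTo ψ U V) (v : Sf V)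
    (x : U) : ev x (comap ψ hψ hm v) = ev ⟨ψ x, hm x.2⟩ v := by
  rw [ev_rep v]; rfl

lemma contDiffOn_coord {ψ : Plane → Plane} {U : Set Plane} (hψ : ContDiffOn ℝ ∞ ψ U) (a : Fin 2) :
    ContDiffOn ℝ ∞ (fun z => ψ z a) U :=
  (EuclideanSpace.proj a : Plane →L[ℝ] ℝ).contDiff.comp_contDiffOn hψ

/-- The chain rule in the form required by `FrameChange.chain`. -/
lemma d_comap (ψ : Plane → Plane) (hψ : ContDiffOn ℝ ∞ ψ U) (hm : Set.MapsTo ψ U V) (v : Sf V)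
    (i : Fin 2) : d i (comap ψ hψ hm v)
      = ∑ a, d i (mk (fun z => ψ z a) (contDiffOn_coord hψ a)) * comap ψ hψ hm (d a v) :=
  ext_ev fun x => by
    simp only [map_sum, map_mul, d_mk, ev_mk, ev_comap]
    rw [show ev x (d i (comap ψ hψ hm v)) = pd i (fun x => (rep v) (ψ x)) x from
      (ev_d i _ _ (fun y => rfl) x).symm]
    exact pd_comp i (differentiableAt_of_contDiffOn V.2 (contDiffOn_rep v) (hm x.2))
      ((hψ.contDiffAt (U.2.mem_nhds x.2)).differentiableAt (by simp))

end Sf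


/-! ### Tensor calculus in a ring with two derivations -/

section Algebraic

variable {A : Type*} [CommRing A] [Algebra ℝ A] (d : Fin 2 → Derivation ℝ A A)

/-- The Christoffel symbols of the metric `G` with inverse `G'`. -/
def chrA (G G' : Fin 2 → Fin 2 → A) (k i j : Fin 2) : A :=
  algebraMap ℝ A (1 / 2) * ∑ l, G' k l * (d i (G l j) + d j (G l i) - d l (G i j))

/-- The trace of a connection. -/
def trA (Γ : Fin 2 → Fin 2 → Fin 2 → A) (i : Fin 2) : A := ∑ j, Γ j i j

/-- The covariant derivative of a density. -/
def nab₀ (Γ : Fin 2 → Fin 2 → Fin 2 → A) (w : ℝ) (f : A) (i : Fin 2) : A :=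
  d i f - algebraMap ℝ A w * trA Γ i * f

/-- The covariant derivative of a covector density. -/
def nab₁ (Γ : Fin 2 → Fin 2 → Fin 2 → A) (w : ℝ) (u : Fin 2 → A) (i j : Fin 2) : A :=
  d i (u j) - ∑ k, Γ k i j * u k - algebraMap ℝ A w * trA Γ i * u j

/-- The covariant derivative of a contravariant tensor density of degree two. -/
def nab₂ (Γ : Fin 2 → Fin 2 → Fin 2 → A) (w : ℝ) (P : Fin 2 → Fin 2 → A) (k i j : Fin 2) : A :=
  d k (P i j) + ∑ s, Γ i k s * P s j + ∑ s, Γ j k s * P i s - algebraMap ℝ A w * trA Γ k * P i j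

/-- The covariant derivative of a tensor density of type `(2,1)`. -/
def nab₃ (Γ : Fin 2 → Fin 2 → Fin 2 → A) (w : ℝ) (T : Fin 2 → Fin 2 → Fin 2 → A)
    (i j k r : Fin 2) : A :=
  d i (T j k r) - ∑ s, Γ s i j * T s k r + ∑ s, Γ k i s * T j s r + ∑ s, Γ r i s * T j k s
    - algebraMap ℝ A w * trA Γ i * T j k r

/-- The curvature tensor. -/
def riemA (Γ : Fin 2 → Fin 2 → Fin 2 → A) (k l i j : Fin 2) : A :=
  d l (Γ k i j) - d j (Γ k i l) + ∑ s, (Γ k l s * Γ s i j - Γ k j s * Γ s i l)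

/-- The scalar curvature. -/
def scalA (Γ : Fin 2 → Fin 2 → Fin 2 → A) (G' : Fin 2 → Fin 2 → A) : A :=
  ∑ i, ∑ j, G' i j * ∑ k, riemA d Γ k k i j

/-- The Schwarzian derivative, for `F` with inverse `F'`. -/
def schA (Γ : Fin 2 → Fin 2 → Fin 2 → A) (G G' : Fin 2 → Fin 2 → A) (F F' : A) (i j : Fin 2) : A :=
  algebraMap ℝ A (1 / 2) * F' * nab₁ d Γ 0 (fun k => d k F) i j
    - algebraMap ℝ A (3 / 4) * F' ^ 2 * (d i F * d j F)
    + algebraMap ℝ A (1 / 8) * F' ^ 2 * (∑ k, ∑ r, G' k r * d k F * d r F) * G i j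

/-- The curved quantization of a symbol of degree two, for a given Schwarzian derivative `S`. -/
def quantA (l m : ℝ) (Γ : Fin 2 → Fin 2 → Fin 2 → A) (G G' : Fin 2 → Fin 2 → A)
    (S P : Fin 2 → Fin 2 → A) (f : A) : A :=
  ∑ i, ∑ j, P i j * nab₁ d Γ l (nab₀ d Γ l f) i j
    + ∑ j, (algebraMap ℝ A (β₁ 2 l m) * ∑ i, nab₂ d Γ (m - l) P i i j
        + algebraMap ℝ A (β₂ 2 l m) * ∑ i, ∑ k, ∑ r, G' i j * G k r * nab₂ d Γ (m - l) P i k r)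
      * nab₀ d Γ l f j
    + (algebraMap ℝ A (β₃ 2 l m) * ∑ i, ∑ j, nab₃ d Γ (m - l) (nab₂ d Γ (m - l) P) i j i j
        + algebraMap ℝ A (β₄ 2 l m) * ∑ i, ∑ j, ∑ k, ∑ r,
            G' i j * G k r * nab₃ d Γ (m - l) (nab₂ d Γ (m - l) P) i j k r
        + algebraMap ℝ A (4 * l * (m - 1) / (2 * (m - l) - 3)) *
          (-(∑ i, ∑ j, S i j * P i j)
            + algebraMap ℝ A (1 / (8 * ((m - l) - 1))) * scalA d Γ G' * ∑ i, ∑ j, G i j * P i j))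
      * f

end Algebraic

/-- Two rings with derivations related by a change of coordinates with Jacobian matrix `J` and
inverse Jacobian matrix `K`. -/
structure FrameChange {A B : Type*} [CommRing A] [Algebra ℝ A] [CommRing B] [Algebra ℝ B]
    (d : Fin 2 → Derivation ℝ A A) (d' : Fin 2 → Derivation ℝ B B) (s : B →ₐ[ℝ] A)
    (J K : Fin 2 → Fin 2 → A) : Prop where
  chain : ∀ i v, d i (s v) = ∑ a, J a i * s (d' a v)
  KJ : ∀ i j, ∑ a, K i a * J a j = if i = j then 1 else 0
  JK : ∀ a b, ∑ i, J a i * K i b = if a = b then 1 else 0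
  symm : ∀ a i j, d i (J a j) = d j (J a i)
  comm : ∀ i j u, d i (d j u) = d j (d i u)

namespace FrameChange

variable {A B : Type*} [CommRing A] [Algebra ℝ A] [CommRing B] [Algebra ℝ B]
  {d : Fin 2 → Derivation ℝ A A} {d' : Fin 2 → Derivation ℝ B B} {s : B →ₐ[ℝ] A}
  {J K : Fin 2 → Fin 2 → A} (h : FrameChange d d' s J K)

/-- The connections `Γ` and `C` are related by the change of coordinates. -/
def Conn (d : Fin 2 → Derivation ℝ A A) (s : B →ₐ[ℝ] A) (J : Fin 2 → Fin 2 → A)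
    (Γ : Fin 2 → Fin 2 → Fin 2 → A) (C : Fin 2 → Fin 2 → Fin 2 → B) : Prop :=
  ∀ c i j, ∑ k, J c k * Γ k i j = d i (J c j) + ∑ a, ∑ b, J a i * J b j * s (C c a b)

/-- `W` is the factor of the densities of degree `w`. -/
def Weight (d : Fin 2 → Derivation ℝ A A) (J K : Fin 2 → Fin 2 → A) (w : ℝ) (W : A) : Prop :=
  ∀ i, d i W = algebraMap ℝ A w * W * ∑ a, ∑ k, K k a * d i (J a k)

variable {Γ : Fin 2 → Fin 2 → Fin 2 → A} {C : Fin 2 → Fin 2 → Fin 2 → B}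

include h

/-- Contracting the law of Γ with the inverse Jacobian leaves the inhomogeneous term tr(J⁻¹∂ᵢJ).
`Weight` differentiates density factors by the same term, so the two cancel in every covariant
derivative below. -/
lemma trace (hΓ : Conn d s J Γ C) (i : Fin 2) :
    trA Γ i = ∑ a, ∑ k, K k a * d i (J a k) + ∑ a, J a i * s (trA C a) := by
  have h00 := h.KJ 0 0
  have h01 := h.KJ 0 1
  have h10 := h.KJ 1 0
  have h11 := h.KJ 1 1
  have g00 := h.JK 0 0
  have g01 := h.JK 0 1
  have g10 := h.JK 1 0
  have g11 := h.JK 1 1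
  have e00 := hΓ 0 i 0
  have e01 := hΓ 0 i 1
  have e10 := hΓ 1 i 0
  have e11 := hΓ 1 i 1
  simp only [trA, Fin.sum_univ_two, map_add] at *
  simp at h00 h01 h10 h11 g00 g01 g10 g11
  linear_combination K 0 0 * e00 + K 0 1 * e10 + K 1 0 * e01 + K 1 1 * e11
    - h00 * Γ 0 i 0 - h01 * Γ 1 i 0 - h10 * Γ 0 i 1 - h11 * Γ 1 i 1
    + (J 0 i * s (C 0 0 0) + J 1 i * s (C 0 1 0)) * g00 + (J 0 i * s (C 0 0 1) + J 1 i * s (C 0 1 1)) * g10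
    + (J 0 i * s (C 1 0 0) + J 1 i * s (C 1 1 0)) * g01 + (J 0 i * s (C 1 0 1) + J 1 i * s (C 1 1 1)) * g11

/-- The derivative of W cancels the inhomogeneous part of the traced connection. -/
lemma nab₀_eq (hΓ : Conn d s J Γ C) {w : ℝ} {W : A} (hW : Weight d J K w W) {f : A} {f' : B}
    (hf : f = W * s f') (i : Fin 2) : nab₀ d Γ w f i = W * ∑ a, J a i * s (nab₀ d' C w f' a) := by
  have e := h.trace hΓ i
  have eW := hW i
  have ec := h.chain i f'
  subst hf
  simp only [nab₀, Fin.sum_univ_two, map_sub, map_mul, AlgHom.commutes,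
    Derivation.leibniz, smul_eq_mul] at *
  linear_combination (-algebraMap ℝ A w * W * s f') * e + s f' * eW + W * ec

lemma nab₁_eq (hΓ : Conn d s J Γ C) {w : ℝ} {W : A} (hW : Weight d J K w W) {u : Fin 2 → A}
    {u' : Fin 2 → B} (hu : ∀ j, u j = W * ∑ a, J a j * s (u' a)) (i j : Fin 2) :
    nab₁ d Γ w u i j = W * ∑ a, ∑ b, J a i * J b j * s (nab₁ d' C w u' a b) := by
  have e := h.trace hΓ i
  have eW := hW i
  have c0 := h.chain i (u' 0)
  have c1 := h.chain i (u' 1)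
  have e0 := hΓ 0 i j
  have e1 := hΓ 1 i j
  simp only [nab₁, hu, Fin.sum_univ_two, map_add, map_sub, map_mul, AlgHom.commutes,
    Derivation.leibniz, smul_eq_mul] at *
  linear_combination (-algebraMap ℝ A w * W * (J 0 j * s (u' 0) + J 1 j * s (u' 1))) * e
    + (J 0 j * s (u' 0) + J 1 j * s (u' 1)) * eW + W * J 0 j * c0 + W * J 1 j * c1
    - W * s (u' 0) * e0 - W * s (u' 1) * e1

/-- The tensor law is differentiated as it stands, with J contracted on the left. Contravariant
indices are never moved across by the inverse Jacobian, so K is never differentiated; the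
derivatives of J are absorbed by `Conn`. -/
lemma nab₂_eq (hΓ : Conn d s J Γ C) {w : ℝ} {W : A} (hW : Weight d J K w W) {P : Fin 2 → Fin 2 → A}
    {P' : Fin 2 → Fin 2 → B} (hP : ∀ a b, ∑ i, ∑ j, J a i * J b j * P i j = W * s (P' a b))
    (k a b : Fin 2) : ∑ i, ∑ j, J a i * J b j * nab₂ d Γ w P k i j
      = W * ∑ c, J c k * s (nab₂ d' C w P' c a b) := by
  have e := h.trace hΓ k
  have eW := hW k
  have hd := congrArg (d k) (hP a b)
  have c := h.chain k (P' a b)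
  have a0 := hΓ a k 0
  have a1 := hΓ a k 1
  have b0 := hΓ b k 0
  have b1 := hΓ b k 1
  have hab := hP a b
  have p0 := hP a 0
  have p1 := hP a 1
  have q0 := hP 0 b
  have q1 := hP 1 b
  simp only [nab₂, Fin.sum_univ_two, map_add, map_sub, map_mul, AlgHom.commutes,
    Derivation.leibniz, smul_eq_mul] at *
  linear_combination hd + W * c + (s (P' a b)) * eW
    - algebraMap ℝ A w * W * s (P' a b) * e
    - algebraMap ℝ A w * trA Γ k * hab
    + (J b 0 * P 0 0 + J b 1 * P 0 1) * a0 + (J b 0 * P 1 0 + J b 1 * P 1 1) * a1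
    + (J a 0 * P 0 0 + J a 1 * P 1 0) * b0 + (J a 0 * P 0 1 + J a 1 * P 1 1) * b1
    + (J 0 k * s (C a 0 0) + J 1 k * s (C a 1 0)) * q0
    + (J 0 k * s (C a 0 1) + J 1 k * s (C a 1 1)) * q1
    + (J 0 k * s (C b 0 0) + J 1 k * s (C b 1 0)) * p0
    + (J 0 k * s (C b 0 1) + J 1 k * s (C b 1 1)) * p1

lemma nab₃_eq (hΓ : Conn d s J Γ C) {w : ℝ} {W : A} (hW : Weight d J K w W)
    {T : Fin 2 → Fin 2 → Fin 2 → A} {T' : Fin 2 → Fin 2 → Fin 2 → B}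
    (hT : ∀ k a b, ∑ i, ∑ j, J a i * J b j * T k i j = W * ∑ c, J c k * s (T' c a b))
    (k l a b : Fin 2) : ∑ i, ∑ j, J a i * J b j * nab₃ d Γ w T k l i j
      = W * ∑ e, ∑ c, J e k * J c l * s (nab₃ d' C w T' e c a b) := by
  have e := h.trace hΓ k
  have eW := hW k
  have hd := congrArg (d k) (hT l a b)
  have c0 := h.chain k (T' 0 a b)
  have c1 := h.chain k (T' 1 a b)
  have a0 := hΓ a k 0
  have a1 := hΓ a k 1
  have b0 := hΓ b k 0
  have b1 := hΓ b k 1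
  have l0 := hΓ 0 k l
  have l1 := hΓ 1 k l
  have hab := hT l a b
  have hab0 := hT 0 a b
  have hab1 := hT 1 a b
  have p0 := hT l a 0
  have p1 := hT l a 1
  have q0 := hT l 0 b
  have q1 := hT l 1 b
  simp only [nab₃, Fin.sum_univ_two, map_add, map_sub, map_mul, AlgHom.commutes,
    Derivation.leibniz, smul_eq_mul] at *
  linear_combination hd + W * J 0 l * c0 + W * J 1 l * c1
    + (J 0 l * s (T' 0 a b) + J 1 l * s (T' 1 a b)) * eW
    - algebraMap ℝ A w * W * (J 0 l * s (T' 0 a b) + J 1 l * s (T' 1 a b)) * e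
    - algebraMap ℝ A w * trA Γ k * hab
    + (J b 0 * T l 0 0 + J b 1 * T l 0 1) * a0 + (J b 0 * T l 1 0 + J b 1 * T l 1 1) * a1
    + (J a 0 * T l 0 0 + J a 1 * T l 1 0) * b0 + (J a 0 * T l 0 1 + J a 1 * T l 1 1) * b1
    + (J 0 k * s (C a 0 0) + J 1 k * s (C a 1 0)) * q0
    + (J 0 k * s (C a 0 1) + J 1 k * s (C a 1 1)) * q1
    + (J 0 k * s (C b 0 0) + J 1 k * s (C b 1 0)) * p0
    + (J 0 k * s (C b 0 1) + J 1 k * s (C b 1 1)) * p1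
    - Γ 0 k l * hab0 - Γ 1 k l * hab1
    - W * s (T' 0 a b) * l0 - W * s (T' 1 a b) * l1

/-- The law of the connection is differentiated in the directions l and j and antisymmetrized. The
third derivatives of the coordinate change cancel since the derivations commute, the second ones
since `symm` holds and the connection C is torsion-free. -/
lemma riem_eq (hΓ : Conn d s J Γ C) (hC : ∀ c, C c 1 0 = C c 0 1) (l i j c : Fin 2) :
    ∑ k, J c k * riemA d Γ k l i j
      = ∑ a, ∑ b, ∑ e, J a l * J b i * J e j * s (riemA d' C c a b e) := by
  have e1 := congrArg (d l) (hΓ c i j)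
  have e2 := congrArg (d j) (hΓ c i l)
  have a0 := hΓ c l 0
  have a1 := hΓ c l 1
  have b0 := hΓ c j 0
  have b1 := hΓ c j 1
  have f0 := hΓ 0 i j
  have f1 := hΓ 1 i j
  have g0 := hΓ 0 i l
  have g1 := hΓ 1 i l
  have cm := h.comm l j (J c i)
  have s1 := h.symm c i j
  have s2 := h.symm c i l
  have t0 := h.symm 0 i j
  have t1 := h.symm 1 i j
  have u0 := h.symm 0 i l
  have u1 := h.symm 1 i l
  have v0 := h.symm 0 l j
  have v1 := h.symm 1 l j
  simp only [riemA, Fin.sum_univ_two, map_add, map_sub, map_mul,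
    Derivation.leibniz, smul_eq_mul, h.chain, hC] at *
  rw [s1] at e1
  rw [s2] at e2
  rw [t0] at f0
  rw [t1] at f1
  rw [u0] at g0
  rw [u1] at g1
  rw [v0, v1] at e1
  linear_combination e1 - e2 + cm + Γ 0 i j * a0 + Γ 1 i j * a1 - Γ 0 i l * b0 - Γ 1 i l * b1
    + (J 0 l * s (C c 0 0) + J 1 l * s (C c 0 1)) * f0
    + (J 0 l * s (C c 0 1) + J 1 l * s (C c 1 1)) * f1
    - (J 0 j * s (C c 0 0) + J 1 j * s (C c 0 1)) * g0
    - (J 0 j * s (C c 0 1) + J 1 j * s (C c 1 1)) * g1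

/-- Of the six terms with second derivatives of the coordinate change in the Christoffel symbol of
the first kind, four cancel in pairs and two coincide; raising the index then gives `Conn`. -/
lemma conn_chr {G G' : Fin 2 → Fin 2 → A} {H H' : Fin 2 → Fin 2 → B}
    (hG : ∀ i j, G i j = ∑ a, ∑ b, J a i * J b j * s (H a b))
    (hG' : ∀ a b, ∑ i, ∑ j, J a i * J b j * G' i j = s (H' a b))
    (hH : ∀ a b, ∑ c, H' a c * H c b = if a = b then 1 else 0) (hs : H 1 0 = H 0 1) :
    Conn d s J (chrA d G G') (chrA d' H H') := by
  intro c i j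
  have key : ∀ l, d i (G l j) + d j (G l i) - d l (G i j)
      = ∑ e, J e l * (∑ a, ∑ b, J a i * J b j * s (d' a (H e b) + d' b (H e a) - d' e (H a b))
        + 2 * ∑ f, s (H e f) * d i (J f j)) := by
    intro l
    have s0 := h.symm 0 j i
    have s1 := h.symm 1 j i
    have t0 := h.symm 0 j l
    have t1 := h.symm 1 j l
    have u0 := h.symm 0 i l
    have u1 := h.symm 1 i l
    simp only [hG, Fin.sum_univ_two, map_add, map_sub, Derivation.leibniz, smul_eq_mul,
      h.chain, hs] at *
    rw [s0, s1, t0, t1, u0, u1]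
    ring
  have e0 := congrArg s (hH c 0)
  have e1 := congrArg s (hH c 1)
  have g0 := hG' c 0
  have g1 := hG' c 1
  have h2 : algebraMap ℝ A (1 / 2) * 2 = 1 := by
    rw [← map_ofNat (algebraMap ℝ A) 2, ← map_mul]; norm_num
  simp only [chrA, key, map_mul, AlgHom.commutes]
  -- Writing the component c through Kronecker symbols lets one combination of the inverse-matrix
  -- relations serve both values of c.
  have ec : d i (J c j) = s (if c = 0 then 1 else 0) * d i (J 0 j)
      + s (if c = 1 then 1 else 0) * d i (J 1 j) := by
    fin_cases c <;> simp
  rw [ec]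
  obtain ⟨X, hX⟩ : ∃ X : Fin 2 → A, ∀ e, X e = ∑ a, ∑ b,
      J a i * J b j * s (d' a (H e b) + d' b (H e a) - d' e (H a b)) := ⟨_, fun _ => rfl⟩
  simp only [← hX]
  have hX0 := hX 0
  have hX1 := hX 1
  simp only [Fin.sum_univ_two, map_add, map_mul, map_sub] at *
  generalize algebraMap ℝ A (1 / 2) = κ at *
  linear_combination
    κ * ((X 0 + 2 * (s (H 0 0) * d i (J 0 j) + s (H 0 1) * d i (J 1 j))) * g0
      + (X 1 + 2 * (s (H 1 0) * d i (J 0 j) + s (H 1 1) * d i (J 1 j))) * g1)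
    + κ * 2 * d i (J 0 j) * e0 + κ * 2 * d i (J 1 j) * e1
    + κ * s (H' c 0) * hX0 + κ * s (H' c 1) * hX1
    + (s (if c = 0 then 1 else 0) * d i (J 0 j) + s (if c = 1 then 1 else 0) * d i (J 1 j)) * h2

/-- In matrix terms the hypothesis says that J intertwines the transposes of N and N', so the two
are conjugate and have the same trace. -/
lemma contract {N N' : Fin 2 → Fin 2 → A}
    (hN : ∀ k a, ∑ i, J a i * N k i = ∑ c, J c k * N' c a) : ∑ k, N k k = ∑ a, N' a a := by
  have h00 := h.KJ 0 0
  have h01 := h.KJ 0 1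
  have h10 := h.KJ 1 0
  have h11 := h.KJ 1 1
  have g00 := h.JK 0 0
  have g01 := h.JK 0 1
  have g10 := h.JK 1 0
  have g11 := h.JK 1 1
  have n00 := hN 0 0
  have n01 := hN 0 1
  have n10 := hN 1 0
  have n11 := hN 1 1
  simp only [Fin.sum_univ_two] at *
  simp at h00 h01 h10 h11 g00 g01 g10 g11
  linear_combination K 0 0 * n00 + K 0 1 * n01 + K 1 0 * n10 + K 1 1 * n11
    - h00 * N 0 0 - h01 * N 0 1 - h10 * N 1 0 - h11 * N 1 1
    + g00 * N' 0 0 + g01 * N' 1 0 * 0 + g10 * N' 1 0 + g01 * N' 0 1 + g11 * N' 1 1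

lemma ric_eq (hΓ : Conn d s J Γ C) (hC : ∀ c, C c 1 0 = C c 0 1) (i j : Fin 2) :
    ∑ k, riemA d Γ k k i j
      = ∑ b, ∑ e, J b i * J e j * s (∑ c, riemA d' C c c b e) := by
  have := h.contract (N := fun l k => riemA d Γ k l i j)
    (N' := fun a c => ∑ b, ∑ e, J b i * J e j * s (riemA d' C c a b e)) (fun l c => by
      rw [h.riem_eq hΓ hC l i j c]
      simp only [Fin.sum_univ_two]; ring)
  rw [this]
  simp only [Fin.sum_univ_two, map_add]; ring

lemma scal_eq {G' : Fin 2 → Fin 2 → A} {H' : Fin 2 → Fin 2 → B} (hΓ : Conn d s J Γ C)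
    (hC : ∀ c, C c 1 0 = C c 0 1)
    (hG' : ∀ a b, ∑ i, ∑ j, J a i * J b j * G' i j = s (H' a b)) :
    scalA d Γ G' = s (scalA d' C H') := by
  simp only [scalA, h.ric_eq hΓ hC, map_sum (s : B →ₐ[ℝ] A), map_mul, ← hG']
  simp only [Fin.sum_univ_two]; ring

omit [CommRing B] [Algebra ℝ B] h in
lemma weight_zero : Weight d J K 0 (1 : A) := fun i => by simp

/-- The differential of F is a covector of weight zero, so `nab₁_eq` with the trivial factor treats
the Hessian; the remaining terms contain no second derivatives. -/
lemma sch_eq {G G' : Fin 2 → Fin 2 → A} {H H' : Fin 2 → Fin 2 → B}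
    (hΓ : Conn d s J Γ C) (hG : ∀ i j, G i j = ∑ a, ∑ b, J a i * J b j * s (H a b))
    (hG' : ∀ a b, ∑ i, ∑ j, J a i * J b j * G' i j = s (H' a b)) (F F' : B) (i j : Fin 2) :
    schA d Γ G G' (s F) (s F') i j = ∑ a, ∑ b, J a i * J b j * s (schA d' C H H' F F' a b) := by
  have e := h.nab₁_eq hΓ (W := 1) weight_zero (u := fun k => d k (s F)) (u' := fun k => d' k F)
    (fun k => by rw [one_mul]; exact h.chain k F) i j
  have q : ∑ k, ∑ r, G' k r * d k (s F) * d r (s F)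
      = s (∑ k, ∑ r, H' k r * d' k F * d' r F) := by
    simp only [h.chain, map_sum (s : B →ₐ[ℝ] A), map_mul, ← hG']
    simp only [Fin.sum_univ_two]; ring
  simp only [schA]
  rw [e, q, hG]
  generalize ∑ k, ∑ r, H' k r * d' k F * d' r F = y
  simp only [map_add, map_sub, map_mul, map_pow, AlgHom.commutes, h.chain, Fin.sum_univ_two]
  ring

/-- Each term is a complete contraction of tensors whose laws are known, with values in densities
whose factor is the product of that of the symbol and that of the argument. The tensor S may be
arbitrary, and the coefficients β play no role. -/
lemma quant_eq (hΓ : Conn d s J Γ C) (hC : ∀ c, C c 1 0 = C c 0 1) {G G' : Fin 2 → Fin 2 → A}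
    {H H' : Fin 2 → Fin 2 → B} (hG : ∀ i j, G i j = ∑ a, ∑ b, J a i * J b j * s (H a b))
    (hG' : ∀ a b, ∑ i, ∑ j, J a i * J b j * G' i j = s (H' a b))
    {S : Fin 2 → Fin 2 → A} {S' : Fin 2 → Fin 2 → B}
    (hS : ∀ i j, S i j = ∑ a, ∑ b, J a i * J b j * s (S' a b))
    {l m : ℝ} {W V : A} (hW : Weight d J K l W) (hV : Weight d J K (m - l) V)
    {P : Fin 2 → Fin 2 → A} {P' : Fin 2 → Fin 2 → B}
    (hP : ∀ a b, ∑ i, ∑ j, J a i * J b j * P i j = V * s (P' a b)) {f : A} {f' : B}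
    (hf : f = W * s f') :
    quantA d l m Γ G G' S P f = V * W * s (quantA d' l m C H H' S' P' f') := by
  have n0 := h.nab₀_eq hΓ hW hf
  have n1 := h.nab₁_eq hΓ hW n0
  have n2 := h.nab₂_eq hΓ hV hP
  have n3 := h.nab₃_eq hΓ hV n2
  have scal := h.scal_eq hΓ hC hG'
  have t1 : ∑ i, ∑ j, P i j * nab₁ d Γ l (nab₀ d Γ l f) i j
      = V * W * ∑ a, ∑ b, s (P' a b) * s (nab₁ d' C l (nab₀ d' C l f') a b) := by
    have h00 := hP 0 0
    have h01 := hP 0 1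
    have h10 := hP 1 0
    have h11 := hP 1 1
    simp only [n1]
    generalize nab₁ d' C l (nab₀ d' C l f') = D
    simp only [Fin.sum_univ_two] at *
    linear_combination W * (s (D 0 0) * h00 + s (D 0 1) * h01 + s (D 1 0) * h10 + s (D 1 1) * h11)
  have v1 : ∀ b, ∑ j, J b j * ∑ i, nab₂ d Γ (m - l) P i i j
      = V * s (∑ i, nab₂ d' C (m - l) P' i i b) := by
    intro b
    have := h.contract (N := fun k i => ∑ j, J b j * nab₂ d Γ (m - l) P k i j)
      (N' := fun c a => V * s (nab₂ d' C (m - l) P' c a b)) (fun k a => by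
        have := n2 k a b
        simp only [Fin.sum_univ_two] at *
        linear_combination this)
    simp only [Fin.sum_univ_two, map_add] at *
    linear_combination this
  have v2 : ∀ b, ∑ j, J b j * ∑ i, ∑ k, ∑ r, G' i j * G k r * nab₂ d Γ (m - l) P i k r
      = V * s (∑ i, ∑ k, ∑ r, H' i b * H k r * nab₂ d' C (m - l) P' i k r) := by
    intro b
    have q : ∀ i, ∑ k, ∑ r, G k r * nab₂ d Γ (m - l) P i k r
        = V * ∑ c, J c i * ∑ k, ∑ r, s (H k r) * s (nab₂ d' C (m - l) P' c k r) := by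
      intro i
      have h00 := n2 i 0 0
      have h01 := n2 i 0 1
      have h10 := n2 i 1 0
      have h11 := n2 i 1 1
      simp only [hG]
      generalize nab₂ d Γ (m - l) P = N at *
      generalize nab₂ d' C (m - l) P' = N' at *
      simp only [Fin.sum_univ_two] at *
      linear_combination s (H 0 0) * h00 + s (H 0 1) * h01 + s (H 1 0) * h10 + s (H 1 1) * h11
    have h0 := hG' 0 b
    have h1 := hG' 1 b
    have q0 := q 0
    have q1 := q 1
    simp only [map_sum (s : B →ₐ[ℝ] A), map_mul]
    generalize nab₂ d Γ (m - l) P = N at *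
    generalize nab₂ d' C (m - l) P' = N' at *
    simp only [Fin.sum_univ_two] at *
    rw [← h0, ← h1]
    linear_combination (J b 0 * G' 0 0 + J b 1 * G' 0 1) * q0 + (J b 0 * G' 1 0 + J b 1 * G' 1 1) * q1
  have v3 : ∑ i, ∑ j, nab₃ d Γ (m - l) (nab₂ d Γ (m - l) P) i j i j
      = V * s (∑ i, ∑ j, nab₃ d' C (m - l) (nab₂ d' C (m - l) P') i j i j) := by
    generalize nab₃ d Γ (m - l) (nab₂ d Γ (m - l) P) = N at *
    generalize nab₃ d' C (m - l) (nab₂ d' C (m - l) P') = N' at *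
    -- The double divergence is contracted one pair of indices at a time: first the derivative index
    -- with the first contravariant index, with l and b free.
    have c1 : ∀ l b, ∑ k, ∑ j, J b j * N k l k j = ∑ a, V * ∑ c, J c l * s (N' a c a b) := by
      intro l b
      refine h.contract (N := fun k i => ∑ j, J b j * N k l i j)
        (N' := fun e a => V * ∑ c, J c l * s (N' e c a b)) (fun k a => ?_)
      have := n3 k l a b
      simp only [Fin.sum_univ_two] at *
      linear_combination this
    have c2 := h.contract (N := fun l j => ∑ k, N k l k j)
      (N' := fun c b => V * ∑ a, s (N' a c a b)) (fun l b => by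
        have := c1 l b
        simp only [Fin.sum_univ_two] at *
        linear_combination this)
    simp only [Fin.sum_univ_two, map_add] at *
    linear_combination c2
  have v4 : ∑ i, ∑ j, ∑ k, ∑ r, G' i j * G k r * nab₃ d Γ (m - l) (nab₂ d Γ (m - l) P) i j k r
      = V * s (∑ i, ∑ j, ∑ k, ∑ r,
        H' i j * H k r * nab₃ d' C (m - l) (nab₂ d' C (m - l) P') i j k r) := by
    generalize nab₃ d Γ (m - l) (nab₂ d Γ (m - l) P) = N at *
    generalize nab₃ d' C (m - l) (nab₂ d' C (m - l) P') = N' at *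
    have q : ∀ i j, ∑ k, ∑ r, G k r * N i j k r
        = V * ∑ e, ∑ c, J e i * J c j * ∑ k, ∑ r, s (H k r) * s (N' e c k r) := by
      intro i j
      have h00 := n3 i j 0 0
      have h01 := n3 i j 0 1
      have h10 := n3 i j 1 0
      have h11 := n3 i j 1 1
      simp only [hG]
      simp only [Fin.sum_univ_two] at *
      linear_combination s (H 0 0) * h00 + s (H 0 1) * h01 + s (H 1 0) * h10 + s (H 1 1) * h11
    have e : ∀ i j, ∑ k, ∑ r, G' i j * G k r * N i j k r = G' i j * ∑ k, ∑ r, G k r * N i j k r := by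
      intro i j
      simp only [Finset.mul_sum, mul_assoc]
    simp only [e, q, map_sum (s : B →ₐ[ℝ] A), map_mul, ← hG']
    clear * -
    simp only [Fin.sum_univ_two]
    ring
  have v5 : ∑ i, ∑ j, S i j * P i j = V * s (∑ i, ∑ j, S' i j * P' i j) := by
    have h00 := hP 0 0
    have h01 := hP 0 1
    have h10 := hP 1 0
    have h11 := hP 1 1
    simp only [hS, Fin.sum_univ_two, map_add, map_mul] at *
    linear_combination s (S' 0 0) * h00 + s (S' 0 1) * h01 + s (S' 1 0) * h10 + s (S' 1 1) * h11
  have v6 : ∑ i, ∑ j, G i j * P i j = V * s (∑ i, ∑ j, H i j * P' i j) := by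
    have h00 := hP 0 0
    have h01 := hP 0 1
    have h10 := hP 1 0
    have h11 := hP 1 1
    simp only [hG, Fin.sum_univ_two, map_add, map_mul] at *
    linear_combination s (H 0 0) * h00 + s (H 0 1) * h01 + s (H 1 0) * h10 + s (H 1 1) * h11
  have t2 : ∀ κ₁ κ₂ : ℝ, ∑ j, (algebraMap ℝ A κ₁ * ∑ i, nab₂ d Γ (m - l) P i i j
        + algebraMap ℝ A κ₂ * ∑ i, ∑ k, ∑ r, G' i j * G k r * nab₂ d Γ (m - l) P i k r)
      * nab₀ d Γ l f j
      = V * W * s (∑ j, (algebraMap ℝ B κ₁ * ∑ i, nab₂ d' C (m - l) P' i i j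
        + algebraMap ℝ B κ₂ * ∑ i, ∑ k, ∑ r, H' i j * H k r * nab₂ d' C (m - l) P' i k r)
      * nab₀ d' C l f' j) := by
    intro κ₁ κ₂
    have v10 := v1 0
    have v11 := v1 1
    have v20 := v2 0
    have v21 := v2 1
    generalize (fun j => ∑ i, nab₂ d' C (m - l) P' i i j) = y1 at *
    simp only [n0]
    generalize nab₀ d' C l f' = D' at *
    rw [Fin.sum_univ_two] at v10 v11 v20 v21
    rw [Fin.sum_univ_two, Fin.sum_univ_two (f := fun j => (algebraMap ℝ B κ₁ * _ + _) * _)]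
    rw [Fin.sum_univ_two (f := fun a => J a 0 * _), Fin.sum_univ_two (f := fun a => J a 1 * _)]
    rw [map_add, map_mul, map_mul, map_add, map_add, map_mul, map_mul, map_mul, map_mul,
      AlgHom.commutes, AlgHom.commutes]
    linear_combination W * (algebraMap ℝ A κ₁ * (s (D' 0) * v10 + s (D' 1) * v11)
      + algebraMap ℝ A κ₂ * (s (D' 0) * v20 + s (D' 1) * v21))
  rw [quantA, t1, t2, v3, v4, v5, v6, scal, quantA, map_add, map_add]
  simp only [← map_mul, ← map_sum]
  rw [map_mul s _ f', map_add, map_add, map_mul s (algebraMap ℝ B _), map_mul s (algebraMap ℝ B _),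
    map_mul s (algebraMap ℝ B _), map_add, map_neg, map_mul s _ (∑ i, ∑ j, H i j * P' i j),
    map_mul s (algebraMap ℝ B _)]
  simp only [AlgHom.commutes]
  linear_combination (V * (algebraMap ℝ A (β₃ 2 l m) *
      s (∑ i, ∑ j, nab₃ d' C (m - l) (nab₂ d' C (m - l) P') i j i j)
    + algebraMap ℝ A (β₄ 2 l m) * s (∑ i, ∑ j, ∑ k, ∑ r,
        H' i j * H k r * nab₃ d' C (m - l) (nab₂ d' C (m - l) P') i j k r)
    + algebraMap ℝ A (4 * l * (m - 1) / (2 * (m - l) - 3)) *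
      (-s (∑ i, ∑ j, S' i j * P' i j) + algebraMap ℝ A (1 / (8 * (m - l - 1)))
        * s (scalA d' C H') * s (∑ i, ∑ j, H i j * P' i j)))) * hf

end FrameChange


/-! ### The relations between the coefficients -/

section Coefficients

variable {l m : ℝ} (h1 : m - l ≠ 1) (h2 : m - l ≠ 3 / 2) (h3 : m - l ≠ 2)
include h1 h2 h3

lemma coeff_ne : 4 - 2 * (m - l) ≠ 0 ∧ 3 - 2 * (m - l) ≠ 0 ∧ 1 - (m - l) ≠ 0 :=
  ⟨fun h => h3 (by linarith), fun h => h2 (by linarith), fun h => h1 (by linarith)⟩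

/-- This relation and the next three are a triangular system that determines the coefficients one
after the other for δ outside {1, 3/2, 2}. The flat equivariance uses the β's only through these
four relations, so their closed forms are needed only in this section. -/
lemma β₁_eq : β₁ 2 l m * (2 - (m - l)) = 2 * l + 1 := by
  obtain ⟨n1, n2, n3⟩ := coeff_ne h1 h2 h3
  rw [β₁, show 2 + 2 * (1 - (m - l)) = 4 - 2 * (m - l) by ring]
  field_simp; ring

lemma β₂_eq : 2 * β₂ 2 l m * (1 - (m - l)) = β₁ 2 l m - 1 := by
  obtain ⟨n1, n2, n3⟩ := coeff_ne h1 h2 h3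
  rw [β₂, β₁, show 2 + 2 * (1 - (m - l)) = 4 - 2 * (m - l) by ring,
    show 2 - 2 * (m - l) = 2 * (1 - (m - l)) by ring]
  field_simp; ring

lemma β₃_eq : β₃ 2 l m * (3 - 2 * (m - l)) = l * β₁ 2 l m := by
  obtain ⟨n1, n2, n3⟩ := coeff_ne h1 h2 h3
  rw [β₃, β₁, show 2 + 2 * (1 - (m - l)) = 4 - 2 * (m - l) by ring,
    show 1 + 2 * (1 - (m - l)) = 3 - 2 * (m - l) by ring]
  field_simp

lemma β₄_eq : 4 * β₄ 2 l m * (1 - (m - l)) = 2 * l * β₂ 2 l m + β₃ 2 l m := by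
  obtain ⟨n1, n2, n3⟩ := coeff_ne h1 h2 h3
  rw [β₄, β₂, β₃, show 2 + 2 * (1 - (m - l)) = 4 - 2 * (m - l) by ring,
    show 1 + 2 * (1 - (m - l)) = 3 - 2 * (m - l) by ring,
    show 2 - 2 * (m - l) = 2 * (1 - (m - l)) by ring,
    show 2 + 2 * (1 - 2 * (m - l)) = 4 * (1 - (m - l)) by ring]
  field_simp; ring

/-- The constant before the Schwarzian is fixed by the terms Pⁱʲ∂ᵢφⱼ with φ = d log F: the Hessian
produces them with coefficient λ, the double divergence with β₃(δ-2), and the Schwarzian contains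
half of ∂ᵢφⱼ. -/
lemma curv_coeff₁ : 4 * l * (m - 1) / (2 * (m - l) - 3) = 2 * l + 2 * β₃ 2 l m * (m - l - 2) := by
  obtain ⟨n1, n2, n3⟩ := coeff_ne h1 h2 h3
  rw [β₃, show 2 + 2 * (1 - (m - l)) = 4 - 2 * (m - l) by ring,
    show 1 + 2 * (1 - (m - l)) = 3 - 2 * (m - l) by ring,
    show 2 * (m - l) - 3 = -(3 - 2 * (m - l)) by ring]
  field_simp; ring

/-- Likewise the constant before the scalar curvature is fixed by the terms with tr P times the flat
divergence of φ. -/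
lemma curv_coeff₂ : 4 * l * (m - 1) / (2 * (m - l) - 3) * (1 / (8 * (m - l - 1)))
    = -(1 / 2 * β₃ 2 l m + β₄ 2 l m * (m - l - 1)) := by
  obtain ⟨n1, n2, n3⟩ := coeff_ne h1 h2 h3
  rw [β₃, β₄, show 2 + 2 * (1 - (m - l)) = 4 - 2 * (m - l) by ring,
    show 1 + 2 * (1 - (m - l)) = 3 - 2 * (m - l) by ring,
    show 2 - 2 * (m - l) = 2 * (1 - (m - l)) by ring,
    show 2 + 2 * (1 - 2 * (m - l)) = 4 * (1 - (m - l)) by ring,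
    show 2 * (m - l) - 3 = -(3 - 2 * (m - l)) by ring,
    show m - l - 1 = - (1 - (m - l)) by ring]
  field_simp; ring

end Coefficients

/-! ### The flat formula -/

section Flat

variable {A : Type*} [CommRing A] [Algebra ℝ A] (d : Fin 2 → Derivation ℝ A A)

/-- The trace of a symbol of degree two. -/
def trP (e : Fin 2 → ℝ) (P : Fin 2 → Fin 2 → A) : A := ∑ k, algebraMap ℝ A (e k) * P k k

/-- The flat quantization of a symbol of degree two. -/
def flatA (e : Fin 2 → ℝ) (l m : ℝ) (P : Fin 2 → Fin 2 → A) (f : A) : A :=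
  ∑ i, ∑ j, P i j * d i (d j f)
    + ∑ j, (algebraMap ℝ A (β₁ 2 l m) * ∑ i, d i (P i j)
        + algebraMap ℝ A (β₂ 2 l m) * (algebraMap ℝ A (e j) * d j (trP e P))) * d j f
    + (algebraMap ℝ A (β₃ 2 l m) * ∑ i, ∑ j, d i (d j (P i j))
        + algebraMap ℝ A (β₄ 2 l m) * ∑ i, algebraMap ℝ A (e i) * d i (d i (trP e P))) * f

/-- The metric `F' · diag(e)`. -/
def diagM (e : Fin 2 → ℝ) (F : A) (i j : Fin 2) : A := if i = j then F * algebraMap ℝ A (e i) else 0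

variable {d} {e : Fin 2 → ℝ} (he : ∀ i, e i = 1 ∨ e i = -1) {F F' : A} (hF : F * F' = 1)
  {φ : Fin 2 → A} (hφ : ∀ i, φ i = F' * d i F)

include hF hφ in
lemma d_inv (i : Fin 2) : d i F' = -F' * φ i := by
  have := congrArg (d i) hF
  simp only [Derivation.leibniz, smul_eq_mul, Derivation.map_one_eq_zero] at this
  rw [hφ]
  linear_combination F' * this - d i F' * hF

include hF hφ in
lemma d_F (i : Fin 2) : d i F = F * φ i := by
  rw [hφ]; linear_combination -d i F * hF

include he hF hφ in
-- The usual conformal change of the Christoffel symbols of a constant metric: for F⁻¹g₀ only the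
-- logarithmic derivative φ of F enters. The inverse metric is again of the form `diagM`, because
-- the signs are their own inverses.
lemma chrA_diagM (k i j : Fin 2) : chrA d (diagM e F') (diagM e F) k i j
    = -(algebraMap ℝ A (1 / 2) * ((if k = j then φ i else 0) + (if k = i then φ j else 0)
      - (if i = j then algebraMap ℝ A (e k * e i) * φ k else 0))) := by
  -- The factor F·F' is kept until the end, so that the case check is purely polynomial.
  have key : chrA d (diagM e F') (diagM e F) k i j
    = F * F' * -(algebraMap ℝ A (1 / 2) * ((if k = j then φ i else 0) + (if k = i then φ j else 0)
      - (if i = j then algebraMap ℝ A (e k * e i) * φ k else 0))) := by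
    have e0 : algebraMap ℝ A (e 0) * algebraMap ℝ A (e 0) = 1 := by
      rw [← map_mul]; rcases he 0 with h | h <;> simp [h]
    have e1 : algebraMap ℝ A (e 1) * algebraMap ℝ A (e 1) = 1 := by
      rw [← map_mul]; rcases he 1 with h | h <;> simp [h]
    rw [chrA, map_mul (algebraMap ℝ A) (e k)]
    generalize algebraMap ℝ A (1 / 2) = κ
    fin_cases k <;> fin_cases i <;> fin_cases j <;>
      simp [diagM, Derivation.leibniz, d_inv hF hφ, e0, e1]
    · linear_combination (κ * F * F' * φ 0) * e0
    · linear_combination (κ * F * F' * φ 1) * e0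
    · linear_combination (κ * F * F' * φ 1) * e0
    · ring
    · ring
    · linear_combination (κ * F * F' * φ 0) * e1
    · linear_combination (κ * F * F' * φ 0) * e1
    · linear_combination (κ * F * F' * φ 1) * e1
  rw [key, hF, one_mul]

/-- The Christoffel symbols of a conformally flat metric. -/
def IsConfConn (e : Fin 2 → ℝ) (φ : Fin 2 → A) (Γ : Fin 2 → Fin 2 → Fin 2 → A) : Prop :=
  ∀ k i j, Γ k i j
    = -(algebraMap ℝ A (1 / 2) * ((if k = j then φ i else 0) + (if k = i then φ j else 0)
      - (if i = j then algebraMap ℝ A (e k * e i) * φ k else 0)))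

variable {Γ : Fin 2 → Fin 2 → Fin 2 → A} (hΓ : IsConfConn e φ Γ)

lemma two_mul_half : 2 * algebraMap ℝ A (1 / 2) = 1 := by
  rw [← map_ofNat (algebraMap ℝ A) 2, ← map_mul]; norm_num

include he hΓ

lemma IsConfConn.trace (i : Fin 2) : trA Γ i = -φ i := by
  have h2 := two_mul_half (A := A)
  have e0 : algebraMap ℝ A (e 0) * algebraMap ℝ A (e 0) = 1 := by
    rw [← map_mul]; rcases he 0 with h | h <;> simp [h]
  have e1 : algebraMap ℝ A (e 1) * algebraMap ℝ A (e 1) = 1 := by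
    rw [← map_mul]; rcases he 1 with h | h <;> simp [h]
  simp only [trA, hΓ _ _ _]
  generalize algebraMap ℝ A (1 / 2) = κ at *
  fin_cases i <;> simp [Fin.sum_univ_two]
  · linear_combination -φ 0 * h2 + κ * φ 0 * e0
  · linear_combination -φ 1 * h2 + κ * φ 1 * e1

/-- The divergence of a symbol with respect to a conformally flat metric. -/
lemma IsConfConn.div {P : Fin 2 → Fin 2 → A} (hP : P 1 0 = P 0 1) (w : ℝ) (j : Fin 2) :
    ∑ i, nab₂ d Γ w P i i j = ∑ i, d i (P i j) + (algebraMap ℝ A w - 2) * ∑ i, φ i * P i j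
      + algebraMap ℝ A (1 / 2) * algebraMap ℝ A (e j) * φ j * trP e P := by
  have h2 := two_mul_half (A := A)
  simp only [nab₂, IsConfConn.trace he hΓ, hΓ _ _ _, trP]
  generalize algebraMap ℝ A (1 / 2) = κ at *
  fin_cases j <;> rcases he 0 with h0 | h0 <;> rcases he 1 with h1 | h1 <;>
    simp [Fin.sum_univ_two, h0, h1, hP]
  all_goals first
    | linear_combination (-2 * (φ 0 * P 0 0 + φ 1 * P 0 1)) * h2
    | linear_combination (-2 * (φ 0 * P 0 1 + φ 1 * P 1 1)) * h2

/-- The metric is parallel, so its contraction with P is differentiated as a density. The -1 comes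
from the factor F⁻¹ between the metric trace and the flat trace. -/
lemma IsConfConn.nab₂_trace {P : Fin 2 → Fin 2 → A} (hP : P 1 0 = P 0 1) (w : ℝ) (i : Fin 2) :
    ∑ k, algebraMap ℝ A (e k) * nab₂ d Γ w P i k k
      = d i (trP e P) + (algebraMap ℝ A w - 1) * φ i * trP e P := by
  have h2 := two_mul_half (A := A)
  simp only [nab₂, IsConfConn.trace he hΓ, hΓ _ _ _, trP]
  generalize algebraMap ℝ A (1 / 2) = κ at *
  fin_cases i <;> rcases he 0 with h0 | h0 <;> rcases he 1 with h1 | h1 <;>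
    simp [Fin.sum_univ_two, h0, h1, hP]
  all_goals first
    | linear_combination (-φ 0 * (P 0 0 + P 1 1)) * h2
    | linear_combination (-φ 1 * (P 0 0 + P 1 1)) * h2
    | linear_combination (-φ 0 * (P 0 0 - P 1 1)) * h2
    | linear_combination (-φ 1 * (P 0 0 - P 1 1)) * h2
    | linear_combination (-φ 0 * (-P 0 0 + P 1 1)) * h2
    | linear_combination (-φ 1 * (-P 0 0 + P 1 1)) * h2
    | linear_combination (-φ 0 * (-P 0 0 - P 1 1)) * h2
    | linear_combination (-φ 1 * (-P 0 0 - P 1 1)) * h2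

/-- The contraction of T is a vector density of weight w, whose divergence meets the connection only
through its trace -φ; hence the factor w-1. -/
lemma IsConfConn.div_div {T : Fin 2 → Fin 2 → Fin 2 → A} (w : ℝ) :
    ∑ i, ∑ j, nab₃ d Γ w T i j i j = ∑ i, (d i (∑ j, T j i j)
      + (algebraMap ℝ A w - 1) * φ i * ∑ j, T j i j) := by
  have h2 := two_mul_half (A := A)
  simp only [nab₃, IsConfConn.trace he hΓ, hΓ _ _ _]
  generalize algebraMap ℝ A (1 / 2) = κ at *
  rcases he 0 with h0 | h0 <;> rcases he 1 with h1 | h1 <;>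
    simp [Fin.sum_univ_two, h0, h1]
  all_goals linear_combination (-φ 0 * (T 0 0 0 + T 1 0 1) - φ 1 * (T 0 1 0 + T 1 1 1)) * h2

/-- The flat trace of Γ over its lower indices vanishes in dimension two, as in the conformal
covariance of the Laplacian, so only the density term and the rescaling of the trace remain. -/
lemma IsConfConn.lap_trace {T : Fin 2 → Fin 2 → Fin 2 → A} (hT : ∀ i, T i 1 0 = T i 0 1) (w : ℝ) :
    ∑ i, ∑ k, algebraMap ℝ A (e i) * algebraMap ℝ A (e k) * nab₃ d Γ w T i i k k
      = ∑ i, algebraMap ℝ A (e i) * (d i (∑ k, algebraMap ℝ A (e k) * T i k k)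
      + (algebraMap ℝ A w - 1) * φ i * ∑ k, algebraMap ℝ A (e k) * T i k k) := by
  have h2 := two_mul_half (A := A)
  simp only [nab₃, IsConfConn.trace he hΓ, hΓ _ _ _]
  have e0 : e 0 * e 0 = 1 := by rcases he 0 with h | h <;> simp [h]
  have e1 : e 1 * e 1 = 1 := by rcases he 1 with h | h <;> simp [h]
  have e0' : algebraMap ℝ A (e 0) * algebraMap ℝ A (e 0) = 1 := by rw [← map_mul, e0, map_one]
  have e1' : algebraMap ℝ A (e 1) * algebraMap ℝ A (e 1) = 1 := by rw [← map_mul, e1, map_one]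
  generalize algebraMap ℝ A (1 / 2) = κ at *
  rcases he 0 with h0 | h0 <;> rcases he 1 with h1 | h1 <;>
    simp [Fin.sum_univ_two, h0, h1, hT]
  · linear_combination (-(φ 0 * (T 0 0 0 + T 0 1 1) + φ 1 * (T 1 0 0 + T 1 1 1))) * h2
  · linear_combination (-(φ 0 * (T 0 0 0 - T 0 1 1) - φ 1 * (T 1 0 0 - T 1 1 1))) * h2
  · linear_combination (-(φ 0 * (T 0 0 0 - T 0 1 1) - φ 1 * (T 1 0 0 - T 1 1 1))) * h2
  · linear_combination (-(φ 0 * (T 0 0 0 + T 0 1 1) + φ 1 * (T 1 0 0 + T 1 1 1))) * h2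

/-- In dimension two the terms quadratic in φ cancel: the curvature of a conformally flat metric is
linear in the derivatives of log F. -/
lemma IsConfConn.curvature :
    ∑ i, ∑ j, (if i = j then algebraMap ℝ A (e i) else 0) * ∑ k, riemA d Γ k k i j
      = ∑ i, algebraMap ℝ A (e i) * d i (φ i) := by
  have h2 := two_mul_half (A := A)
  simp only [riemA, hΓ _ _ _]
  generalize hκ : algebraMap ℝ A (1 / 2) = κ at *
  have hd : ∀ i, d i κ = 0 := fun i => by rw [← hκ]; simp
  rcases he 0 with h0 | h0 <;> rcases he 1 with h1 | h1 <;>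
    simp [Fin.sum_univ_two, h0, h1, Derivation.leibniz, hd]
  · linear_combination (d 0 (φ 0) + d 1 (φ 1)) * h2
  · linear_combination (d 0 (φ 0) - d 1 (φ 1)) * h2
  · linear_combination (-d 0 (φ 0) + d 1 (φ 1)) * h2
  · linear_combination (-d 0 (φ 0) - d 1 (φ 1)) * h2

lemma IsConfConn.hess {P : Fin 2 → Fin 2 → A} (hP : P 1 0 = P 0 1) (w : ℝ) (f : A) :
    ∑ i, ∑ j, P i j * nab₁ d Γ w (nab₀ d Γ w f) i j
      = ∑ i, ∑ j, P i j * d i (d j f)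
        + (2 * algebraMap ℝ A w + 1) * ∑ i, ∑ j, P i j * φ i * d j f
        - algebraMap ℝ A (1 / 2) * trP e P * ∑ k, algebraMap ℝ A (e k) * φ k * d k f
        + f * (algebraMap ℝ A w * ∑ i, ∑ j, P i j * d i (φ j)
          + algebraMap ℝ A w * (algebraMap ℝ A w + 1) * ∑ i, ∑ j, P i j * φ i * φ j
          - algebraMap ℝ A (1 / 2) * algebraMap ℝ A w * trP e P
            * ∑ k, algebraMap ℝ A (e k) * φ k * φ k) := by
  have h2 := two_mul_half (A := A)
  simp only [nab₁, nab₀, IsConfConn.trace he hΓ, hΓ _ _ _, trP]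
  generalize algebraMap ℝ A (1 / 2) = κ at *
  rcases he 0 with h0 | h0 <;> rcases he 1 with h1 | h1 <;>
    simp [Fin.sum_univ_two, h0, h1, Derivation.leibniz, hP]
  all_goals linear_combination (P 0 1 * (φ 0 * (d 1 f + algebraMap ℝ A w * φ 1 * f)
      + φ 1 * (d 0 f + algebraMap ℝ A w * φ 0 * f)) + P 0 0 * φ 0 * (d 0 f + algebraMap ℝ A w * φ 0 * f)
      + P 1 1 * φ 1 * (d 1 f + algebraMap ℝ A w * φ 1 * f)) * h2

include hF hφ in
-- For the chart itself the Schwarzian is a second-order expression in log F, in general nonzero; it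
-- is the term that cancels the dependence of the curved formula on F.
lemma IsConfConn.sch (i j : Fin 2) :
    schA d Γ (diagM e F') (diagM e F) F F' i j
      = algebraMap ℝ A (1 / 2) * d i (φ j) + algebraMap ℝ A (1 / 4) * φ i * φ j
        - algebraMap ℝ A (1 / 8) * (if i = j then algebraMap ℝ A (e i) else 0)
          * ∑ k, algebraMap ℝ A (e k) * φ k * φ k := by
  have h2 := two_mul_half (A := A)
  have h3 : algebraMap ℝ A (3 / 4) = 3 * algebraMap ℝ A (1 / 2) ^ 2 := by
    rw [← map_ofNat (algebraMap ℝ A) 3, ← map_pow, ← map_mul]; norm_num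
  have h4 : algebraMap ℝ A (1 / 4) = algebraMap ℝ A (1 / 2) ^ 2 := by
    rw [← map_pow]; norm_num
  have h8 : algebraMap ℝ A (1 / 8) = algebraMap ℝ A (1 / 2) ^ 3 := by
    rw [← map_pow]; norm_num
  simp only [schA, nab₁, d_F hF hφ, hΓ _ _ _, h3, h4, h8, diagM]
  generalize algebraMap ℝ A (1 / 2) = κ at *
  have u2 : F ^ 2 * F' ^ 2 = 1 := by rw [← mul_pow, hF, one_pow]
  have u3 : F ^ 3 * F' ^ 3 = 1 := by rw [← mul_pow, hF, one_pow]
  have aux : ∀ X Y z b : A, κ * F' * (F * X) - 3 * κ ^ 2 * F' ^ 2 * (F * φ i * (F * φ j))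
      + κ ^ 3 * F' ^ 2 * (F ^ 3 * Y) * (F' * b) = κ * X - 3 * κ ^ 2 * φ i * φ j + κ ^ 3 * Y * b := by
    intro X Y z b
    linear_combination κ * X * hF - 3 * κ ^ 2 * φ i * φ j * u2 + κ ^ 3 * Y * b * u3
  have a1 : d i (F * φ j) - ∑ k, -(κ * ((if k = j then φ i else 0) + (if k = i then φ j else 0)
      - (if i = j then algebraMap ℝ A (e k * e i) * φ k else 0))) * (F * φ k)
      - algebraMap ℝ A 0 * trA Γ i * (F * φ j)
      = F * (φ i * φ j + d i (φ j) + ∑ k, (κ * ((if k = j then φ i else 0) + (if k = i then φ j else 0)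
      - (if i = j then algebraMap ℝ A (e k * e i) * φ k else 0))) * φ k) := by
    simp only [Derivation.leibniz, d_F hF hφ, smul_eq_mul, map_zero, Fin.sum_univ_two]
    ring
  have a2 : ∑ k, ∑ r, (if k = r then F * algebraMap ℝ A (e k) else 0) * (F * φ k) * (F * φ r)
      = F ^ 3 * ∑ k, algebraMap ℝ A (e k) * φ k * φ k := by
    simp [Fin.sum_univ_two]; ring
  have a3 : (if i = j then F' * algebraMap ℝ A (e i) else 0)
      = F' * (if i = j then algebraMap ℝ A (e i) else 0) := by split_ifs <;> simp
  rw [a1, a2, a3, aux _ _ 0]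
  fin_cases i <;> fin_cases j <;> rcases he 0 with h0 | h0 <;> rcases he 1 with h1 | h1 <;>
    simp [Fin.sum_univ_two, h0, h1]
  · linear_combination (-κ * φ 0 * φ 0 + κ ^ 2 * (φ 0 ^ 2 + φ 1 ^ 2)) * h2
  · linear_combination (-κ * φ 0 * φ 0 + κ ^ 2 * (φ 0 ^ 2 - φ 1 ^ 2)) * h2
  · linear_combination (-κ * φ 0 * φ 0 + κ ^ 2 * (φ 0 ^ 2 - φ 1 ^ 2)) * h2
  · linear_combination (-κ * φ 0 * φ 0 + κ ^ 2 * (φ 0 ^ 2 + φ 1 ^ 2)) * h2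
  · linear_combination (-κ * φ 0 * φ 1) * h2
  · linear_combination (-κ * φ 0 * φ 1) * h2
  · linear_combination (-κ * φ 0 * φ 1) * h2
  · linear_combination (-κ * φ 0 * φ 1) * h2
  · linear_combination (-κ * φ 0 * φ 1) * h2
  · linear_combination (-κ * φ 0 * φ 1) * h2
  · linear_combination (-κ * φ 0 * φ 1) * h2
  · linear_combination (-κ * φ 0 * φ 1) * h2
  · linear_combination (-κ * φ 1 * φ 1 + κ ^ 2 * (φ 0 ^ 2 + φ 1 ^ 2)) * h2
  · linear_combination (-κ * φ 1 * φ 1 + κ ^ 2 * (φ 1 ^ 2 - φ 0 ^ 2)) * h2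
  · linear_combination (-κ * φ 1 * φ 1 + κ ^ 2 * (φ 1 ^ 2 - φ 0 ^ 2)) * h2
  · linear_combination (-κ * φ 1 * φ 1 + κ ^ 2 * (φ 0 ^ 2 + φ 1 ^ 2)) * h2

include hF hφ in
-- The dependence on the conformal factor drops out. The difference of the two sides is a sum of
-- independent expressions in φ, its derivatives, P and f, and each coefficient vanishes by the
-- relations between the constants. The hypothesis `hd` says that φ is closed, as a logarithmic
-- derivative is.
lemma IsConfConn.quant {P : Fin 2 → Fin 2 → A} (hP : P 1 0 = P 0 1) {l m : ℝ}
    (h1 : m - l ≠ 1) (h2 : m - l ≠ 3 / 2) (h3 : m - l ≠ 2) (hd : d 0 (φ 1) = d 1 (φ 0))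
    (f : A) :
    quantA d l m Γ (diagM e F') (diagM e F) (schA d Γ (diagM e F') (diagM e F) F F') P f
      = flatA d e l m P f := by
  have hs : ∀ k, nab₂ d Γ (m - l) P k 1 0 = nab₂ d Γ (m - l) P k 0 1 := fun k => by
    simp only [nab₂, hP, Fin.sum_univ_two]; ring
  have hdiv := IsConfConn.div (d := d) he hΓ hP (m - l)
  have htr := IsConfConn.nab₂_trace (d := d) he hΓ hP (m - l)
  have hdd := IsConfConn.div_div (d := d) he hΓ (T := nab₂ d Γ (m - l) P) (m - l)
  have hlt := IsConfConn.lap_trace (d := d) he hΓ (T := nab₂ d Γ (m - l) P) hs (m - l)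
  have hcu := IsConfConn.curvature (d := d) he hΓ
  have hdiv' : ∀ i, ∑ j, nab₂ d Γ (m - l) P j i j = ∑ i_1, d i_1 (P i_1 i)
      + (algebraMap ℝ A (m - l) - 2) * ∑ i_1, φ i_1 * P i_1 i
      + algebraMap ℝ A (1 / 2) * algebraMap ℝ A (e i) * φ i * trP e P := by
    intro i
    rw [← hdiv i]
    fin_cases i <;> simp [Fin.sum_univ_two, hs]
  simp only [htr, hdiv'] at hdd hlt
  have e1 : ∀ j, ∑ i, ∑ k, ∑ r, diagM e F i j * diagM e F' k r * nab₂ d Γ (m - l) P i k r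
      = algebraMap ℝ A (e j) * (d j (trP e P) + (algebraMap ℝ A (m - l) - 1) * φ j * trP e P) := by
    intro j
    rw [← htr]
    fin_cases j <;> simp [Fin.sum_univ_two, diagM]
    · linear_combination (algebraMap ℝ A (e 0)) * (algebraMap ℝ A (e 0) * nab₂ d Γ (m - l) P 0 0 0
        + algebraMap ℝ A (e 1) * nab₂ d Γ (m - l) P 0 1 1) * hF
    · linear_combination (algebraMap ℝ A (e 1)) * (algebraMap ℝ A (e 0) * nab₂ d Γ (m - l) P 1 0 0
        + algebraMap ℝ A (e 1) * nab₂ d Γ (m - l) P 1 1 1) * hF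
  have e2 : ∀ N : Fin 2 → Fin 2 → Fin 2 → Fin 2 → A,
      ∑ i, ∑ j, ∑ k, ∑ r, diagM e F i j * diagM e F' k r * N i j k r
      = ∑ i, ∑ k, algebraMap ℝ A (e i) * algebraMap ℝ A (e k) * N i i k k := by
    intro N
    simp [Fin.sum_univ_two, diagM]
    linear_combination (algebraMap ℝ A (e 0) * (algebraMap ℝ A (e 0) * N 0 0 0 0
        + algebraMap ℝ A (e 1) * N 0 0 1 1) + algebraMap ℝ A (e 1) * (algebraMap ℝ A (e 0) * N 1 1 0 0
        + algebraMap ℝ A (e 1) * N 1 1 1 1)) * hF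
  have e3 : scalA d Γ (diagM e F) * ∑ i, ∑ j, diagM e F' i j * P i j
      = (∑ i, algebraMap ℝ A (e i) * d i (φ i)) * trP e P := by
    rw [← hcu]
    simp [scalA, Fin.sum_univ_two, diagM, trP]
    generalize riemA d Γ = R
    linear_combination (algebraMap ℝ A (e 0) * (R 0 0 0 0 + R 1 1 0 0)
      + algebraMap ℝ A (e 1) * (R 0 0 1 1 + R 1 1 1 1))
      * (algebraMap ℝ A (e 0) * P 0 0 + algebraMap ℝ A (e 1) * P 1 1) * hF
  have e4 : ∑ i, ∑ j, schA d Γ (diagM e F') (diagM e F) F F' i j * P i j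
      = algebraMap ℝ A (1 / 2) * ∑ i, ∑ j, P i j * d i (φ j)
        + algebraMap ℝ A (1 / 4) * ∑ i, ∑ j, P i j * φ i * φ j
        - algebraMap ℝ A (1 / 8) * trP e P * ∑ k, algebraMap ℝ A (e k) * φ k * φ k := by
    simp only [IsConfConn.sch he hF hφ hΓ, trP]
    simp [Fin.sum_univ_two, hP]
    ring
  have r1 := congrArg (algebraMap ℝ A) (β₁_eq h1 h2 h3)
  have r2 := congrArg (algebraMap ℝ A) (β₂_eq h1 h2 h3)
  have r3 := congrArg (algebraMap ℝ A) (β₃_eq h1 h2 h3)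
  have r4 := congrArg (algebraMap ℝ A) (β₄_eq h1 h2 h3)
  have c1 := congrArg (algebraMap ℝ A) (curv_coeff₁ h1 h2 h3)
  have c2 := congrArg (algebraMap ℝ A) (curv_coeff₂ h1 h2 h3)
  have κ2 := two_mul_half (A := A)
  have h4 : algebraMap ℝ A (1 / 4) = algebraMap ℝ A (1 / 2) ^ 2 := by
    rw [← map_pow]; norm_num
  have h8 : algebraMap ℝ A (1 / 8) = algebraMap ℝ A (1 / 2) ^ 3 := by
    rw [← map_pow]; norm_num
  rw [map_mul] at c2
  simp only [quantA, flatA]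
  rw [IsConfConn.hess he hΓ hP, hdd, e2, hlt,
    mul_assoc (algebraMap ℝ A (1 / (8 * (m - l - 1)))), e3, e4]
  simp only [hdiv, e1, nab₀, IsConfConn.trace he hΓ, h4, h8]
  generalize algebraMap ℝ A (4 * l * (m - 1) / (2 * (m - l) - 3)) = c at *
  generalize algebraMap ℝ A (1 / (8 * (m - l - 1))) = c' at *
  simp only [map_mul, map_add, map_sub, map_neg, map_ofNat, map_one] at r1 r2 r3 r4 c1 c2
  simp only [map_sub (algebraMap ℝ A)]
  generalize algebraMap ℝ A (β₁ 2 l m) = b₁ at *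
  generalize algebraMap ℝ A (β₂ 2 l m) = b₂ at *
  generalize algebraMap ℝ A (β₃ 2 l m) = b₃ at *
  generalize algebraMap ℝ A (β₄ 2 l m) = b₄ at *
  have dκ : ∀ i, d i (algebraMap ℝ A (1 / 2)) = 0 := fun i => by simp
  generalize algebraMap ℝ A (1 / 2) = κ at *
  generalize trP e P = t at *
  clear hdiv hdiv' htr hdd hlt hcu e1 e2 e3 e4 hs h4 h8 h1 h2 h3
  simp only [Fin.sum_univ_two, map_add, map_sub, Derivation.leibniz, Derivation.map_algebraMap,
    smul_eq_mul, dκ, hd, hP, Derivation.map_one_eq_zero]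
  have d2 : ∀ i, d i (2 : A) = 0 := fun i => by
    rw [← map_ofNat (algebraMap ℝ A) 2, Derivation.map_algebraMap]
  simp only [d2]
  generalize algebraMap ℝ A l = L at *
  generalize algebraMap ℝ A m = N at *
  generalize algebraMap ℝ A (e 0) = e₀ at *
  generalize algebraMap ℝ A (e 1) = e₁ at *
  -- One line or group per type of term: P·φ·df, tr P·φ·df, P·∂φ, P·φ·φ, tr P·|φ|², φ·div P, φ·d tr
  -- P, and tr P·div φ. The relation `κ2` only normalizes the powers of 1/2.
  linear_combination
    (-((φ 0 * P 0 0 + φ 1 * P 0 1) * d 0 f + (φ 0 * P 0 1 + φ 1 * P 1 1) * d 1 f)) * r1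
    + (t * (e₀ * φ 0 * d 0 f + e₁ * φ 1 * d 1 f)) * (-κ * r2 + b₂ * (1 - (N - L)) * κ2)
    + f * (P 0 0 * d 0 (φ 0) + 2 * P 0 1 * d 1 (φ 0) + P 1 1 * d 1 (φ 1))
      * (-κ * c1 - (L + b₃ * (N - L - 2)) * κ2)
    + f * (P 0 0 * φ 0 * φ 0 + 2 * P 0 1 * φ 0 * φ 1 + P 1 1 * φ 1 * φ 1)
      * (-κ ^ 2 * c1 + (-κ * (L + b₃ * (N - L - 2)) - b₃ * (N - L - 1) * (N - L - 2) + L ^ 2) * κ2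
        + (-L + κ * L) * r1 - κ * (N - L - 2) * r3)
    + f * t * (e₀ * φ 0 * φ 0 + e₁ * φ 1 * φ 1)
      * (κ ^ 3 * c1 + (κ ^ 2 * (L + b₃ * (N - L - 2)) - (2 * κ + 1) * b₄ * (N - L - 1) ^ 2
          - (2 * κ + 1) * b₂ * L * (N - L - 1) - κ * (b₁ - 1) * L - κ * b₃ * (N - L - 1)) * κ2
        - κ ^ 2 * (N - L - 1) * r4 - κ ^ 2 * L * r2 - κ ^ 2 * r3)
    + f * (φ 0 * (d 0 (P 0 0) + d 1 (P 0 1)) + φ 1 * (d 0 (P 0 1) + d 1 (P 1 1))) * (-r3)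
    + f * (e₀ * φ 0 * d 0 t + e₁ * φ 1 * d 1 t) * (-κ * r4 - (2 * b₄ * (N - L - 1) + b₂ * L) * κ2)
    + f * t * (e₀ * d 0 (φ 0) + e₁ * d 1 (φ 1)) * c2

end Flat


/-! ### Equivariance of the flat formula -/

section Lie

variable {A : Type*} [CommRing A] [Algebra ℝ A] (d : Fin 2 → Derivation ℝ A A)

/-- The Lie derivative of a density. -/
def lieA₀ (w : ℝ) (X : Fin 2 → A) (f : A) : A :=
  ∑ k, X k * d k f + algebraMap ℝ A w * (∑ k, d k (X k)) * f

/-- The Lie derivative of a symbol of degree one. -/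
def lieA₁ (w : ℝ) (X : Fin 2 → A) (P : Fin 2 → A) (i : Fin 2) : A :=
  ∑ k, X k * d k (P i) - ∑ k, d k (X i) * P k + algebraMap ℝ A w * (∑ k, d k (X k)) * P i

/-- The Lie derivative of a symbol of degree two. -/
def lieA₂ (w : ℝ) (X : Fin 2 → A) (P : Fin 2 → Fin 2 → A) (i j : Fin 2) : A :=
  ∑ k, X k * d k (P i j) - ∑ k, d k (X i) * P k j - ∑ k, d k (X j) * P i k
    + algebraMap ℝ A w * (∑ k, d k (X k)) * P i j

/-- The quantization of a symbol of degree one. -/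
def flatA₁ (l m : ℝ) (P : Fin 2 → A) (f : A) : A :=
  ∑ i, P i * d i f + algebraMap ℝ A (l / (1 - (m - l))) * (∑ i, d i (P i)) * f

/-- The vector field `X` is conformal: its derivative is the sum of the dilation `u` and of the
rotation `v`, and the derivatives of these are given by the constants `c`. -/
structure IsConfField (e : Fin 2 → ℝ) (X : Fin 2 → A) (u v : A) (c : Fin 2 → ℝ) : Prop where
  d00 : d 0 (X 0) = u
  d11 : d 1 (X 1) = u
  d01 : d 0 (X 1) = algebraMap ℝ A (e 0) * v
  d10 : d 1 (X 0) = -(algebraMap ℝ A (e 1) * v)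
  du : ∀ i, d i u = algebraMap ℝ A (c i)
  dv0 : d 0 v = -algebraMap ℝ A (e 1 * c 1)
  dv1 : d 1 v = algebraMap ℝ A (e 0 * c 0)

variable {d} {e : Fin 2 → ℝ} (he : ∀ i, e i = 1 ∨ e i = -1) (hc : ∀ u, d 1 (d 0 u) = d 0 (d 1 u))
  {X : Fin 2 → A} {u v : A} {c : Fin 2 → ℝ} (hX : IsConfField d e X u v c)

include he hc hX

set_option maxHeartbeats 1000000 in
-- All terms of the commutator without derivatives of the dilation and rotation parts cancel. These
-- derivatives are the constants c, so the defect is linear in c and consists of four groups, with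
-- df contracted with P or multiplied by tr P, and with f times div P or d tr P. One relation
-- between the β's disposes of each group.
lemma flatA_lie {P : Fin 2 → Fin 2 → A} (hP : P 1 0 = P 0 1) {l m : ℝ}
    (h1 : m - l ≠ 1) (h2 : m - l ≠ 3 / 2) (h3 : m - l ≠ 2) (f : A) :
    flatA d e l m (lieA₂ d (m - l) X P) f
      = lieA₀ d m X (flatA d e l m P f) - flatA d e l m P (lieA₀ d l X f) := by
  have r1 := congrArg (algebraMap ℝ A) (β₁_eq h1 h2 h3)
  have r2 := congrArg (algebraMap ℝ A) (β₂_eq h1 h2 h3)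
  have r3 := congrArg (algebraMap ℝ A) (β₃_eq h1 h2 h3)
  have r4 := congrArg (algebraMap ℝ A) (β₄_eq h1 h2 h3)
  simp only [map_mul, map_add, map_sub, map_ofNat, map_one] at r1 r2 r3 r4
  obtain ⟨x00, x11, x01, x10, xu, xv0, xv1⟩ := hX
  -- Infinitesimal rotations preserve the flat trace up to no term at all, so the trace is acted
  -- upon like a density; it can then be treated as a separate unknown t.
  have ht : trP e (lieA₂ d (m - l) X P) = X 0 * d 0 (trP e P) + X 1 * d 1 (trP e P)
      + 2 * (algebraMap ℝ A (m - l) - 1) * u * trP e P := by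
    simp only [trP, lieA₂, Fin.sum_univ_two, map_add, Derivation.leibniz, Derivation.map_algebraMap,
      smul_eq_mul, x00, x11, x01, x10, hP]
    ring
  simp only [flatA, ht]
  have tr : trP e P = algebraMap ℝ A (e 0) * P 0 0 + algebraMap ℝ A (e 1) * P 1 1 := by
    simp only [trP, Fin.sum_univ_two]
  have dt : ∀ i, d i (trP e P)
      = algebraMap ℝ A (e 0) * d i (P 0 0) + algebraMap ℝ A (e 1) * d i (P 1 1) := fun i => by
    rw [tr]; simp
  have dt0 := dt 0
  have dt1 := dt 1
  generalize trP e P = t at *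
  clear ht h1 h2 h3 dt
  simp only [lieA₀, lieA₂]
  simp only [Fin.sum_univ_two, map_add, map_sub, map_neg, Derivation.leibniz,
    Derivation.map_algebraMap, Derivation.map_one_eq_zero, smul_eq_mul, x00, x11, x01, x10, xu, xv0,
    xv1, hc, map_mul (algebraMap ℝ A), hP]
  generalize algebraMap ℝ A (β₁ 2 l m) = b₁ at *
  generalize algebraMap ℝ A (β₂ 2 l m) = b₂ at *
  generalize algebraMap ℝ A (β₃ 2 l m) = b₃ at *
  generalize algebraMap ℝ A (β₄ 2 l m) = b₄ at *
  have d2 : ∀ i, d i (2 : A) = 0 := fun i => by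
    rw [← map_ofNat (algebraMap ℝ A) 2, Derivation.map_algebraMap]
  simp only [d2, map_zero]
  generalize algebraMap ℝ A l = L at *
  generalize algebraMap ℝ A m = N at *
  generalize algebraMap ℝ A (c 0) = c₀ at *
  generalize algebraMap ℝ A (c 1) = c₁ at *
  rcases he 0 with h0 | h0 <;> rcases he 1 with h1 | h1 <;>
    simp only [h0, h1, map_neg, map_one] at tr dt0 dt1 ⊢
  · linear_combination
      (-2 * ((c₀ * P 0 0 + c₁ * P 0 1) * d 0 f + (c₀ * P 0 1 + c₁ * P 1 1) * d 1 f)) * r1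
      - t * (c₀ * d 0 f + c₁ * d 1 f) * r2
      - 2 * f * (c₀ * (d 0 (P 0 0) + d 1 (P 0 1)) + c₁ * (d 0 (P 0 1) + d 1 (P 1 1))) * r3
      - f * (c₀ * d 0 t + c₁ * d 1 t) * r4
      - (b₁ - 1) * (c₀ * d 0 f + c₁ * d 1 f) * tr - b₃ * f * (c₀ * dt0 + c₁ * dt1)
  · linear_combination
      (-2 * ((c₀ * P 0 0 + c₁ * P 0 1) * d 0 f + (c₀ * P 0 1 + c₁ * P 1 1) * d 1 f)) * r1
      - t * (c₀ * d 0 f - c₁ * d 1 f) * r2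
      - 2 * f * (c₀ * (d 0 (P 0 0) + d 1 (P 0 1)) + c₁ * (d 0 (P 0 1) + d 1 (P 1 1))) * r3
      - f * (c₀ * d 0 t - c₁ * d 1 t) * r4
      - (b₁ - 1) * (c₀ * d 0 f - c₁ * d 1 f) * tr - b₃ * f * (c₀ * dt0 - c₁ * dt1)
  · linear_combination
      (-2 * ((c₀ * P 0 0 + c₁ * P 0 1) * d 0 f + (c₀ * P 0 1 + c₁ * P 1 1) * d 1 f)) * r1
      - t * (-c₀ * d 0 f + c₁ * d 1 f) * r2
      - 2 * f * (c₀ * (d 0 (P 0 0) + d 1 (P 0 1)) + c₁ * (d 0 (P 0 1) + d 1 (P 1 1))) * r3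
      - f * (-c₀ * d 0 t + c₁ * d 1 t) * r4
      - (b₁ - 1) * (-c₀ * d 0 f + c₁ * d 1 f) * tr - b₃ * f * (-c₀ * dt0 + c₁ * dt1)
  · linear_combination
      (-2 * ((c₀ * P 0 0 + c₁ * P 0 1) * d 0 f + (c₀ * P 0 1 + c₁ * P 1 1) * d 1 f)) * r1
      - t * (-c₀ * d 0 f - c₁ * d 1 f) * r2
      - 2 * f * (c₀ * (d 0 (P 0 0) + d 1 (P 0 1)) + c₁ * (d 0 (P 0 1) + d 1 (P 1 1))) * r3
      - f * (-c₀ * d 0 t - c₁ * d 1 t) * r4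
      - (b₁ - 1) * (-c₀ * d 0 f - c₁ * d 1 f) * tr - b₃ * f * (-c₀ * dt0 - c₁ * dt1)

/-- The only defect is the contraction of P with the gradient of the divergence of X, once from L_X
f with the factor λ and once from div P with the factor δ-1. -/
lemma flatA₁_lie {P : Fin 2 → A} {l m : ℝ} (h1 : m - l ≠ 1) (f : A) :
    flatA₁ d l m (lieA₁ d (m - l) X P) f
      = lieA₀ d m X (flatA₁ d l m P f) - flatA₁ d l m P (lieA₀ d l X f) := by
  have r := congrArg (algebraMap ℝ A)
    (show l / (1 - (m - l)) * (1 - (m - l)) = l from div_mul_cancel₀ _ (sub_ne_zero.2 h1.symm))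
  simp only [map_mul, map_sub, map_one] at r
  obtain ⟨x00, x11, x01, x10, xu, xv0, xv1⟩ := hX
  simp only [flatA₁, lieA₀, lieA₁]
  generalize hb : algebraMap ℝ A (l / (1 - (m - l))) = b at *
  have db : ∀ i, d i b = 0 := fun i => by rw [← hb]; simp
  simp only [Fin.sum_univ_two, map_add, map_sub, map_neg, Derivation.leibniz,
    Derivation.map_algebraMap, smul_eq_mul, x00, x11, x01, x10, xu, xv0, xv1, db, hc,
    map_mul (algebraMap ℝ A)]
  rcases he 0 with h0 | h0 <;> rcases he 1 with h1 | h1 <;>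
    simp only [h0, h1, map_neg, map_one]
  all_goals linear_combination (-2 * (algebraMap ℝ A (c 0) * P 0 + algebraMap ℝ A (c 1) * P 1) * f) * r

end Lie


/-! ### Changes of coordinates -/

section Transition

variable {M : Type*} [TopologicalSpace M] [ChartedSpace Plane M]

lemma mem_overlap {e e' : Chart M} {x : Plane} :
    x ∈ overlap e e' ↔ x ∈ e.1.target ∧ e.1.symm x ∈ e'.1.source := by
  simp [overlap]

lemma overlap_subset (e e' : Chart M) : overlap e e' ⊆ e.1.target := fun _ hx => (mem_overlap.1 hx).1

lemma isOpen_overlap (e e' : Chart M) : IsOpen (overlap e e') :=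
  (e.1.symm.trans e'.1).open_source

lemma overlap_self (e : Chart M) : overlap e e = e.1.target := by
  ext x
  rw [mem_overlap]
  exact ⟨fun h => h.1, fun h => ⟨h, e.1.map_target h⟩⟩

lemma transition_self {e : Chart M} {x : Plane} (hx : x ∈ e.1.target) : transition e e x = x :=
  e.1.right_inv hx

lemma transition_mem_target {e e' : Chart M} {x : Plane} (hx : x ∈ overlap e e') :
    transition e e' x ∈ e'.1.target := e'.1.map_source (mem_overlap.1 hx).2

lemma symm_transition {e e' : Chart M} {x : Plane} (hx : x ∈ overlap e e') :
    e'.1.symm (transition e e' x) = e.1.symm x := e'.1.left_inv (mem_overlap.1 hx).2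

lemma transition_mem {e e' e'' : Chart M} {x : Plane} (hx : x ∈ overlap e e')
    (hx' : x ∈ overlap e e'') : transition e e' x ∈ overlap e' e'' :=
  mem_overlap.2 ⟨transition_mem_target hx, by rw [symm_transition hx]; exact (mem_overlap.1 hx').2⟩

lemma mem_overlap_of_transition {e e' e'' : Chart M} {x : Plane} (hx : x ∈ overlap e e')
    (hx' : transition e e' x ∈ overlap e' e'') : x ∈ overlap e e'' :=
  mem_overlap.2 ⟨(mem_overlap.1 hx).1, by rw [← symm_transition hx]; exact (mem_overlap.1 hx').2⟩

lemma transition_trans {e e' : Chart M} (e'' : Chart M) {x : Plane} (hx : x ∈ overlap e e') :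
    transition e' e'' (transition e e' x) = transition e e'' x := by
  rw [transition, symm_transition hx, transition]

lemma mem_overlap_self {e e' : Chart M} {x : Plane} (hx : x ∈ overlap e e') : x ∈ overlap e e := by
  rw [overlap_self]; exact overlap_subset _ _ hx

lemma transition_mem_symm {e e' : Chart M} {x : Plane} (hx : x ∈ overlap e e') :
    transition e e' x ∈ overlap e' e := transition_mem hx (mem_overlap_self hx)

lemma transition_transition {e e' : Chart M} {x : Plane} (hx : x ∈ overlap e e') :
    transition e' e (transition e e' x) = x := by
  rw [transition_trans e hx, transition_self (overlap_subset _ _ hx)]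

lemma contDiffOn_transition (e e' : Chart M) :
    ContDiffOn ℝ ∞ (transition e e') (overlap e e') := by
  have h := StructureGroupoid.compatible_of_mem_maximalAtlas e.2 e'.2
  rw [contDiffGroupoid, mem_groupoid_of_pregroupoid] at h
  have h' := h.1
  simp only [contDiffPregroupoid, modelWithCornersSelf_coe, modelWithCornersSelf_coe_symm,
    Function.comp_id, Function.id_comp, Set.preimage_id, Set.range_id, Set.inter_univ] at h'
  exact h'

lemma differentiableAt_transition {e e' : Chart M} {x : Plane} (hx : x ∈ overlap e e') :
    DifferentiableAt ℝ (transition e e') x :=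
  ((contDiffOn_transition e e').contDiffAt ((isOpen_overlap e e').mem_nhds hx)).differentiableAt
    (by simp)

lemma continuousAt_transition {e e' : Chart M} {x : Plane} (hx : x ∈ overlap e e') :
    ContinuousAt (transition e e') x := (differentiableAt_transition hx).continuousAt

lemma contDiffOn_jac (e e' : Chart M) (a i : Fin 2) :
    ContDiffOn ℝ ∞ (fun x => jac e e' x a i) (overlap e e') :=
  contDiffOn_pd (isOpen_overlap e e') (Sf.contDiffOn_coord (contDiffOn_transition e e') a) i

lemma pd_comp_transition {e e' : Chart M} {x : Plane} (hx : x ∈ overlap e e') (i : Fin 2)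
    {v : Plane → ℝ} (hv : DifferentiableAt ℝ v (transition e e' x)) :
    pd i (fun z => v (transition e e' z)) x = ∑ a, jac e e' x a i * pd a v (transition e e' x) :=
  pd_comp i hv (differentiableAt_transition hx)

lemma jac_trans {e e' e'' : Chart M} {x : Plane} (hx : x ∈ overlap e e') (hx' : x ∈ overlap e e'') :
    jac e e'' x = jac e' e'' (transition e e' x) * jac e e' x := by
  ext a i
  rw [Matrix.mul_apply]
  have h1 : jac e e'' x a i
      = pd i (fun z => (fun y => transition e' e'' y a) (transition e e' z)) x :=
    pd_congr_on ((isOpen_overlap e e').inter (isOpen_overlap e e'')) (fun y hy => by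
      simp only [transition_trans e'' hy.1]) ⟨hx, hx'⟩
  refine h1.trans ((pd_comp_transition (v := fun y => transition e' e'' y a) hx i ?_).trans ?_)
  · exact differentiableAt_of_contDiffOn (isOpen_overlap e' e'')
      (Sf.contDiffOn_coord (contDiffOn_transition e' e'') a) (transition_mem hx hx')
  · exact Finset.sum_congr rfl fun k _ => mul_comm _ _

lemma jac_self {e : Chart M} {x : Plane} (hx : x ∈ e.1.target) : jac e e x = 1 := by
  ext a i
  have h1 : jac e e x a i = pd i (fun z => z a) x :=
    pd_congr_on e.1.open_target (fun y hy => by rw [transition_self hy]) hx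
  rw [h1, pd_coord, Matrix.one_apply]
  simp [eq_comm]

lemma jac_symm_mul {e e' : Chart M} {x : Plane} (hx : x ∈ overlap e e') :
    jac e' e (transition e e' x) * jac e e' x = 1 := by
  rw [← jac_trans hx (mem_overlap_self hx), jac_self (overlap_subset _ _ hx)]

lemma jac_mul_symm {e e' : Chart M} {x : Plane} (hx : x ∈ overlap e e') :
    jac e e' x * jac e' e (transition e e' x) = 1 :=
  mul_eq_one_comm.1 (jac_symm_mul hx)

lemma det_jac_ne {e e' : Chart M} {x : Plane} (hx : x ∈ overlap e e') : (jac e e' x).det ≠ 0 := by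
  intro h
  have := congrArg Matrix.det (jac_symm_mul hx)
  rw [Matrix.det_mul, h, mul_zero, Matrix.det_one] at this
  exact zero_ne_one this

/-- The factor of the densities of degree `w` under a change of coordinates. -/
def densFactor (w : ℝ) (e e' : Chart M) (x : Plane) : ℝ := |(jac e e' x).det| ^ w

lemma densFactor_pos (w : ℝ) {e e' : Chart M} {x : Plane} (hx : x ∈ overlap e e') :
    0 < densFactor w e e' x := Real.rpow_pos_of_pos (abs_pos.2 (det_jac_ne hx)) w

lemma densFactor_trans (w : ℝ) {e e' e'' : Chart M} {x : Plane} (hx : x ∈ overlap e e')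
    (hx' : x ∈ overlap e e'') :
    densFactor w e e'' x = densFactor w e e' x * densFactor w e' e'' (transition e e' x) := by
  rw [densFactor, jac_trans hx hx', Matrix.det_mul, abs_mul,
    Real.mul_rpow (abs_nonneg _) (abs_nonneg _), mul_comm]; rfl

lemma densFactor_self (w : ℝ) {e : Chart M} {x : Plane} (hx : x ∈ e.1.target) :
    densFactor w e e x = 1 := by
  rw [densFactor, jac_self hx]; simp

lemma densFactor_add (w w' : ℝ) {e e' : Chart M} {x : Plane} (hx : x ∈ overlap e e') :
    densFactor w e e' x * densFactor w' e e' x = densFactor (w + w') e e' x :=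
  (Real.rpow_add (abs_pos.2 (det_jac_ne hx)) w w').symm

/-- `Real.log` does not see the sign of its argument, so one smooth expression covers coordinate
changes of both orientations. -/
lemma densFactor_eq_exp (w : ℝ) {e e' : Chart M} {x : Plane} (hx : x ∈ overlap e e') :
    densFactor w e e' x = Real.exp (w * Real.log (jac e e' x).det) := by
  rw [densFactor, Real.rpow_def_of_pos (abs_pos.2 (det_jac_ne hx)), Real.log_abs, mul_comm]

lemma contDiffOn_det_jac (e e' : Chart M) :
    ContDiffOn ℝ ∞ (fun x => (jac e e' x).det) (overlap e e') := by
  simp only [Matrix.det_fin_two]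
  exact ((contDiffOn_jac e e' 0 0).mul (contDiffOn_jac e e' 1 1)).sub
    ((contDiffOn_jac e e' 0 1).mul (contDiffOn_jac e e' 1 0))

lemma contDiffOn_densFactor (w : ℝ) (e e' : Chart M) :
    ContDiffOn ℝ ∞ (densFactor w e e') (overlap e e') := by
  refine ContDiffOn.congr (f := fun x => Real.exp (w * Real.log (jac e e' x).det)) ?_
    fun x hx => densFactor_eq_exp w hx
  exact (contDiffOn_const.mul ((contDiffOn_det_jac e e').log fun x hx => det_jac_ne hx)).exp

lemma pd_densFactor (w : ℝ) {e e' : Chart M} {x : Plane} (hx : x ∈ overlap e e') (i : Fin 2) :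
    pd i (densFactor w e e') x = w * densFactor w e e' x * (((jac e e' x).det)⁻¹
      * pd i (fun z => (jac e e' z).det) x) := by
  rw [pd_congr_on (isOpen_overlap e e') (fun y hy => densFactor_eq_exp w hy) hx,
    densFactor_eq_exp w hx]
  have hd := differentiableAt_of_contDiffOn (isOpen_overlap e e') (contDiffOn_det_jac e e') hx
  have h1 := (((hd.hasFDerivAt.log (det_jac_ne hx)).const_mul w).exp).fderiv
  simp only [pd]
  rw [h1]
  simp only [smul_apply, smul_eq_mul]
  ring

/-- The overlap of two coordinate domains, as an open set. -/
abbrev overlapO (e e' : Chart M) : TopologicalSpace.Opens Plane := ⟨overlap e e', isOpen_overlap e e'⟩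

lemma mapsTo_transition (e e' : Chart M) :
    Set.MapsTo (transition e e') (overlapO e e') (overlapO e' e) :=
  fun _ hx => transition_mem_symm hx

/-- The pull-back by a change of coordinates. -/
def pull (e e' : Chart M) : Sf (overlapO e' e) →ₐ[ℝ] Sf (overlapO e e') :=
  Sf.comap (transition e e') (contDiffOn_transition e e') (mapsTo_transition e e')

lemma ev_pull {e e' : Chart M} (v : Sf (overlapO e' e)) (x : overlapO e e') :
    Sf.ev x (pull e e' v) = Sf.ev ⟨transition e e' x, mapsTo_transition e e' x.2⟩ v :=
  Sf.ev_comap _ _ _ v x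

/-- The Jacobian matrix. -/
def jacA (e e' : Chart M) (a i : Fin 2) : Sf (overlapO e e') :=
  Sf.mk (fun x => jac e e' x a i) (contDiffOn_jac e e' a i)

lemma ev_jacA {e e' : Chart M} (a i : Fin 2) (x : overlapO e e') :
    Sf.ev x (jacA e e' a i) = jac e e' x a i := rfl

/-- The inverse of the Jacobian matrix. -/
def jacInvA (e e' : Chart M) (i a : Fin 2) : Sf (overlapO e e') := pull e e' (jacA e' e i a)

/-- The symmetry of the derivatives of J is the symmetry of second partial derivatives. Through this
instance all the algebraic transformation laws apply to pairs of charts. -/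
lemma frameChange (e e' : Chart M) :
    FrameChange Sf.d Sf.d (pull e e') (jacA e e') (jacInvA e e') where
  chain i v := by
    rw [pull, Sf.d_comap]
    exact Finset.sum_congr rfl fun a _ => by rw [Sf.d_mk]; rfl
  KJ i j := Sf.ext_ev fun x => by
    have h := congrFun (congrFun (jac_symm_mul x.2) i) j
    rw [Matrix.mul_apply, Matrix.one_apply] at h
    simp only [map_sum, map_mul, jacInvA, ev_pull, ev_jacA]
    split_ifs at h ⊢ <;> simpa using h
  JK a b := Sf.ext_ev fun x => by
    have h := congrFun (congrFun (jac_mul_symm x.2) a) b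
    rw [Matrix.mul_apply, Matrix.one_apply] at h
    simp only [map_sum, map_mul, jacInvA, ev_pull, ev_jacA]
    split_ifs at h ⊢ <;> simpa using h
  symm a i j := by
    have h : ∀ k, jacA e e' a k = Sf.d k (Sf.mk (fun z => transition e e' z a)
        (Sf.contDiffOn_coord (contDiffOn_transition e e') a)) := fun k => by
      rw [Sf.d_mk]; rfl
    rw [h, h, Sf.d_comm]
  comm := Sf.d_comm

/-- The factor of the densities. -/
def densA (w : ℝ) (e e' : Chart M) : Sf (overlapO e e') :=
  Sf.mk (densFactor w e e') (contDiffOn_densFactor w e e')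

lemma FrameChange.d_det {A B : Type*} [CommRing A] [Algebra ℝ A] [CommRing B]
    [Algebra ℝ B] {d : Fin 2 → Derivation ℝ A A} {d' : Fin 2 → Derivation ℝ B B} {s : B →ₐ[ℝ] A}
    {J K : Fin 2 → Fin 2 → A} (h : FrameChange d d' s J K) (i : Fin 2) :
    d i (J 0 0 * J 1 1 - J 0 1 * J 1 0)
      = (J 0 0 * J 1 1 - J 0 1 * J 1 0) * ∑ a, ∑ k, K k a * d i (J a k) := by
  have k00 := h.KJ 0 0
  have k01 := h.KJ 0 1
  have k10 := h.KJ 1 0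
  have k11 := h.KJ 1 1
  simp only [Fin.sum_univ_two, map_sub, Derivation.leibniz, smul_eq_mul, if_true, zero_ne_one,
    one_ne_zero, if_false] at *
  linear_combination -d i (J 0 0) * (J 1 1 * k00 - J 1 0 * k01)
    - d i (J 1 0) * (-J 0 1 * k00 + J 0 0 * k01) - d i (J 0 1) * (J 1 1 * k10 - J 1 0 * k11)
    - d i (J 1 1) * (-J 0 1 * k10 + J 0 0 * k11)

/-- Jacobi's formula for the logarithmic derivative of the determinant, raised to the power w. -/
lemma weight_densA (w : ℝ) (e e' : Chart M) :
    FrameChange.Weight Sf.d (jacA e e') (jacInvA e e') w (densA w e e') := by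
  intro i
  have hdet : Sf.mk (fun x => (jac e e' x).det) (contDiffOn_det_jac e e')
      = jacA e e' 0 0 * jacA e e' 1 1 - jacA e e' 0 1 * jacA e e' 1 0 :=
    Sf.ext_ev fun x => by
      rw [Sf.ev_mk, Matrix.det_fin_two, map_sub, map_mul, map_mul]; rfl
  have hd := (frameChange e e').d_det i
  rw [← hdet] at hd
  generalize ∑ a, ∑ k, jacInvA e e' k a * Sf.d i (jacA e e' a k) = θ at *
  refine Sf.ext_ev fun x => ?_
  have hd' := congrArg (Sf.ev x) hd
  have hx := det_jac_ne x.2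
  rw [Sf.d_mk, map_mul, Sf.ev_mk, Sf.ev_mk] at hd'
  rw [densA, Sf.d_mk, Sf.ev_mk, pd_densFactor w x.2, hd', map_mul, map_mul, Sf.ev_mk,
    Sf.ev_algebraMap, inv_mul_cancel_left₀ hx]

end Transition


/-! ### The formulas in coordinates as formulas in the ring of smooth functions -/

section Link

variable {U : TopologicalSpace.Opens Plane} {G : Plane → Matrix (Fin 2) (Fin 2) ℝ}
  {g g' : Fin 2 → Fin 2 → Sf U} (hg : ∀ i j, ∀ y : U, G y i j = Sf.ev y (g i j))
  (hg' : ∀ i j, ∀ y : U, (G y)⁻¹ i j = Sf.ev y (g' i j))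

include hg hg'

/-- The coordinate formulas are built from values, partial derivatives and real constants. As
`Sf.ev` is a homomorphism and `Sf.ev_d` matches the derivatives, each formula is the value of its
algebraic version; the same scheme gives the other lemmas of this section. -/
lemma christoffel_ev (k i j : Fin 2) (y : U) :
    christoffel G k i j y = Sf.ev y (chrA Sf.d g g' k i j) := by
  have hd : ∀ a b c, pd a (fun z => G z b c) y = Sf.ev y (Sf.d a (g b c)) :=
    fun a b c => Sf.ev_d a (fun z => G z b c) _ (hg b c) y
  simp only [christoffel, chrA, map_mul, map_sum, map_add, map_sub, Sf.ev_algebraMap, hg', hd]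

lemma christoffelTrace_ev (i : Fin 2) (y : U) :
    christoffelTrace G i y = Sf.ev y (trA (chrA Sf.d g g') i) := by
  simp only [christoffelTrace, trA, map_sum, christoffel_ev hg hg']

variable {f : Plane → ℝ} {f' : Sf U} (hf : ∀ y : U, f y = Sf.ev y f')

include hf in
lemma covD_ev (w : ℝ) (i : Fin 2) (y : U) :
    covD G w f i y = Sf.ev y (nab₀ Sf.d (chrA Sf.d g g') w f' i) := by
  simp only [covD, nab₀, map_mul, map_sub, Sf.ev_algebraMap, christoffelTrace_ev hg hg',
    Sf.ev_d _ _ _ hf, hf y]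

include hf in
lemma covDD_ev (w : ℝ) (i j : Fin 2) (y : U) :
    covDD G w f i j y
      = Sf.ev y (nab₁ Sf.d (chrA Sf.d g g') w (nab₀ Sf.d (chrA Sf.d g g') w f') i j) := by
  simp only [covDD, nab₁, map_mul, map_sub, map_sum, Sf.ev_algebraMap, christoffelTrace_ev hg hg',
    christoffel_ev hg hg', covD_ev hg hg' hf, Sf.ev_d _ _ _ (covD_ev hg hg' hf w _)]

variable {P : Plane → Matrix (Fin 2) (Fin 2) ℝ} {P' : Fin 2 → Fin 2 → Sf U}
  (hP : ∀ i j, ∀ y : U, P y i j = Sf.ev y (P' i j))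

include hP in
lemma covP_ev (w : ℝ) (k i j : Fin 2) (y : U) :
    covP G w P k i j y = Sf.ev y (nab₂ Sf.d (chrA Sf.d g g') w P' k i j) := by
  have hd : ∀ a b c, pd a (fun z => P z b c) y = Sf.ev y (Sf.d a (P' b c)) :=
    fun a b c => Sf.ev_d a (fun z => P z b c) _ (hP b c) y
  simp only [covP, nab₂, map_mul, map_sub, map_add, map_sum, Sf.ev_algebraMap,
    christoffelTrace_ev hg hg', christoffel_ev hg hg', hd, hP _ _ y]

include hP in
lemma covPP_ev (w : ℝ) (i j k r : Fin 2) (y : U) :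
    covPP G w P i j k r y
      = Sf.ev y (nab₃ Sf.d (chrA Sf.d g g') w (nab₂ Sf.d (chrA Sf.d g g') w P') i j k r) := by
  simp only [covPP, nab₃, map_mul, map_sub, map_add, map_sum, Sf.ev_algebraMap,
    christoffelTrace_ev hg hg', christoffel_ev hg hg', covP_ev hg hg' hP,
    Sf.ev_d _ _ _ (covP_ev hg hg' hP w _ _ _)]

lemma scalarCurvature_ev (y : U) :
    scalarCurvature G y = Sf.ev y (scalA Sf.d (chrA Sf.d g g') g') := by
  simp only [scalarCurvature, ricci, scalA, riemA, map_mul, map_sub, map_add, map_sum,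
    christoffel_ev hg hg', Sf.ev_d _ _ _ (christoffel_ev hg hg' _ _ _), hg']

lemma schwarzian_ev {F : Plane → ℝ} {F₁ F₂ : Sf U} (hF : ∀ y : U, F y = Sf.ev y F₁)
    (hF' : F₁ * F₂ = 1) (i j : Fin 2) (y : U) :
    schwarzian G F i j y = Sf.ev y (schA Sf.d (chrA Sf.d g g') g g' F₁ F₂ i j) := by
  have h := congrArg (Sf.ev y) hF'
  rw [map_mul, map_one] at h
  have h1 : Sf.ev y F₂ = (Sf.ev y F₁)⁻¹ := eq_inv_of_mul_eq_one_right h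
  have h0 : Sf.ev y F₁ ≠ 0 := left_ne_zero_of_mul_eq_one h
  simp only [schwarzian, schA, nab₁, map_mul, map_sub, map_add, map_sum, map_pow,
    christoffel_ev hg hg', Sf.ev_d _ _ _ (Sf.ev_d _ _ _ hF), Sf.ev_d _ _ _ hF, hg', hg _ _ y, hF y,
    h1, Sf.ev_algebraMap]
  field_simp
  ring

end Link

/-- The explicit formula on surfaces, for given values `S` of the Schwarzian derivative. -/
def curvedFormula (l m : ℝ) (G : Plane → Matrix (Fin 2) (Fin 2) ℝ) (S : Fin 2 → Fin 2 → ℝ)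
    (P : Plane → Matrix (Fin 2) (Fin 2) ℝ) (f : Plane → ℝ) (x : Plane) : ℝ :=
  ∑ i, ∑ j, P x i j * covDD G l f i j x
    + ∑ j, (β₁ 2 l m * ∑ i, covP G (m - l) P i i j x
        + β₂ 2 l m * ∑ i, ∑ k, ∑ r, (G x)⁻¹ i j * G x k r * covP G (m - l) P i k r x)
      * covD G l f j x
    + (β₃ 2 l m * ∑ i, ∑ j, covPP G (m - l) P i j i j x
        + β₄ 2 l m * ∑ i, ∑ j, ∑ k, ∑ r,
            (G x)⁻¹ i j * G x k r * covPP G (m - l) P i j k r x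
        + 4 * l * (m - 1) / (2 * (m - l) - 3) *
          (-(∑ i, ∑ j, S i j * P x i j)
            + 1 / (8 * ((m - l) - 1)) * scalarCurvature G x * ∑ i, ∑ j, G x i j * P x i j))
      * f x

lemma surfaceFormula_eq_curvedFormula (l m : ℝ) (G : Plane → Matrix (Fin 2) (Fin 2) ℝ)
    (F : Plane → ℝ) (P : Plane → Matrix (Fin 2) (Fin 2) ℝ) (f : Plane → ℝ) (x : Plane) :
    surfaceFormula l m G F P f x
      = curvedFormula l m G (fun i j => schwarzian G F i j x) P f x := rfl

/-- The tensor S enters linearly, without derivatives. Splitting it off allows naturality to be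
proved at a single point, with S known there only. -/
lemma curvedFormula_eq_zero_sub (l m : ℝ) (G : Plane → Matrix (Fin 2) (Fin 2) ℝ)
    (S : Fin 2 → Fin 2 → ℝ) (P : Plane → Matrix (Fin 2) (Fin 2) ℝ) (f : Plane → ℝ) (x : Plane) :
    curvedFormula l m G S P f x = curvedFormula l m G 0 P f x
      - 4 * l * (m - 1) / (2 * (m - l) - 3) * (∑ i, ∑ j, S i j * P x i j) * f x := by
  simp only [curvedFormula, Pi.zero_apply, zero_mul, Finset.sum_const_zero]
  ring

lemma curvedFormula_ev {U : TopologicalSpace.Opens Plane} {G : Plane → Matrix (Fin 2) (Fin 2) ℝ}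
    {g g' : Fin 2 → Fin 2 → Sf U} (hg : ∀ i j, ∀ y : U, G y i j = Sf.ev y (g i j))
    (hg' : ∀ i j, ∀ y : U, (G y)⁻¹ i j = Sf.ev y (g' i j)) {f : Plane → ℝ} {f' : Sf U}
    (hf : ∀ y : U, f y = Sf.ev y f') {P : Plane → Matrix (Fin 2) (Fin 2) ℝ}
    {P' : Fin 2 → Fin 2 → Sf U} (hP : ∀ i j, ∀ y : U, P y i j = Sf.ev y (P' i j)) (l m : ℝ) (y : U)
    {S : Fin 2 → Fin 2 → ℝ} {S' : Fin 2 → Fin 2 → Sf U} (hS : ∀ i j, S i j = Sf.ev y (S' i j)) :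
    curvedFormula l m G S P f y
      = Sf.ev y (quantA Sf.d l m (chrA Sf.d g g') g g' S' P' f') := by
  simp only [curvedFormula, quantA, map_mul, map_add, map_sum, map_neg, Sf.ev_algebraMap,
    covDD_ev hg hg' hf, covD_ev hg hg' hf, covP_ev hg hg' hP, covPP_ev hg hg' hP,
    scalarCurvature_ev hg hg', hg _ _ y, hg' _ _ y, hf y, hP _ _ y, hS]

/-! ### Naturality -/

section Naturality

variable {M : Type*} [TopologicalSpace M] [ChartedSpace Plane M] (g : Metric M)

lemma Metric.contDiffOn_inv (e : Chart M) (i j : Fin 2) :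
    ContDiffOn ℝ ∞ (fun x => (g.comp e x)⁻¹ i j) e.1.target := by
  have hd : ContDiffOn ℝ ∞ (fun x => (g.comp e x).det) e.1.target := by
    simp only [Matrix.det_fin_two]
    exact ((g.smooth e 0 0).mul (g.smooth e 1 1)).sub ((g.smooth e 0 1).mul (g.smooth e 1 0))
  have ha : ContDiffOn ℝ ∞ (fun x => (g.comp e x).adjugate i j) e.1.target := by
    simp only [Matrix.adjugate_fin_two]
    fin_cases i <;> fin_cases j
    · exact g.smooth e 1 1
    · exact (g.smooth e 0 1).neg
    · exact (g.smooth e 1 0).neg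
    · exact g.smooth e 0 0
  refine ((hd.inv fun x hx => g.nondegenerate e x hx).mul ha).congr fun x hx => ?_
  rw [Matrix.inv_def, Ring.inverse_eq_inv']
  rfl

/-- The components of the metric on an open subset of the coordinate domain. -/
def Metric.lift (e : Chart M) {U : TopologicalSpace.Opens Plane} (hU : (U : Set Plane) ⊆ e.1.target)
    (i j : Fin 2) : Sf U := Sf.mk (fun x => g.comp e x i j) ((g.smooth e i j).mono hU)

/-- The components of the inverse of the metric. -/
def Metric.liftInv (e : Chart M) {U : TopologicalSpace.Opens Plane}
    (hU : (U : Set Plane) ⊆ e.1.target) (i j : Fin 2) : Sf U :=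
  Sf.mk (fun x => (g.comp e x)⁻¹ i j) ((g.contDiffOn_inv e i j).mono hU)

lemma Metric.ev_lift (e : Chart M) {U : TopologicalSpace.Opens Plane}
    (hU : (U : Set Plane) ⊆ e.1.target) (i j : Fin 2) (y : U) :
    Sf.ev y (g.lift e hU i j) = g.comp e y i j := rfl

lemma Metric.ev_liftInv (e : Chart M) {U : TopologicalSpace.Opens Plane}
    (hU : (U : Set Plane) ⊆ e.1.target) (i j : Fin 2) (y : U) :
    Sf.ev y (g.liftInv e hU i j) = (g.comp e y)⁻¹ i j := rfl

/-- The component of a density on an open subset of the coordinate domain. -/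
def Density.lift {w : ℝ} (f : Density M w) (e : Chart M) {U : TopologicalSpace.Opens Plane}
    (hU : (U : Set Plane) ⊆ e.1.target) : Sf U := Sf.mk (f.1 e) ((f.2.1 e).mono hU)

lemma Density.ev_lift {w : ℝ} (f : Density M w) (e : Chart M) {U : TopologicalSpace.Opens Plane}
    (hU : (U : Set Plane) ⊆ e.1.target) (y : U) : Sf.ev y (Density.lift f e hU) = f.1 e y := rfl

/-- The components of a symbol of degree two on an open subset of the coordinate domain. -/
def Symbol₂.lift {w : ℝ} (P : Symbol₂ M w) (e : Chart M) {U : TopologicalSpace.Opens Plane}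
    (hU : (U : Set Plane) ⊆ e.1.target) (i j : Fin 2) : Sf U :=
  Sf.mk (fun x => P.1 e x i j) ((P.2.1 e i j).mono hU)

lemma Symbol₂.ev_lift {w : ℝ} (P : Symbol₂ M w) (e : Chart M) {U : TopologicalSpace.Opens Plane}
    (hU : (U : Set Plane) ⊆ e.1.target) (i j : Fin 2) (y : U) :
    Sf.ev y (Symbol₂.lift P e hU i j) = P.1 e y i j := rfl

lemma Metric.isUnit_det {e : Chart M} {x : Plane} (hx : x ∈ e.1.target) :
    IsUnit (g.comp e x).det := isUnit_iff_ne_zero.2 (g.nondegenerate e x hx)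

lemma Metric.transform_mul {e e' : Chart M} {x : Plane} (hx : x ∈ overlap e e') :
    g.comp e x = (jac e e' x).transpose * g.comp e' (transition e e' x) * jac e e' x := by
  ext i j
  rw [g.transform e e' x hx]
  simp only [Matrix.mul_apply, Matrix.transpose_apply, Fin.sum_univ_two]
  ring

lemma Metric.inv_transform {e e' : Chart M} {x : Plane} (hx : x ∈ overlap e e') :
    jac e e' x * (g.comp e x)⁻¹ * (jac e e' x).transpose
      = (g.comp e' (transition e e' x))⁻¹ := by
  have hu : IsUnit (jac e e' x).det := isUnit_iff_ne_zero.2 (det_jac_ne hx)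
  have hu' : IsUnit (jac e e' x).transpose.det := by rwa [Matrix.det_transpose]
  rw [g.transform_mul hx, Matrix.mul_inv_rev, Matrix.mul_inv_rev,
    ← Matrix.mul_assoc, Matrix.mul_nonsing_inv _ hu, Matrix.one_mul, Matrix.mul_assoc,
    Matrix.nonsing_inv_mul _ hu', Matrix.mul_one]

lemma Metric.inv_mul {e : Chart M} {x : Plane} (hx : x ∈ e.1.target) (a b : Fin 2) :
    ∑ c, (g.comp e x)⁻¹ a c * g.comp e x c b = if a = b then 1 else 0 := by
  have := congrFun (congrFun (Matrix.nonsing_inv_mul _ (g.isUnit_det hx)) a) b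
  rwa [Matrix.mul_apply, Matrix.one_apply] at this

variable {e e' : Chart M}

lemma Metric.lift_transform (i j : Fin 2) :
    g.lift e (U := overlapO e e') (overlap_subset e e') i j = ∑ a, ∑ b,
      jacA e e' a i * jacA e e' b j
        * pull e e' (g.lift e' (U := overlapO e' e) (overlap_subset e' e) a b) :=
  Sf.ext_ev fun x => by
    simp only [map_sum, map_mul, ev_pull, ev_jacA, Metric.ev_lift]
    exact g.transform e e' x x.2 i j

lemma Metric.liftInv_transform (a b : Fin 2) :
    ∑ i, ∑ j, jacA e e' a i * jacA e e' b j
        * g.liftInv e (U := overlapO e e') (overlap_subset e e') i j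
      = pull e e' (g.liftInv e' (U := overlapO e' e) (overlap_subset e' e) a b) :=
  Sf.ext_ev fun x => by
    have := congrFun (congrFun (g.inv_transform x.2) a) b
    simp only [Matrix.mul_apply, Matrix.transpose_apply, Fin.sum_univ_two] at this
    simp only [map_sum, map_mul, ev_pull, ev_jacA, Metric.ev_liftInv]
    simp only [Fin.sum_univ_two]
    refine Eq.trans ?_ this
    ring

lemma Metric.liftInv_mul (e : Chart M) {U : TopologicalSpace.Opens Plane}
    (hU : (U : Set Plane) ⊆ e.1.target) (a b : Fin 2) :
    ∑ c, g.liftInv e hU a c * g.lift e hU c b = if a = b then 1 else 0 :=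
  Sf.ext_ev fun x => by
    have := g.inv_mul (hU x.2) a b
    simp only [map_sum, map_mul]
    refine Eq.trans this ?_
    split_ifs <;> simp

lemma Metric.lift_symm (e : Chart M) {U : TopologicalSpace.Opens Plane}
    (hU : (U : Set Plane) ⊆ e.1.target) : g.lift e hU 1 0 = g.lift e hU 0 1 :=
  Sf.mk_eq_mk fun x hx => g.symm e x (hU hx) 1 0

/-- The Levi-Civita connection on an open subset of the coordinate domain. -/
def Metric.chr (e : Chart M) {U : TopologicalSpace.Opens Plane}
    (hU : (U : Set Plane) ⊆ e.1.target) : Fin 2 → Fin 2 → Fin 2 → Sf U :=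
  chrA Sf.d (g.lift e hU) (g.liftInv e hU)

lemma Metric.chr_symm (e : Chart M) {U : TopologicalSpace.Opens Plane}
    (hU : (U : Set Plane) ⊆ e.1.target) (c : Fin 2) : g.chr e hU c 1 0 = g.chr e hU c 0 1 := by
  simp only [Metric.chr, chrA, Metric.lift_symm, Fin.sum_univ_two]
  ring

lemma Metric.conn_chr : FrameChange.Conn Sf.d (pull e e') (jacA e e')
    (g.chr e (U := overlapO e e') (overlap_subset e e'))
    (g.chr e' (U := overlapO e' e) (overlap_subset e' e)) :=
  (frameChange e e').conn_chr g.lift_transform g.liftInv_transform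
    (g.liftInv_mul e' _) (g.lift_symm e' _)

lemma Symbol₂.lift_transform {w : ℝ} (P : Symbol₂ M w) (a b : Fin 2) :
    ∑ i, ∑ j, jacA e e' a i * jacA e e' b j
        * Symbol₂.lift P e (U := overlapO e e') (overlap_subset e e') i j
      = densA w e e'
        * pull e e' (Symbol₂.lift P e' (U := overlapO e' e) (overlap_subset e' e) a b) :=
  Sf.ext_ev fun x => by
    simp only [map_sum, map_mul, ev_pull, ev_jacA, Symbol₂.ev_lift]
    exact P.2.2.2.2 e e' x x.2 a b

lemma Density.lift_transform {w : ℝ} (f : Density M w) :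
    Density.lift f e (U := overlapO e e') (overlap_subset e e') = densA w e e'
        * pull e e' (Density.lift f e' (U := overlapO e' e) (overlap_subset e' e)) :=
  Sf.ext_ev fun x => by
    simp only [map_mul, ev_pull, Density.ev_lift]
    exact f.2.2.2 e e' x x.2

lemma curvedFormula_lift {l m w : ℝ} (P : Symbol₂ M w) (f : Density M l)
    (e : Chart M) {U : TopologicalSpace.Opens Plane} (hU : (U : Set Plane) ⊆ e.1.target) (y : U)
    {S : Fin 2 → Fin 2 → ℝ} {S' : Fin 2 → Fin 2 → Sf U} (hS : ∀ i j, S i j = Sf.ev y (S' i j)) :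
    curvedFormula l m (g.comp e) S (P.1 e) (f.1 e) y
      = Sf.ev y (quantA Sf.d l m (g.chr e hU) (g.lift e hU) (g.liftInv e hU) S'
        (Symbol₂.lift P e hU) (Density.lift f e hU)) := by
  rw [Metric.chr]
  exact curvedFormula_ev (G := g.comp e) (g := g.lift e hU) (g' := g.liftInv e hU)
    (fun i j y => (g.ev_lift e hU i j y).symm) (fun i j y => (g.ev_liftInv e hU i j y).symm)
    (f := f.1 e) (f' := Density.lift f e hU) (fun y => (Density.ev_lift f e hU y).symm)
    (P := P.1 e) (P' := Symbol₂.lift P e hU) (fun i j y => (Symbol₂.ev_lift P e hU i j y).symm)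
    l m y hS

lemma curvedFormula_zero_transition {l m : ℝ} (P : Symbol₂ M (m - l)) (f : Density M l)
    {x : Plane} (hx : x ∈ overlap e e') :
    curvedFormula l m (g.comp e) 0 (P.1 e) (f.1 e) x = densFactor m e e' x
      * curvedFormula l m (g.comp e') 0 (P.1 e') (f.1 e') (transition e e' x) := by
  have hx' := transition_mem_symm hx
  have e1 := curvedFormula_lift (m := m) g P f e (overlap_subset e e') (U := overlapO e e') ⟨x, hx⟩
    (S := 0) (S' := 0) (fun _ _ => (map_zero _).symm)
  have e2 := curvedFormula_lift (m := m) g P f e' (overlap_subset e' e) (U := overlapO e' e) ⟨_, hx'⟩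
    (S := 0) (S' := 0) (fun _ _ => (map_zero _).symm)
  have q := (frameChange e e').quant_eq g.conn_chr (g.chr_symm e' _) g.lift_transform
      g.liftInv_transform (S := 0) (S' := 0) (fun _ _ => by simp) (weight_densA l e e')
      (weight_densA (m - l) e e') (Symbol₂.lift_transform P) (Density.lift_transform f)
  have q' := congrArg (Sf.ev ⟨x, hx⟩) q
  rw [map_mul, map_mul, ev_pull] at q'
  refine e1.trans (q'.trans ?_)
  rw [← e2]
  congr 1
  exact (densFactor_add (m - l) l hx).trans (by rw [sub_add_cancel])

/-- Naturality of the explicit formula. -/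
theorem curvedFormula_transition {l m : ℝ} (P : Symbol₂ M (m - l)) (f : Density M l) {x : Plane}
    (hx : x ∈ overlap e e') {S S' : Fin 2 → Fin 2 → ℝ}
    (hS : ∀ i j, S i j = ∑ a, ∑ b, jac e e' x a i * jac e e' x b j * S' a b) :
    curvedFormula l m (g.comp e) S (P.1 e) (f.1 e) x = densFactor m e e' x
      * curvedFormula l m (g.comp e') S' (P.1 e') (f.1 e') (transition e e' x) := by
  obtain ⟨hP1, hP2, hP3, hP4⟩ := P.2
  obtain ⟨hf1, hf2, hf3⟩ := f.2
  rw [curvedFormula_eq_zero_sub, curvedFormula_zero_transition g P f hx,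
    curvedFormula_eq_zero_sub l m (g.comp e') S']
  have hSP : ∑ i, ∑ j, S i j * P.1 e x i j
      = densFactor (m - l) e e' x * ∑ a, ∑ b, S' a b * P.1 e' (transition e e' x) a b := by
    have h00 := hP4 e e' x hx 0 0
    have h01 := hP4 e e' x hx 0 1
    have h10 := hP4 e e' x hx 1 0
    have h11 := hP4 e e' x hx 1 1
    change _ = densFactor (m - l) e e' x * _ at h00 h01 h10 h11
    simp only [hS, Fin.sum_univ_two] at *
    linear_combination S' 0 0 * h00 + S' 0 1 * h01 + S' 1 0 * h10 + S' 1 1 * h11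
  have hd : densFactor m e e' x = densFactor (m - l) e e' x * densFactor l e e' x := by
    rw [densFactor_add _ _ hx, sub_add_cancel]
  have hf : f.1 e x = densFactor l e e' x * f.1 e' (transition e e' x) := hf3 e e' x hx
  rw [hSP, hf, hd]
  ring

/-- Naturality of the Schwarzian derivative. -/
theorem schwarzian_transition {F F' : Plane → ℝ} (hF : ContDiffOn ℝ ∞ F' (overlap e' e))
    (hF0 : ∀ y ∈ overlap e' e, F' y ≠ 0) (hFF' : ∀ y ∈ overlap e e', F y = F' (transition e e' y))
    {x : Plane} (hx : x ∈ overlap e e') (i j : Fin 2) :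
    schwarzian (g.comp e) F i j x = ∑ a, ∑ b, jac e e' x a i * jac e e' x b j
      * schwarzian (g.comp e') F' a b (transition e e' x) := by
  have hx' := transition_mem_symm hx
  have hI : ContDiffOn ℝ ∞ (fun y => (F' y)⁻¹) (overlap e' e) := hF.inv hF0
  have hu : Sf.mk (U := overlapO e' e) F' hF * Sf.mk (U := overlapO e' e) _ hI = 1 :=
    Sf.ext_ev fun y => by
      rw [map_mul, Sf.ev_mk, Sf.ev_mk, map_one, mul_inv_cancel₀ (hF0 y y.2)]
  have hu' := congrArg (pull e e') hu
  rw [map_mul, map_one] at hu'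
  have e1 := schwarzian_ev (U := overlapO e e') (G := g.comp e)
    (g := g.lift e (overlap_subset e e')) (g' := g.liftInv e (overlap_subset e e'))
    (fun _ _ _ => rfl) (fun _ _ _ => rfl) (F := F)
    (F₁ := pull e e' (Sf.mk (U := overlapO e' e) F' hF)) (fun y => by
      rw [ev_pull]; exact hFF' y y.2) hu' i j ⟨x, hx⟩
  have e2 := fun a b => schwarzian_ev (U := overlapO e' e) (G := g.comp e')
    (g := g.lift e' (overlap_subset e' e)) (g' := g.liftInv e' (overlap_subset e' e))
    (fun _ _ _ => rfl) (fun _ _ _ => rfl) (F := F')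
    (F₁ := Sf.mk (U := overlapO e' e) F' hF) (fun y => rfl) hu a b ⟨_, hx'⟩
  have q := congrArg (Sf.ev ⟨x, hx⟩) ((frameChange e e').sch_eq g.conn_chr g.lift_transform
    g.liftInv_transform (Sf.mk (U := overlapO e' e) F' hF) (Sf.mk (U := overlapO e' e) _ hI) i j)
  refine e1.trans (q.trans ?_)
  simp only [map_sum, map_mul, ev_pull, ev_jacA, e2]
  rfl

end Naturality


/-! ### Conformal fields -/

section ConfPoly

variable {A : Type*} [CommRing A] [Algebra ℝ A]

/-- The field of the conformal Lie algebra with the translation part `a`, the rotation part `r`,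
the dilation part `s` and the inversion part `b`. -/
def confPoly (e : Fin 2 → ℝ) (a : Fin 2 → ℝ) (r s : ℝ) (b : Fin 2 → ℝ) (x : Fin 2 → A)
    (k : Fin 2) : A :=
  algebraMap ℝ A (a k) + algebraMap ℝ A r * (![-(algebraMap ℝ A (e 1) * x 1),
    algebraMap ℝ A (e 0) * x 0] k) + algebraMap ℝ A s * x k
  + ∑ i, algebraMap ℝ A (b i) * ((if k = i then ∑ j, algebraMap ℝ A (e j) * x j * x j else 0)
    - 2 * (algebraMap ℝ A (e i) * x i * x k))

/-- The dilation part of the derivative of a conformal field. -/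
def confDil (e : Fin 2 → ℝ) (s : ℝ) (b : Fin 2 → ℝ) (x : Fin 2 → A) : A :=
  algebraMap ℝ A s - 2 * ∑ i, algebraMap ℝ A (b i * e i) * x i

/-- The rotation part of the derivative of a conformal field. -/
def confRot (r : ℝ) (b : Fin 2 → ℝ) (x : Fin 2 → A) : A :=
  algebraMap ℝ A r + 2 * (algebraMap ℝ A (b 1) * x 0) - 2 * (algebraMap ℝ A (b 0) * x 1)

variable (e a b : Fin 2 → ℝ) (r s : ℝ) (x : Fin 2 → A) (D : Derivation ℝ A A)

lemma derivation_two : D (2 : A) = 0 := by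
  rw [← map_ofNat (algebraMap ℝ A) 2, Derivation.map_algebraMap]

/-- Here x need not be a coordinate system: the same identity serves for the coordinate functions
and for the components of a transition map. -/
lemma derivation_confPoly_zero : D (confPoly e a r s b x 0)
    = confDil e s b x * D (x 0) - algebraMap ℝ A (e 1) * confRot r b x * D (x 1) := by
  simp only [confPoly, confDil, confRot, Fin.sum_univ_two, map_add, map_sub, map_neg,
    Derivation.leibniz, Derivation.map_algebraMap, smul_eq_mul, derivation_two, Matrix.cons_val_zero,
    if_true, zero_ne_one, if_false, map_zero, map_mul (algebraMap ℝ A)]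
  ring

lemma derivation_confPoly_one : D (confPoly e a r s b x 1)
    = algebraMap ℝ A (e 0) * confRot r b x * D (x 0) + confDil e s b x * D (x 1) := by
  simp only [confPoly, confDil, confRot, Fin.sum_univ_two, map_add, map_sub,
    Derivation.leibniz, Derivation.map_algebraMap, smul_eq_mul, derivation_two, Matrix.cons_val_one,
    if_true, one_ne_zero, if_false, map_zero, map_mul (algebraMap ℝ A), Matrix.cons_val_zero]
  ring

lemma isConfField_confPoly (he : ∀ i, e i = 1 ∨ e i = -1) {d : Fin 2 → Derivation ℝ A A}
    (hx : ∀ i j, d i (x j) = if i = j then 1 else 0) :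
    IsConfField d e (confPoly e a r s b x) (confDil e s b x) (confRot r b x)
      (fun i => -(2 * (b i * e i))) where
  d00 := by rw [derivation_confPoly_zero, hx, hx]; simp
  d11 := by rw [derivation_confPoly_one, hx, hx]; simp
  d01 := by rw [derivation_confPoly_one, hx, hx]; simp
  d10 := by rw [derivation_confPoly_zero, hx, hx]; simp
  du i := by
    fin_cases i <;> simp [confDil, derivation_two, hx, map_ofNat]
  dv0 := by rcases he 1 with h | h <;> simp [confRot, derivation_two, hx, h, map_ofNat]
  dv1 := by rcases he 0 with h | h <;> simp [confRot, derivation_two, hx, h, map_ofNat]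

end ConfPoly

/-- A normal form for the fields of the algebra, linear in the parameters. It makes them explicit
polynomials that can be differentiated and evaluated in any algebra. -/
lemma exists_confPoly {ε : Fin 2 → ℝ} {X : Plane → Fin 2 → ℝ} (hX : X ∈ confAlg ε) :
    ∃ a r s b, ∀ x : Plane, X x = confPoly ε a r s b x := by
  induction hX using Submodule.span_induction with
  | mem X h =>
    rcases h with ((⟨i, rfl⟩ | ⟨⟨i, j⟩, rfl⟩) | h) | ⟨i, rfl⟩
    · refine ⟨Pi.single i 1, 0, 0, 0, fun x => funext fun k => ?_⟩
      simp [translationField, confPoly]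
    · refine ⟨0, if i = j then 0 else if i = 0 then 1 else -1, 0, 0, fun x => funext fun k => ?_⟩
      fin_cases i <;> fin_cases j <;> fin_cases k <;> simp [rotationField, confPoly]
    · rw [Set.mem_singleton_iff] at h
      subst h
      refine ⟨0, 0, 1, 0, fun x => funext fun k => ?_⟩
      simp [homothetyField, confPoly]
    · refine ⟨0, 0, 0, Pi.single i 1, fun x => funext fun k => ?_⟩
      fin_cases i <;> fin_cases k <;> simp [inversionField, confPoly, Fin.sum_univ_two] <;> ring
  | zero => exact ⟨0, 0, 0, 0, fun x => funext fun k => by fin_cases k <;> simp [confPoly]⟩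
  | add X Y _ _ hX hY =>
    obtain ⟨a, r, s, b, h⟩ := hX
    obtain ⟨a', r', s', b', h'⟩ := hY
    refine ⟨a + a', r + r', s + s', b + b', fun x => funext fun k => ?_⟩
    rw [Pi.add_apply, Pi.add_apply, h, h']
    simp only [confPoly, Fin.sum_univ_two, Pi.add_apply, map_add]
    ring
  | smul t X _ hX =>
    obtain ⟨a, r, s, b, h⟩ := hX
    refine ⟨t • a, t * r, t * s, t • b, fun x => funext fun k => ?_⟩
    rw [Pi.smul_apply, Pi.smul_apply, h]
    fin_cases k <;> simp [confPoly, Fin.sum_univ_two] <;> ring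

lemma confPoly_mem (ε a : Fin 2 → ℝ) (r s : ℝ) (b : Fin 2 → ℝ) :
    (fun x : Plane => confPoly ε a r s b x) ∈ confAlg ε := by
  have h : (fun x : Plane => confPoly ε a r s b x)
      = ∑ i, a i • translationField i + r • rotationField ε 0 1 + s • homothetyField
        + ∑ i, b i • inversionField ε i := by
    funext x k
    fin_cases k <;> simp [confPoly, translationField, rotationField, homothetyField, inversionField,
      Fin.sum_univ_two] <;> ring
  rw [h]
  refine add_mem (add_mem (add_mem (sum_mem fun i _ => ?_) ?_) ?_) (sum_mem fun i _ => ?_) <;>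
    refine Submodule.smul_mem _ _ (Submodule.subset_span ?_)
  · exact Or.inl (Or.inl (Or.inl ⟨i, rfl⟩))
  · exact Or.inl (Or.inl (Or.inr ⟨(0, 1), rfl⟩))
  · exact Or.inl (Or.inr rfl)
  · exact Or.inr ⟨i, rfl⟩

lemma ev_confPoly {U : TopologicalSpace.Opens Plane} (e a : Fin 2 → ℝ) (r s : ℝ) (b : Fin 2 → ℝ)
    (ψ : Fin 2 → Sf U) (x : U) (k : Fin 2) :
    Sf.ev x (confPoly e a r s b ψ k) = confPoly e a r s b (fun j => Sf.ev x (ψ j)) k := by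
  fin_cases k <;> simp [confPoly, Fin.sum_univ_two, map_ofNat]

/-! ### Conformal changes of coordinates that preserve the conformal Lie algebra -/

section Moebius

variable {A : Type*} [CommRing A] [Algebra ℝ A] {d : Fin 2 → Derivation ℝ A A}
  (hc : ∀ u, d 1 (d 0 u) = d 0 (d 1 u))
  {e : Fin 2 → ℝ} (he : ∀ i, e i = 1 ∨ e i = -1) {ψ x : Fin 2 → A} {h h' : A} (hh : h * h' = 1)
  (hψ : ∀ i j, ∑ a, algebraMap ℝ A (e a) * d i (ψ a) * d j (ψ a)
    = if i = j then h * algebraMap ℝ A (e i) else 0)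

include he hh hψ

/-- Conformality exhibits a left inverse of the Jacobian matrix, namely its transpose rescaled by
h⁻¹ and the signs; for square matrices this is also a right inverse. -/
lemma conformal_inv (b a : Fin 2) :
    ∑ j, d j (ψ b) * (h' * algebraMap ℝ A (e j * e a) * d j (ψ a)) = if b = a then 1 else 0 := by
  have hK : (Matrix.of fun j a => h' * algebraMap ℝ A (e j * e a) * d j (ψ a))
      * (Matrix.of fun a j => d j (ψ a)) = 1 := by
    ext i j
    have e2 : algebraMap ℝ A (e i) * algebraMap ℝ A (e i) = 1 := by
      rw [← map_mul]; rcases he i with h | h <;> simp [h]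
    have h1 : ∑ a, h' * algebraMap ℝ A (e i * e a) * d i (ψ a) * d j (ψ a)
        = h' * algebraMap ℝ A (e i) * ∑ a, algebraMap ℝ A (e a) * d i (ψ a) * d j (ψ a) := by
      simp only [Fin.sum_univ_two, map_mul]; ring
    rw [Matrix.mul_apply]
    simp only [Matrix.of_apply]
    rw [h1, hψ, Matrix.one_apply]
    split_ifs
    · linear_combination (h * h') * e2 + hh
    · ring
  have hJ := mul_eq_one_comm.1 hK
  have := congrFun (congrFun hJ b) a
  rwa [Matrix.mul_apply, Matrix.one_apply] at this

include hc

/-- The argument behind the Levi-Civita connection: the derivatives of the conformality equations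
determine all products of first with second derivatives of ψ, and hence the second derivatives, in
terms of d log h. -/
lemma conformal_hess (c i j : Fin 2) :
    2 * d i (d j (ψ c)) = d j (ψ c) * (h' * d i h) + d i (ψ c) * (h' * d j h)
      - if i = j then ∑ k, algebraMap ℝ A (e k * e i) * d k (ψ c) * (h' * d k h) else 0 := by
  have hK := conformal_inv he hh hψ c
  have e2 : ∀ i, algebraMap ℝ A (e i) * algebraMap ℝ A (e i) = 1 := fun i => by
    rw [← map_mul]; rcases he i with h | h <;> simp [h]
  have h20 := e2 0
  have h21 := e2 1
  have hK0 := hK 0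
  have hK1 := hK 1
  have d00 : ∀ k, d k (∑ a, algebraMap ℝ A (e a) * d 0 (ψ a) * d 0 (ψ a))
      = d k h * algebraMap ℝ A (e 0) := fun k => by rw [hψ]; simp [mul_comm]
  have d11 : ∀ k, d k (∑ a, algebraMap ℝ A (e a) * d 1 (ψ a) * d 1 (ψ a))
      = d k h * algebraMap ℝ A (e 1) := fun k => by rw [hψ]; simp [mul_comm]
  have d01 : ∀ k, d k (∑ a, algebraMap ℝ A (e a) * d 0 (ψ a) * d 1 (ψ a)) = 0 := fun k => by
    rw [hψ]; simp
  have a0 := d00 0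
  have a1 := d00 1
  have b0 := d11 0
  have b1 := d11 1
  have c0 := d01 0
  have c1 := d01 1
  -- The second derivative is expanded in the frame formed by the first derivatives, by means of
  -- `conformal_inv`.
  have ip : ∀ i j, 2 * d i (d j (ψ c))
      = 2 * ∑ k, d k (ψ c) * (h' * algebraMap ℝ A (e k)
        * ∑ a, algebraMap ℝ A (e a) * d k (ψ a) * d i (d j (ψ a))) := fun i j => by
    fin_cases c <;> simp only [Fin.zero_eta, Fin.mk_one, if_true, zero_ne_one, one_ne_zero, if_false,
      map_mul, Fin.sum_univ_two] at hK0 hK1 ⊢ <;>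
    linear_combination (-2 * d i (d j (ψ 0))) * hK0 - 2 * d i (d j (ψ 1)) * hK1
  rw [ip]
  simp only [Fin.sum_univ_two, map_add, Derivation.leibniz, Derivation.map_algebraMap, smul_eq_mul,
    hc, map_mul] at a0 a1 b0 b1 c0 c1 ⊢
  fin_cases i <;> fin_cases j <;> simp only [Fin.zero_eta, Fin.mk_one, if_true, zero_ne_one,
    one_ne_zero, if_false, hc]
  · linear_combination (d 0 (ψ c) * h' * algebraMap ℝ A (e 0)) * a0
      + d 1 (ψ c) * h' * algebraMap ℝ A (e 1) * (2 * c0 - a1) + 2 * d 0 (ψ c) * h' * d 0 h * h20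
  · linear_combination (d 0 (ψ c) * h' * algebraMap ℝ A (e 0)) * a1
      + d 1 (ψ c) * h' * algebraMap ℝ A (e 1) * b0 + d 0 (ψ c) * h' * d 1 h * h20
      + d 1 (ψ c) * h' * d 0 h * h21
  · linear_combination (d 0 (ψ c) * h' * algebraMap ℝ A (e 0)) * a1
      + d 1 (ψ c) * h' * algebraMap ℝ A (e 1) * b0 + d 0 (ψ c) * h' * d 1 h * h20
      + d 1 (ψ c) * h' * d 0 h * h21
  · linear_combination (d 1 (ψ c) * h' * algebraMap ℝ A (e 1)) * b1
      + d 0 (ψ c) * h' * algebraMap ℝ A (e 0) * (2 * c1 - b0) + 2 * d 1 (ψ c) * h' * d 1 h * h21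

/-- If ψ carries X to a conformal field with dilation part u, then L_X(h g₀) = 2u h g₀. The trace of
this equation, in dimension two, is the identity. -/
lemma conformal_div {X : Fin 2 → A} {a b : Fin 2 → ℝ} {r s : ℝ}
    (hX : ∀ c, confPoly e a r s b ψ c = ∑ i, d i (ψ c) * X i) :
    ∑ i, d i (X i) + ∑ i, h' * d i h * X i = 2 * confDil e s b ψ := by
  have e2 : ∀ i, algebraMap ℝ A (e i) * algebraMap ℝ A (e i) = 1 := fun i => by
    rw [← map_mul]; rcases he i with h | h <;> simp [h]
  have h20 := e2 0
  have h21 := e2 1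
  have J := conformal_inv he hh hψ
  have J00 := J 0 0
  have J01 := J 0 1
  have J10 := J 1 0
  have J11 := J 1 1
  have K := fun i j => congrArg (fun t => h' * algebraMap ℝ A (e i) * t) (hψ i j)
  have K00 := K 0 0
  have K01 := K 0 1
  have K10 := K 1 0
  have K11 := K 1 1
  have H := conformal_hess hc he hh hψ
  have D0 : ∀ j, d j (confPoly e a r s b ψ 0) = d j (∑ i, d i (ψ 0) * X i) := fun j => by rw [hX]
  have D1 : ∀ j, d j (confPoly e a r s b ψ 1) = d j (∑ i, d i (ψ 1) * X i) := fun j => by rw [hX]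
  simp only [derivation_confPoly_zero, Fin.sum_univ_two, map_add, Derivation.leibniz,
    smul_eq_mul] at D0
  simp only [derivation_confPoly_one, Fin.sum_univ_two, map_add, Derivation.leibniz,
    smul_eq_mul] at D1
  have D00 := D0 0
  have D01 := D0 1
  have D10 := D1 0
  have D11 := D1 1
  have H000 := H 0 0 0
  have H001 := H 0 0 1
  have H011 := H 0 1 1
  have H100 := H 1 0 0
  have H101 := H 1 0 1
  have H111 := H 1 1 1
  simp only [if_true, zero_ne_one, one_ne_zero, if_false, Fin.sum_univ_two, map_mul, hc]
    at J00 J01 J10 J11 K00 K01 K10 K11 D00 D01 D10 D11 H000 H001 H011 H100 H101 H111 ⊢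
  generalize confDil e s b ψ = u at *
  generalize confRot r b ψ = v at *
  have hκ := two_mul_half (A := A)
  generalize algebraMap ℝ A (1 / 2) = κ at *
  generalize algebraMap ℝ A (e 0) = E₀ at *
  generalize algebraMap ℝ A (e 1) = E₁ at *
  clear D0 D1 H K J e2 hX hψ hc
  -- `conformal_hess` provides twice the second derivatives, so the doubled identity is proved and
  -- then halved.
  suffices hs : 2 * (d 0 (X 0) + d 1 (X 1) + (h' * d 0 h * X 0 + h' * d 1 h * X 1)) = 2 * (2 * u) by
    linear_combination κ * hs - (d 0 (X 0) + d 1 (X 1) + (h' * d 0 h * X 0 + h' * d 1 h * X 1)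
      - 2 * u) * hκ
  linear_combination - 2 * (h' * (E₀ * E₀) * d 0 (ψ 0)) * D00
    - 2 * (h' * (E₀ * E₁) * d 0 (ψ 1)) * D10
    - 2 * (h' * (E₁ * E₀) * d 1 (ψ 0)) * D01
    - 2 * (h' * (E₁ * E₁) * d 1 (ψ 1)) * D11
    + 2 * u * (J00 + J11) - 2 * E₁ * v * J10 + 2 * E₀ * v * J01
    - X 0 * (h' * (E₀ * E₀) * d 0 (ψ 0)) * H000
    - X 0 * (h' * (E₁ * E₀) * d 1 (ψ 0)) * H001
    - X 1 * (h' * (E₀ * E₀) * d 0 (ψ 0)) * H001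
    - X 1 * (h' * (E₁ * E₀) * d 1 (ψ 0)) * H011
    - X 0 * (h' * (E₀ * E₁) * d 0 (ψ 1)) * H100
    - X 0 * (h' * (E₁ * E₁) * d 1 (ψ 1)) * H101
    - X 1 * (h' * (E₀ * E₁) * d 0 (ψ 1)) * H101
    - X 1 * (h' * (E₁ * E₁) * d 1 (ψ 1)) * H111
    - (2 * d 0 (X 0) + X 0 * (h' * d 0 h) + X 1 * (h' * d 1 h) + X 0 * (h' * d 0 h) - E₀ * E₀ * (h' * d 0 h) * X 0) * K00
    - (2 * d 0 (X 1) + X 1 * (h' * d 0 h) - E₁ * E₀ * (h' * d 1 h) * X 0) * K01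
    - (2 * d 1 (X 1) + X 0 * (h' * d 0 h) + X 1 * (h' * d 1 h) + X 1 * (h' * d 1 h) - E₁ * E₁ * (h' * d 1 h) * X 1) * K11
    - (2 * d 1 (X 0) + X 0 * (h' * d 1 h) - E₀ * E₁ * (h' * d 0 h) * X 1) * K10
    - (2 * d 0 (X 0) + X 0 * (h' * d 0 h) + X 1 * (h' * d 1 h) + X 0 * (h' * d 0 h) - E₀ * E₀ * (h' * d 0 h) * X 0) * (E₀ * E₀ * hh + h20)
    + X 0 * (h' * d 0 h) * h20
    - (2 * d 1 (X 1) + X 0 * (h' * d 0 h) + X 1 * (h' * d 1 h) + X 1 * (h' * d 1 h) - E₁ * E₁ * (h' * d 1 h) * X 1) * (E₁ * E₁ * hh + h21)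
    + X 1 * (h' * d 1 h) * h21

/-- The dilation part is an affine function of ψ, and the equation in `conformal_hess` is linear in
the component and holds for constants. -/
lemma conformal_dil_hess (b : Fin 2 → ℝ) (s : ℝ) (i j : Fin 2) :
    2 * d i (d j (confDil e s b ψ))
      = h' * d i h * d j (confDil e s b ψ) + h' * d j h * d i (confDil e s b ψ)
        - if i = j then ∑ k, algebraMap ℝ A (e k * e i) * (h' * d k h) * d k (confDil e s b ψ)
          else 0 := by
  have H0 := conformal_hess hc he hh hψ 0 i j
  have H1 := conformal_hess hc he hh hψ 1 i j
  simp only [confDil, map_add, map_sub, Derivation.leibniz, Derivation.map_algebraMap, smul_eq_mul,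
    derivation_two, Fin.sum_univ_two, mul_zero, add_zero, zero_sub, map_neg]
  split_ifs at H0 H1 ⊢ <;> try simp only [Fin.sum_univ_two] at H0 H1
  all_goals linear_combination (-2 * algebraMap ℝ A (b 0 * e 0)) * H0 - 2 * algebraMap ℝ A (b 1 * e 1) * H1

/-- A conformal change of coordinates that preserves the translations and the dilation preserves
the flat Schwarzian derivative. -/
theorem conformal_factor (hx : ∀ i j, d i (x j) = if i = j then 1 else 0)
    (hT : ∀ k, ∃ a r s b, ∀ c, confPoly e a r s b ψ c = d k (ψ c))
    (hE : ∃ a r s b, ∀ c, confPoly e a r s b ψ c = ∑ i, d i (ψ c) * x i) (i j : Fin 2) :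
    4 * d i (h' * d j h) = 2 * (h' * d i h) * (h' * d j h)
      - if i = j then algebraMap ℝ A (e i) * ∑ k, algebraMap ℝ A (e k) * (h' * d k h) * (h' * d k h)
        else 0 := by
  have hη : ∀ i j, d i (h' * d j h) = d j (h' * d i h) := fun i j => by
    simp only [Derivation.leibniz, smul_eq_mul, d_inv hh (fun i => rfl)]
    fin_cases i <;> fin_cases j <;> simp [hc] <;> ring
  -- `conformal_div` for a translation, which has no divergence: each component of d log h is twice
  -- an affine function of ψ.
  have key : ∀ k, ∃ s b, h' * d k h = 2 * confDil e s b ψ := fun k => by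
    obtain ⟨a, r, s, b, h⟩ := hT k
    refine ⟨s, b, ?_⟩
    rw [← conformal_div hc he hh hψ (X := Pi.single k 1) (a := a) (b := b) (r := r) (s := s)]
    · fin_cases k <;> simp [Fin.sum_univ_two]
    · intro c
      rw [h]
      fin_cases k <;> simp [Fin.sum_univ_two]
  -- Hence each of these components satisfies the second-order equation of `conformal_dil_hess`.
  have hess : ∀ k, 2 * d i (d j (h' * d k h))
      = h' * d i h * d j (h' * d k h) + h' * d j h * d i (h' * d k h)
        - if i = j then ∑ l, algebraMap ℝ A (e l * e i) * (h' * d l h) * d l (h' * d k h)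
          else 0 := fun k => by
    obtain ⟨s, b, hk⟩ := key k
    have := conformal_dil_hess hc he hh hψ b s i j
    rw [hk]
    simp only [Derivation.leibniz, smul_eq_mul, derivation_two, mul_zero, add_zero]
    split_ifs at this ⊢ <;> try simp only [Fin.sum_univ_two] at this ⊢
    all_goals linear_combination 2 * this
  obtain ⟨a, r, s, b, hE⟩ := hE
  have hD := conformal_div hc he hh hψ hE
  have hDD := conformal_dil_hess hc he hh hψ b s i j
  -- The dilation xᵏ∂ₖ has divergence 2, so `hD` reads 2 + Σ xᵏηₖ = 2u with η = d log h. It is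
  -- differentiated once here and a second time in `D2`.
  have D1 : ∀ l, 2 * d l (confDil e s b ψ) = h' * d l h + ∑ k, x k * d l (h' * d k h) := fun l => by
    have := congrArg (d l) hD
    simp only [map_add, Fin.sum_univ_two, Derivation.leibniz (D := d l) (h' * _) (x _),
      Derivation.leibniz (D := d l) 2 _, hx, smul_eq_mul, derivation_two] at this
    rw [← sub_eq_zero] at this ⊢
    rw [← neg_eq_zero, ← this]
    fin_cases l <;> simp [Fin.sum_univ_two] <;> ring
  have D2 : 2 * d i (d j (confDil e s b ψ))
      = 2 * d i (h' * d j h) + ∑ k, x k * d i (d j (h' * d k h)) := by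
    have := congrArg (d i) (D1 j)
    simp only [map_add, Fin.sum_univ_two, Derivation.leibniz (D := d i) (x _) _,
      Derivation.leibniz (D := d i) 2 _, hx, smul_eq_mul, derivation_two] at this
    have hji := hη j i
    fin_cases i <;> simp only [Fin.zero_eta, Fin.mk_one, if_true, if_false, zero_ne_one,
      one_ne_zero, Fin.sum_univ_two] at this hji ⊢ <;> linear_combination this + hji
  have k0 := hess 0
  have k1 := hess 1
  have d0 := D1 0
  have d1 := D1 1
  have di := D1 i
  have dj := D1 j
  simp only [Fin.sum_univ_two, map_mul (algebraMap ℝ A)] at k0 k1 D2 d0 d1 di dj hDD ⊢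
  -- After the Hessians of u and of the ηₖ are replaced by means of their common equation, the terms
  -- containing x cancel. An expression for ∂η in terms of η alone is left.
  split_ifs at k0 k1 hDD ⊢
  · linear_combination (-2) * D2 + 2 * hDD + (h' * d i h) * dj + h' * d j h * di
      - x 0 * k0 - x 1 * k1 - algebraMap ℝ A (e 0) * algebraMap ℝ A (e i) * (h' * d 0 h) * d0
      - algebraMap ℝ A (e 1) * algebraMap ℝ A (e i) * (h' * d 1 h) * d1
  · linear_combination (-2) * D2 + 2 * hDD + (h' * d i h) * dj + h' * d j h * di
      - x 0 * k0 - x 1 * k1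

end Moebius

/-! ### The Schwarzian derivative and products of conformal factors -/

section Schwarzian

variable {A : Type*} [CommRing A] [Algebra ℝ A] {d : Fin 2 → Derivation ℝ A A}

/-- In terms of d log F the Schwarzian is polynomial without denominators, and a product of factors
corresponds to a sum of logarithmic derivatives. -/
lemma schA_log {F F' : A} (hF : F * F' = 1) {φ : Fin 2 → A} (hφ : ∀ i, φ i = F' * d i F)
    (Γ : Fin 2 → Fin 2 → Fin 2 → A) (G G' : Fin 2 → Fin 2 → A) (i j : Fin 2) :
    schA d Γ G G' F F' i j
      = algebraMap ℝ A (1 / 2) * (d i (φ j) - ∑ k, Γ k i j * φ k)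
        - algebraMap ℝ A (1 / 4) * (φ i * φ j)
        + algebraMap ℝ A (1 / 8) * (∑ k, ∑ r, G' k r * φ k * φ r) * G i j := by
  have h2 := two_mul_half (A := A)
  have h3 : algebraMap ℝ A (3 / 4) = 3 * algebraMap ℝ A (1 / 2) ^ 2 := by
    rw [← map_ofNat (algebraMap ℝ A) 3, ← map_pow, ← map_mul]; norm_num
  have h4 : algebraMap ℝ A (1 / 4) = algebraMap ℝ A (1 / 2) ^ 2 := by
    rw [← map_pow]; norm_num
  have u2 : F ^ 2 * F' ^ 2 = 1 := by rw [← mul_pow, hF, one_pow]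
  simp only [schA, nab₁, d_F hF hφ, Derivation.leibniz, smul_eq_mul, Fin.sum_univ_two, map_zero, h3,
    h4]
  generalize algebraMap ℝ A (1 / 2) = κ at *
  linear_combination κ * (d i (φ j) + φ i * φ j - Γ 0 i j * φ 0 - Γ 1 i j * φ 1) * hF
    + (algebraMap ℝ A (1 / 8) * (G' 0 0 * φ 0 * φ 0 + G' 0 1 * φ 0 * φ 1 + G' 1 0 * φ 1 * φ 0
      + G' 1 1 * φ 1 * φ 1) * G i j - 3 * κ ^ 2 * φ i * φ j) * u2 - κ * φ i * φ j * h2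

/-- The cocycle property of the Schwarzian derivative, for a conformal factor with vanishing flat
Schwarzian derivative. -/
lemma IsConfConn.sch_mul {e : Fin 2 → ℝ} {F F' h h' : A}
    (hF : F * F' = 1) (hh : h * h' = 1) {Γ : Fin 2 → Fin 2 → Fin 2 → A}
    (hΓ : IsConfConn e (fun i => F' * d i F) Γ)
    (hη : ∀ i j, 4 * d i (h' * d j h) = 2 * (h' * d i h) * (h' * d j h)
      - if i = j then algebraMap ℝ A (e i) * ∑ k, algebraMap ℝ A (e k) * (h' * d k h) * (h' * d k h)
        else 0) (i j : Fin 2) :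
    schA d Γ (diagM e F') (diagM e F) (h * F) (h' * F') i j
      = schA d Γ (diagM e F') (diagM e F) F F' i j := by
  have hhF : (h * F) * (h' * F') = 1 := by linear_combination h * h' * hF + hh
  rw [schA_log hhF (φ := fun i => F' * d i F + h' * d i h) (fun i => by
    simp only [Derivation.leibniz, smul_eq_mul]
    linear_combination (-(F' * d i F)) * hh - h' * d i h * hF),
    schA_log hF (φ := fun i => F' * d i F) (fun i => rfl)]
  have H := hη i j
  have h2 := two_mul_half (A := A)
  have h4 : algebraMap ℝ A (1 / 4) = algebraMap ℝ A (1 / 2) ^ 2 := by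
    rw [← map_pow]; norm_num
  have h8 : algebraMap ℝ A (1 / 8) = algebraMap ℝ A (1 / 2) ^ 3 := by
    rw [← map_pow]; norm_num
  simp only [map_add, hΓ _ _ _, h4, h8, diagM]
  generalize algebraMap ℝ A (1 / 2) = κ at *
  have H' : d i (h' * d j h) = κ * ((h' * d i h) * (h' * d j h)) - κ ^ 2 * if i = j then
      algebraMap ℝ A (e i) * ∑ k, algebraMap ℝ A (e k) * (h' * d k h) * (h' * d k h) else 0 := by
    linear_combination κ ^ 2 * H - (d i (h' * d j h)) * (1 + 2 * κ) * h2
      + (κ * ((h' * d i h) * (h' * d j h))) * h2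
  rw [H']
  fin_cases i <;> fin_cases j <;> simp only [Fin.zero_eta, Fin.mk_one, if_true, if_false,
    zero_ne_one, one_ne_zero, Fin.sum_univ_two, map_mul (algebraMap ℝ A)]
  · linear_combination κ ^ 3 * algebraMap ℝ A (e 0) * (algebraMap ℝ A (e 0)
        * (2 * (F' * d 0 F) * (h' * d 0 h) + (h' * d 0 h) * (h' * d 0 h)) + algebraMap ℝ A (e 1)
        * (2 * (F' * d 1 F) * (h' * d 1 h) + (h' * d 1 h) * (h' * d 1 h))) * hF
      + κ ^ 2 * algebraMap ℝ A (e 0) * (algebraMap ℝ A (e 0) * ((F' * d 0 F) * (h' * d 0 h))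
        + algebraMap ℝ A (e 1) * ((F' * d 1 F) * (h' * d 1 h))) * h2
  · ring
  · ring
  · linear_combination κ ^ 3 * algebraMap ℝ A (e 1) * (algebraMap ℝ A (e 0)
        * (2 * (F' * d 0 F) * (h' * d 0 h) + (h' * d 0 h) * (h' * d 0 h)) + algebraMap ℝ A (e 1)
        * (2 * (F' * d 1 F) * (h' * d 1 h) + (h' * d 1 h) * (h' * d 1 h))) * hF
      + κ ^ 2 * algebraMap ℝ A (e 1) * (algebraMap ℝ A (e 0) * ((F' * d 0 F) * (h' * d 0 h))
        + algebraMap ℝ A (e 1) * ((F' * d 1 F) * (h' * d 1 h))) * h2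

end Schwarzian


/-! ### Adapted charts -/

lemma Sf.contDiffOn_of_ev {U : TopologicalSpace.Opens Plane} {v : Plane → ℝ} {u : Sf U}
    (h : ∀ y : U, v y = Sf.ev y u) : ContDiffOn ℝ ∞ v U :=
  (Sf.contDiffOn_rep u).congr fun y hy => by rw [h ⟨y, hy⟩, Sf.ev_rep]

/-- A positive smooth function near a point extends to a positive smooth function on the plane. -/
lemma exists_contDiff_pos_eq {F : Plane → ℝ} {W : Set Plane} (hW : IsOpen W)
    (hF : ContDiffOn ℝ ∞ F W) (h0 : ∀ y ∈ W, 0 < F y) {x : Plane} (hx : x ∈ W) :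
    ∃ F₁ : Plane → ℝ, ContDiff ℝ ∞ F₁ ∧ (∀ y, 0 < F₁ y) ∧ F₁ =ᶠ[𝓝 x] F := by
  obtain ⟨R, hR, hball⟩ := Metric.isOpen_iff.1 hW x hx
  let χ : ContDiffBump x := ⟨R / 3, R / 2, by positivity, by linarith⟩
  have hχ : ∀ y ∉ W, χ y = 0 := fun y hy => χ.zero_of_le_dist (by
    by_contra hlt
    refine hy (hball (Metric.mem_ball.2 ?_))
    have : χ.rOut = R / 2 := rfl
    linarith [not_le.1 hlt])
  -- On W this is a convex combination of 1 and F, hence positive; outside W it is 1.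
  refine ⟨fun y => 1 + χ y * (F y - 1), ?_, fun y => ?_, ?_⟩
  · rw [contDiff_iff_contDiffAt]
    intro y
    by_cases hy : y ∈ Metric.ball x R
    · have hF' := hF.contDiffAt (hW.mem_nhds (hball hy))
      exact contDiffAt_const.add ((χ.contDiff.contDiffAt).mul (hF'.sub contDiffAt_const))
    · have : (fun z => 1 + χ z * (F z - 1)) =ᶠ[𝓝 y] fun _ => 1 := by
        have hy' : y ∈ (Metric.closedBall x (R / 2))ᶜ := fun h => hy (by
          rw [Metric.mem_closedBall] at h; rw [Metric.mem_ball]; linarith)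
        filter_upwards [Metric.isClosed_closedBall.isOpen_compl.mem_nhds hy'] with z hz
        rw [χ.zero_of_le_dist (le_of_lt (not_le.1 hz)), zero_mul, add_zero]
      exact contDiffAt_const.congr_of_eventuallyEq this
  · by_cases hy : y ∈ W
    · have h1 : χ y ≤ 1 := χ.le_one
      rcases eq_or_lt_of_le (χ.nonneg (x := y)) with h | h
      · simp [← h]
      · nlinarith [mul_pos h (h0 y hy)]
    · simp [hχ y hy]
  · filter_upwards [χ.eventuallyEq_one] with y hy
    simp only [Pi.one_apply] at hy
    rw [hy]; ring

lemma schwarzian_congr {G : Plane → Matrix (Fin 2) (Fin 2) ℝ} {F F₁ : Plane → ℝ} {x : Plane}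
    (h : F =ᶠ[𝓝 x] F₁) (i j : Fin 2) : schwarzian G F i j x = schwarzian G F₁ i j x := by
  have hp : ∀ k, pd k F =ᶠ[𝓝 x] pd k F₁ := fun k => by
    filter_upwards [h.eventuallyEq_nhds] with y hy
    exact pd_congr hy
  simp only [schwarzian, h.self_of_nhds, fun k => (hp k).self_of_nhds, pd_congr (hp j)]

section Adapted

variable {M : Type*} [TopologicalSpace M] [ChartedSpace Plane M] {ε : Fin 2 → ℝ}
  (hε : ∀ i, ε i = 1 ∨ ε i = -1) {𝒜 : Set (Chart M)} (h𝒜 : IsConfAtlas ε 𝒜) {g : Metric M}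
  {φ : Chart M} {F : M → ℝ} (hF : Uniformizes ε g φ F)

include hF

lemma Uniformizes.pos {e : Chart M} {x : Plane} (hx : x ∈ overlap e φ) : 0 < F (e.1.symm x) :=
  hF.1 _ (mem_overlap.1 hx).2

lemma Uniformizes.comp_self {x : Plane} (hx : x ∈ φ.1.target) (i j : Fin 2) :
    g.comp φ x i j = if i = j then (F (φ.1.symm x))⁻¹ * ε i else 0 := by
  rw [hF.2 φ x (by rwa [overlap_self]), jac_self hx]
  fin_cases i <;> fin_cases j <;> simp [Matrix.one_apply]

include hε

/-- The smoothness of F is not part of `Uniformizes`; it follows from that of the metric, since F is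
the inverse of ε₀g₀₀ in the chart φ. -/
lemma Uniformizes.contDiffOn_self : ContDiffOn ℝ ∞ (fun z => F (φ.1.symm z)) φ.1.target := by
  have h : ∀ z ∈ φ.1.target, F (φ.1.symm z) = (ε 0 * g.comp φ z 0 0)⁻¹ := fun z hz => by
    rw [hF.comp_self hz, if_pos rfl]
    rcases hε 0 with h | h <;> simp [h]
  have hs : ContDiffOn ℝ ∞ (fun z => ε 0 * g.comp φ z 0 0) φ.1.target :=
    contDiffOn_const.mul (g.smooth φ 0 0)
  refine ContDiffOn.congr (hs.inv fun z hz => ?_) h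
  have hp : 0 < F (φ.1.symm z) := hF.pos (by rwa [overlap_self])
  rw [h z hz] at hp
  exact fun h0 => by rw [h0] at hp; simp at hp

lemma Uniformizes.contDiffOn (e : Chart M) :
    ContDiffOn ℝ ∞ (fun z => F (e.1.symm z)) (overlap e φ) := by
  have hs : ContDiffOn ℝ ∞ ((fun z => F (φ.1.symm z)) ∘ transition e φ) (overlap e φ) :=
    (hF.contDiffOn_self hε).comp (contDiffOn_transition e φ) fun z hz => transition_mem_target hz
  refine hs.congr fun z hz => ?_
  simp only [Function.comp, symm_transition hz]

set_option maxHeartbeats 1000000 in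
/-- In an adapted chart, the Schwarzian derivatives of all adapted charts agree. -/
lemma schwarzian_adapted (h𝒜 : IsConfAtlas ε 𝒜) (hφ : φ ∈ 𝒜) {c : Chart M} (hc : c ∈ 𝒜)
    {F' : M → ℝ} (hF' : Uniformizes ε g c F') {x : Plane} (hx : x ∈ overlap c φ) (i j : Fin 2) :
    schwarzian (g.comp c) (fun z => F (c.1.symm z)) i j x
      = schwarzian (g.comp c) (fun z => F' (c.1.symm z)) i j x := by
  have hX : ∀ X ∈ confAlg ε, ∃ a r s b, ∀ᶠ z in 𝓝 x, ∀ k,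
      confPoly ε a r s b (transition c φ z) k = ∑ i, jac c φ z k i * X z i := fun X hX => by
    obtain ⟨Y, hY, h⟩ := h𝒜.2 c hc φ hφ X hX x hx
    obtain ⟨a, r, s, b, hab⟩ := exists_confPoly hY
    refine ⟨a, r, s, b, ?_⟩
    filter_upwards [h] with z hz k
    rw [← hz k, hab]
  have hT : ∀ k, translationField k ∈ confAlg ε := fun k =>
    Submodule.subset_span (Or.inl (Or.inl (Or.inl ⟨k, rfl⟩)))
  obtain ⟨a₀, r₀, s₀, b₀, h₀⟩ := hX _ (hT 0)
  obtain ⟨a₁, r₁, s₁, b₁, h₁⟩ := hX _ (hT 1)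
  obtain ⟨a₂, r₂, s₂, b₂, h₂⟩ := hX homothetyField
    (Submodule.subset_span (Or.inl (Or.inr rfl)))
  -- The images of fields are only locally given by one element of the algebra. Only two
  -- translations and the dilation are needed, so a common neighbourhood exists.
  obtain ⟨V, hV, hVo, hxV⟩ := mem_nhds_iff.1
    (((h₀.and (h₁.and h₂)).and ((isOpen_overlap c φ).mem_nhds hx)))
  let U : TopologicalSpace.Opens Plane := ⟨V, hVo⟩
  have hU : ∀ y : U, (y : Plane) ∈ overlap c φ := fun y => (hV y.2).2
  have hUt : ∀ y : U, (y : Plane) ∈ c.1.target := fun y => overlap_subset _ _ (hU y)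
  have hUs : (U : Set Plane) ⊆ overlap c φ := fun y hy => (hV hy).2
  have hUc : (U : Set Plane) ⊆ c.1.target := hUs.trans (overlap_subset _ _)
  have hV0 : ∀ (y : U) k, confPoly ε a₀ r₀ s₀ b₀ (fun j => transition c φ y j) k
      = ∑ i, jac c φ y k i * translationField 0 y i := fun y k => (hV y.2).1.1 k
  have hV1 : ∀ (y : U) k, confPoly ε a₁ r₁ s₁ b₁ (fun j => transition c φ y j) k
      = ∑ i, jac c φ y k i * translationField 1 y i := fun y k => (hV y.2).1.2.1 k
  have hV2 : ∀ (y : U) k, confPoly ε a₂ r₂ s₂ b₂ (fun j => transition c φ y j) k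
      = ∑ i, jac c φ y k i * homothetyField y i := fun y k => (hV y.2).1.2.2 k
  have cF := (hF.contDiffOn hε c).mono hUs
  have cF' := (hF'.contDiffOn_self hε).mono hUc
  have pF : ∀ y ∈ (U : Set Plane), F (c.1.symm y) ≠ 0 := fun y hy => (hF.pos (hUs hy)).ne'
  have pF' : ∀ y ∈ (U : Set Plane), F' (c.1.symm y) ≠ 0 := fun y hy =>
    (hF'.pos (by rw [overlap_self]; exact hUc hy)).ne'
  let p : Sf U := Sf.mk _ cF'
  let p' : Sf U := Sf.mk _ (cF'.inv pF')
  -- The two descriptions of the metric, F⁻¹ψ^*g₀ and F'⁻¹g₀, show that the transition ψ has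
  -- conformal factor h = F/F'. Thus F = h·F', as needed for `IsConfConn.sch_mul`.
  let h : Sf U := Sf.mk _ (cF.mul (cF'.inv pF'))
  let h' : Sf U := Sf.mk _ ((cF.inv pF).mul cF')
  have hp : ∀ y, Sf.ev y p = F' (c.1.symm y) := fun y => rfl
  have hp' : ∀ y, Sf.ev y p' = (F' (c.1.symm y))⁻¹ := fun y => rfl
  have hh : ∀ y, Sf.ev y h = F (c.1.symm y) * (F' (c.1.symm y))⁻¹ := fun y => rfl
  have hh' : ∀ y, Sf.ev y h' = (F (c.1.symm y))⁻¹ * F' (c.1.symm y) := fun y => rfl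
  clear_value p p' h h'
  have epp : p * p' = 1 := Sf.ext_ev fun y => by
    rw [map_mul, hp, hp', map_one, mul_inv_cancel₀ (pF' y y.2)]
  have ehh : h * h' = 1 := Sf.ext_ev fun y => by
    rw [map_mul, hh, hh', map_one]
    have := pF y y.2
    have := pF' y y.2
    field_simp
  let ψ : Fin 2 → Sf U := fun a => Sf.mk (fun z => transition c φ z a)
    ((Sf.contDiffOn_coord (contDiffOn_transition c φ) a).mono hUs)
  have hψ : ∀ a y, Sf.ev y (ψ a) = transition c φ y a := fun _ _ => rfl
  clear_value ψ
  have hJ : ∀ i a y, Sf.ev y (Sf.d i (ψ a)) = jac c φ y a i := fun i a y => by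
    exact (Sf.ev_d i (fun z => transition c φ z a) _ (fun y => (hψ a y).symm) y).symm
  let X : Fin 2 → Sf U := fun a => Sf.mk (fun z => z a) (Sf.contDiffOn_coord contDiffOn_id a)
  have hXc : ∀ a y, Sf.ev y (X a) = (y : Plane) a := fun _ _ => rfl
  clear_value X
  have hd : ∀ i j, Sf.d i (X j) = if i = j then 1 else 0 := fun i j => Sf.ext_ev fun y => by
    rw [← Sf.ev_d i (fun z => z j) _ (fun y => (hXc j y).symm), pd_coord]
    split_ifs <;> simp
  have hg : ∀ i j, ∀ y : U, g.comp c y i j = Sf.ev y (diagM ε p' i j) := fun i j y => by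
    rw [hF'.comp_self (hUt y), diagM]
    split_ifs <;> simp [hp']
  have hg' : ∀ i j, ∀ y : U, (g.comp c y)⁻¹ i j = Sf.ev y (diagM ε p i j) := fun i j y => by
    have hm : (Matrix.of fun i j => Sf.ev y (diagM ε p i j)) * g.comp c y = 1 := by
      ext i j
      have := pF' y y.2
      rw [Matrix.mul_apply]
      simp only [hF'.comp_self (hUt y), Matrix.of_apply, diagM]
      rcases hε 0 with h0 | h0 <;> rcases hε 1 with h1 | h1 <;> fin_cases i <;> fin_cases j <;>
        simp [h0, h1, hp, this]
    rw [Matrix.inv_eq_left_inv hm, Matrix.of_apply]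
  have hconf : ∀ i j, ∑ a, algebraMap ℝ (Sf U) (ε a) * Sf.d i (ψ a) * Sf.d j (ψ a)
      = if i = j then h * algebraMap ℝ (Sf U) (ε i) else 0 := fun i j => Sf.ext_ev fun y => by
    have e1 := hF.2 c y (hU y) i j
    rw [hF'.comp_self (hUt y)] at e1
    have n1 := pF y y.2
    rw [eq_inv_mul_iff_mul_eq₀ n1] at e1
    simp only [map_sum, map_mul, Sf.ev_algebraMap, hJ]
    rw [← e1]
    split_ifs
    · rw [map_mul, hh, Sf.ev_algebraMap]; ring
    · simp
  have T0 : ∀ k, confPoly ε a₀ r₀ s₀ b₀ ψ k = Sf.d 0 (ψ k) := fun k => Sf.ext_ev fun y => by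
    rw [ev_confPoly, hJ]
    simp only [hψ]
    rw [hV0 y k]
    simp [translationField]
  have T1 : ∀ k, confPoly ε a₁ r₁ s₁ b₁ ψ k = Sf.d 1 (ψ k) := fun k => Sf.ext_ev fun y => by
    rw [ev_confPoly, hJ]
    simp only [hψ]
    rw [hV1 y k]
    simp [translationField]
  have T2 : ∀ k, confPoly ε a₂ r₂ s₂ b₂ ψ k = ∑ i, Sf.d i (ψ k) * X i := fun k =>
    Sf.ext_ev fun y => by
      rw [ev_confPoly]
      simp only [hψ, map_sum, map_mul, hJ, hXc]
      exact hV2 y k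
  have hcomm : ∀ u : Sf U, Sf.d 1 (Sf.d 0 u) = Sf.d 0 (Sf.d 1 u) := fun u => Sf.d_comm 1 0 u
  have hη := conformal_factor (A := Sf U) (d := Sf.d) (e := ε) (ψ := ψ) (x := X) (h := h) (h' := h')
    hcomm hε ehh hconf hd (Fin.forall_fin_two.2 ⟨⟨a₀, r₀, s₀, b₀, T0⟩, ⟨a₁, r₁, s₁, b₁, T1⟩⟩) ⟨a₂, r₂, s₂, b₂, T2⟩
  have hΓ : IsConfConn ε (fun i => p' * Sf.d i p) (chrA Sf.d (diagM ε p') (diagM ε p)) :=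
    fun k i j => chrA_diagM hε epp (fun _ => rfl) k i j
  have hs := congrArg (Sf.ev ⟨x, hxV⟩) (hΓ.sch_mul epp ehh hη i j)
  rwa [← schwarzian_ev hg hg' (F := fun z => F (c.1.symm z)) (fun y => by
      have := pF' y y.2
      rw [map_mul, hh, hp]
      field_simp) (by linear_combination h * h' * epp + ehh),
    ← schwarzian_ev hg hg' (F := fun z => F' (c.1.symm z)) (fun y => (hp y).symm) epp] at hs

omit hF in
/-- Naturality of the Schwarzian derivative of an adapted chart. -/
lemma Uniformizes.schwarzian_transition (hF : Uniformizes ε g φ F) {e e' : Chart M} {x : Plane}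
    (hx : x ∈ overlap e e') (hxφ : x ∈ overlap e φ) (i j : Fin 2) :
    schwarzian (g.comp e) (fun z => F (e.1.symm z)) i j x
      = ∑ a, ∑ b, jac e e' x a i * jac e e' x b j
        * schwarzian (g.comp e') (fun z => F (e'.1.symm z)) a b (transition e e' x) := by
  have hx' : transition e e' x ∈ overlap e' φ := transition_mem hx hxφ
  -- F is smooth only over the domain of φ, which need not contain the overlap of e and e'. As the
  -- Schwarzian depends on the germ only, F may be replaced by a positive function that is smooth
  -- everywhere.
  obtain ⟨F₁, hF₁, hp, he⟩ := exists_contDiff_pos_eq (isOpen_overlap e' φ) (hF.contDiffOn hε e')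
    (fun y hy => hF.pos hy) hx'
  simp only [← schwarzian_congr he]
  rw [← ConfQuant.schwarzian_transition g (F := fun z => F₁ (transition e e' z)) hF₁.contDiffOn
    (fun y _ => (hp y).ne') (fun y _ => rfl) hx]
  refine schwarzian_congr ?_ i j
  filter_upwards [(continuousAt_transition hx).eventually he,
    (isOpen_overlap e e').mem_nhds hx] with z hz hz'
  rw [hz, symm_transition hz']

/-- The Schwarzian derivatives of all adapted charts agree. -/
theorem schwarzian_unique (h𝒜 : IsConfAtlas ε 𝒜) (hφ : φ ∈ 𝒜) {c : Chart M} (hc : c ∈ 𝒜)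
    {F' : M → ℝ} (hF' : Uniformizes ε g c F') {e : Chart M} {x : Plane} (hx : x ∈ overlap e φ)
    (hx' : x ∈ overlap e c) (i j : Fin 2) :
    schwarzian (g.comp e) (fun z => F (e.1.symm z)) i j x
      = schwarzian (g.comp e) (fun z => F' (e.1.symm z)) i j x := by
  rw [hF.schwarzian_transition hε hx' hx, hF'.schwarzian_transition hε hx' hx']
  simp only [schwarzian_adapted hε hF h𝒜 hφ hc hF' (transition_mem hx' hx)]

end Adapted


/-! ### The quantization as a formula with coefficients -/

section

variable {A B : Type*} [CommRing A] [Algebra ℝ A] [CommRing B] [Algebra ℝ B]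
  {d : Fin 2 → Derivation ℝ A A} {d' : Fin 2 → Derivation ℝ B B} {s : B →ₐ[ℝ] A}
  {J K : Fin 2 → Fin 2 → A}

/-- Naturality of the quantization of symbols of degree one. -/
lemma FrameChange.flat₁_eq (h : FrameChange d d' s J K) {l m : ℝ} (h1 : m - l ≠ 1) {W V : A}
    (hW : Weight d J K l W) (hV : Weight d J K (m - l) V) {P : Fin 2 → A} {P' : Fin 2 → B}
    (hP : ∀ a, ∑ i, J a i * P i = V * s (P' a)) {f : A} {f' : B} (hf : f = W * s f') :
    flatA₁ d l m P f = V * W * s (flatA₁ d' l m P' f') := by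
  obtain ⟨θ, hθ⟩ : ∃ θ : Fin 2 → A, ∀ i, ∑ a, ∑ k, K k a * d i (J a k) = θ i := ⟨_, fun i => rfl⟩
  have hV' : ∀ i, d i V = algebraMap ℝ A (m - l) * V * θ i := fun i => by rw [hV i, hθ]
  have hW' : ∀ i, d i W = algebraMap ℝ A l * W * θ i := fun i => by rw [hW i, hθ]
  -- The divergence of P fails to be covariant by (δ-1)θ·P, where θ is the logarithmic derivative of
  -- the Jacobian determinant, and the derivative of f by λθf. The coefficient λ/(1-δ) balances the
  -- two defects.
  have key : ∑ i, d i (P i) + ∑ i, θ i * P i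
      = algebraMap ℝ A (m - l) * ∑ i, θ i * P i + V * ∑ a, s (d' a (P' a)) := by
    have E := fun k a => congrArg (d k) (hP a)
    simp only [Fin.sum_univ_two, map_add, Derivation.leibniz, smul_eq_mul, hV', h.chain] at E
    have E00 := E 0 0
    have E01 := E 0 1
    have E10 := E 1 0
    have E11 := E 1 1
    have k00 := h.KJ 0 0
    have k01 := h.KJ 0 1
    have k10 := h.KJ 1 0
    have k11 := h.KJ 1 1
    have j00 := h.JK 0 0
    have j01 := h.JK 0 1
    have j10 := h.JK 1 0
    have j11 := h.JK 1 1
    have p0 := hP 0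
    have p1 := hP 1
    have t0 := hθ 0
    have t1 := hθ 1
    simp only [Fin.sum_univ_two, if_true, zero_ne_one, one_ne_zero, if_false] at *
    linear_combination -(P 0) * t0 - P 1 * t1
      + K 0 0 * E00
      + K 0 1 * E01
      + K 1 0 * E10
      + K 1 1 * E11
      + (algebraMap ℝ A (m - l) * θ 0 * P 0 - d 0 (P 0)) * k00
      + (algebraMap ℝ A (m - l) * θ 0 * P 1 - d 0 (P 1)) * k01
      + (algebraMap ℝ A (m - l) * θ 1 * P 0 - d 1 (P 0)) * k10
      + (algebraMap ℝ A (m - l) * θ 1 * P 1 - d 1 (P 1)) * k11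
      + K 0 0 * P 1 * h.symm 0 1 0
      + K 0 1 * P 1 * h.symm 1 1 0
      + K 1 0 * P 0 * h.symm 0 0 1
      + K 1 1 * P 0 * h.symm 1 0 1
      + V * s (d' 0 (P' 0)) * j00
      + V * s (d' 1 (P' 0)) * j10
      + V * s (d' 0 (P' 1)) * j01
      + V * s (d' 1 (P' 1)) * j11
      - algebraMap ℝ A (m - l) * θ 0 * K 0 0 * p0
      - algebraMap ℝ A (m - l) * θ 0 * K 0 1 * p1
      - algebraMap ℝ A (m - l) * θ 1 * K 1 0 * p0
      - algebraMap ℝ A (m - l) * θ 1 * K 1 1 * p1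
  have r := congrArg (algebraMap ℝ A)
    (show l / (1 - (m - l)) * (1 - (m - l)) = l from div_mul_cancel₀ _ (sub_ne_zero.2 h1.symm))
  simp only [map_mul, map_one, map_sub (algebraMap ℝ A) 1] at r
  have p0 := hP 0
  have p1 := hP 1
  subst hf
  simp only [flatA₁, Fin.sum_univ_two, Derivation.leibniz, smul_eq_mul, hW', h.chain, map_add,
    map_mul, AlgHom.commutes] at p0 p1 key ⊢
  linear_combination algebraMap ℝ A (l / (1 - (m - l))) * W * s f' * key
    - W * s f' * (θ 0 * P 0 + θ 1 * P 1) * r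
    + W * s (d' 0 f') * p0 + W * s (d' 1 f') * p1

/-- The first-order coefficient of the quantization of a symbol of degree two. -/
def quantA₁ (d : Fin 2 → Derivation ℝ A A) (l m : ℝ) (Γ : Fin 2 → Fin 2 → Fin 2 → A)
    (G G' P : Fin 2 → Fin 2 → A) (k : Fin 2) : A :=
  (algebraMap ℝ A (β₁ 2 l m) * ∑ i, nab₂ d Γ (m - l) P i i k
        + algebraMap ℝ A (β₂ 2 l m) * ∑ i, ∑ j, ∑ r, G' i k * G j r * nab₂ d Γ (m - l) P i j r)
    - ∑ i, ∑ j, P i j * Γ k i j - algebraMap ℝ A l * ∑ i, (P i k + P k i) * trA Γ i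

/-- The coefficient of order zero is the value on the constant 1, so the long expression with second
covariant derivatives of P need not be expanded. -/
lemma quantA_expr (d : Fin 2 → Derivation ℝ A A) (l m : ℝ) (Γ : Fin 2 → Fin 2 → Fin 2 → A)
    (G G' S P : Fin 2 → Fin 2 → A) (f : A) :
    quantA d l m Γ G G' S P f = ∑ i, ∑ j, P i j * d i (d j f)
      + ∑ i, quantA₁ d l m Γ G G' P i * d i f + quantA d l m Γ G G' S P 1 * f := by
  simp only [quantA, quantA₁]
  generalize nab₂ d Γ (m - l) P = N
  generalize nab₃ d Γ (m - l) N = N₃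
  generalize scalA d Γ G' = R
  simp only [nab₁, nab₀, Derivation.map_one_eq_zero]
  generalize trA Γ = t
  simp only [Fin.sum_univ_two, map_sub, Derivation.leibniz, smul_eq_mul, Derivation.map_algebraMap,
    mul_zero, zero_sub, add_zero, map_neg, mul_one]
  ring

lemma nab₂_comb (d : Fin 2 → Derivation ℝ A A) (w : ℝ) (Γ : Fin 2 → Fin 2 → Fin 2 → A)
    (r r' : ℝ) (P P' : Fin 2 → Fin 2 → A) (k i j : Fin 2) :
    nab₂ d Γ w (fun i j => algebraMap ℝ A r * P i j + algebraMap ℝ A r' * P' i j) k i j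
      = algebraMap ℝ A r * nab₂ d Γ w P k i j + algebraMap ℝ A r' * nab₂ d Γ w P' k i j := by
  simp only [nab₂, Fin.sum_univ_two, map_add, Derivation.leibniz, Derivation.map_algebraMap,
    smul_eq_mul, mul_zero, add_zero]
  ring

lemma nab₃_comb (d : Fin 2 → Derivation ℝ A A) (w : ℝ) (Γ : Fin 2 → Fin 2 → Fin 2 → A)
    (r r' : ℝ) (T T' : Fin 2 → Fin 2 → Fin 2 → A) (h k i j : Fin 2) :
    nab₃ d Γ w (fun k i j => algebraMap ℝ A r * T k i j + algebraMap ℝ A r' * T' k i j) h k i j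
      = algebraMap ℝ A r * nab₃ d Γ w T h k i j + algebraMap ℝ A r' * nab₃ d Γ w T' h k i j := by
  simp only [nab₃, Fin.sum_univ_two, map_add, Derivation.leibniz, Derivation.map_algebraMap,
    smul_eq_mul, mul_zero, add_zero]
  ring

/-- Combinations with two real coefficients cover additivity, homogeneity and the value at zero at
once. -/
lemma quantA_comb (d : Fin 2 → Derivation ℝ A A) (l m : ℝ) (Γ : Fin 2 → Fin 2 → Fin 2 → A)
    (G G' S P P' : Fin 2 → Fin 2 → A) (r r' : ℝ) (f : A) :
    quantA d l m Γ G G' S (fun i j => algebraMap ℝ A r * P i j + algebraMap ℝ A r' * P' i j) f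
      = algebraMap ℝ A r * quantA d l m Γ G G' S P f
        + algebraMap ℝ A r' * quantA d l m Γ G G' S P' f := by
  have h₂ : nab₂ d Γ (m - l) (fun i j => algebraMap ℝ A r * P i j + algebraMap ℝ A r' * P' i j)
      = fun k i j => algebraMap ℝ A r * nab₂ d Γ (m - l) P k i j
        + algebraMap ℝ A r' * nab₂ d Γ (m - l) P' k i j := by
    funext k i j; exact nab₂_comb d (m - l) Γ r r' P P' k i j
  simp only [quantA, h₂, nab₃_comb]
  generalize nab₃ d Γ (m - l) (nab₂ d Γ (m - l) P) = N₃
  generalize nab₃ d Γ (m - l) (nab₂ d Γ (m - l) P') = N₃'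
  generalize nab₂ d Γ (m - l) P = N
  generalize nab₂ d Γ (m - l) P' = N'
  generalize scalA d Γ G' = R
  generalize nab₁ d Γ l (nab₀ d Γ l f) = D
  generalize nab₀ d Γ l f = D₀
  simp only [Fin.sum_univ_two]
  ring

end


/-! ### The quantization attached to a metric and a covariant tensor field -/

section Global

variable {M : Type*} [TopologicalSpace M] [ChartedSpace Plane M]

/-- Covariant tensor fields of degree two. -/
structure IsCotensor (S : Chart M → Plane → Fin 2 → Fin 2 → ℝ) : Prop where
  smooth : ∀ e i j, ContDiffOn ℝ ∞ (fun x => S e x i j) e.1.target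
  transform : ∀ e e', ∀ x ∈ overlap e e', ∀ i j,
    S e x i j = ∑ a, ∑ b, jac e e' x a i * jac e e' x b j * S e' (transition e e' x) a b

/-- The components of a symbol of degree one on an open subset of the coordinate domain. -/
def Symbol₁.lift {w : ℝ} (P : Symbol₁ M w) (e : Chart M) {U : TopologicalSpace.Opens Plane}
    (hU : (U : Set Plane) ⊆ e.1.target) (i : Fin 2) : Sf U :=
  Sf.mk (fun x => P.1 e x i) ((P.2.1 e i).mono hU)

lemma Symbol₁.ev_lift {w : ℝ} (P : Symbol₁ M w) (e : Chart M) {U : TopologicalSpace.Opens Plane}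
    (hU : (U : Set Plane) ⊆ e.1.target) (i : Fin 2) (y : U) :
    Sf.ev y (Symbol₁.lift P e hU i) = P.1 e y i := rfl

/-- The quantization of symbols of degree at most one. -/
def lowerFormula (l m : ℝ) (P₁ : Plane → Fin 2 → ℝ) (P₀ f : Plane → ℝ) (x : Plane) : ℝ :=
  ∑ i, P₁ x i * pd i f x + l / (1 - (m - l)) * (∑ i, pd i (fun z => P₁ z i) x) * f x + P₀ x * f x

lemma lowerFormula_ev {U : TopologicalSpace.Opens Plane} {P₁ : Plane → Fin 2 → ℝ}
    {P₀ f : Plane → ℝ} {P₁' : Fin 2 → Sf U} {P₀' f' : Sf U}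
    (h₁ : ∀ i, ∀ y : U, P₁ y i = Sf.ev y (P₁' i)) (h₀ : ∀ y : U, P₀ y = Sf.ev y P₀')
    (hf : ∀ y : U, f y = Sf.ev y f') (l m : ℝ) (y : U) :
    lowerFormula l m P₁ P₀ f y = Sf.ev y (flatA₁ Sf.d l m P₁' f' + P₀' * f') := by
  have hd : ∀ i, pd i (fun z => P₁ z i) y = Sf.ev y (Sf.d i (P₁' i)) := fun i =>
    Sf.ev_d i (fun z => P₁ z i) _ (h₁ i) y
  simp only [lowerFormula, flatA₁, map_add, map_mul, map_sum, Sf.ev_algebraMap, hd, h₁ _ y, h₀ y,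
    hf y, Sf.ev_d _ _ _ hf]

variable (g : Metric M) (S : Chart M → Plane → Fin 2 → Fin 2 → ℝ)

/-- The value of the quantization, in coordinates. -/
def quantVal {l m : ℝ} (P : Symbol M (m - l)) (f : Density M l) (e : Chart M) (x : Plane) : ℝ :=
  curvedFormula l m (g.comp e) (S e x) (P.1.1 e) (f.1 e) x
    + lowerFormula l m (P.2.1.1 e) (P.2.2.1 e) (f.1 e) x

variable {S} (hS : IsCotensor S)

/-- The components of a covariant tensor field on an open subset of the coordinate domain. -/
def IsCotensor.lift (hS : IsCotensor S) (e : Chart M) {U : TopologicalSpace.Opens Plane}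
    (hU : (U : Set Plane) ⊆ e.1.target) (i j : Fin 2) : Sf U :=
  Sf.mk (fun x => S e x i j) ((hS.smooth e i j).mono hU)

lemma IsCotensor.ev_lift (e : Chart M) {U : TopologicalSpace.Opens Plane}
    (hU : (U : Set Plane) ⊆ e.1.target) (i j : Fin 2) (y : U) :
    Sf.ev y (hS.lift e hU i j) = S e y i j := rfl

/-- The quantization, as a smooth function. -/
def quantLift (hS : IsCotensor S) {l m : ℝ} (P : Symbol M (m - l)) (e : Chart M)
    {U : TopologicalSpace.Opens Plane} (hU : (U : Set Plane) ⊆ e.1.target) (f : Sf U) : Sf U :=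
  quantA Sf.d l m (g.chr e hU) (g.lift e hU) (g.liftInv e hU) (hS.lift e hU)
      (Symbol₂.lift P.1 e hU) f
    + (flatA₁ Sf.d l m (Symbol₁.lift P.2.1 e hU) f + Density.lift P.2.2 e hU * f)

lemma quantVal_ev {l m : ℝ} (P : Symbol M (m - l)) (f : Density M l) (e : Chart M)
    {U : TopologicalSpace.Opens Plane} (hU : (U : Set Plane) ⊆ e.1.target) (y : U) :
    quantVal g S P f e y = Sf.ev y (quantLift g hS P e hU (Density.lift f e hU)) := by
  rw [quantVal, quantLift, map_add]
  congr 1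
  · exact curvedFormula_lift (m := m) g P.1 f e hU y (S' := hS.lift e hU)
      fun i j => (hS.ev_lift e hU i j y).symm
  · exact lowerFormula_ev (P₁ := P.2.1.1 e) (P₁' := Symbol₁.lift P.2.1 e hU) (P₀ := P.2.2.1 e)
      (P₀' := Density.lift P.2.2 e hU) (f := f.1 e) (f' := Density.lift f e hU)
      (fun i y => (Symbol₁.ev_lift P.2.1 e hU i y).symm)
      (fun y => (Density.ev_lift P.2.2 e hU y).symm) (fun y => (Density.ev_lift f e hU y).symm) l m y

lemma Symbol₁.lift_transform {w : ℝ} (P : Symbol₁ M w) {e e' : Chart M} (a : Fin 2) :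
    ∑ i, jacA e e' a i * Symbol₁.lift P e (U := overlapO e e') (overlap_subset e e') i
      = densA w e e'
        * pull e e' (Symbol₁.lift P e' (U := overlapO e' e) (overlap_subset e' e) a) :=
  Sf.ext_ev fun x => by
    simp only [map_sum, map_mul, ev_pull, ev_jacA, Symbol₁.ev_lift]
    exact P.2.2.2 e e' x x.2 a

lemma lowerFormula_transition {l m : ℝ} (h1 : m - l ≠ 1) (P : Symbol M (m - l)) (f : Density M l)
    {e e' : Chart M} {x : Plane} (hx : x ∈ overlap e e') :
    lowerFormula l m (P.2.1.1 e) (P.2.2.1 e) (f.1 e) x = densFactor m e e' x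
      * lowerFormula l m (P.2.1.1 e') (P.2.2.1 e') (f.1 e') (transition e e' x) := by
  have hx' := transition_mem_symm hx
  have e1 := fun (e : Chart M) {U : TopologicalSpace.Opens Plane}
    (hU : (U : Set Plane) ⊆ e.1.target) (y : U) => lowerFormula_ev (P₁ := P.2.1.1 e)
      (P₁' := Symbol₁.lift P.2.1 e hU) (P₀ := P.2.2.1 e)
      (P₀' := Density.lift P.2.2 e hU) (f := f.1 e) (f' := Density.lift f e hU)
      (fun i y => (Symbol₁.ev_lift P.2.1 e hU i y).symm)
      (fun y => (Density.ev_lift P.2.2 e hU y).symm) (fun y => (Density.ev_lift f e hU y).symm) l m y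
  have e2 := e1 e (U := overlapO e e') (overlap_subset e e') ⟨x, hx⟩
  have e3 := e1 e' (U := overlapO e' e) (overlap_subset e' e) ⟨_, hx'⟩
  have q := (frameChange e e').flat₁_eq h1 (weight_densA l e e') (weight_densA (m - l) e e')
    (Symbol₁.lift_transform P.2.1) (Density.lift_transform f)
  refine e2.trans ?_
  rw [show lowerFormula l m (P.2.1.1 e') (P.2.2.1 e') (f.1 e') (transition e e' x) = _ from e3,
    q, Density.lift_transform (e := e) (e' := e') f,
    Density.lift_transform (e := e) (e' := e') P.2.2]
  simp only [map_add, map_mul, ev_pull]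
  have hd : Sf.ev ⟨x, hx⟩ (densA (m - l) e e') * Sf.ev ⟨x, hx⟩ (densA l e e')
      = densFactor m e e' x := (densFactor_add (m - l) l hx).trans (by rw [sub_add_cancel])
  rw [← hd]
  ring

include hS in
lemma quantVal_transition {l m : ℝ} (h1 : m - l ≠ 1) (P : Symbol M (m - l)) (f : Density M l)
    {e e' : Chart M} {x : Plane} (hx : x ∈ overlap e e') :
    quantVal g S P f e x = densFactor m e e' x * quantVal g S P f e' (transition e e' x) := by
  rw [quantVal, quantVal, lowerFormula_transition h1 P f hx,
    curvedFormula_transition g P.1 f hx (hS.transform e e' x hx)]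
  ring

include hS in
lemma contDiffOn_quantVal {l m : ℝ} (P : Symbol M (m - l)) (f : Density M l) (e : Chart M) :
    ContDiffOn ℝ ∞ (quantVal g S P f e) e.1.target :=
  Sf.contDiffOn_of_ev (U := ⟨e.1.target, e.1.open_target⟩) fun y => quantVal_ev g hS P f e subset_rfl y

open Classical in
/-- The quantization of a symbol applied to a density. -/
def quantDensity {l m : ℝ} (h1 : m - l ≠ 1) (P : Symbol M (m - l)) (f : Density M l) :
    Density M m :=
  ⟨fun e x => if x ∈ e.1.target then quantVal g S P f e x else 0,
    fun e => (contDiffOn_quantVal g hS P f e).congr fun x hx => if_pos hx,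
    fun e x hx => if_neg hx, fun e e' x hx => by
      beta_reduce
      rw [if_pos (overlap_subset _ _ hx), if_pos (transition_mem_target hx),
        quantVal_transition g hS h1 P f hx]
      rfl⟩

lemma quantDensity_apply {l m : ℝ} (h1 : m - l ≠ 1) (P : Symbol M (m - l)) (f : Density M l)
    {e : Chart M} {x : Plane} (hx : x ∈ e.1.target) :
    (quantDensity g hS h1 P f).1 e x = quantVal g S P f e x := if_pos hx

lemma Density.ext_target {w : ℝ} {f f' : Density M w}
    (h : ∀ e : Chart M, ∀ x ∈ e.1.target, f.1 e x = f'.1 e x) : f = f' := by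
  refine Subtype.ext (funext fun e => funext fun x => ?_)
  by_cases hx : x ∈ e.1.target
  · exact h e x hx
  · rw [f.2.2.1 e x hx, f'.2.2.1 e x hx]

lemma quantLift_comb_right {l m : ℝ} (P : Symbol M (m - l)) (e : Chart M)
    {U : TopologicalSpace.Opens Plane} (hU : (U : Set Plane) ⊆ e.1.target) (r r' : ℝ) (f f' : Sf U) :
    quantLift g hS P e hU (algebraMap ℝ _ r * f + algebraMap ℝ _ r' * f')
      = algebraMap ℝ _ r * quantLift g hS P e hU f + algebraMap ℝ _ r' * quantLift g hS P e hU f' := by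
  simp only [quantLift]
  rw [quantA_expr _ _ _ _ _ _ _ _ f, quantA_expr _ _ _ _ _ _ _ _ f', quantA_expr]
  simp only [flatA₁, map_add, Derivation.leibniz, smul_eq_mul, Derivation.map_algebraMap, mul_zero,
    add_zero, Fin.sum_univ_two]
  ring

lemma quantLift_comb_left {l m : ℝ} {P P' P'' : Symbol M (m - l)} (r r' : ℝ)
    (hP : P'' = r • P + r' • P') (e : Chart M) {U : TopologicalSpace.Opens Plane}
    (hU : (U : Set Plane) ⊆ e.1.target) (f : Sf U) :
    quantLift g hS P'' e hU f
      = algebraMap ℝ _ r * quantLift g hS P e hU f + algebraMap ℝ _ r' * quantLift g hS P' e hU f := by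
  have h2 : Symbol₂.lift P''.1 e hU = fun i j => algebraMap ℝ _ r * Symbol₂.lift P.1 e hU i j
      + algebraMap ℝ _ r' * Symbol₂.lift P'.1 e hU i j := by
    funext i j; subst hP; rfl
  have h1 : Symbol₁.lift P''.2.1 e hU = fun i => algebraMap ℝ _ r * Symbol₁.lift P.2.1 e hU i
      + algebraMap ℝ _ r' * Symbol₁.lift P'.2.1 e hU i := by
    funext i; subst hP; rfl
  have h0 : Density.lift P''.2.2 e hU = algebraMap ℝ _ r * Density.lift P.2.2 e hU
      + algebraMap ℝ _ r' * Density.lift P'.2.2 e hU := by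
    subst hP; rfl
  simp only [quantLift, h2, h1, h0, quantA_comb]
  simp only [flatA₁, map_add, Derivation.leibniz, smul_eq_mul, Derivation.map_algebraMap, mul_zero,
    add_zero, Fin.sum_univ_two]
  ring

/-- The domain of a chart, as an open set. -/
abbrev targetO (e : Chart M) : TopologicalSpace.Opens Plane := ⟨e.1.target, e.1.open_target⟩

lemma quantDensity_comb_right {l m : ℝ} (h1 : m - l ≠ 1) (P : Symbol M (m - l)) (r r' : ℝ)
    (f f' : Density M l) : quantDensity g hS h1 P (r • f + r' • f')
      = r • quantDensity g hS h1 P f + r' • quantDensity g hS h1 P f' :=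
  Density.ext_target fun e x hx => by
    change _ = r * (quantDensity g hS h1 P f).1 e x + r' * (quantDensity g hS h1 P f').1 e x
    simp only [quantDensity_apply g hS h1 _ _ hx,
      quantVal_ev g hS _ _ e (U := targetO e) subset_rfl ⟨x, hx⟩]
    have := congrArg (Sf.ev ⟨x, hx⟩) (quantLift_comb_right g hS P e (U := targetO e) subset_rfl r r'
      (Density.lift f e subset_rfl) (Density.lift f' e subset_rfl))
    rw [map_add, map_mul, map_mul] at this
    exact this

lemma quantDensity_comb_left {l m : ℝ} (h1 : m - l ≠ 1) (P P' : Symbol M (m - l)) (r r' : ℝ)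
    (f : Density M l) : quantDensity g hS h1 (r • P + r' • P') f
      = r • quantDensity g hS h1 P f + r' • quantDensity g hS h1 P' f :=
  Density.ext_target fun e x hx => by
    change _ = r * (quantDensity g hS h1 P f).1 e x + r' * (quantDensity g hS h1 P' f).1 e x
    simp only [quantDensity_apply g hS h1 _ _ hx,
      quantVal_ev g hS _ _ e (U := targetO e) subset_rfl ⟨x, hx⟩]
    have := congrArg (Sf.ev ⟨x, hx⟩) (quantLift_comb_left g hS r r' rfl e (U := targetO e)
      subset_rfl (Density.lift f e subset_rfl) (P := P) (P' := P'))
    rw [map_add, map_mul, map_mul] at this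
    exact this

/-- The quantization of a symbol, as a linear operator. -/
def quantOp {l m : ℝ} (h1 : m - l ≠ 1) (P : Symbol M (m - l)) : Density M l →ₗ[ℝ] Density M m where
  toFun := quantDensity g hS h1 P
  map_add' f f' := by simpa using quantDensity_comb_right g hS h1 P 1 1 f f'
  map_smul' r f := by simpa using quantDensity_comb_right g hS h1 P r 0 f 0

lemma quantLift_expr {l m : ℝ} (P : Symbol M (m - l)) (e : Chart M)
    {U : TopologicalSpace.Opens Plane} (hU : (U : Set Plane) ⊆ e.1.target) (f : Sf U) :
    quantLift g hS P e hU f = ∑ i, ∑ j, Symbol₂.lift P.1 e hU i j * Sf.d i (Sf.d j f)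
      + ∑ i, (quantA₁ Sf.d l m (g.chr e hU) (g.lift e hU) (g.liftInv e hU)
          (Symbol₂.lift P.1 e hU) i + Symbol₁.lift P.2.1 e hU i) * Sf.d i f
      + quantLift g hS P e hU 1 * f := by
  simp only [quantLift]
  rw [quantA_expr]
  simp only [flatA₁, Derivation.map_one_eq_zero, mul_zero, Fin.sum_univ_two]
  ring

lemma hasExpr_of_ev {l m : ℝ} {A : Density M l →ₗ[ℝ] Density M m} {e : Chart M}
    {p₂ : Fin 2 → Fin 2 → Sf (targetO e)} {p₁ : Fin 2 → Sf (targetO e)} {p₀ : Sf (targetO e)}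
    (hs : ∀ i j, p₂ i j = p₂ j i)
    (h : ∀ (f : Density M l) (y : targetO e), (A f).1 e y = Sf.ev y
      (∑ i, ∑ j, p₂ i j * Sf.d i (Sf.d j (Density.lift f e subset_rfl))
      + ∑ i, p₁ i * Sf.d i (Density.lift f e subset_rfl) + p₀ * Density.lift f e subset_rfl))
    {a₂ : Plane → Matrix (Fin 2) (Fin 2) ℝ} {a₁ : Plane → Fin 2 → ℝ} {a₀ : Plane → ℝ}
    (h₂ : ∀ i j, ∀ y : targetO e, a₂ y i j = Sf.ev y (p₂ i j))
    (h₁ : ∀ i, ∀ y : targetO e, a₁ y i = Sf.ev y (p₁ i))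
    (h₀ : ∀ y : targetO e, a₀ y = Sf.ev y p₀) : HasExpr A e a₂ a₁ a₀ := by
  refine ⟨fun i j => Sf.contDiffOn_of_ev (U := targetO e) (h₂ i j),
    fun i => Sf.contDiffOn_of_ev (U := targetO e) (h₁ i),
    Sf.contDiffOn_of_ev (U := targetO e) h₀, fun x hx i j => ?_, fun f x hx => ?_⟩
  · exact (h₂ i j ⟨x, hx⟩).trans ((congrArg _ (hs i j)).trans (h₂ j i ⟨x, hx⟩).symm)
  · obtain ⟨y, rfl⟩ : ∃ y : targetO e, (y : Plane) = x := ⟨⟨x, hx⟩, rfl⟩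
    have hf : ∀ y : targetO e, f.1 e y = Sf.ev y (Density.lift f e subset_rfl) := fun y => rfl
    have hd : ∀ i, ∀ y : targetO e, pd i (f.1 e) y
      = Sf.ev y (Sf.d i (Density.lift f e subset_rfl)) := fun i y => Sf.ev_d i _ _ hf y
    have hdd : ∀ i j, ∀ y : targetO e, pd i (pd j (f.1 e)) y
      = Sf.ev y (Sf.d i (Sf.d j (Density.lift f e subset_rfl))) := fun i j y =>
        Sf.ev_d i _ _ (hd j) y
    rw [h f y]
    simp only [map_add, map_sum, map_mul, h₂, h₁, h₀, hdd, hd, hf]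

lemma Symbol₂.lift_symm {w : ℝ} (P : Symbol₂ M w) (e : Chart M) {U : TopologicalSpace.Opens Plane}
    (hU : (U : Set Plane) ⊆ e.1.target) (i j : Fin 2) :
    Symbol₂.lift P e hU i j = Symbol₂.lift P e hU j i :=
  Sf.ext_ev fun y => P.2.2.2.1 e y i j

lemma quantOp_ev {l m : ℝ} (h1 : m - l ≠ 1) (P : Symbol M (m - l)) (e : Chart M)
    (f : Density M l) (y : targetO e) : (quantOp g hS h1 P f).1 e y
      = Sf.ev y (quantLift g hS P e subset_rfl (Density.lift f e subset_rfl)) :=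
  (quantDensity_apply g hS h1 P f y.2).trans (quantVal_ev g hS P f e subset_rfl y)

lemma hasExpr_quantOp {l m : ℝ} (h1 : m - l ≠ 1) (P : Symbol M (m - l)) (e : Chart M) :
    ∃ a₁ a₀, HasExpr (quantOp g hS h1 P) e (P.1.1 e) a₁ a₀ :=
  ⟨fun x i => Sf.rep (quantA₁ Sf.d l m (g.chr e (U := targetO e) subset_rfl)
      (g.lift e subset_rfl) (g.liftInv e subset_rfl) (Symbol₂.lift P.1 e subset_rfl) i
      + Symbol₁.lift P.2.1 e subset_rfl i) x,
    Sf.rep (quantLift g hS P e (U := targetO e) subset_rfl 1),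
    hasExpr_of_ev (p₂ := Symbol₂.lift P.1 e subset_rfl) (Symbol₂.lift_symm P.1 e subset_rfl)
    (fun f y => by rw [quantOp_ev, quantLift_expr]) (fun i j y => rfl)
    (fun i y => (Sf.ev_rep _ y).symm) (fun y => (Sf.ev_rep _ y).symm)⟩

lemma quantA_zero {A : Type*} [CommRing A] [Algebra ℝ A] (d : Fin 2 → Derivation ℝ A A) (l m : ℝ)
    (Γ : Fin 2 → Fin 2 → Fin 2 → A) (G G' S : Fin 2 → Fin 2 → A) (f : A) :
    quantA d l m Γ G G' S 0 f = 0 := by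
  have h := quantA_comb d l m Γ G G' S 0 0 0 0 f
  simp only [map_zero, zero_mul, add_zero] at h
  exact h

lemma hasExpr_quantOp_of_eq_zero {l m : ℝ} (h1 : m - l ≠ 1) (P : Symbol M (m - l)) (hP : P.1 = 0)
    (e : Chart M) : ∃ a₀, HasExpr (quantOp g hS h1 P) e 0 (P.2.1.1 e) a₀ := by
  have h2 : Symbol₂.lift P.1 e (U := targetO e) subset_rfl = 0 := by rw [hP]; rfl
  refine ⟨_, hasExpr_of_ev (p₂ := 0) (p₁ := Symbol₁.lift P.2.1 e subset_rfl)
    (p₀ := algebraMap ℝ _ (l / (1 - (m - l)))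
      * (∑ i, Sf.d i (Symbol₁.lift P.2.1 e subset_rfl i)) + Density.lift P.2.2 e subset_rfl)
    (fun _ _ => rfl) (fun f y => ?_) (fun i j y => (map_zero _).symm)
    (fun i y => rfl) (fun y => (Sf.ev_rep _ y).symm)⟩
  rw [quantOp_ev, quantLift, h2, quantA_zero, zero_add, flatA₁]
  congr 1
  simp only [Pi.zero_apply, zero_mul, Finset.sum_const_zero]
  ring

lemma hasExpr_quantOp_of_eq_zero' {l m : ℝ} (h1 : m - l ≠ 1) (P : Symbol M (m - l)) (hP : P.1 = 0)
    (hP' : P.2.1 = 0) (e : Chart M) : HasExpr (quantOp g hS h1 P) e 0 0 (P.2.2.1 e) := by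
  have h2 : Symbol₂.lift P.1 e (U := targetO e) subset_rfl = 0 := by rw [hP]; rfl
  have h3 : Symbol₁.lift P.2.1 e (U := targetO e) subset_rfl = 0 := by rw [hP']; rfl
  refine hasExpr_of_ev (p₂ := 0) (p₁ := 0) (p₀ := Density.lift P.2.2 e subset_rfl)
    (fun _ _ => rfl) (fun f y => ?_) (fun i j y => (map_zero _).symm)
    (fun i y => (map_zero _).symm) (fun y => rfl)
  rw [quantOp_ev, quantLift, h2, h3, quantA_zero, zero_add, flatA₁]
  congr 1
  simp only [Pi.zero_apply, zero_mul, map_zero, mul_zero, Finset.sum_const_zero]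

/-- The quantization attached to a metric and a covariant tensor field. -/
def quantization {l m : ℝ} (h1 : m - l ≠ 1) : Symbol M (m - l) →ₗ[ℝ] DiffOp₂ M l m where
  toFun P := ⟨quantOp g hS h1 P, fun e => ⟨_, hasExpr_quantOp g hS h1 P e⟩⟩
  map_add' P P' := Subtype.ext (LinearMap.ext fun f => by
    have := quantDensity_comb_left g hS h1 P P' 1 1 f
    rw [one_smul, one_smul, one_smul, one_smul] at this
    exact this)
  map_smul' r P := Subtype.ext (LinearMap.ext fun f => by
    have := quantDensity_comb_left g hS h1 P P r 0 f
    rw [zero_smul, zero_smul, add_zero, add_zero] at this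
    exact this)

lemma quantization_apply {l m : ℝ} (h1 : m - l ≠ 1) (P : Symbol M (m - l)) (f : Density M l)
    {e : Chart M} {x : Plane} (hx : x ∈ e.1.target) :
    ((quantization g hS h1 P).1 f).1 e x = quantVal g S P f e x :=
  quantDensity_apply g hS h1 P f hx

lemma preservesSymbol_quantization {l m : ℝ} (h1 : m - l ≠ 1) :
    PreservesSymbol (quantization (l := l) (m := m) g hS h1) := fun P e =>
  ⟨hasExpr_quantOp g hS h1 P e, fun h => hasExpr_quantOp_of_eq_zero g hS h1 P h e,
    fun h h' => hasExpr_quantOp_of_eq_zero' g hS h1 P h h' e⟩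

end Global


/-! ### Lie derivatives as formulas in the ring of smooth functions -/

section Link

variable {U : TopologicalSpace.Opens Plane} {X : Plane → Fin 2 → ℝ} {X' : Fin 2 → Sf U}
  (hX : ∀ k, ∀ y : U, X y k = Sf.ev y (X' k))

include hX

lemma divergence_ev (y : U) : divergence X y = Sf.ev y (∑ k, Sf.d k (X' k)) := by
  have hd : ∀ k, pd k (fun z => X z k) y = Sf.ev y (Sf.d k (X' k)) := fun k =>
    Sf.ev_d k (fun z => X z k) _ (hX k) y
  simp only [divergence, hd, map_sum]

lemma lie₀_ev {f : Plane → ℝ} {f' : Sf U} (hf : ∀ y : U, f y = Sf.ev y f') (w : ℝ) (y : U) :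
    lie₀ w X f y = Sf.ev y (lieA₀ Sf.d w X' f') := by
  simp only [lie₀, lieA₀, map_add, map_mul, map_sum, divergence_ev hX, hf y, hX _ y,
    Sf.ev_algebraMap, Sf.ev_d _ _ _ hf]

lemma lie₁_ev {P : Plane → Fin 2 → ℝ} {P' : Fin 2 → Sf U}
    (hP : ∀ i, ∀ y : U, P y i = Sf.ev y (P' i)) (w : ℝ) (i : Fin 2) (y : U) :
    lie₁ w X P y i = Sf.ev y (lieA₁ Sf.d w X' P' i) := by
  have hd : ∀ k i, pd k (fun z => X z i) y = Sf.ev y (Sf.d k (X' i)) := fun k i =>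
    Sf.ev_d k (fun z => X z i) _ (hX i) y
  have hdP : ∀ k i, pd k (fun z => P z i) y = Sf.ev y (Sf.d k (P' i)) := fun k i =>
    Sf.ev_d k (fun z => P z i) _ (hP i) y
  simp only [lie₁, lieA₁, map_add, map_sub, map_mul, map_sum, divergence_ev hX, hP _ y, hX _ y,
    Sf.ev_algebraMap, hd, hdP]

lemma lie₂_ev {P : Plane → Matrix (Fin 2) (Fin 2) ℝ} {P' : Fin 2 → Fin 2 → Sf U}
    (hP : ∀ i j, ∀ y : U, P y i j = Sf.ev y (P' i j)) (w : ℝ) (i j : Fin 2) (y : U) :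
    lie₂ w X P y i j = Sf.ev y (lieA₂ Sf.d w X' P' i j) := by
  have hd : ∀ k i, pd k (fun z => X z i) y = Sf.ev y (Sf.d k (X' i)) := fun k i =>
    Sf.ev_d k (fun z => X z i) _ (hX i) y
  have hdP : ∀ k i j, pd k (fun z => P z i j) y = Sf.ev y (Sf.d k (P' i j)) := fun k i j =>
    Sf.ev_d k (fun z => P z i j) _ (hP i j) y
  simp only [lie₂, lieA₂, map_add, map_sub, map_mul, map_sum, divergence_ev hX, hP _ _ y, hX _ y,
    Sf.ev_algebraMap, hd, hdP]

end Link

/-- The coordinate functions. -/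
def coordA (U : TopologicalSpace.Opens Plane) (i : Fin 2) : Sf U :=
  Sf.mk (fun z => z i) (Sf.contDiffOn_coord contDiffOn_id i)

lemma d_coordA (U : TopologicalSpace.Opens Plane) (i j : Fin 2) :
    Sf.d i (coordA U j) = if i = j then 1 else 0 := Sf.ext_ev fun y => by
  rw [← Sf.ev_d i (fun z => z j) (coordA U j) (fun y => rfl), pd_coord]
  split_ifs <;> simp

lemma exists_isConfField {ε : Fin 2 → ℝ} (hε : ∀ i, ε i = 1 ∨ ε i = -1)
    {X : Plane → Fin 2 → ℝ} (hX : X ∈ confAlg ε) (U : TopologicalSpace.Opens Plane) :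
    ∃ (X' : Fin 2 → Sf U) (u v : Sf U) (c : Fin 2 → ℝ), (∀ k, ∀ y : U, X y k = Sf.ev y (X' k)) ∧
      IsConfField Sf.d ε X' u v c := by
  obtain ⟨a, r, s, b, h⟩ := exists_confPoly hX
  refine ⟨confPoly ε a r s b (coordA U), _, _, _, fun k y => ?_,
    isConfField_confPoly ε a b r s (coordA U) hε (d_coordA U)⟩
  rw [ev_confPoly, h]
  rfl

section Global

variable {M : Type*} [TopologicalSpace M] [ChartedSpace Plane M] {ε : Fin 2 → ℝ}
  (hε : ∀ i, ε i = 1 ∨ ε i = -1) {𝒜 : Set (Chart M)} (h𝒜 : IsConfAtlas ε 𝒜) (g : Metric M)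
  (hg : ∀ φ ∈ 𝒜, ∃ F : M → ℝ, Uniformizes ε g φ F)

/-! ### The Schwarzian derivative of the flat conformal structure -/

open Classical in
/-- The Schwarzian derivative of the adapted charts. -/
def confSchwarzian (ε : Fin 2 → ℝ) (𝒜 : Set (Chart M)) (e : Chart M) (x : Plane)
    (i j : Fin 2) : ℝ :=
  if h : ∃ s : Chart M × (M → ℝ), s.1 ∈ 𝒜 ∧ Uniformizes ε g s.1 s.2 ∧ x ∈ overlap e s.1 then
    schwarzian (g.comp e) (fun z => h.choose.2 (e.1.symm z)) i j x
  else 0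

variable {g}

include hε h𝒜

/-- The choice of an adapted chart at each point is immaterial by `schwarzian_unique`, so near a
given point one fixed chart may be used. -/
lemma confSchwarzian_eq {φ : Chart M} (hφ : φ ∈ 𝒜) {F : M → ℝ} (hF : Uniformizes ε g φ F)
    {e : Chart M} {x : Plane} (hx : x ∈ overlap e φ) (i j : Fin 2) :
    confSchwarzian g ε 𝒜 e x i j
      = schwarzian (g.comp e) (fun z => F (e.1.symm z)) i j x := by
  have h : ∃ s : Chart M × (M → ℝ), s.1 ∈ 𝒜 ∧ Uniformizes ε g s.1 s.2 ∧ x ∈ overlap e s.1 :=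
    ⟨(φ, F), hφ, hF, hx⟩
  rw [confSchwarzian, dif_pos h]
  exact schwarzian_unique hε h.choose_spec.2.1 h𝒜 h.choose_spec.1 hφ hF h.choose_spec.2.2 hx i j

include hg

omit hε in
lemma exists_adapted (e : Chart M) {x : Plane} (hx : x ∈ e.1.target) :
    ∃ φ ∈ 𝒜, ∃ F : M → ℝ, Uniformizes ε g φ F ∧ x ∈ overlap e φ := by
  obtain ⟨φ, hφ, h⟩ := h𝒜.1 (e.1.symm x)
  obtain ⟨F, hF⟩ := hg φ hφ
  exact ⟨φ, hφ, F, hF, mem_overlap.2 ⟨hx, h⟩⟩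

/-- Smoothness is local, and near each point a single adapted chart computes the tensor; its
transformation law is that of the Schwarzian of this chart. -/
lemma isCotensor_confSchwarzian : IsCotensor (confSchwarzian g ε 𝒜) where
  smooth e i j x hx := by
    obtain ⟨φ, hφ, F, hF, hxφ⟩ := exists_adapted h𝒜 hg e hx
    have hs := hF.contDiffOn hε e
    have hI : ContDiffOn ℝ ∞ (fun z => (F (e.1.symm z))⁻¹) (overlap e φ) :=
      hs.inv fun y hy => (hF.pos hy).ne'
    have h1 : Sf.mk (U := overlapO e φ) _ hs * Sf.mk (U := overlapO e φ) _ hI = 1 :=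
      Sf.ext_ev fun y => by
        rw [map_mul, Sf.ev_mk, Sf.ev_mk, map_one, mul_inv_cancel₀ (hF.pos y.2).ne']
    have hev := schwarzian_ev (G := g.comp e) (g := g.lift e (U := overlapO e φ) (overlap_subset e φ))
      (g' := g.liftInv e (overlap_subset e φ))
      (fun i j y => (g.ev_lift e (overlap_subset e φ) i j y).symm)
      (fun i j y => (g.ev_liftInv e (overlap_subset e φ) i j y).symm)
      (F := fun z => F (e.1.symm z)) (F₁ := Sf.mk _ hs) (fun y => rfl) h1 i j
    have := Sf.contDiffOn_of_ev (U := overlapO e φ) hev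
    refine ContDiffAt.contDiffWithinAt ?_
    refine (this.contDiffAt ((isOpen_overlap e φ).mem_nhds hxφ)).congr_of_eventuallyEq ?_
    filter_upwards [(isOpen_overlap e φ).mem_nhds hxφ] with z hz
    exact confSchwarzian_eq hε h𝒜 hφ hF hz i j
  transform e e' x hx i j := by
    obtain ⟨φ, hφ, F, hF, hxφ⟩ := exists_adapted h𝒜 hg e (overlap_subset _ _ hx)
    rw [confSchwarzian_eq hε h𝒜 hφ hF hxφ, hF.schwarzian_transition hε hx hxφ]
    simp only [confSchwarzian_eq hε h𝒜 hφ hF (transition_mem hx hxφ)]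

lemma quantization_formula {l m : ℝ} (h1 : m - l ≠ 1) {φ : Chart M} (hφ : φ ∈ 𝒜) {F : M → ℝ}
    (hF : Uniformizes ε g φ F) (P : Symbol₂ M (m - l)) (f : Density M l) {e : Chart M} {x : Plane}
    (hx : x ∈ overlap e φ) :
    ((quantization g (isCotensor_confSchwarzian hε h𝒜 hg) h1 (P, 0, 0)).1 f).1 e x
      = surfaceFormula l m (g.comp e) (fun z => F (e.1.symm z)) (P.1 e) (f.1 e) x := by
  rw [quantization_apply _ _ _ _ _ (overlap_subset _ _ hx), quantVal,
    surfaceFormula_eq_curvedFormula]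
  have h0 : lowerFormula l m ((0 : Symbol₁ M (m - l)).1 e) ((0 : Density M (m - l)).1 e) (f.1 e) x
      = 0 := by
    simp [lowerFormula, pd_const]
  have hS : confSchwarzian g ε 𝒜 e x
      = fun i j => schwarzian (g.comp e) (fun z => F (e.1.symm z)) i j x := by
    funext i j; exact confSchwarzian_eq hε h𝒜 hφ hF hx i j
  rw [hS]
  exact (congrArg _ h0).trans (add_zero _)

/-! ### Equivariance -/

set_option maxHeartbeats 1000000 in
-- In an adapted chart the metric, its inverse and the Schwarzian take the shape required by
-- `IsConfConn.quant`, so the global quantization becomes the flat one.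
lemma quantA_adapted {l m : ℝ} (h1 : m - l ≠ 1) (h2 : m - l ≠ 3 / 2) (h3 : m - l ≠ 2) {c : Chart M}
    (hc : c ∈ 𝒜) {U : TopologicalSpace.Opens Plane} (hU : (U : Set Plane) ⊆ c.1.target)
    {P : Fin 2 → Fin 2 → Sf U} (hP : P 1 0 = P 0 1) (f : Sf U) :
    quantA Sf.d l m (g.chr c hU) (g.lift c hU) (g.liftInv c hU)
      ((isCotensor_confSchwarzian hε h𝒜 hg).lift c hU) P f = flatA Sf.d ε l m P f := by
  obtain ⟨F, hF⟩ := hg c hc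
  have hs := (hF.contDiffOn_self hε).mono hU
  have hp : ∀ y ∈ (U : Set Plane), 0 < F (c.1.symm y) := fun y hy =>
    hF.pos (by rw [overlap_self]; exact hU hy)
  have hI : ContDiffOn ℝ ∞ (fun z => (F (c.1.symm z))⁻¹) U := hs.inv fun y hy => (hp y hy).ne'
  obtain ⟨p, hp1⟩ : ∃ p : Sf U, ∀ y : U, Sf.ev y p = F (c.1.symm y) := ⟨Sf.mk _ hs, fun y => rfl⟩
  obtain ⟨p', hp2⟩ : ∃ p : Sf U, ∀ y : U, Sf.ev y p = (F (c.1.symm y))⁻¹ :=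
    ⟨Sf.mk _ hI, fun y => rfl⟩
  have hpp : p * p' = 1 := Sf.ext_ev fun y => by
    rw [map_mul, hp1, hp2, map_one, mul_inv_cancel₀ (hp y y.2).ne']
  have hG : g.lift c hU = diagM ε p' := by
    funext i j
    refine Sf.ext_ev fun y => ?_
    rw [Metric.ev_lift, hF.comp_self (hU y.2), diagM]
    split_ifs <;> simp [hp2]
  have hG' : g.liftInv c hU = diagM ε p := by
    funext i j
    refine Sf.ext_ev fun y => ?_
    have hm : (Matrix.of fun i j => Sf.ev y (diagM ε p i j)) * g.comp c y = 1 := by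
      ext i j
      have := (hp y y.2).ne'
      rw [Matrix.mul_apply]
      simp only [hF.comp_self (hU y.2), Matrix.of_apply, diagM]
      rcases hε 0 with h0 | h0 <;> rcases hε 1 with h1 | h1 <;> fin_cases i <;> fin_cases j <;>
        simp [h0, h1, hp1, this]
    rw [Metric.ev_liftInv, Matrix.inv_eq_left_inv hm, Matrix.of_apply]
  have hSc : (isCotensor_confSchwarzian hε h𝒜 hg).lift c hU
      = schA Sf.d (chrA Sf.d (diagM ε p') (diagM ε p)) (diagM ε p') (diagM ε p) p p' := by
    funext i j
    refine Sf.ext_ev fun y => ?_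
    rw [IsCotensor.ev_lift, confSchwarzian_eq hε h𝒜 hc hF (by rw [overlap_self]; exact hU y.2),
      ← hG, ← hG']
    exact schwarzian_ev (G := g.comp c) (g := g.lift c hU) (g' := g.liftInv c hU)
      (fun i j y => (g.ev_lift c hU i j y).symm) (fun i j y => (g.ev_liftInv c hU i j y).symm)
      (F := fun z => F (c.1.symm z)) (F₁ := p) (fun y => (hp1 y).symm) hpp i j y
  rw [hSc, Metric.chr, hG, hG']
  have hφ : ∀ i, p' * Sf.d i p = p' * Sf.d i p := fun i => rfl
  refine IsConfConn.quant (φ := fun i => p' * Sf.d i p) hε hpp hφ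
    (fun k i j => chrA_diagM hε hpp hφ k i j) hP h1 h2 h3 ?_ f
  simp only [Derivation.leibniz, smul_eq_mul, d_inv hpp hφ, Sf.d_comm 1 0]
  ring

set_option maxHeartbeats 1000000 in
-- With the quantization flat in adapted charts, the claim splits by degree into `flatA_lie`,
-- `flatA₁_lie` and, for degree zero, the Leibniz rule for Lie derivatives of densities.
theorem confEquivariant_quantization {l m : ℝ} (h1 : m - l ≠ 1) (h2 : m - l ≠ 3 / 2)
    (h3 : m - l ≠ 2) : ConfEquivariant ε 𝒜
      (quantization (l := l) (m := m) g (isCotensor_confSchwarzian hε h𝒜 hg) h1) := by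
  intro c hc V hV hVo X hX P P' f f' hP₂ hP₁ hP₀ hf x hx
  obtain ⟨U, rfl⟩ : ∃ U : TopologicalSpace.Opens Plane, (U : Set Plane) = V := ⟨⟨V, hVo⟩, rfl⟩
  have hU : (U : Set Plane) ⊆ c.1.target := hV
  obtain ⟨X', u, v, cc, hX', hconf⟩ := exists_isConfField hε hX U
  have hcomm : ∀ u : Sf U, Sf.d 1 (Sf.d 0 u) = Sf.d 0 (Sf.d 1 u) := fun u => Sf.d_comm 1 0 u
  have q₂ : Symbol₂.lift P'.1 c hU = lieA₂ Sf.d (m - l) X' (Symbol₂.lift P.1 c hU) := by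
    funext i j
    refine Sf.ext_ev fun y => ?_
    rw [Symbol₂.ev_lift, hP₂ y y.2]
    exact lie₂_ev hX' (fun i j y => (Symbol₂.ev_lift P.1 c hU i j y).symm) _ i j y
  have q₁ : Symbol₁.lift P'.2.1 c hU = lieA₁ Sf.d (m - l) X' (Symbol₁.lift P.2.1 c hU) := by
    funext i
    refine Sf.ext_ev fun y => ?_
    rw [Symbol₁.ev_lift, hP₁ y y.2]
    exact lie₁_ev hX' (fun i y => (Symbol₁.ev_lift P.2.1 c hU i y).symm) _ i y
  have q₀ : Density.lift P'.2.2 c hU = lieA₀ Sf.d (m - l) X' (Density.lift P.2.2 c hU) := by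
    refine Sf.ext_ev fun y => ?_
    rw [Density.ev_lift, hP₀ y y.2]
    exact lie₀_ev hX' (fun y => (Density.ev_lift P.2.2 c hU y).symm) _ y
  have qf : Density.lift f' c hU = lieA₀ Sf.d l X' (Density.lift f c hU) := by
    refine Sf.ext_ev fun y => ?_
    rw [Density.ev_lift, hf y y.2]
    exact lie₀_ev hX' (fun y => (Density.ev_lift f c hU y).symm) _ y
  have hval : ∀ (P : Symbol M (m - l)) (f : Density M l) (y : U),
      ((quantization g (isCotensor_confSchwarzian hε h𝒜 hg) h1 P).1 f).1 c y
        = Sf.ev y (flatA Sf.d ε l m (Symbol₂.lift P.1 c hU) (Density.lift f c hU)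
          + (flatA₁ Sf.d l m (Symbol₁.lift P.2.1 c hU) (Density.lift f c hU)
            + Density.lift P.2.2 c hU * Density.lift f c hU)) := fun P f y => by
    rw [quantization_apply _ _ _ _ _ (hU y.2),
      quantVal_ev g (isCotensor_confSchwarzian hε h𝒜 hg) P f c hU, quantLift,
      quantA_adapted hε h𝒜 hg h1 h2 h3 hc hU (Symbol₂.lift_symm P.1 c hU 1 0)]
  obtain ⟨y, rfl⟩ : ∃ y : U, (y : Plane) = x := ⟨⟨x, hx⟩, rfl⟩
  rw [hval, hval, lie₀_ev hX' (hval P f) m y, ← map_sub, q₂, q₁, q₀, qf,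
    flatA_lie hε hcomm hconf (Symbol₂.lift_symm P.1 c hU 1 0) h1 h2 h3,
    flatA₁_lie hε hcomm hconf h1]
  congr 1
  generalize flatA Sf.d ε l m (Symbol₂.lift P.1 c hU) = Q₂
  generalize flatA₁ Sf.d l m (Symbol₁.lift P.2.1 c hU) = Q₁
  simp only [lieA₀, map_add, Derivation.leibniz, smul_eq_mul, Fin.sum_univ_two, map_sub]
  ring

end Global


/-! ### Fields with prescribed components in a chart -/

section Extension

variable {M : Type*} [TopologicalSpace M] [ChartedSpace Plane M]

open Classical in
/-- The extension by zero of a function on the overlap of two charts. -/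
def extendZero (e c : Chart M) (φ : Plane → ℝ) (x : Plane) : ℝ := if x ∈ overlap e c then φ x else 0

lemma extendZero_of_mem {e c : Chart M} {φ : Plane → ℝ} {x : Plane} (hx : x ∈ overlap e c) :
    extendZero e c φ x = φ x := if_pos hx

lemma extendZero_of_notMem {e c : Chart M} {φ : Plane → ℝ} {x : Plane} (hx : x ∉ overlap e c) :
    extendZero e c φ x = 0 := if_neg hx

/-- A point of the domain of e either lies over K, hence inside the overlap, or has a neighbourhood
that avoids the closed image of K in M, where the extension vanishes. Closedness in M, and not
merely in the chart, is what rules out bad behaviour at the boundary of the overlap. -/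
lemma contDiffOn_extendZero {e c : Chart M} {φ : Plane → ℝ} {K : Set Plane} (hK : K ⊆ c.1.target)
    (hK' : IsClosed (c.1.symm '' K)) (hφ : ContDiffOn ℝ ∞ φ (overlap e c))
    (h0 : ∀ x ∈ overlap e c, transition e c x ∉ K → φ x = 0) :
    ContDiffOn ℝ ∞ (extendZero e c φ) e.1.target := by
  intro x hx
  apply ContDiffAt.contDiffWithinAt
  by_cases hxK : e.1.symm x ∈ c.1.symm '' K
  · have hxo : x ∈ overlap e c := by
      obtain ⟨y, hy, hxy⟩ := hxK
      exact mem_overlap.2 ⟨hx, hxy ▸ c.1.map_target (hK hy)⟩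
    have hn := (isOpen_overlap e c).mem_nhds hxo
    exact (hφ.contDiffAt hn).congr_of_eventuallyEq
      (Filter.eventually_of_mem hn fun y hy => extendZero_of_mem hy)
  · have hn : ∀ᶠ y in 𝓝 x, e.1.symm y ∉ c.1.symm '' K :=
      (e.1.continuousAt_symm hx).eventually (hK'.isOpen_compl.mem_nhds hxK)
    refine (contDiffAt_const (c := (0 : ℝ))).congr_of_eventuallyEq (hn.mono fun y hy => ?_)
    by_cases hyo : y ∈ overlap e c
    · rw [extendZero_of_mem hyo]
      refine h0 y hyo fun hyK => hy ⟨_, hyK, symm_transition hyo⟩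
    · exact extendZero_of_notMem hyo

/-- A cut-off in the chart `c`, which is equal to one on `V` and supported in `W`. -/
structure Cutoff (c : Chart M) (V W : TopologicalSpace.Opens Plane) where
  fn : Plane → ℝ
  supp : Set Plane
  le : V ≤ W
  le_target : (W : Set Plane) ⊆ c.1.target
  one : ∀ x ∈ V, fn x = 1
  zero : ∀ x ∈ c.1.target, x ∉ supp → fn x = 0
  supp_subset : supp ⊆ c.1.target
  closed : IsClosed (c.1.symm '' supp)
  smooth : ∀ u : Plane → ℝ, ContDiffOn ℝ ∞ u W → (∀ x ∉ W, u x = 0) →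
    ContDiffOn ℝ ∞ (fun x => fn x * u x) c.1.target

namespace Cutoff

variable {c : Chart M} {V W : TopologicalSpace.Opens Plane} (C : Cutoff c V W) (w : ℝ)

open Classical in
/-- A function on `W`, multiplied with the cut-off. -/
def val : Sf W →ₗ[ℝ] Plane → ℝ where
  toFun u x := C.fn x * (if h : x ∈ W then Sf.ev ⟨x, h⟩ u else 0)
  map_add' u v := funext fun x => by
    by_cases h : x ∈ W <;> simp [h, mul_add]
  map_smul' r u := funext fun x => by
    by_cases h : x ∈ W <;> simp [h, mul_left_comm]

lemma val_apply (u : Sf W) (x : V) : C.val u x = Sf.ev ⟨x, C.le x.2⟩ u := by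
  have h : (x : Plane) ∈ W := C.le x.2
  simp [val, C.one x x.2, h]

lemma contDiffOn_val (u : Sf W) : ContDiffOn ℝ ∞ (C.val u) c.1.target := by
  refine C.smooth _ ((Sf.contDiffOn_rep u).congr fun x hx => ?_) fun x hx => dif_neg hx
  rw [← Sf.ev_rep u ⟨x, hx⟩]
  exact dif_pos hx

lemma val_eq_zero (u : Sf W) {x : Plane} (hx : x ∈ c.1.target) (hx' : x ∉ C.supp) :
    C.val u x = 0 := by
  simp [val, C.zero x hx hx']

lemma contDiffOn_val_transition (u : Sf W) (e : Chart M) :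
    ContDiffOn ℝ ∞ (fun x => C.val u (transition e c x)) (overlap e c) :=
  (C.contDiffOn_val u).comp (contDiffOn_transition e c) fun _ hx => transition_mem_target hx

lemma contDiffOn_jac_transition (e : Chart M) (i a : Fin 2) :
    ContDiffOn ℝ ∞ (fun x => jac c e (transition e c x) i a) (overlap e c) :=
  (contDiffOn_jac c e i a).comp (contDiffOn_transition e c) fun _ hx => transition_mem_symm hx

lemma mem_overlap_right (_ : Cutoff c V W) {x : Plane} (hx : x ∈ V) : x ∈ overlap c c := by
  rw [overlap_self]; exact Cutoff.le_target ‹_› (Cutoff.le ‹_› hx)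

end Cutoff

lemma overlap_transition_iff {e e' c : Chart M} {x : Plane} (hx : x ∈ overlap e e') :
    transition e e' x ∈ overlap e' c ↔ x ∈ overlap e c :=
  ⟨fun h => mem_overlap_of_transition hx h, fun h => transition_mem hx h⟩

lemma jac_mul_jac_transition {e e' c : Chart M} {x : Plane} (hx : x ∈ overlap e e')
    (hc : x ∈ overlap e c) (a b : Fin 2) :
    ∑ i, jac e e' x a i * jac c e (transition e c x) i b = jac c e' (transition e c x) a b := by
  have h := jac_trans (e := c) (e' := e) (e'' := e') (x := transition e c x) (transition_mem_symm hc)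
    (transition_mem hc hx)
  rw [transition_transition hc] at h
  rw [h, Matrix.mul_apply]

namespace Cutoff

variable {c : Chart M} {V W : TopologicalSpace.Opens Plane} (C : Cutoff c V W) (w : ℝ)

/-- The density whose component in the chart `c` is a given function, cut off. -/
def dens : Sf W →ₗ[ℝ] Density M w where
  toFun u := ⟨fun e => extendZero e c fun x => densFactor w e c x * C.val u (transition e c x), by
    refine ⟨fun e => contDiffOn_extendZero C.supp_subset C.closed
      ((contDiffOn_densFactor w e c).mul (C.contDiffOn_val_transition u e)) fun x hx hx' => ?_,
      fun e x hx => extendZero_of_notMem fun h => hx (overlap_subset _ _ h), fun e e' x hx => ?_⟩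
    · rw [C.val_eq_zero u (transition_mem_target hx) hx', mul_zero]
    · beta_reduce
      by_cases hc : x ∈ overlap e c
      · rw [extendZero_of_mem hc, extendZero_of_mem ((overlap_transition_iff hx).2 hc),
          transition_trans c hx, densFactor_trans w hx hc, mul_assoc]
        rfl
      · rw [extendZero_of_notMem hc, extendZero_of_notMem (mt (overlap_transition_iff hx).1 hc),
          mul_zero]⟩
  map_add' u v := Subtype.ext <| funext fun e => funext fun x => by
    simp only [Submodule.coe_add, Pi.add_apply]
    by_cases hc : x ∈ overlap e c
    · simp only [extendZero_of_mem hc, map_add, Pi.add_apply]; ring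
    · simp only [extendZero_of_notMem hc, add_zero]
  map_smul' r u := Subtype.ext <| funext fun e => funext fun x => by
    simp only [Submodule.coe_smul, Pi.smul_apply, smul_eq_mul, RingHom.id_apply]
    by_cases hc : x ∈ overlap e c
    · simp only [extendZero_of_mem hc, map_smul, Pi.smul_apply, smul_eq_mul]; ring
    · simp only [extendZero_of_notMem hc, mul_zero]

lemma dens_apply (u : Sf W) (x : V) : (C.dens w u).1 c x = Sf.ev ⟨x, C.le x.2⟩ u := by
  have h := C.le_target (C.le x.2)
  have key : (C.dens w u).1 c x
      = extendZero c c (fun x => densFactor w c c x * C.val u (transition c c x)) x := rfl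
  rw [key, extendZero_of_mem (C.mem_overlap_right x.2),
    transition_self h, densFactor_self w h, one_mul, C.val_apply]

/-- The symbol of degree one whose components in the chart `c` are given functions, cut off. -/
def sym₁ : (Fin 2 → Sf W) →ₗ[ℝ] Symbol₁ M w where
  toFun u := ⟨fun e x i => extendZero e c (fun x => densFactor w e c x *
      ∑ a, jac c e (transition e c x) i a * C.val (u a) (transition e c x)) x, by
    refine ⟨fun e i => contDiffOn_extendZero C.supp_subset C.closed
      ((contDiffOn_densFactor w e c).mul (ContDiffOn.sum fun a _ =>
        (contDiffOn_jac_transition e i a).mul (C.contDiffOn_val_transition (u a) e)))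
        fun x hx hx' => ?_,
      fun e x hx i => extendZero_of_notMem fun h => hx (overlap_subset _ _ h),
      fun e e' x hx i => ?_⟩
    · simp [fun a => C.val_eq_zero (u a) (transition_mem_target hx) hx']
    · by_cases hc : x ∈ overlap e c
      · simp only [extendZero_of_mem hc, extendZero_of_mem ((overlap_transition_iff hx).2 hc),
          transition_trans c hx, densFactor_trans w hx hc, ← jac_mul_jac_transition hx hc]
        change _ = densFactor w e e' x * _
        simp only [Fin.sum_univ_two]
        ring
      · simp [extendZero_of_notMem hc, extendZero_of_notMem (mt (overlap_transition_iff hx).1 hc)]⟩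
  map_add' u v := Subtype.ext <| funext fun e => funext fun x => funext fun i => by
    simp only [Submodule.coe_add, Pi.add_apply]
    by_cases hc : x ∈ overlap e c
    · simp only [extendZero_of_mem hc, map_add, Pi.add_apply, Fin.sum_univ_two]; ring
    · simp only [extendZero_of_notMem hc, add_zero]
  map_smul' r u := Subtype.ext <| funext fun e => funext fun x => funext fun i => by
    simp only [Submodule.coe_smul, Pi.smul_apply, smul_eq_mul, RingHom.id_apply]
    by_cases hc : x ∈ overlap e c
    · simp only [extendZero_of_mem hc, map_smul, Pi.smul_apply, smul_eq_mul, Fin.sum_univ_two]; ring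
    · simp only [extendZero_of_notMem hc, mul_zero]

lemma sym₁_apply (u : Fin 2 → Sf W) (x : V) (i : Fin 2) :
    (C.sym₁ w u).1 c x i = Sf.ev ⟨x, C.le x.2⟩ (u i) := by
  have h := C.le_target (C.le x.2)
  simp only [sym₁, LinearMap.coe_mk, AddHom.coe_mk, extendZero_of_mem (C.mem_overlap_right x.2),
    transition_self h, densFactor_self w h, one_mul, C.val_apply, jac_self h,
    Matrix.one_apply, ite_mul, zero_mul, Finset.sum_ite_eq, Finset.mem_univ, if_true]

/-- The components of the symbol `Cutoff.sym₂`. -/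
def symFun (u : Fin 2 → Fin 2 → Sf W) (e : Chart M) (x : Plane) (i j : Fin 2) : ℝ :=
  extendZero e c (fun x => densFactor w e c x *
    ∑ a, ∑ b, jac c e (transition e c x) i a * jac c e (transition e c x) j b *
      (1 / 2 * (C.val (u a b) (transition e c x) + C.val (u b a) (transition e c x)))) x

lemma symFun_add (u v : Fin 2 → Fin 2 → Sf W) (e : Chart M) (x : Plane) (i j : Fin 2) :
    C.symFun w (u + v) e x i j = C.symFun w u e x i j + C.symFun w v e x i j := by
  unfold symFun
  by_cases hc : x ∈ overlap e c
  · simp only [extendZero_of_mem hc, map_add, Pi.add_apply, Fin.sum_univ_two]; ring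
  · simp only [extendZero_of_notMem hc, add_zero]

lemma symFun_smul (r : ℝ) (u : Fin 2 → Fin 2 → Sf W) (e : Chart M) (x : Plane) (i j : Fin 2) :
    C.symFun w (r • u) e x i j = r * C.symFun w u e x i j := by
  unfold symFun
  by_cases hc : x ∈ overlap e c
  · simp only [extendZero_of_mem hc, map_smul, Pi.smul_apply, smul_eq_mul, Fin.sum_univ_two]; ring
  · simp only [extendZero_of_notMem hc, mul_zero]

lemma symFun_mem (u : Fin 2 → Fin 2 → Sf W) : C.symFun w u ∈ Symbol₂ M w := by
  refine ⟨fun e i j => contDiffOn_extendZero C.supp_subset C.closed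
    ((contDiffOn_densFactor w e c).mul (ContDiffOn.sum fun a _ => ContDiffOn.sum fun b _ =>
      ((contDiffOn_jac_transition e i a).mul (contDiffOn_jac_transition e j b)).mul
      (contDiffOn_const.mul ((C.contDiffOn_val_transition (u a b) e).add
        (C.contDiffOn_val_transition (u b a) e))))) fun x hx hx' => ?_,
    fun e x hx i j => extendZero_of_notMem fun h => hx (overlap_subset _ _ h),
    fun e x i j => ?_, fun e e' x hx i j => ?_⟩
  · simp [fun a b => C.val_eq_zero (u a b) (transition_mem_target hx) hx']
  · unfold symFun
    by_cases hc : x ∈ overlap e c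
    · simp only [extendZero_of_mem hc, Fin.sum_univ_two]
      ring
    · simp only [extendZero_of_notMem hc]
  · unfold symFun
    by_cases hc : x ∈ overlap e c
    · simp only [extendZero_of_mem hc, extendZero_of_mem ((overlap_transition_iff hx).2 hc),
        transition_trans c hx, densFactor_trans w hx hc, ← jac_mul_jac_transition hx hc]
      change _ = densFactor w e e' x * _
      simp only [Fin.sum_univ_two]
      ring
    · simp [extendZero_of_notMem hc, extendZero_of_notMem (mt (overlap_transition_iff hx).1 hc)]

/-- The symbol of degree two whose components in the chart `c` are given functions, symmetrized
and cut off. -/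
def sym₂ : (Fin 2 → Fin 2 → Sf W) →ₗ[ℝ] Symbol₂ M w where
  toFun u := ⟨C.symFun w u, C.symFun_mem w u⟩
  map_add' u v := Subtype.ext <| funext fun e => funext fun x => funext fun i => funext fun j =>
    C.symFun_add w u v e x i j
  map_smul' r u := Subtype.ext <| funext fun e => funext fun x => funext fun i => funext fun j =>
    C.symFun_smul w r u e x i j

/-- The symmetrization makes `sym₂` linear on all matrices of functions, so that it can be composed
with functionals; on symmetric ones it changes nothing. -/
lemma sym₂_apply (u : Fin 2 → Fin 2 → Sf W) (hu : ∀ i j, u i j = u j i) (x : V) (i j : Fin 2) :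
    (C.sym₂ w u).1 c x i j = Sf.ev ⟨x, C.le x.2⟩ (u i j) := by
  have h := C.le_target (C.le x.2)
  have key : (C.sym₂ w u).1 c x i j = C.symFun w u c x i j := rfl
  rw [key, symFun, extendZero_of_mem (C.mem_overlap_right x.2)]
  simp only [transition_self h, densFactor_self w h, one_mul, C.val_apply, jac_self h,
    Fin.sum_univ_two]
  rw [hu 1 0]
  have h2 : ∀ k : Fin 2, k = 0 ∨ k = 1 := by decide
  rcases h2 i with rfl | rfl <;> rcases h2 j with rfl | rfl <;>
    simp only [Matrix.one_apply_eq, Matrix.one_apply_ne zero_ne_one, Matrix.one_apply_ne one_ne_zero,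
      hu 1 0] <;> ring

end Cutoff

/-- If the chart `c` is defined everywhere, then no cut-off is needed. -/
def Cutoff.ofUniv {c : Chart M} (hc : c.1.source = Set.univ) : Cutoff c (targetO c) (targetO c) where
  fn _ := 1
  supp := c.1.target
  le := le_rfl
  le_target := subset_rfl
  one _ _ := rfl
  zero _ hx hx' := absurd hx hx'
  supp_subset := subset_rfl
  closed := by rw [c.1.symm_image_target_eq_source, hc]; exact isClosed_univ
  smooth _ hu _ := contDiffOn_const.mul hu

/-- Concentric balls: on R/4 the bump function is 1, its support lies in the compact ball of radius
R/2, whose image in M is closed because M is Hausdorff, and W is the ball of radius R, whose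
convexity serves Hadamard's lemma. -/
lemma exists_cutoff [T2Space M] (c : Chart M) {x₀ : Plane} (hx₀ : x₀ ∈ c.1.target) :
    ∃ V W : TopologicalSpace.Opens Plane, x₀ ∈ V ∧ Convex ℝ (W : Set Plane) ∧ Nonempty (Cutoff c V W) := by
  obtain ⟨R, hR, hR'⟩ := Metric.isOpen_iff.1 c.1.open_target x₀ hx₀
  let χ : ContDiffBump x₀ := ⟨R / 4, R / 2, by positivity, by linarith⟩
  have hsub : Metric.closedBall x₀ (R / 2) ⊆ c.1.target :=
    (Metric.closedBall_subset_ball (by linarith)).trans hR'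
  refine ⟨⟨Metric.ball x₀ (R / 4), Metric.isOpen_ball⟩, ⟨Metric.ball x₀ R, Metric.isOpen_ball⟩,
    Metric.mem_ball_self (by positivity), convex_ball _ _, ⟨{
      fn := χ
      supp := Metric.closedBall x₀ (R / 2)
      le := Metric.ball_subset_ball (by linarith)
      le_target := hR'
      one := fun x hx => χ.one_of_mem_closedBall (Metric.ball_subset_closedBall hx)
      zero := fun x _ hx => χ.zero_of_le_dist (by
        rw [Metric.mem_closedBall, not_le] at hx; exact hx.le)
      supp_subset := hsub
      closed := ((isCompact_closedBall x₀ (R / 2)).image_of_continuousOn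
        (c.1.continuousOn_symm.mono hsub)).isClosed
      smooth := fun u hu hu' => by
        intro x hx
        apply ContDiffAt.contDiffWithinAt
        by_cases h : x ∈ Metric.ball x₀ R
        · exact (χ.contDiff.contDiffAt).mul (hu.contDiffAt (Metric.isOpen_ball.mem_nhds h))
        · have hn : ∀ᶠ y in 𝓝 x, y ∉ Metric.closedBall x₀ (R / 2) :=
            Metric.isClosed_closedBall.isOpen_compl.mem_nhds fun h' =>
              h (Metric.closedBall_subset_ball (by linarith) h')
          refine (contDiffAt_const (c := (0 : ℝ))).congr_of_eventuallyEq (hn.mono fun y hy => ?_)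
          beta_reduce
          rw [χ.zero_of_le_dist (by rw [Metric.mem_closedBall, not_le] at hy; exact hy.le), zero_mul] }⟩⟩

end Extension


/-! ### Radial averages -/

section Radial

open MeasureTheory in
-- The integral is the value at 0 of a convolution with the indicator of (0,1], depending on the
-- parameter x. The bump function is 1 on the relevant range and provides the compact support that
-- the smoothness theorem for such convolutions requires.
lemma contDiff_integral_segment {w : Plane → ℝ} (hw : ContDiff ℝ ∞ w) (x₀ : Plane) :
    ContDiff ℝ ∞ (fun x : Plane => ∫ t in (0 : ℝ)..1, w (x₀ + t • (x - x₀))) := by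
  let χ : ContDiffBump (0 : ℝ) := ⟨2, 3, by norm_num, by norm_num⟩
  have hf : LocallyIntegrable ((Set.Ioc (0 : ℝ) 1).indicator fun _ => (1 : ℝ)) volume :=
    (locallyIntegrable_const (1 : ℝ)).indicator measurableSet_Ioc
  have key := contDiffOn_convolution_right_with_param (𝕜 := ℝ) (μ := volume) (n := ⊤)
    (ContinuousLinearMap.mul ℝ ℝ) (g := fun (p : Plane) (s : ℝ) => χ s * w (x₀ - s • (p - x₀)))
    isOpen_univ (isCompact_closedBall (0 : ℝ) 3)
    (fun p s _ hs => by
      rw [χ.zero_of_le_dist (by rw [Metric.mem_closedBall, not_le] at hs; exact hs.le), zero_mul])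
    hf (ContDiff.contDiffOn (by
      refine (χ.contDiff.comp contDiff_snd).mul (hw.comp ?_)
      exact contDiff_const.sub (contDiff_snd.smul (contDiff_fst.sub contDiff_const))))
  rw [Set.univ_prod_univ, contDiffOn_univ] at key
  have h := key.comp (contDiff_id.prodMk (contDiff_const (c := (0 : ℝ))))
  refine (congrArg (ContDiff ℝ ∞) (funext fun x => ?_)).mpr h
  simp only [Function.comp_apply, convolution_def, ContinuousLinearMap.mul_apply', id]
  rw [intervalIntegral.integral_of_le zero_le_one, ← integral_indicator measurableSet_Ioc]
  refine integral_congr_ae (Filter.Eventually.of_forall fun t => ?_)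
  beta_reduce
  by_cases ht : t ∈ Set.Ioc (0 : ℝ) 1
  · rw [Set.indicator_of_mem ht, Set.indicator_of_mem ht, χ.one_of_mem_closedBall]
    · simp
    · have h2 : χ.rIn = 2 := rfl
      rw [Metric.mem_closedBall, h2, dist_zero_right, zero_sub, norm_neg, Real.norm_eq_abs, abs_le]
      constructor <;> linarith [ht.1, ht.2]
  · rw [Set.indicator_of_notMem ht, Set.indicator_of_notMem ht, zero_mul]

variable {W : Set Plane} (hW : IsOpen W) {x₀ : Plane} (hs : StarConvex ℝ x₀ W) {w : Plane → ℝ}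
  (hw : ContDiffOn ℝ ∞ w W)

include hs in
lemma segment_mem {x : Plane} (hx : x ∈ W) {t : ℝ} (ht : t ∈ Set.Icc (0 : ℝ) 1) :
    x₀ + t • (x - x₀) ∈ W := by
  have h := hs hx (sub_nonneg.2 ht.2) ht.1 (by ring)
  convert h using 1
  rw [smul_sub, sub_smul, one_smul]; abel

include hW hs hw

/-- Near x the integral sees w only close to the compact segment from x₀ to x, so w may be cut off
to a smooth function on the plane. -/
lemma contDiffOn_integral_segment :
    ContDiffOn ℝ ∞ (fun x : Plane => ∫ t in (0 : ℝ)..1, w (x₀ + t • (x - x₀))) W := by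
  intro x hx
  apply ContDiffAt.contDiffWithinAt
  set S := (fun t : ℝ => x₀ + t • (x - x₀)) '' Set.Icc 0 1 with hS
  have hSc : IsCompact S := isCompact_Icc.image (by fun_prop)
  have hSW : S ⊆ W := by
    rintro _ ⟨t, ht, rfl⟩
    exact segment_mem hs hx ht
  obtain ⟨δ, hδ, hδW⟩ := hSc.exists_cthickening_subset_open hW hSW
  obtain ⟨χ, hχ, -, hχs, hχ1⟩ := exists_contMDiff_support_eq_eq_one_iff (𝓡 2) (n := ⊤)
    (Metric.isOpen_thickening (δ := δ) (E := S)) (Metric.isClosed_cthickening (δ := δ / 2) (E := S))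
    (Metric.cthickening_subset_thickening' hδ (by linarith) S)
  have hχ' : ContDiff ℝ ∞ χ := hχ.contDiff
  have hsm : ContDiff ℝ ∞ (fun z => χ z * w z) := by
    rw [contDiff_iff_contDiffAt]
    intro z
    by_cases hz : z ∈ Metric.cthickening δ S
    · exact hχ'.contDiffAt.mul (hw.contDiffAt (hW.mem_nhds (hδW hz)))
    · have hn := Metric.isClosed_cthickening.isOpen_compl.mem_nhds hz
      refine (contDiffAt_const (c := (0 : ℝ))).congr_of_eventuallyEq
        (Filter.eventually_of_mem hn fun y hy => ?_)
      have : χ y = 0 := by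
        by_contra h
        have h' : y ∈ Function.support χ := h
        rw [hχs] at h'
        exact hy (Metric.thickening_subset_cthickening _ _ h')
      simp [this]
  refine ((contDiff_integral_segment hsm x₀).contDiffAt).congr_of_eventuallyEq ?_
  filter_upwards [Metric.ball_mem_nhds x (half_pos hδ)] with y hy
  refine intervalIntegral.integral_congr fun t ht => ?_
  rw [Set.uIcc_of_le zero_le_one] at ht
  have : χ (x₀ + t • (y - x₀)) = 1 := by
    rw [← hχ1]
    refine Metric.mem_cthickening_of_dist_le _ (x₀ + t • (x - x₀)) _ _ ⟨t, ht, rfl⟩ ?_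
    rw [dist_add_left, dist_eq_norm, ← smul_sub, norm_smul, sub_sub_sub_cancel_right,
      Real.norm_of_nonneg ht.1]
    rw [Metric.mem_ball, dist_eq_norm] at hy
    nlinarith [ht.2, norm_nonneg (y - x)]
  simp only [this, one_mul]

omit hW in
lemma intervalIntegrable_segment {x : Plane} (hx : x ∈ W) :
    IntervalIntegrable (fun t : ℝ => w (x₀ + t • (x - x₀))) MeasureTheory.volume 0 1 :=
  ContinuousOn.intervalIntegrable (by
    rw [Set.uIcc_of_le zero_le_one]
    exact hw.continuousOn.comp (by fun_prop) fun _ ht => segment_mem hs hx ht)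

/-- Hadamard's lemma. -/
lemma eq_add_sum_integral_segment {x : Plane} (hx : x ∈ W) :
    w x = w x₀ + ∑ k, (x k - x₀ k) * ∫ t in (0 : ℝ)..1, pd k w (x₀ + t • (x - x₀)) := by
  have hI := fun k => intervalIntegrable_segment hs (contDiffOn_pd hW hw k) hx
  have hd : ∀ t ∈ Set.uIcc (0 : ℝ) 1, HasDerivAt (fun t : ℝ => w (x₀ + t • (x - x₀)))
      (∑ k, (x k - x₀ k) * pd k w (x₀ + t • (x - x₀))) t := by
    intro t ht
    rw [Set.uIcc_of_le zero_le_one] at ht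
    have h1 := (differentiableAt_of_contDiffOn hW hw (segment_mem hs hx ht)).hasFDerivAt
    have h2 : HasDerivAt (fun t : ℝ => x₀ + t • (x - x₀)) (x - x₀) t := by
      simpa using ((hasDerivAt_id t).smul_const (x - x₀)).const_add x₀
    have h3 := h1.comp_hasDerivAt t h2
    rw [fderiv_eq_sum_pd] at h3
    exact h3
  have hsum : IntervalIntegrable (fun t : ℝ => ∑ k, (x k - x₀ k) * pd k w (x₀ + t • (x - x₀)))
      MeasureTheory.volume 0 1 := by
    simp only [Fin.sum_univ_two]
    exact ((hI 0).const_mul _).add ((hI 1).const_mul _)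
  have h := intervalIntegral.integral_eq_sub_of_hasDerivAt hd hsum
  rw [intervalIntegral.integral_finsetSum fun k _ => (hI k).const_mul _] at h
  simp only [intervalIntegral.integral_const_mul] at h
  rw [h]
  simp

/-- Along the ray through x, s times the average at parameter s is the integral of w from 0 to s;
the identity is its derivative at s = 1. -/
lemma radial_integral_segment {x : Plane} (hx : x ∈ W) :
    ∑ k, (x k - x₀ k) * pd k (fun x : Plane => ∫ t in (0 : ℝ)..1, w (x₀ + t • (x - x₀))) x
      + (∫ t in (0 : ℝ)..1, w (x₀ + t • (x - x₀))) = w x := by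
  set z : Plane → ℝ := fun x => ∫ t in (0 : ℝ)..1, w (x₀ + t • (x - x₀)) with hz
  have hzs := contDiffOn_integral_segment hW hs hw
  have h1 := (differentiableAt_of_contDiffOn hW hzs hx).hasFDerivAt
  have hline : HasDerivAt (fun s : ℝ => x₀ + s • (x - x₀)) (x - x₀) 1 := by
    simpa using ((hasDerivAt_id (1 : ℝ)).smul_const (x - x₀)).const_add x₀
  have hx1 : x₀ + (1 : ℝ) • (x - x₀) = x := by simp
  have h2 : HasDerivAt (fun s : ℝ => z (x₀ + s • (x - x₀))) (fderiv ℝ z x (x - x₀)) 1 := by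
    have h1' : HasFDerivAt z (fderiv ℝ z x) (x₀ + (1 : ℝ) • (x - x₀)) := by rw [hx1]; exact h1
    exact h1'.comp_hasDerivAt (1 : ℝ) hline
  have h3 := (hasDerivAt_id (1 : ℝ)).mul h2
  have hcont : ContinuousAt (fun t : ℝ => w (x₀ + t • (x - x₀))) 1 := by
    refine ContinuousAt.comp (g := w) ?_ hline.continuousAt
    rw [hx1]; exact (hw.contDiffAt (hW.mem_nhds hx)).continuousAt
  have hmeas : StronglyMeasurableAtFilter (fun t : ℝ => w (x₀ + t • (x - x₀))) (𝓝 1)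
      MeasureTheory.volume := by
    have hopen : IsOpen ((fun t : ℝ => x₀ + t • (x - x₀)) ⁻¹' W) := hW.preimage (by fun_prop)
    refine ContinuousOn.stronglyMeasurableAtFilter hopen
      (hw.continuousOn.comp (by fun_prop) fun _ ht => ht) 1 ?_
    rw [Set.mem_preimage, hx1]; exact hx
  have h4 := intervalIntegral.integral_hasDerivAt_right (intervalIntegrable_segment hs hw hx)
    hmeas hcont
  have heq : (fun s : ℝ => id s * z (x₀ + s • (x - x₀)))
      = fun s => ∫ t in (0 : ℝ)..s, w (x₀ + t • (x - x₀)) := by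
    funext s
    have := intervalIntegral.mul_integral_comp_mul_right (a := 0) (b := 1)
      (f := fun t => w (x₀ + t • (x - x₀))) s
    rw [zero_mul, one_mul] at this
    rw [← this, id, hz]
    simp only [add_sub_cancel_left, smul_smul]
  have h5 := h3.unique (heq ▸ h4)
  rw [hx1, fderiv_eq_sum_pd] at h5
  simp only [id, one_mul] at h5
  rw [← h5, add_comm]
  rfl

end Radial

/-! ### Coordinates centred at a point, and the Euler field -/

section CenteredCoord

variable {W : TopologicalSpace.Opens Plane} {x₀ : Plane}

/-- The coordinates centred at the point `x₀`. -/
def cenA (W : TopologicalSpace.Opens Plane) (x₀ : Plane) (k : Fin 2) : Sf W :=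
  coordA W k - algebraMap ℝ (Sf W) (x₀ k)

lemma d_cenA (i j : Fin 2) : Sf.d i (cenA W x₀ j) = if i = j then 1 else 0 := by
  rw [cenA, map_sub, d_coordA, Derivation.map_algebraMap, sub_zero]

lemma ev_cenA (x : W) (k : Fin 2) : Sf.ev x (cenA W x₀ k) = (x : Plane) k - x₀ k := by
  rw [cenA, map_sub, Sf.ev_algebraMap]; rfl

/-- The operator E + 1, with E the Euler field about x₀, is surjective on smooth functions. This
replaces any continuity assumption on functionals. -/
lemma exists_radial (hs : StarConvex ℝ x₀ (W : Set Plane)) (w : Sf W) :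
    ∃ z : Sf W, ∑ k, cenA W x₀ k * Sf.d k z + z = w := by
  refine ⟨Sf.mk _ (contDiffOn_integral_segment W.2 hs (Sf.contDiffOn_rep w)), Sf.ext_ev fun x => ?_⟩
  rw [Sf.ev_rep w, ← radial_integral_segment W.2 hs (Sf.contDiffOn_rep w) x.2]
  simp only [map_add, map_sum, map_mul, ev_cenA, Sf.d_mk, Sf.ev_mk]

lemma exists_hadamard (hs : StarConvex ℝ x₀ (W : Set Plane)) (u : Sf W) :
    ∃ (c : ℝ) (z : Fin 2 → Sf W), u = algebraMap ℝ (Sf W) c + ∑ k, cenA W x₀ k * z k := by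
  refine ⟨Sf.rep u x₀, fun k => Sf.mk _ (contDiffOn_integral_segment W.2 hs
    (contDiffOn_pd W.2 (Sf.contDiffOn_rep u) k)), Sf.ext_ev fun x => ?_⟩
  rw [Sf.ev_rep u, eq_add_sum_integral_segment W.2 hs (Sf.contDiffOn_rep u) x.2]
  simp only [map_add, map_sum, map_mul, ev_cenA, Sf.ev_mk, Sf.ev_algebraMap]

end CenteredCoord


/-! ### Invariant functionals -/

section Euler

variable {A : Type*} [CommRing A] [Algebra ℝ A] {d : Fin 2 → Derivation ℝ A A} {y : Fin 2 → A}
  (hy : ∀ i j, d i (y j) = if i = j then 1 else 0)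
  (hrad : ∀ w, ∃ z, ∑ k, y k * d k z + z = w)
  (hhad : ∀ u, ∃ (c : ℝ) (z : Fin 2 → A), u = algebraMap ℝ A c + ∑ k, y k * z k)

include hy in
lemma radial_coord (k : Fin 2) : ∑ i, y i * d i (y k) = y k := by
  simp [hy]

lemma radial_mul (u v : A) : ∑ i, y i * d i (u * v)
    = u * ∑ i, y i * d i v + v * ∑ i, y i * d i u := by
  simp only [Derivation.leibniz, smul_eq_mul, Fin.sum_univ_two]
  ring

include hy hrad hhad

/-- A functional that is homogeneous of degree one vanishes if it vanishes on linear functions. -/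
lemma eq_zero_of_homogeneous_one {T : A →ₗ[ℝ] ℝ} (h : ∀ u, T (∑ i, y i * d i u) = T u)
    (h1 : ∀ k, T (y k) = 0) (u : A) : T u = 0 := by
  have hc : ∀ c : ℝ, T (algebraMap ℝ A c) = 0 := fun c => by
    rw [← h]; simp
  have hl : ∀ (c : ℝ) k, T (y k * algebraMap ℝ A c) = 0 := fun c k => by
    rw [mul_comm, ← Algebra.smul_def, map_smul, h1, smul_zero]
  -- With z = (E+1)z', the element yₖyⱼz is (E-1)(yₖyⱼz'), and T vanishes on the image of E-1.
  have hq : ∀ k j z, T (y k * (y j * z)) = 0 := fun k j z => by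
    obtain ⟨z', rfl⟩ := hrad z
    have := h (y k * (y j * z'))
    rw [radial_mul, radial_mul, radial_coord hy, radial_coord hy] at this
    rw [show y k * (y j * (∑ i, y i * d i z' + z')) = y k * (y j * ∑ i, y i * d i z' + z' * y j)
      + y j * z' * y k - y k * (y j * z') by ring, map_sub, this, sub_self]
  obtain ⟨c, z, rfl⟩ := hhad u
  have hz : ∀ k, T (y k * z k) = 0 := fun k => by
    obtain ⟨c', z', hz'⟩ := hhad (z k)
    rw [hz', mul_add, Finset.mul_sum, map_add, map_sum, hl, zero_add]
    exact Finset.sum_eq_zero fun j _ => hq k j (z' j)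
  rw [map_add, map_sum, hc, zero_add]
  exact Finset.sum_eq_zero fun k _ => hz k

/-- A functional that is homogeneous of degree two vanishes if it vanishes on quadratic forms. -/
lemma eq_zero_of_homogeneous_two {T : A →ₗ[ℝ] ℝ} (h : ∀ u, T (∑ i, y i * d i u) = 2 * T u)
    (h2 : ∀ j k, T (y j * y k) = 0) (u : A) : T u = 0 := by
  have hc : ∀ c : ℝ, T (algebraMap ℝ A c) = 0 := fun c => by
    have := h (algebraMap ℝ A c)
    simpa using this.symm
  have h1 : ∀ k, T (y k) = 0 := fun k => by
    have := h (y k)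
    rw [radial_coord hy] at this
    linarith
  have hl : ∀ (c : ℝ) k, T (y k * algebraMap ℝ A c) = 0 := fun c k => by
    rw [mul_comm, ← Algebra.smul_def, map_smul, h1, smul_zero]
  have hq : ∀ (c : ℝ) k j, T (y k * (y j * algebraMap ℝ A c)) = 0 := fun c k j => by
    rw [← mul_assoc, mul_comm, ← Algebra.smul_def, map_smul, h2, smul_zero]
  -- As in degree one: with z = (E+1)z', the cubic multiple of z is the image of the cubic multiple
  -- of z' under E-2.
  have ht : ∀ k j i z, T (y k * (y j * (y i * z))) = 0 := fun k j i z => by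
    obtain ⟨z', rfl⟩ := hrad z
    have := h (y k * (y j * (y i * z')))
    rw [radial_mul, radial_mul, radial_mul, radial_coord hy, radial_coord hy, radial_coord hy] at this
    rw [show y k * (y j * (y i * (∑ i, y i * d i z' + z')))
      = y k * (y j * (y i * ∑ i, y i * d i z' + z' * y i) + y i * z' * y j)
      + y j * (y i * z') * y k - y k * (y j * (y i * z')) - y k * (y j * (y i * z')) by ring,
      map_sub, map_sub, this]
    ring
  obtain ⟨c, z, rfl⟩ := hhad u
  have hz : ∀ k j v, T (y k * (y j * v)) = 0 := fun k j v => by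
    obtain ⟨c', z', rfl⟩ := hhad v
    rw [mul_add, mul_add, Finset.mul_sum, Finset.mul_sum, map_add, map_sum, hq, zero_add]
    exact Finset.sum_eq_zero fun i _ => ht k j i (z' i)
  have hz' : ∀ k, T (y k * z k) = 0 := fun k => by
    obtain ⟨c', z', hz'⟩ := hhad (z k)
    rw [hz', mul_add, Finset.mul_sum, map_add, map_sum, hl, zero_add]
    exact Finset.sum_eq_zero fun j _ => hz k j (z' j)
  rw [map_add, map_sum, hc, zero_add]
  exact Finset.sum_eq_zero fun k _ => hz' k

variable {e : Fin 2 → ℝ} (he : ∀ i, e i = 1 ∨ e i = -1)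

include he

/-- An invariant functional of order one on vector fields with values in densities vanishes. -/
lemma vector_functional_eq_zero {T : Fin 2 → A →ₗ[ℝ] ℝ} {D : ℝ} (hD : D ≠ 1)
    (h0 : ∀ r s b u, T 0 (∑ k, confPoly e 0 r s b y k * d k u + D • (confDil e s b y * u))
      - e 0 * T 1 (confRot r b y * u) = s * (D + 1) * T 0 u)
    (h1 : ∀ r s b u, T 1 (∑ k, confPoly e 0 r s b y k * d k u + D • (confDil e s b y * u))
      + e 1 * T 0 (confRot r b y * u) = s * (D + 1) * T 1 u) (i : Fin 2) (u : A) : T i u = 0 := by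
  -- Inversions tested on the constant 1 and the rotation on the coordinates give linear equations
  -- for the values on coordinates, solvable for D ≠ 1; the dilation gives the homogeneity.
  have a1 := h0 0 0 ![1, 0] 1
  have a2 := h0 0 0 ![0, 1] 1
  have b1 := h0 1 0 0 (y 0)
  have b2 := h0 1 0 0 (y 1)
  have E0 := fun u => h0 0 1 0 u
  have E1 := fun u => h1 0 1 0 u
  simp [confPoly, confDil, confRot, Fin.sum_univ_two, Algebra.algebraMap_eq_smul_one, two_mul, hy,
    add_mul] at a1 a2 b1 b2 E0 E1
  have e0 : e 0 ≠ 0 := by rcases he 0 with h | h <;> simp [h]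
  have e1 : e 1 ≠ 0 := by rcases he 1 with h | h <;> simp [h]
  have hD' : 1 - D ≠ 0 := sub_ne_zero.2 hD.symm
  have t00 : T 0 (y 0) = 0 :=
    (mul_eq_zero.1 (show e 0 * (1 - D) * T 0 (y 0) = 0 by linear_combination a1 / 2 + b2)).resolve_left
      (mul_ne_zero e0 hD')
  have t11 : T 1 (y 1) = 0 :=
    (mul_eq_zero.1 (show e 0 * T 1 (y 1) = 0 by rw [t00] at b2; linear_combination -b2)).resolve_left e0
  have t01 : T 0 (y 1) = 0 :=
    (mul_eq_zero.1 (show e 1 * (1 - D) * T 0 (y 1) = 0 by linear_combination a2 / 2 - b1)).resolve_left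
      (mul_ne_zero e1 hD')
  have t10 : T 1 (y 0) = 0 :=
    (mul_eq_zero.1 (show e 0 * T 1 (y 0) = 0 by rw [t01] at b1; linear_combination -b1)).resolve_left e0
  have hT0 := eq_zero_of_homogeneous_one hy hrad hhad (T := T 0) (fun u => by
    have := E0 u
    rw [Fin.sum_univ_two, map_add]; linarith) (Fin.forall_fin_two.2 ⟨t00, t01⟩)
  have hT1 := eq_zero_of_homogeneous_one hy hrad hhad (T := T 1) (fun u => by
    have := E1 u
    rw [Fin.sum_univ_two, map_add]; linarith) (Fin.forall_fin_two.2 ⟨t10, t11⟩)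
  exact Fin.forall_fin_two (p := fun i => ∀ u, T i u = 0) |>.2 ⟨hT0, hT1⟩ i u

/-- Invariant vector-valued functionals of order one on functions vanish. -/
lemma trace_functional_one_eq_zero {S : Fin 2 → A →ₗ[ℝ] ℝ} {D : ℝ} (hD : D ≠ 0)
    (h : ∀ i s b u, S i (∑ k, confPoly e 0 0 s b y k * d k u + D • (confDil e s b y * u))
      = s * (D + 2) * S i u - s * S i u) (i : Fin 2) (u : A) : S i u = 0 := by
  have a1 := h i 0 ![1, 0] 1
  have a2 := h i 0 ![0, 1] 1
  have E := fun u => h i 1 0 u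
  simp [confPoly, confDil, Fin.sum_univ_two, Algebra.algebraMap_eq_smul_one, two_mul,
    add_mul] at a1 a2 E
  have e0 : e 0 ≠ 0 := by rcases he 0 with h | h <;> simp [h]
  have e1 : e 1 ≠ 0 := by rcases he 1 with h | h <;> simp [h]
  exact eq_zero_of_homogeneous_one hy hrad hhad (T := S i) (fun u => by
    have := E u
    rw [Fin.sum_univ_two, map_add]; linarith) (Fin.forall_fin_two.2
      ⟨(a1.resolve_left hD).resolve_left e0, (a2.resolve_left hD).resolve_left e1⟩) u

/-- Invariant vector-valued functionals of order one on trace-free symbols vanish. -/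
lemma traceless_functional_one_eq_zero {Z T : Fin 2 → A →ₗ[ℝ] ℝ} {D : ℝ} (hD : D ≠ 2)
    (hZ : ∀ i r s b u, Z i (∑ k, confPoly e 0 r s b y k * d k u + D • (confDil e s b y * u))
      - 2 * T i (confRot r b y * u)
        = s * (D + 2) * Z i u - (s * Z i u + r * ![-e 1 * Z 1 u, e 0 * Z 0 u] i))
    (hT : ∀ i r s b u, T i (∑ k, confPoly e 0 r s b y k * d k u + D • (confDil e s b y * u))
      + 2 * (e 0 * e 1) * Z i (confRot r b y * u)
        = s * (D + 2) * T i u - (s * T i u + r * ![-e 1 * T 1 u, e 0 * T 0 u] i)) (i : Fin 2) (u : A) :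
    Z i u = 0 ∧ T i u = 0 := by
  have e0 : e 0 ≠ 0 := by rcases he 0 with h | h <;> simp [h]
  have e1 : e 1 ≠ 0 := by rcases he 1 with h | h <;> simp [h]
  have a1 := fun i => hZ i 0 0 ![1, 0] 1
  have a2 := fun i => hZ i 0 0 ![0, 1] 1
  have a3 := fun i => hT i 0 0 ![1, 0] 1
  have a4 := fun i => hT i 0 0 ![0, 1] 1
  have r00 := hZ 0 1 0 0 (y 0)
  have r10 := hZ 1 1 0 0 (y 0)
  have r01 := hZ 0 1 0 0 (y 1)
  have r11 := hZ 1 1 0 0 (y 1)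
  have E := fun u => hZ i 0 1 0 u
  have E' := fun u => hT i 0 1 0 u
  simp [-mul_eq_zero, -Fin.forall_fin_two, confPoly, confDil, confRot, Fin.sum_univ_two, Algebra.algebraMap_eq_smul_one,
    two_mul, hy, add_mul] at a1 a2 a3 a4 r00 r10 r01 r11 E E'
  have hz : ∀ i, Z i (y 0) = 0 ∧ Z i (y 1) = 0 := by
    -- The inversions alone give systems of determinant proportional to 4-D². The root D = 2 is
    -- excluded by hypothesis; at D = -2 the inversions still express T through Z, and the rotation
    -- supplies the missing equations.
    by_cases hD2 : D = -2
    · subst hD2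
      have t0 : ∀ i, T i (y 0) = e 1 * Z i (y 1) := fun i => by linear_combination -a2 i / 4
      have t1 : ∀ i, T i (y 1) = -e 0 * Z i (y 0) := fun i => by linear_combination a1 i / 4
      rw [t0] at r00 r10
      rw [t1] at r01 r11
      have z00 : Z 0 (y 0) = 0 := (mul_eq_zero.1 (show e 0 * Z 0 (y 0) = 0 by
        linear_combination (3 * r01 - r10) / 8)).resolve_left e0
      have z11 : Z 1 (y 1) = 0 := (mul_eq_zero.1 (show e 1 * Z 1 (y 1) = 0 by
        rw [z00] at r01; linear_combination -r01)).resolve_left e1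
      have z01 : Z 0 (y 1) = 0 := (mul_eq_zero.1 (show e 0 * e 1 * Z 0 (y 1) = 0 by
        linear_combination (-3 * e 0 * r00 - e 1 * r11) / 8)).resolve_left (mul_ne_zero e0 e1)
      have z10 : Z 1 (y 0) = 0 := (mul_eq_zero.1 (show e 1 * Z 1 (y 0) = 0 by
        rw [z01] at r00; linear_combination -r00)).resolve_left e1
      exact Fin.forall_fin_two.2 ⟨⟨z00, z01⟩, ⟨z10, z11⟩⟩
    · have hD4 : e 0 * e 1 * (4 - D ^ 2) ≠ 0 := mul_ne_zero (mul_ne_zero e0 e1) fun h => by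
        have : (D - 2) * (D + 2) = 0 := by linear_combination -h
        rcases mul_eq_zero.1 this with h | h
        · exact hD (by linarith)
        · exact hD2 (by linarith)
      refine fun i => ⟨(mul_eq_zero.1 (show e 0 * e 1 * (4 - D ^ 2) * Z i (y 0) = 0 by
        linear_combination a4 i + D * e 1 / 2 * a1 i)).resolve_left hD4,
        (mul_eq_zero.1 (show e 0 * e 1 * (4 - D ^ 2) * Z i (y 1) = 0 by
        linear_combination -a3 i + D * e 0 / 2 * a2 i)).resolve_left hD4⟩
  have ht : ∀ i, T i (y 0) = 0 ∧ T i (y 1) = 0 := fun i => by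
    have h1 := a1 i
    have h2 := a2 i
    rw [(hz i).1] at h1
    rw [(hz i).2] at h2
    exact ⟨by linear_combination -h2 / 4, by linear_combination h1 / 4⟩
  exact ⟨eq_zero_of_homogeneous_one hy hrad hhad (T := Z i) (fun u => by
    have := E u
    rw [Fin.sum_univ_two, map_add]; linarith) (Fin.forall_fin_two.2 (hz i)) u,
    eq_zero_of_homogeneous_one hy hrad hhad (T := T i) (fun u => by
    have := E' u
    rw [Fin.sum_univ_two, map_add]; linarith) (Fin.forall_fin_two.2 (ht i)) u⟩

/-- Invariant functionals of order two on functions vanish. -/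
lemma trace_functional_two_eq_zero {S : A →ₗ[ℝ] ℝ} {D : ℝ} (hD : D ≠ 0)
    (h : ∀ r s b u, S (∑ k, confPoly e 0 r s b y k * d k u + D • (confDil e s b y * u))
      = s * (D + 2) * S u) (u : A) : S u = 0 := by
  have e0 : e 0 ≠ 0 := by rcases he 0 with h | h <;> simp [h]
  have e1 : e 1 ≠ 0 := by rcases he 1 with h | h <;> simp [h]
  have a := h 0 0 ![1, 0] (y 0)
  have r0 := h 1 0 0 (y 0 * y 0)
  have r1 := h 1 0 0 (y 0 * y 1)
  have E := fun u => h 0 1 0 u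
  simp [-mul_eq_zero, -mul_eq_mul_left_iff, confPoly, confDil, Fin.sum_univ_two, Algebra.algebraMap_eq_smul_one, two_mul, hy,
    add_mul, mul_add, mul_comm (y 1) (y 0)] at a r0 r1 E
  have s00 : S (y 0 * y 0) = 0 := (mul_eq_zero.1 (show D * e 0 * S (y 0 * y 0) = 0 by
    linear_combination -(a + r1) / 2)).resolve_left (mul_ne_zero hD e0)
  have s11 : S (y 1 * y 1) = 0 := (mul_eq_zero.1 (show e 1 * S (y 1 * y 1) = 0 by
    rw [s00] at r1; linear_combination -r1)).resolve_left e1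
  have s01 : S (y 0 * y 1) = 0 := (mul_eq_zero.1 (show e 1 * S (y 0 * y 1) = 0 by
    linear_combination r0)).resolve_left e1
  exact eq_zero_of_homogeneous_two hy hrad hhad (T := S) (fun u => by
    have := E u
    rw [Fin.sum_univ_two, map_add]; linarith) (Fin.forall_fin_two.2
      ⟨Fin.forall_fin_two.2 ⟨s00, s01⟩, Fin.forall_fin_two.2 ⟨by rw [mul_comm, s01], s11⟩⟩) u

/-- Invariant functionals of order two on trace-free symbols vanish. -/
lemma traceless_functional_two_eq_zero {Z T : A →ₗ[ℝ] ℝ} {D : ℝ} (hD : D ≠ 1)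
    (hZ : ∀ r s b u, Z (∑ k, confPoly e 0 r s b y k * d k u + D • (confDil e s b y * u))
      - 2 * T (confRot r b y * u) = s * (D + 2) * Z u)
    (hT : ∀ r s b u, T (∑ k, confPoly e 0 r s b y k * d k u + D • (confDil e s b y * u))
      + 2 * (e 0 * e 1) * Z (confRot r b y * u) = s * (D + 2) * T u) (u : A) :
    Z u = 0 ∧ T u = 0 := by
  have e0 : e 0 ≠ 0 := by rcases he 0 with h | h <;> simp [h]
  have e1 : e 1 ≠ 0 := by rcases he 1 with h | h <;> simp [h]
  -- In degree two the inversions are tested on coordinates and the rotation on quadratic forms. The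
  -- exceptional value D = 1 stands for δ = 3/2.
  have a0 := hZ 0 0 ![1, 0] (y 0)
  have a1 := hZ 0 0 ![1, 0] (y 1)
  have r0 := hZ 1 0 0 (y 0 * y 0)
  have r1 := hZ 1 0 0 (y 1 * y 1)
  have r2 := hZ 1 0 0 (y 0 * y 1)
  have q0 := hT 1 0 0 (y 0 * y 0)
  have q1 := hT 1 0 0 (y 1 * y 1)
  have E := fun u => hZ 0 1 0 u
  have E' := fun u => hT 0 1 0 u
  simp [-mul_eq_zero, -mul_eq_mul_left_iff, confPoly, confDil, confRot, Fin.sum_univ_two, Algebra.algebraMap_eq_smul_one,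
    two_mul, hy, add_mul, mul_add, mul_comm (y 1) (y 0)] at a0 a1 r0 r1 r2 q0 q1 E E'
  have hD' : 1 - D ≠ 0 := sub_ne_zero.2 hD.symm
  have t01 : T (y 0 * y 1) = 0 := (mul_eq_zero.1 (show e 0 * e 1 * (1 - D) * T (y 0 * y 1) = 0 by
    linear_combination e 0 * e 1 / 2 * a0 - e 1 / 4 * q1 + e 0 * (1 + 2 * D) / 4 * q0)).resolve_left
    (mul_ne_zero (mul_ne_zero e0 e1) hD')
  have z01 : Z (y 0 * y 1) = 0 := (mul_eq_zero.1 (show e 0 * (1 - D) * Z (y 0 * y 1) = 0 by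
    linear_combination a1 / 2 + r1)).resolve_left (mul_ne_zero e0 hD')
  rw [t01] at q0 q1
  rw [z01] at r0 r1
  have z00 : Z (y 0 * y 0) = 0 := (mul_eq_zero.1 (show e 0 * e 1 * Z (y 0 * y 0) = 0 by
    linear_combination q0 / 2)).resolve_left (mul_ne_zero e0 e1)
  have z11 : Z (y 1 * y 1) = 0 := (mul_eq_zero.1 (show e 0 * e 1 * Z (y 1 * y 1) = 0 by
    linear_combination q1 / 2)).resolve_left (mul_ne_zero e0 e1)
  have t00 : T (y 0 * y 0) = 0 := by linear_combination -r0 / 2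
  have t11 : T (y 1 * y 1) = 0 := by linear_combination -r1 / 2
  exact ⟨eq_zero_of_homogeneous_two hy hrad hhad (T := Z) (fun u => by
    have := E u
    rw [Fin.sum_univ_two, map_add]; linarith) (Fin.forall_fin_two.2
      ⟨Fin.forall_fin_two.2 ⟨z00, z01⟩, Fin.forall_fin_two.2 ⟨by rw [mul_comm, z01], z11⟩⟩) u,
    eq_zero_of_homogeneous_two hy hrad hhad (T := T) (fun u => by
    have := E' u
    rw [Fin.sum_univ_two, map_add]; linarith) (Fin.forall_fin_two.2
      ⟨Fin.forall_fin_two.2 ⟨t00, t01⟩, Fin.forall_fin_two.2 ⟨by rw [mul_comm, t01], t11⟩⟩) u⟩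

end Euler

/-! ### Symbols of degree two with constant directions -/

section Directions

variable {A : Type*} [CommRing A] [Algebra ℝ A] {d : Fin 2 → Derivation ℝ A A}

/-- The symbol of degree two with the components `pu`, `qu`, `ru`. -/
def symEmb (p q r : ℝ) : A →ₗ[ℝ] Fin 2 → Fin 2 → A where
  toFun u := ![![p • u, q • u], ![q • u, r • u]]
  map_add' u v := by ext i j; fin_cases i <;> fin_cases j <;> simp
  map_smul' c u := by
    ext i j; fin_cases i <;> fin_cases j <;> simp [smul_comm c]

lemma symEmb_symm (p q r : ℝ) (u : A) (i j : Fin 2) : symEmb p q r u i j = symEmb p q r u j i := by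
  fin_cases i <;> fin_cases j <;> simp [symEmb]

lemma symEmb_comb (p q r p' q' r' a a' : ℝ) (u : A) :
    a • symEmb p q r u + a' • symEmb p' q' r' u
      = symEmb (a * p + a' * p') (a * q + a' * q') (a * r + a' * r') u := by
  ext i j; fin_cases i <;> fin_cases j <;> simp [symEmb, add_smul, mul_smul]

lemma eq_symEmb_of_symm {P : Fin 2 → Fin 2 → A} (hP : ∀ i j, P i j = P j i) :
    P = symEmb 1 0 0 (P 0 0) + symEmb 0 1 0 (P 0 1) + symEmb 0 0 1 (P 1 1) := by
  ext i j; fin_cases i <;> fin_cases j <;> simp [symEmb, hP 1 0]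

/-- On a fixed direction a conformal field acts like on a function, with weight D = 2δ-2 for the
dilation part, and the rotation part mixes directions. It kills the trace direction (e₀, 0, e₁) and
mixes the two trace-free ones. -/
lemma lieA₂_symEmb {e : Fin 2 → ℝ} (r s : ℝ) (b : Fin 2 → ℝ) {y : Fin 2 → A}
    (hy : ∀ i j, d i (y j) = if i = j then 1 else 0) (w p q p' : ℝ) (u : A) :
    lieA₂ d w (confPoly e 0 r s b y) (symEmb p q p' u)
      = symEmb p q p' (∑ k, confPoly e 0 r s b y k * d k u + (2 * w - 2) • (confDil e s b y * u))
        + symEmb (2 * (e 1 * q)) (e 1 * p' - e 0 * p) (-(2 * (e 0 * q))) (confRot r b y * u) := by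
  ext i j
  fin_cases i <;> fin_cases j <;>
    simp [lieA₂, symEmb, Fin.sum_univ_two, derivation_confPoly_zero, derivation_confPoly_one, hy,
      Algebra.smul_def, map_ofNat] <;> ring

/-- The vector field with the components `pu`, `qu`. -/
def vecEmb (p q : ℝ) : A →ₗ[ℝ] Fin 2 → A where
  toFun u := ![p • u, q • u]
  map_add' u v := by ext i; fin_cases i <;> simp
  map_smul' c u := by ext i; fin_cases i <;> simp [smul_comm c]

lemma eq_vecEmb (P : Fin 2 → A) : P = vecEmb 1 0 (P 0) + vecEmb 0 1 (P 1) := by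
  ext i; fin_cases i <;> simp [vecEmb]

lemma vecEmb_eq (p q : ℝ) (u : A) : vecEmb p q u = p • vecEmb 1 0 u + q • vecEmb 0 1 u := by
  ext i; fin_cases i <;> simp [vecEmb]

lemma lieA₁_vecEmb {e : Fin 2 → ℝ} (r s : ℝ) (b : Fin 2 → ℝ) {y : Fin 2 → A}
    (hy : ∀ i j, d i (y j) = if i = j then 1 else 0) (w p q : ℝ) (u : A) :
    lieA₁ d w (confPoly e 0 r s b y) (vecEmb p q u)
      = vecEmb p q (∑ k, confPoly e 0 r s b y k * d k u + (2 * w - 1) • (confDil e s b y * u))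
        + vecEmb (e 1 * q) (-(e 0 * p)) (confRot r b y * u) := by
  ext i
  fin_cases i <;>
    simp [lieA₁, vecEmb, Fin.sum_univ_two, derivation_confPoly_zero, derivation_confPoly_one, hy,
      Algebra.smul_def, map_ofNat] <;> ring

variable {y : Fin 2 → A} (hy : ∀ i j, d i (y j) = if i = j then 1 else 0)
  (hrad : ∀ w, ∃ z, ∑ k, y k * d k z + z = w)
  (hhad : ∀ u, ∃ (c : ℝ) (z : Fin 2 → A), u = algebraMap ℝ A c + ∑ k, y k * z k)
  {e : Fin 2 → ℝ} (he : ∀ i, e i = 1 ∨ e i = -1) {δ : ℝ}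

include he in
-- The splitting into the trace direction and two trace-free directions, which turns a functional on
-- symbols into the functionals S, Z and T on functions.
lemma symEmb_eq (p q r : ℝ) (u : A) :
    symEmb p q r u = ((p * e 0 + r * e 1) / 2) • symEmb (e 0) 0 (e 1) u
      + ((p * e 0 - r * e 1) / 2) • symEmb (e 0) 0 (-e 1) u + q • symEmb 0 1 0 u := by
  have h0 : e 0 * e 0 = 1 := by rcases he 0 with h | h <;> simp [h]
  have h1 : e 1 * e 1 = 1 := by rcases he 1 with h | h <;> simp [h]
  rw [symEmb_comb, ← one_smul ℝ (symEmb _ _ _ u), ← one_smul ℝ (symEmb _ (_ + _) _ u), symEmb_comb]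
  rw [one_smul]
  congr 2
  · linear_combination -p * h0
  · ring
  · linear_combination -r * h1

include hy hrad hhad he

/-- An invariant functional on symbols of degree one vanishes. -/
theorem invariant_functional₁_eq_zero (hδ : δ ≠ 1) {τ : (Fin 2 → A) →ₗ[ℝ] ℝ}
    (h : ∀ r s b P, τ (lieA₁ d δ (confPoly e 0 r s b y) P) = δ * (2 * s) * τ P) (P : Fin 2 → A) :
    τ P = 0 := by
  have hr : ∀ p q u, τ (vecEmb p q u) = p * τ (vecEmb 1 0 u) + q * τ (vecEmb 0 1 u) := by
    intro p q u
    rw [vecEmb_eq p q u, map_add, map_smul, map_smul, smul_eq_mul, smul_eq_mul]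
  have key := vector_functional_eq_zero hy hrad hhad he (D := 2 * δ - 1) (by intro h; apply hδ; linarith)
    (T := ![τ.comp (vecEmb 1 0), τ.comp (vecEmb 0 1)])
    (fun r s b u => by
      have := h r s b (vecEmb 1 0 u)
      rw [lieA₁_vecEmb r s b hy, map_add, hr _ _ (confRot r b y * u)] at this
      simp only [Matrix.cons_val_zero, Matrix.cons_val_one, LinearMap.comp_apply]
      linear_combination this)
    (fun r s b u => by
      have := h r s b (vecEmb 0 1 u)
      rw [lieA₁_vecEmb r s b hy, map_add, hr _ _ (confRot r b y * u)] at this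
      simp only [Matrix.cons_val_zero, Matrix.cons_val_one, LinearMap.comp_apply]
      linear_combination this)
  rw [eq_vecEmb P, map_add]
  have k0 := key 0 (P 0)
  have k1 := key 1 (P 1)
  simp only [Matrix.cons_val_zero, Matrix.cons_val_one, LinearMap.comp_apply] at k0 k1
  rw [k0, k1, add_zero]

/-- An invariant vector-valued functional of order one on symbols of degree two vanishes. -/
theorem invariant_vector_functional₂_eq_zero (hδ : δ ≠ 1) (hδ' : δ ≠ 2)
    {τ : Fin 2 → (Fin 2 → Fin 2 → A) →ₗ[ℝ] ℝ}
    (h : ∀ i r s b P, (∀ i j, P i j = P j i) → τ i (lieA₂ d δ (confPoly e 0 r s b y) P)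
      = δ * (2 * s) * τ i P - (s * τ i P + r * ![-e 1 * τ 1 P, e 0 * τ 0 P] i))
    (i : Fin 2) {P : Fin 2 → Fin 2 → A} (hP : ∀ i j, P i j = P j i) : τ i P = 0 := by
  have h0 : e 0 * e 0 = 1 := by rcases he 0 with h | h <;> simp [h]
  have h1 : e 1 * e 1 = 1 := by rcases he 1 with h | h <;> simp [h]
  have hr : ∀ i p q r u, τ i (symEmb p q r u) = (p * e 0 + r * e 1) / 2 * τ i (symEmb (e 0) 0 (e 1) u)
      + (p * e 0 - r * e 1) / 2 * τ i (symEmb (e 0) 0 (-e 1) u) + q * τ i (symEmb 0 1 0 u) := by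
    intro i p q r u
    rw [symEmb_eq he p q r u]
    simp only [map_add, map_smul, smul_eq_mul]
  have hS := trace_functional_one_eq_zero hy hrad hhad he (D := 2 * δ - 2)
    (by intro h; apply hδ; linarith) (S := fun i => (τ i).comp (symEmb (e 0) 0 (e 1)))
    (fun i s b u => by
      have := h i 0 s b (symEmb (e 0) 0 (e 1) u) (symEmb_symm _ _ _ u)
      rw [lieA₂_symEmb 0 s b hy, map_add, hr _ _ _ _ (confRot 0 b y * u)] at this
      simp only [LinearMap.comp_apply]
      linear_combination this + (h0 - h1) * τ i (symEmb 0 1 0 (confRot 0 b y * u)))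
  have hZT := traceless_functional_one_eq_zero hy hrad hhad he (D := 2 * δ - 2)
    (by intro h; apply hδ'; linarith) (Z := fun i => (τ i).comp (symEmb (e 0) 0 (-e 1)))
    (T := fun i => (τ i).comp (symEmb 0 1 0))
    (fun i r s b u => by
      have := h i r s b (symEmb (e 0) 0 (-e 1) u) (symEmb_symm _ _ _ u)
      rw [lieA₂_symEmb r s b hy, map_add, hr _ _ _ _ (confRot r b y * u)] at this
      simp only [LinearMap.comp_apply]
      linear_combination this + (h0 + h1) * τ i (symEmb 0 1 0 (confRot r b y * u)))
    (fun i r s b u => by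
      have := h i r s b (symEmb 0 1 0 u) (symEmb_symm _ _ _ u)
      rw [lieA₂_symEmb r s b hy, map_add, hr _ _ _ _ (confRot r b y * u)] at this
      simp only [LinearMap.comp_apply]
      linear_combination this)
  simp only [LinearMap.comp_apply] at hS hZT
  rw [eq_symEmb_of_symm hP, map_add, map_add, hr, hr i 0 1 0, hr i 0 0 1]
  simp only [hS, (hZT _ _).1, (hZT _ _).2, mul_zero, add_zero]

/-- An invariant functional on symbols of degree two vanishes. -/
theorem invariant_functional₂_eq_zero (hδ : δ ≠ 1) (hδ' : δ ≠ 3 / 2)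
    {τ : (Fin 2 → Fin 2 → A) →ₗ[ℝ] ℝ}
    (h : ∀ r s b P, (∀ i j, P i j = P j i) → τ (lieA₂ d δ (confPoly e 0 r s b y) P)
      = δ * (2 * s) * τ P) {P : Fin 2 → Fin 2 → A} (hP : ∀ i j, P i j = P j i) : τ P = 0 := by
  have h0 : e 0 * e 0 = 1 := by rcases he 0 with h | h <;> simp [h]
  have h1 : e 1 * e 1 = 1 := by rcases he 1 with h | h <;> simp [h]
  have hr : ∀ p q r u, τ (symEmb p q r u) = (p * e 0 + r * e 1) / 2 * τ (symEmb (e 0) 0 (e 1) u)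
      + (p * e 0 - r * e 1) / 2 * τ (symEmb (e 0) 0 (-e 1) u) + q * τ (symEmb 0 1 0 u) := by
    intro p q r u
    rw [symEmb_eq he p q r u]
    simp only [map_add, map_smul, smul_eq_mul]
  have hS := trace_functional_two_eq_zero hy hrad hhad he (D := 2 * δ - 2)
    (by intro h; apply hδ; linarith) (S := τ.comp (symEmb (e 0) 0 (e 1)))
    (fun r s b u => by
      have := h r s b (symEmb (e 0) 0 (e 1) u) (symEmb_symm _ _ _ u)
      rw [lieA₂_symEmb r s b hy, map_add, hr _ _ _ (confRot r b y * u)] at this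
      simp only [LinearMap.comp_apply]
      linear_combination this + (h0 - h1) * τ (symEmb 0 1 0 (confRot r b y * u)))
  have hZT := traceless_functional_two_eq_zero hy hrad hhad he (D := 2 * δ - 2)
    (by intro h; apply hδ'; linarith) (Z := τ.comp (symEmb (e 0) 0 (-e 1)))
    (T := τ.comp (symEmb 0 1 0))
    (fun r s b u => by
      have := h r s b (symEmb (e 0) 0 (-e 1) u) (symEmb_symm _ _ _ u)
      rw [lieA₂_symEmb r s b hy, map_add, hr _ _ _ (confRot r b y * u)] at this
      simp only [LinearMap.comp_apply]
      linear_combination this + (h0 + h1) * τ (symEmb 0 1 0 (confRot r b y * u)))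
    (fun r s b u => by
      have := h r s b (symEmb 0 1 0 u) (symEmb_symm _ _ _ u)
      rw [lieA₂_symEmb r s b hy, map_add, hr _ _ _ (confRot r b y * u)] at this
      simp only [LinearMap.comp_apply]
      linear_combination this)
  simp only [LinearMap.comp_apply] at hS hZT
  rw [eq_symEmb_of_symm hP, map_add, map_add, hr, hr 0 1 0, hr 0 0 1]
  simp only [hS, (hZT _).1, (hZT _).2, mul_zero, add_zero]

end Directions


/-! ### Uniqueness -/

lemma lie₀_congr {V : Set Plane} (hV : IsOpen V) {f g : Plane → ℝ} (h : ∀ y ∈ V, f y = g y)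
    {x : Plane} (hx : x ∈ V) (w : ℝ) (X : Plane → Fin 2 → ℝ) : lie₀ w X f x = lie₀ w X g x := by
  simp only [lie₀, pd_congr_on hV h hx, h x hx]

lemma lie₁_congr {V : Set Plane} (hV : IsOpen V) {P Q : Plane → Fin 2 → ℝ}
    (h : ∀ y ∈ V, ∀ i, P y i = Q y i) {x : Plane} (hx : x ∈ V) (w : ℝ) (X : Plane → Fin 2 → ℝ)
    (i : Fin 2) : lie₁ w X P x i = lie₁ w X Q x i := by
  simp only [lie₁, pd_congr_on hV (fun y hy => h y hy i) hx, h x hx]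

lemma lie₂_congr {V : Set Plane} (hV : IsOpen V) {P Q : Plane → Matrix (Fin 2) (Fin 2) ℝ}
    (h : ∀ y ∈ V, ∀ i j, P y i j = Q y i j) {x : Plane} (hx : x ∈ V) (w : ℝ)
    (X : Plane → Fin 2 → ℝ) (i j : Fin 2) : lie₂ w X P x i j = lie₂ w X Q x i j := by
  simp only [lie₂, pd_congr_on hV (fun y hy => h y hy i j) hx, h x hx]

/-- Recentring a conformal field at x₀ only changes its lower parameters, so the isotropy algebra at
x₀ looks like that at the origin. -/
lemma confPoly_sub_mem (ε : Fin 2 → ℝ) (r s : ℝ) (b : Fin 2 → ℝ) (x₀ : Plane) :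
    (fun x : Plane => confPoly ε 0 r s b fun k => x k - x₀ k) ∈ confAlg ε := by
  have h : (fun x : Plane => confPoly ε 0 r s b fun k => x k - x₀ k)
      = fun x : Plane => confPoly ε (fun k => confPoly ε 0 r s b (fun k => -x₀ k) k)
        (r + 2 * (b 0 * x₀ 1 - b 1 * x₀ 0)) (s + 2 * ∑ i, b i * ε i * x₀ i) b x := by
    funext x k
    fin_cases k <;> simp [confPoly, Fin.sum_univ_two] <;> ring
  rw [h]
  exact confPoly_mem _ _ _ _ _

section Uniqueness

variable {M : Type*} [TopologicalSpace M] [ChartedSpace Plane M]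

lemma HasExpr.sub {l m : ℝ} {A B C : Density M l →ₗ[ℝ] Density M m} {e : Chart M}
    {a₂ b₂ : Plane → Matrix (Fin 2) (Fin 2) ℝ} {a₁ b₁ : Plane → Fin 2 → ℝ} {a₀ b₀ : Plane → ℝ}
    (hA : HasExpr A e a₂ a₁ a₀) (hB : HasExpr B e b₂ b₁ b₀)
    (hC : ∀ f x, (C f).1 e x = (A f).1 e x - (B f).1 e x) :
    HasExpr C e (a₂ - b₂) (a₁ - b₁) (a₀ - b₀) := by
  obtain ⟨h₂, h₁, h₀, hs, h⟩ := hA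
  obtain ⟨k₂, k₁, k₀, ks, k⟩ := hB
  refine ⟨fun i j => (h₂ i j).sub (k₂ i j), fun i => (h₁ i).sub (k₁ i), h₀.sub k₀,
    fun x hx i j => ?_, fun f x hx => ?_⟩
  · simp [hs x hx i j, ks x hx i j]
  · rw [hC, h f x hx, k f x hx]
    simp only [Pi.sub_apply, Matrix.sub_apply, sub_mul, Finset.sum_sub_distrib]
    ring

/-- The difference of two linear maps from symbols to differential operators. -/
def opSub {l m w : ℝ} (Q Q' : Symbol M w →ₗ[ℝ] DiffOp₂ M l m) : Symbol M w →ₗ[ℝ] DiffOp₂ M l m :=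
  Q + (-1 : ℝ) • Q'

lemma opSub_apply {l m w : ℝ} (Q Q' : Symbol M w →ₗ[ℝ] DiffOp₂ M l m) (P : Symbol M w)
    (f : Density M l) (e : Chart M) (x : Plane) :
    ((opSub Q Q' P).1 f).1 e x = ((Q P).1 f).1 e x - ((Q' P).1 f).1 e x := by
  have : ((opSub Q Q' P).1 f).1 e x = ((Q P).1 f).1 e x + (-1) * ((Q' P).1 f).1 e x := rfl
  rw [this]; ring

/-- The principal symbols of `D(P)` vanish, at each order. -/
def LowersOrder {l m w : ℝ} (D : Symbol M w →ₗ[ℝ] DiffOp₂ M l m) (e : Chart M) : Prop :=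
  ∀ P : Symbol M w, (∃ a₁ a₀, HasExpr (D P).1 e 0 a₁ a₀) ∧
    (P.1 = 0 → ∃ a₀, HasExpr (D P).1 e 0 0 a₀) ∧
    (P.1 = 0 → P.2.1 = 0 → HasExpr (D P).1 e 0 0 0)

lemma PreservesSymbol.lowersOrder {l m w : ℝ} {Q Q' : Symbol M w →ₗ[ℝ] DiffOp₂ M l m}
    (hQ : PreservesSymbol Q) (hQ' : PreservesSymbol Q') (e : Chart M) :
    LowersOrder (opSub Q Q') e := by
  intro P
  obtain ⟨⟨a₁, a₀, h⟩, h1, h0⟩ := hQ P e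
  obtain ⟨⟨b₁, b₀, k⟩, k1, k0⟩ := hQ' P e
  have hC := fun f x => opSub_apply Q Q' P f e x
  refine ⟨⟨a₁ - b₁, a₀ - b₀, ?_⟩, fun hP => ?_, fun hP hP' => ?_⟩
  · have := h.sub k hC
    rwa [sub_self] at this
  · obtain ⟨a₀, h⟩ := h1 hP
    obtain ⟨b₀, k⟩ := k1 hP
    have := h.sub k hC
    rw [sub_self, sub_self] at this
    exact ⟨_, this⟩
  · have := (h0 hP hP').sub (k0 hP hP') hC
    rwa [sub_self, sub_self, sub_self] at this

lemma EquivariantOn.opSub {ε : Fin 2 → ℝ} {l m w : ℝ} {Q Q' : Symbol M w →ₗ[ℝ] DiffOp₂ M l m}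
    {c : Chart M} {V : Set Plane} (hVc : V ⊆ c.1.target) (hQ : EquivariantOn ε Q c V)
    (hQ' : EquivariantOn ε Q' c V) : EquivariantOn ε (opSub Q Q') c V := by
  intro X hX P P' f f' h₂ h₁ h₀ h x hx
  have hs := fun Q : Symbol M w →ₗ[ℝ] DiffOp₂ M l m =>
    differentiableAt_of_contDiffOn c.1.open_target (((Q P).1 f).2.1 c) (hVc hx)
  have hp : ∀ k, pd k (((ConfQuant.opSub Q Q' P).1 f).1 c) x
      = pd k (((Q P).1 f).1 c) x - pd k (((Q' P).1 f).1 c) x := fun k => by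
    rw [funext (opSub_apply Q Q' P f c)]
    simp only [pd]
    rw [fderiv_fun_sub (hs Q) (hs Q')]
    rfl
  have hl : lie₀ m X (((ConfQuant.opSub Q Q' P).1 f).1 c) x
      = lie₀ m X (((Q P).1 f).1 c) x - lie₀ m X (((Q' P).1 f).1 c) x := by
    simp only [lie₀, hp, opSub_apply, mul_sub, Finset.sum_sub_distrib]
    ring
  rw [hl, opSub_apply, opSub_apply, hQ X hX P P' f f' h₂ h₁ h₀ h x hx,
    hQ' X hX P P' f f' h₂ h₁ h₀ h x hx]
  ring

/-! ### Vanishing at a point of equivariant maps that lower the order -/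

section Local

variable {ε : Fin 2 → ℝ} {l m : ℝ} {D : Symbol M (m - l) →ₗ[ℝ] DiffOp₂ M l m}
  {c : Chart M} {V W : TopologicalSpace.Opens Plane} (C : Cutoff c V W)

/-- Equivariant maps are local. -/
lemma EquivariantOn.eq_zero_of_eq_zero (hD : EquivariantOn ε D c V) {P : Symbol M (m - l)}
    (h₂ : ∀ x ∈ V, ∀ i j, P.1.1 c x i j = 0) (h₁ : ∀ x ∈ V, ∀ i, P.2.1.1 c x i = 0)
    (h₀ : ∀ x ∈ V, P.2.2.1 c x = 0) (f : Density M l) {x : Plane} (hx : x ∈ V) :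
    ((D P).1 f).1 c x = 0 := by
  have hp : ∀ k, pd k (fun _ : Plane => (0 : ℝ)) = 0 := fun k => funext fun x => pd_const k 0 x
  -- Equivariance for the field 0 and the symbol 0: as P vanishes on V, it is admissible there as
  -- the Lie derivative of 0, although nothing is known about it elsewhere.
  have key := hD 0 (zero_mem _) 0 P f 0 (fun x hx i j => by simp [h₂ x hx i j, lie₂, divergence])
    (fun x hx i => by simp [h₁ x hx i, lie₁, divergence])
    (fun x hx => by simp [h₀ x hx, lie₀, divergence])
    (fun x hx => by
      have : (0 : Density M l).1 c x = 0 := rfl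
      simp [this, lie₀, divergence, hp]) x hx
  rw [key, map_zero]
  simp [lie₀, divergence, hp]

variable {X : Plane → Fin 2 → ℝ} {X' : Fin 2 → Sf W} (hX : ∀ k, ∀ y : W, X y k = Sf.ev y (X' k))

lemma Cutoff.dens_eq_rep (w : ℝ) (u : Sf W) {x : Plane} (hx : x ∈ V) :
    (C.dens w u).1 c x = Sf.rep u x := by
  rw [C.dens_apply w u ⟨x, hx⟩, Sf.ev_rep]

lemma Cutoff.pd_dens (w : ℝ) (u : Sf W) (i : Fin 2) (x : V) :
    pd i ((C.dens w u).1 c) x = Sf.ev ⟨x, C.le x.2⟩ (Sf.d i u) := by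
  rw [pd_congr_on V.2 (fun y hy => C.dens_eq_rep w u hy) x.2]
  exact Sf.ev_d i (Sf.rep u) u (fun y => (Sf.ev_rep u y).symm) ⟨x, C.le x.2⟩

include hX

/-- On V the cut-off is invisible. Hence the cut-off of a Lie derivative is a global field that
equals the Lie derivative over V, as the definition of equivariance demands. -/
lemma Cutoff.dens_lie (w : ℝ) (u : Sf W) {x : Plane} (hx : x ∈ V) :
    (C.dens w (lieA₀ Sf.d w X' u)).1 c x = lie₀ w X ((C.dens w u).1 c) x := by
  rw [lie₀_congr V.2 (fun y hy => C.dens_eq_rep w u hy) hx, C.dens_apply w _ ⟨x, hx⟩]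
  exact (lie₀_ev hX (fun y => (Sf.ev_rep u y).symm) w ⟨x, C.le hx⟩).symm

lemma Cutoff.sym₁_lie (w : ℝ) (u : Fin 2 → Sf W) {x : Plane} (hx : x ∈ V) (i : Fin 2) :
    (C.sym₁ w (lieA₁ Sf.d w X' u)).1 c x i = lie₁ w X ((C.sym₁ w u).1 c) x i := by
  rw [lie₁_congr V.2 (Q := fun y i => Sf.rep (u i) y)
    (fun y hy i => by rw [C.sym₁_apply w u ⟨y, hy⟩, Sf.ev_rep]) hx, C.sym₁_apply w _ ⟨x, hx⟩]
  exact (lie₁_ev hX (P' := u) (fun i y => (Sf.ev_rep (u i) y).symm) w i ⟨x, C.le hx⟩).symm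

lemma Cutoff.sym₂_lie (w : ℝ) (u : Fin 2 → Fin 2 → Sf W) (hu : ∀ i j, u i j = u j i) {x : Plane}
    (hx : x ∈ V) (i j : Fin 2) :
    (C.sym₂ w (lieA₂ Sf.d w X' u)).1 c x i j = lie₂ w X ((C.sym₂ w u).1 c) x i j := by
  rw [lie₂_congr V.2 (Q := fun y i j => Sf.rep (u i j) y)
    (fun y hy i j => by rw [C.sym₂_apply w u hu ⟨y, hy⟩, Sf.ev_rep]) hx, C.sym₂_apply w _ ?_ ⟨x, hx⟩]
  · exact (lie₂_ev hX (P' := u) (fun i j y => (Sf.ev_rep (u i j) y).symm) w i j ⟨x, C.le hx⟩).symm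
  · refine Fin.forall_fin_two.2 ⟨Fin.forall_fin_two.2 ⟨rfl, ?_⟩, Fin.forall_fin_two.2 ⟨?_, rfl⟩⟩ <;>
      (simp only [lieA₂, Fin.sum_univ_two, hu 1 0]; ring)

omit hX

/-- The value of an operator at a point, on a fixed density. -/
def valAt (c : Chart M) (x : Plane) (f : Density M l) : DiffOp₂ M l m →ₗ[ℝ] ℝ where
  toFun A := (A.1 f).1 c x
  map_add' _ _ := rfl
  map_smul' _ _ := rfl

variable {x₀ : Plane} (hx₀ : x₀ ∈ V)

/-- The centred fields vanish at x₀, so only their divergence 2s acts there. -/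
lemma ev_lieA₀_coord (r s : ℝ) (b : Fin 2 → ℝ) (w : ℝ) (q : W) (hq : (q : Plane) = x₀) (u : Sf W) :
    Sf.ev q (lieA₀ Sf.d w (confPoly ε 0 r s b (cenA W x₀)) u) = w * (2 * s) * Sf.ev q u := by
  have hy : ∀ k, Sf.ev q (cenA W x₀ k) = 0 := fun k => by rw [ev_cenA, hq, sub_self]
  simp only [lieA₀, Fin.sum_univ_two, derivation_confPoly_zero, derivation_confPoly_one, d_cenA,
    map_add, map_mul, ev_confPoly, Sf.ev_algebraMap]
  have hX : ∀ k, confPoly ε 0 r s b (fun j => Sf.ev q (cenA W x₀ j)) k = 0 := fun k => by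
    fin_cases k <;> simp [confPoly, hy]
  have hc : Sf.ev q (confDil ε s b (cenA W x₀)) = s := by simp [confDil, hy]
  simp only [hX, hc, if_true, zero_ne_one, one_ne_zero, if_false, map_zero, map_one, map_sub, map_mul,
    Sf.ev_algebraMap]
  ring

/-- The action on first derivatives at x₀ of the coordinate functions: the density weight together
with the linear part of the field. It makes first-order coefficients an invariant vector rather than
invariant scalars. -/
lemma ev_d_lieA₀_coord (r s : ℝ) (b : Fin 2 → ℝ) (w : ℝ) (q : W) (hq : (q : Plane) = x₀)
    (i k : Fin 2) :
    Sf.ev q (Sf.d i (lieA₀ Sf.d w (confPoly ε 0 r s b (cenA W x₀)) (cenA W x₀ k)))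
      = (if i = k then w * (2 * s) + s else 0) + r * ![![0, ε 0] k, ![-ε 1, 0] k] i := by
  have hy : ∀ k, Sf.ev q (cenA W x₀ k) = 0 := fun k => by rw [ev_cenA, hq, sub_self]
  have h2 : ∀ i : Fin 2, i = 0 ∨ i = 1 := by decide
  rcases h2 i with rfl | rfl <;> rcases h2 k with rfl | rfl <;>
  · simp [lieA₀, Fin.sum_univ_two, derivation_confPoly_zero, derivation_confPoly_one, d_cenA, confDil,
      confRot, derivation_two, hy]
    try ring_nf

/-- F may be any function, since its derivatives are multiplied by the vanishing value of the field.
-/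
lemma lie₀_center (r s : ℝ) (b : Fin 2 → ℝ) (w : ℝ) (F : Plane → ℝ) :
    lie₀ w (fun z => confPoly ε 0 r s b fun k => z k - x₀ k) F x₀ = w * (2 * s) * F x₀ := by
  have hX : ∀ k, ∀ y : (⊤ : TopologicalSpace.Opens Plane),
      confPoly ε 0 r s b (fun k => (y : Plane) k - x₀ k) k
        = Sf.ev y (confPoly ε 0 r s b (cenA ⊤ x₀) k) := fun k y => by
    rw [ev_confPoly]; simp only [ev_cenA]
  have hq : Sf.ev ⟨x₀, TopologicalSpace.Opens.mem_top x₀⟩ (∑ k, Sf.d k (confPoly ε 0 r s b (cenA ⊤ x₀) k)) = 2 * s := by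
    have := ev_lieA₀_coord (ε := ε) (W := ⊤) r s b 1 ⟨x₀, TopologicalSpace.Opens.mem_top x₀⟩ rfl 1
    simpa [lieA₀] using this
  have hdiv := divergence_ev (X := fun z => confPoly ε 0 r s b fun k => z k - x₀ k) hX
    ⟨x₀, TopologicalSpace.Opens.mem_top x₀⟩
  rw [hq] at hdiv
  simp only [lie₀]
  rw [hdiv]
  simp [confPoly]

lemma HasExpr.apply_dens {A : Density M l →ₗ[ℝ] Density M m} {a₁ : Plane → Fin 2 → ℝ}
    {a₀ : Plane → ℝ} (hA : HasExpr A c 0 a₁ a₀) (u : Sf W) :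
    (A (C.dens l u)).1 c x₀ = ∑ i, a₁ x₀ i * Sf.ev ⟨x₀, C.le hx₀⟩ (Sf.d i u)
      + a₀ x₀ * Sf.ev ⟨x₀, C.le hx₀⟩ u := by
  rw [hA.2.2.2.2 _ _ (C.le_target (C.le hx₀))]
  simp only [C.pd_dens l u _ ⟨x₀, hx₀⟩, C.dens_apply l u ⟨x₀, hx₀⟩, Pi.zero_apply, Matrix.zero_apply,
    zero_mul, Finset.sum_const_zero, zero_add]

include hx₀ in
-- Cut-off coordinates centred at x₀ serve as test densities that isolate one coefficient; this
-- expresses the coefficients as linear functionals of the operator.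
lemma HasExpr.coeff₁ {A : Density M l →ₗ[ℝ] Density M m} {a₁ : Plane → Fin 2 → ℝ}
    {a₀ : Plane → ℝ} (hA : HasExpr A c 0 a₁ a₀) (k : Fin 2) :
    (A (C.dens l (cenA W x₀ k))).1 c x₀ = a₁ x₀ k := by
  rw [hA.apply_dens C hx₀]
  simp only [d_cenA, ev_cenA, sub_self, mul_zero, add_zero]
  fin_cases k <;> simp

include hx₀ in
lemma HasExpr.coeff₀ {A : Density M l →ₗ[ℝ] Density M m} {a₁ : Plane → Fin 2 → ℝ}
    {a₀ : Plane → ℝ} (hA : HasExpr A c 0 a₁ a₀) : (A (C.dens l 1)).1 c x₀ = a₀ x₀ := by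
  rw [hA.apply_dens C hx₀]
  simp

variable (hD : EquivariantOn ε D c V)

lemma centered_field (r s : ℝ) (b : Fin 2 → ℝ) (k : Fin 2) (y : W) :
    confPoly ε 0 r s b (fun k => (y : Plane) k - x₀ k) k
      = Sf.ev y (confPoly ε 0 r s b (cenA W x₀) k) := by
  rw [ev_confPoly]; simp only [ev_cenA]

include hx₀ hD

/-- At the fixed point x₀ the Lie derivative of the result is a scalar multiple of it, so
equivariance becomes a relation for functionals of the components P alone. -/
lemma equivariance_sym₁ (r s : ℝ) (b : Fin 2 → ℝ) (P : Fin 2 → Sf W) (u : Sf W) :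
    ((D (0, C.sym₁ _ (lieA₁ Sf.d (m - l) (confPoly ε 0 r s b (cenA W x₀)) P), 0)).1
        (C.dens l u)).1 c x₀
      = m * (2 * s) * ((D (0, C.sym₁ _ P, 0)).1 (C.dens l u)).1 c x₀
        - ((D (0, C.sym₁ _ P, 0)).1
          (C.dens l (lieA₀ Sf.d l (confPoly ε 0 r s b (cenA W x₀)) u))).1 c x₀ := by
  have hp : ∀ k, pd k (fun _ : Plane => (0 : ℝ)) = 0 := fun k => funext fun x => pd_const k 0 x
  have hp' : ∀ k, pd k (0 : Plane → ℝ) = 0 := hp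
  have hX := centered_field (ε := ε) (W := W) (x₀ := x₀) r s b
  rw [hD _ (confPoly_sub_mem ε r s b x₀) (0, C.sym₁ _ P, 0) _ (C.dens l u) _
    (fun x hx i j => by simp [lie₂, hp]) (fun x hx i => C.sym₁_lie hX (m - l) P hx i)
    (fun x hx => by simp [lie₀, hp']) (fun x hx => C.dens_lie hX l u hx) x₀ hx₀, lie₀_center]

lemma equivariance_sym₂ (r s : ℝ) (b : Fin 2 → ℝ) (P : Fin 2 → Fin 2 → Sf W)
    (hP : ∀ i j, P i j = P j i) (u : Sf W) :
    ((D (C.sym₂ _ (lieA₂ Sf.d (m - l) (confPoly ε 0 r s b (cenA W x₀)) P), 0, 0)).1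
        (C.dens l u)).1 c x₀
      = m * (2 * s) * ((D (C.sym₂ _ P, 0, 0)).1 (C.dens l u)).1 c x₀
        - ((D (C.sym₂ _ P, 0, 0)).1
          (C.dens l (lieA₀ Sf.d l (confPoly ε 0 r s b (cenA W x₀)) u))).1 c x₀ := by
  have hp : ∀ k, pd k (fun _ : Plane => (0 : ℝ)) = 0 := fun k => funext fun x => pd_const k 0 x
  have hp' : ∀ k, pd k (0 : Plane → ℝ) = 0 := hp
  have hX := centered_field (ε := ε) (W := W) (x₀ := x₀) r s b
  rw [hD _ (confPoly_sub_mem ε r s b x₀) (C.sym₂ _ P, 0, 0) _ (C.dens l u) _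
    (fun x hx i j => C.sym₂_lie hX (m - l) P hP hx i j) (fun x hx i => by simp [lie₁, hp])
    (fun x hx => by simp [lie₀, hp']) (fun x hx => C.dens_lie hX l u hx) x₀ hx₀, lie₀_center]

variable (hε : ∀ i, ε i = 1 ∨ ε i = -1) (hs : StarConvex ℝ x₀ (W : Set Plane)) (hL : LowersOrder D c)

include hε hs hL

/-- On symbols of degree one D has values of order zero, and the coefficient at x₀ is an invariant
functional of weight m-l = δ. -/
lemma apply_sym₁_eq_zero (h1 : m - l ≠ 1) (P : Fin 2 → Sf W) (f : Density M l) :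
    ((D (0, C.sym₁ _ P, 0)).1 f).1 c x₀ = 0 := by
  have hO : ∀ P, ∃ a₀, HasExpr (D (0, C.sym₁ _ P, 0)).1 c 0 0 a₀ := fun P => (hL _).2.1 rfl
  have key := invariant_functional₁_eq_zero (d_cenA (W := W) (x₀ := x₀)) (exists_radial hs)
    (exists_hadamard hs) hε h1 (τ := (valAt c x₀ (C.dens l 1)).comp (D.comp
      ((LinearMap.inr ℝ _ _).comp ((LinearMap.inl ℝ _ _).comp (C.sym₁ (m - l))))))
    (fun r s b P => by
      have h := equivariance_sym₁ C hx₀ hD r s b P 1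
      obtain ⟨a₀, ha⟩ := hO P
      rw [ha.apply_dens C hx₀ (lieA₀ _ _ _ _), ev_lieA₀_coord r s b l _ rfl, ← ha.coeff₀ C hx₀,
        map_one (Sf.ev _)] at h
      simp only [Pi.zero_apply, zero_mul, Finset.sum_const_zero, zero_add] at h
      change _ = (m - l) * (2 * s) * ((D (0, C.sym₁ _ P, 0)).1 (C.dens l 1)).1 c x₀
      refine Eq.trans h ?_
      ring) P
  obtain ⟨a₀, ha⟩ := hO P
  have h0 : a₀ x₀ = 0 := (ha.coeff₀ C hx₀).symm.trans key
  rw [ha.2.2.2.2 _ _ (C.le_target (C.le hx₀)), h0]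
  simp

/-- The coefficients of order one form an invariant vector-valued functional and vanish first. The
coefficient of order zero becomes invariant only afterwards, because inversions change the constant
1 into a density with nonzero gradient at x₀. -/
lemma apply_sym₂_eq_zero (h1 : m - l ≠ 1) (h2 : m - l ≠ 3 / 2) (h3 : m - l ≠ 2)
    (P : Fin 2 → Fin 2 → Sf W) (hP : ∀ i j, P i j = P j i) (f : Density M l) :
    ((D (C.sym₂ _ P, 0, 0)).1 f).1 c x₀ = 0 := by
  have hO : ∀ P, ∃ a₁ a₀, HasExpr (D (C.sym₂ _ P, 0, 0)).1 c 0 a₁ a₀ := fun P => (hL _).1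
  have key₁ := fun k (P : Fin 2 → Fin 2 → Sf W) (hP : ∀ i j, P i j = P j i) => invariant_vector_functional₂_eq_zero (d_cenA (W := W) (x₀ := x₀))
    (exists_radial hs) (exists_hadamard hs) hε h1 h3
    (τ := fun k => (valAt c x₀ (C.dens l (cenA W x₀ k))).comp (D.comp
      ((LinearMap.inl ℝ _ _).comp (C.sym₂ (m - l)))))
    (fun k r s b P hP => by
      have h := equivariance_sym₂ C hx₀ hD r s b P hP (cenA W x₀ k)
      obtain ⟨a₁, a₀, ha⟩ := hO P
      rw [ha.apply_dens C hx₀ (lieA₀ _ _ _ _), ev_lieA₀_coord r s b l _ rfl, ev_cenA, sub_self] at h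
      simp only [ev_d_lieA₀_coord r s b l _ rfl, ← ha.coeff₁ C hx₀, Fin.sum_univ_two] at h
      refine Eq.trans h ?_
      change _ = (m - l) * (2 * s) * ((D (C.sym₂ _ P, 0, 0)).1 (C.dens l (cenA W x₀ k))).1 c x₀
        - (s * ((D (C.sym₂ _ P, 0, 0)).1 (C.dens l (cenA W x₀ k))).1 c x₀
          + r * ![-ε 1 * ((D (C.sym₂ _ P, 0, 0)).1 (C.dens l (cenA W x₀ 1))).1 c x₀,
            ε 0 * ((D (C.sym₂ _ P, 0, 0)).1 (C.dens l (cenA W x₀ 0))).1 c x₀] k)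
      have hk : ∀ k : Fin 2, k = 0 ∨ k = 1 := by decide
      rcases hk k with rfl | rfl <;> simp <;> ring) k hP
  have h₁ : ∀ (P : Fin 2 → Fin 2 → Sf W), (∀ i j, P i j = P j i) → ∀ a₁ a₀,
      HasExpr (D (C.sym₂ _ P, 0, 0)).1 c 0 a₁ a₀ → ∀ k, a₁ x₀ k = 0 := fun P hP a₁ a₀ ha k =>
    (ha.coeff₁ C hx₀ k).symm.trans (key₁ k P hP)
  have key := invariant_functional₂_eq_zero (d_cenA (W := W) (x₀ := x₀))
    (exists_radial hs) (exists_hadamard hs) hε h1 h2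
    (τ := (valAt c x₀ (C.dens l 1)).comp (D.comp ((LinearMap.inl ℝ _ _).comp (C.sym₂ (m - l)))))
    (fun r s b P hP => by
      have h := equivariance_sym₂ C hx₀ hD r s b P hP 1
      obtain ⟨a₁, a₀, ha⟩ := hO P
      rw [ha.apply_dens C hx₀ (lieA₀ _ _ _ _), ev_lieA₀_coord r s b l _ rfl, ← ha.coeff₀ C hx₀,
        map_one (Sf.ev _)] at h
      simp only [h₁ P hP a₁ a₀ ha, zero_mul, Finset.sum_const_zero, zero_add] at h
      refine Eq.trans h ?_
      change _ = (m - l) * (2 * s) * ((D (C.sym₂ _ P, 0, 0)).1 (C.dens l 1)).1 c x₀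
      ring) hP
  obtain ⟨a₁, a₀, ha⟩ := hO P
  have h0 : a₀ x₀ = 0 := (ha.coeff₀ C hx₀).symm.trans key
  rw [ha.2.2.2.2 _ _ (C.le_target (C.le hx₀)), h0]
  simp [h₁ P hP a₁ a₀ ha]

include C in
/-- An equivariant map that lowers the order vanishes at the point `x₀`. -/
theorem EquivariantOn.apply_eq_zero (h1 : m - l ≠ 1) (h2 : m - l ≠ 3 / 2) (h3 : m - l ≠ 2)
    (P : Symbol M (m - l)) (f : Density M l) : ((D P).1 f).1 c x₀ = 0 := by
  set P₂ := Symbol₂.lift P.1 c C.le_target with hP₂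
  set P₁ := Symbol₁.lift P.2.1 c C.le_target with hP₁
  set P₀ := Density.lift P.2.2 c C.le_target with hP₀
  have hs₂ : ∀ i j, P₂ i j = P₂ j i := fun i j => Symbol₂.lift_symm P.1 c C.le_target i j
  -- P agrees on V with the cut-off of its own components, so locality reduces the claim to cut-off
  -- symbols of each degree.
  have hloc := hD.eq_zero_of_eq_zero (P := P + (-1 : ℝ) • (C.sym₂ _ P₂, C.sym₁ _ P₁, C.dens _ P₀))
    (fun x hx i j => by
      change P.1.1 c x i j + (-1) * (C.sym₂ _ P₂).1 c x i j = 0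
      rw [C.sym₂_apply _ P₂ hs₂ ⟨x, hx⟩, hP₂, Symbol₂.ev_lift]
      ring)
    (fun x hx i => by
      change P.2.1.1 c x i + (-1) * (C.sym₁ _ P₁).1 c x i = 0
      rw [C.sym₁_apply _ P₁ ⟨x, hx⟩, hP₁, Symbol₁.ev_lift]
      ring)
    (fun x hx => by
      change P.2.2.1 c x + (-1) * (C.dens _ P₀).1 c x = 0
      rw [C.dens_apply _ P₀ ⟨x, hx⟩, hP₀, Density.ev_lift]
      ring) f hx₀
  have hsplit : P = (P + (-1 : ℝ) • (C.sym₂ _ P₂, C.sym₁ _ P₁, C.dens _ P₀))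
      + ((C.sym₂ _ P₂, 0, 0) + ((0, C.sym₁ _ P₁, 0) + (0, 0, C.dens _ P₀))) := by
    have h : ∀ Q : Symbol M (m - l), (-1 : ℝ) • Q + Q = 0 := fun Q => by
      have : (-1 : ℝ) • Q + (1 : ℝ) • Q = 0 := by rw [← add_smul]; norm_num
      rwa [one_smul] at this
    have h' : ((C.sym₂ _ P₂, 0, 0) + ((0, C.sym₁ _ P₁, 0) + (0, 0, C.dens _ P₀)) : Symbol M (m - l))
        = (C.sym₂ _ P₂, C.sym₁ _ P₁, C.dens _ P₀) := by simp
    rw [h', add_assoc, h, add_zero]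
  generalize P + (-1 : ℝ) • (C.sym₂ _ P₂, C.sym₁ _ P₁, C.dens _ P₀) = R at hloc hsplit
  have hval := congrArg (fun P => valAt c x₀ f (D P)) hsplit
  simp only [map_add] at hval
  have h₀ := ((hL (0, 0, C.dens _ P₀)).2.2 rfl rfl).2.2.2.2 f _ (C.le_target (C.le hx₀))
  have e₂ : valAt c x₀ f (D (C.sym₂ _ P₂, 0, 0)) = 0 :=
    apply_sym₂_eq_zero C hx₀ hD hε hs hL h1 h2 h3 P₂ hs₂ f
  have e₁ : valAt c x₀ f (D (0, C.sym₁ _ P₁, 0)) = 0 :=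
    apply_sym₁_eq_zero C hx₀ hD hε hs hL h1 P₁ f
  have e₀ : valAt c x₀ f (D (0, 0, C.dens _ P₀)) = 0 := h₀.trans (by simp)
  rw [e₂, e₁, e₀, add_zero, add_zero, add_zero] at hval
  exact hval.trans hloc

end Local

/-- A conformally equivariant map that preserves the principal symbol is unique. -/
theorem eq_of_equivariant [T2Space M] {ε : Fin 2 → ℝ} (hε : ∀ i, ε i = 1 ∨ ε i = -1)
    {𝒜 : Set (Chart M)} (h𝒜 : IsConfAtlas ε 𝒜) {l m : ℝ} (h1 : m - l ≠ 1) (h2 : m - l ≠ 3 / 2)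
    (h3 : m - l ≠ 2) {Q Q' : Symbol M (m - l) →ₗ[ℝ] DiffOp₂ M l m} (hQ : PreservesSymbol Q)
    (hQ' : PreservesSymbol Q') (hE : ConfEquivariant ε 𝒜 Q)
    (hE' : ConfEquivariant ε 𝒜 Q' ∨ ∃ c ∈ 𝒜, c.1.source = Set.univ ∧ Convex ℝ c.1.target ∧
      EquivariantOn ε Q' c c.1.target) : Q' = Q := by
  have hpt : ∀ p : M, ∃ c : Chart M, p ∈ c.1.source ∧ ∀ P f,
      ((opSub Q' Q P).1 f).1 c (c.1 p) = 0 := by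
    intro p
    rcases hE' with hE' | ⟨c, hc, hcu, hconv, hE'⟩
    · obtain ⟨c, hc, hp⟩ := h𝒜.1 p
      have hx := c.1.map_source hp
      obtain ⟨V, W, hV, hW, ⟨C⟩⟩ := exists_cutoff c hx
      have hVc : (V : Set Plane) ⊆ c.1.target := fun _ hy => C.le_target (C.le hy)
      exact ⟨c, hp, fun P f => EquivariantOn.apply_eq_zero C hV
        ((hE' c hc V hVc V.2).opSub hVc (hE c hc V hVc V.2)) hε (hW.starConvex (C.le hV))
        (hQ'.lowersOrder hQ c) h1 h2 h3 P f⟩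
    -- Equivariance over all of M does not restrict to small open sets. Here the cut-off is the
    -- constant 1 with V and W the whole convex target, which is star-shaped about each of its
    -- points.
    · have hp : p ∈ c.1.source := hcu ▸ Set.mem_univ p
      have hx := c.1.map_source hp
      exact ⟨c, hp, fun P f => EquivariantOn.apply_eq_zero (Cutoff.ofUniv hcu) (x₀ := c.1 p) hx
        (hE'.opSub subset_rfl (hE c hc _ subset_rfl c.1.open_target)) hε (hconv.starConvex hx)
        (hQ'.lowersOrder hQ c) h1 h2 h3 P f⟩
  refine LinearMap.ext fun P => Subtype.ext <| LinearMap.ext fun f => Density.ext_target fun e x hx => ?_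
  obtain ⟨c, hp, hc⟩ := hpt (e.1.symm x)
  have h := ((opSub Q' Q P).1 f).2.2.2 e c x (mem_overlap.2 ⟨hx, hp⟩)
  rw [transition, hc, mul_zero, opSub_apply] at h
  exact sub_eq_zero.1 h

end Uniqueness


/-! ### Maps that preserve the principal symbol are bijective -/

section Bijective

variable {M : Type*} [TopologicalSpace M] [ChartedSpace Plane M]

lemma Cutoff.pd_pd_dens {c : Chart M} {V W : TopologicalSpace.Opens Plane} (C : Cutoff c V W)
    (w : ℝ) (u : Sf W) (i j : Fin 2) (x : V) :
    pd i (pd j ((C.dens w u).1 c)) x = Sf.ev ⟨x, C.le x.2⟩ (Sf.d i (Sf.d j u)) := by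
  rw [pd_congr_on V.2 (v := Sf.rep (Sf.d j u)) (fun y hy => by
    rw [C.pd_dens w u j ⟨y, hy⟩, Sf.ev_rep]) x.2]
  exact Sf.ev_d i _ _ (fun y => (Sf.ev_rep (Sf.d j u) y).symm) ⟨x, C.le x.2⟩

/-- Test densities with prescribed two-jet at a point; for a = b the Hessian entry is 2, which
explains the factors 2 in their use. -/
lemma exists_density_hess [T2Space M] (w : ℝ) {e : Chart M} {x : Plane} (hx : x ∈ e.1.target)
    (a b : Fin 2) : ∃ f : Density M w, f.1 e x = 0 ∧ (∀ i, pd i (f.1 e) x = 0) ∧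
      ∀ i j, pd i (pd j (f.1 e)) x
        = (if i = a ∧ j = b then 1 else 0) + (if i = b ∧ j = a then 1 else 0) := by
  obtain ⟨V, W, hV, -, ⟨C⟩⟩ := exists_cutoff e hx
  refine ⟨C.dens w (cenA W x a * cenA W x b), ?_, fun i => ?_, fun i j => ?_⟩
  · rw [C.dens_apply w _ ⟨x, hV⟩, map_mul, ev_cenA]; simp
  · rw [C.pd_dens w _ i ⟨x, hV⟩]; simp [ev_cenA]
  · rw [C.pd_pd_dens w _ i j ⟨x, hV⟩]
    fin_cases a <;> fin_cases b <;> fin_cases i <;> fin_cases j <;> simp [d_cenA]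

lemma exists_density_grad [T2Space M] (w : ℝ) {e : Chart M} {x : Plane} (hx : x ∈ e.1.target)
    (a : Fin 2) : ∃ f : Density M w, f.1 e x = 0 ∧ (∀ i, pd i (f.1 e) x = if i = a then 1 else 0) ∧
      ∀ i j, pd i (pd j (f.1 e)) x = 0 := by
  obtain ⟨V, W, hV, -, ⟨C⟩⟩ := exists_cutoff e hx
  refine ⟨C.dens w (cenA W x a), ?_, fun i => ?_, fun i j => ?_⟩
  · rw [C.dens_apply w _ ⟨x, hV⟩, ev_cenA]; simp
  · rw [C.pd_dens w _ i ⟨x, hV⟩, d_cenA]; split_ifs <;> simp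
  · rw [C.pd_pd_dens w _ i j ⟨x, hV⟩, d_cenA]; split_ifs <;> simp

lemma exists_density_one [T2Space M] (w : ℝ) {e : Chart M} {x : Plane} (hx : x ∈ e.1.target) :
    ∃ f : Density M w, f.1 e x = 1 ∧ (∀ i, pd i (f.1 e) x = 0) ∧
      ∀ i j, pd i (pd j (f.1 e)) x = 0 := by
  obtain ⟨V, W, hV, -, ⟨C⟩⟩ := exists_cutoff e hx
  refine ⟨C.dens w 1, ?_, fun i => ?_, fun i j => ?_⟩
  · rw [C.dens_apply w _ ⟨x, hV⟩, map_one]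
  · rw [C.pd_dens w _ i ⟨x, hV⟩]; simp
  · rw [C.pd_pd_dens w _ i j ⟨x, hV⟩]; simp

/-! ### Change of coordinates in the derivatives of a density -/

section Derivatives

variable {w : ℝ} (f : Density M w) {e e' : Chart M} {x : Plane} (hx : x ∈ overlap e e')

lemma pd_eq_ev_lift (e e' : Chart M) (i : Fin 2) (y : overlapO e e') :
    pd i (f.1 e) y = Sf.ev y (Sf.d i (Density.lift f e (U := overlapO e e') (overlap_subset e e'))) :=
  Sf.ev_d i (f.1 e) _ (fun _ => rfl) y

lemma pd_pd_eq_ev_lift (e e' : Chart M) (i j : Fin 2) (y : overlapO e e') :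
    pd i (pd j (f.1 e)) y
      = Sf.ev y (Sf.d i (Sf.d j (Density.lift f e (U := overlapO e e') (overlap_subset e e')))) :=
  Sf.ev_d i (pd j (f.1 e)) _ (fun y => Sf.ev_d j (f.1 e) _ (fun _ => rfl) y) y

include hx

lemma density_transition : f.1 e x = densFactor w e e' x * f.1 e' (transition e e' x) :=
  f.2.2.2 e e' x hx

/-- At a zero of the density the derivative of the density factor drops out, so the first
nonvanishing derivative transforms as a tensor. -/
lemma pd_transition_of_eq_zero (h0 : f.1 e' (transition e e' x) = 0) (i : Fin 2) :
    pd i (f.1 e) x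
      = densFactor w e e' x * ∑ a, jac e e' x a i * pd a (f.1 e') (transition e e' x) := by
  have hd := fun a => pd_eq_ev_lift f e' e a
    ⟨transition e e' x, transition_mem_symm hx⟩
  rw [pd_eq_ev_lift f e e' i ⟨x, hx⟩, Density.lift_transform f]
  simp only [Derivation.leibniz, (frameChange e e').chain, smul_eq_mul, map_add, map_mul, map_sum,
    ev_pull, ev_jacA, Density.ev_lift, h0, zero_mul, add_zero, ← hd]
  rfl

lemma pd_pd_transition_of_eq_zero (h0 : f.1 e' (transition e e' x) = 0)
    (h1 : ∀ a, pd a (f.1 e') (transition e e' x) = 0) (i j : Fin 2) :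
    pd i (pd j (f.1 e)) x = densFactor w e e' x * ∑ a, ∑ b,
      jac e e' x a i * jac e e' x b j * pd a (pd b (f.1 e')) (transition e e' x) := by
  have hd := fun a => (h1 a).symm.trans (pd_eq_ev_lift f e' e a
    ⟨transition e e' x, transition_mem_symm hx⟩)
  have hdd := fun a b => pd_pd_eq_ev_lift f e' e a b
    ⟨transition e e' x, transition_mem_symm hx⟩
  rw [pd_pd_eq_ev_lift f e e' i j ⟨x, hx⟩, Density.lift_transform f]
  simp only [Derivation.leibniz, (frameChange e e').chain, smul_eq_mul, map_add, map_mul,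
    Fin.sum_univ_two, ev_pull, ev_jacA, Density.ev_lift, h0, zero_mul, mul_zero, add_zero, ← hd, ← hdd]
  change densFactor w e e' x * _ = _
  ring

end Derivatives

/-! ### The coefficients of a differential operator -/

section Coefficients

variable {l m : ℝ} {A : Density M l →ₗ[ℝ] Density M m} {e : Chart M}
  {a₂ b₂ : Plane → Matrix (Fin 2) (Fin 2) ℝ} {a₁ b₁ : Plane → Fin 2 → ℝ} {a₀ b₀ : Plane → ℝ}

lemma HasExpr.congr (h : HasExpr A e a₂ a₁ a₀) (h₂ : ∀ x ∈ e.1.target, ∀ i j, b₂ x i j = a₂ x i j)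
    (h₁ : ∀ x ∈ e.1.target, ∀ i, b₁ x i = a₁ x i) (h₀ : ∀ x ∈ e.1.target, b₀ x = a₀ x) :
    HasExpr A e b₂ b₁ b₀ := by
  obtain ⟨k₂, k₁, k₀, ks, k⟩ := h
  refine ⟨fun i j => (k₂ i j).congr fun x hx => h₂ x hx i j,
    fun i => (k₁ i).congr fun x hx => h₁ x hx i, k₀.congr h₀, fun x hx i j => ?_, fun f x hx => ?_⟩
  · rw [h₂ x hx, h₂ x hx, ks x hx]
  · simp only [k f x hx, h₂ x hx, h₁ x hx, h₀ x hx]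

lemma HasExpr.unique [T2Space M] (h : HasExpr A e a₂ a₁ a₀) (h' : HasExpr A e b₂ b₁ b₀)
    {x : Plane} (hx : x ∈ e.1.target) :
    (∀ i j, a₂ x i j = b₂ x i j) ∧ (∀ i, a₁ x i = b₁ x i) ∧ a₀ x = b₀ x := by
  obtain ⟨-, -, -, hs, h⟩ := h
  obtain ⟨-, -, -, hs', h'⟩ := h'
  refine ⟨fun i j => ?_, fun i => ?_, ?_⟩
  · obtain ⟨f, f₀, f₁, f₂⟩ := exists_density_hess l hx i j
    have key := (h f x hx).symm.trans (h' f x hx)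
    have q := hs x hx 1 0
    have q' := hs' x hx 1 0
    simp only [f₀, f₁, f₂, Fin.sum_univ_two] at key
    fin_cases i <;> fin_cases j <;> simp at key ⊢ <;> linarith
  · obtain ⟨f, f₀, f₁, f₂⟩ := exists_density_grad l hx i
    simpa [f₀, f₁, f₂] using (h f x hx).symm.trans (h' f x hx)
  · obtain ⟨f, f₀, f₁, f₂⟩ := exists_density_one l hx
    simpa [f₀, f₁, f₂] using (h f x hx).symm.trans (h' f x hx)

lemma hasExpr_zero (e : Chart M) : HasExpr (0 : Density M l →ₗ[ℝ] Density M m) e 0 0 0 :=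
  ⟨fun _ _ => contDiffOn_const, fun _ => contDiffOn_const, contDiffOn_const, fun _ _ _ _ => rfl,
    fun _ _ _ => by simp⟩

open Classical in
/-- The principal coefficients of an operator of order two form a symbol. -/
lemma exists_symbol₂ [T2Space M] (a₂ : Chart M → Plane → Matrix (Fin 2) (Fin 2) ℝ)
    (hA : ∀ e, ∃ a₁ a₀, HasExpr A e (a₂ e) a₁ a₀) :
    ∃ P : Symbol₂ M (m - l), ∀ e, ∃ a₁ a₀, HasExpr A e (P.1 e) a₁ a₀ := by
  refine ⟨⟨fun e x => if x ∈ e.1.target then a₂ e x else 0, fun e i j => ?_, fun e x hx i j => ?_,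
    fun e x i j => ?_, fun e e' x hx a b => ?_⟩, fun e => ?_⟩
  · obtain ⟨a₁, a₀, h⟩ := hA e
    exact (h.1 i j).congr fun x hx => by simp [hx]
  · simp [hx]
  · obtain ⟨a₁, a₀, h⟩ := hA e
    by_cases hx : x ∈ e.1.target
    · simpa [hx] using h.2.2.2.1 x hx i j
    · simp [hx]
  · have hy := overlap_subset _ _ (transition_mem_symm hx)
    obtain ⟨a₁, a₀, -, -, -, hs, h⟩ := hA e
    obtain ⟨b₁, b₀, -, -, -, hs', h'⟩ := hA e'
    -- On a density whose one-jet vanishes the lower coefficients of A are invisible, so the law of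
    -- the density A f is the law of the principal coefficients.
    obtain ⟨f, f₀, f₁, f₂⟩ := exists_density_hess l hy a b
    have key := (A f).2.2.2 e e' x hx
    change _ = densFactor m e e' x * _ at key
    rw [h f x (overlap_subset _ _ hx), h' f _ hy, density_transition f hx] at key
    simp only [pd_transition_of_eq_zero f hx f₀, pd_pd_transition_of_eq_zero f hx f₀ f₁] at key
    have q := hs x (overlap_subset _ _ hx) 1 0
    have q' := hs' _ hy 1 0
    have hm : densFactor m e e' x = densFactor l e e' x * densFactor (m - l) e e' x := by
      rw [densFactor_add _ _ hx]; congr 1; ring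
    have hp := (densFactor_pos l hx).ne'
    change _ = densFactor (m - l) e e' x * _
    simp only [if_pos (overlap_subset _ _ hx), if_pos hy]
    -- The argument contributes a factor of weight l, whose cancellation leaves the weight m-l; the
    -- 2 is that of the test Hessian.
    refine mul_left_cancel₀ (mul_ne_zero two_ne_zero hp) ?_
    rw [hm] at key
    simp only [f₀, f₁, f₂, Fin.sum_univ_two] at key ⊢
    fin_cases a <;> fin_cases b <;> simp [q, q', -mul_eq_mul_left_iff] at key ⊢ <;>
      linear_combination key
  · obtain ⟨a₁, a₀, h⟩ := hA e
    exact ⟨a₁, a₀, h.congr (fun x hx i j => by simp [hx]) (fun _ _ _ => rfl) fun _ _ => rfl⟩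

open Classical in
/-- The principal coefficients of an operator of order one form a symbol. -/
lemma exists_symbol₁ [T2Space M] (a₁ : Chart M → Plane → Fin 2 → ℝ)
    (hA : ∀ e, ∃ a₀, HasExpr A e 0 (a₁ e) a₀) :
    ∃ P : Symbol₁ M (m - l), ∀ e, ∃ a₀, HasExpr A e 0 (P.1 e) a₀ := by
  refine ⟨⟨fun e x => if x ∈ e.1.target then a₁ e x else 0, fun e i => ?_, fun e x hx i => ?_,
    fun e e' x hx a => ?_⟩, fun e => ?_⟩
  · obtain ⟨a₀, h⟩ := hA e
    exact (h.2.1 i).congr fun x hx => by simp [hx]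
  · simp [hx]
  · have hy := overlap_subset _ _ (transition_mem_symm hx)
    obtain ⟨a₀, -, -, -, -, h⟩ := hA e
    obtain ⟨b₀, -, -, -, -, h'⟩ := hA e'
    obtain ⟨f, f₀, f₁, f₂⟩ := exists_density_grad l hy a
    have key := (A f).2.2.2 e e' x hx
    change _ = densFactor m e e' x * _ at key
    rw [h f x (overlap_subset _ _ hx), h' f _ hy, density_transition f hx] at key
    simp only [pd_transition_of_eq_zero f hx f₀] at key
    have hm : densFactor m e e' x = densFactor l e e' x * densFactor (m - l) e e' x := by
      rw [densFactor_add _ _ hx]; congr 1; ring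
    change _ = densFactor (m - l) e e' x * _
    simp only [if_pos (overlap_subset _ _ hx), if_pos hy]
    refine mul_left_cancel₀ (densFactor_pos l hx).ne' ?_
    rw [hm] at key
    simp [f₀, f₁, -mul_eq_mul_left_iff] at key ⊢
    linear_combination key
  · obtain ⟨a₀, h⟩ := hA e
    exact ⟨a₀, h.congr (fun _ _ _ _ => rfl) (fun x hx i => by simp [hx]) fun _ _ => rfl⟩

open Classical in
/-- The coefficient of an operator of order zero is a density. -/
lemma exists_symbol₀ [T2Space M] (a₀ : Chart M → Plane → ℝ) (hA : ∀ e, HasExpr A e 0 0 (a₀ e)) :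
    ∃ P : Density M (m - l), ∀ e, HasExpr A e 0 0 (P.1 e) := by
  refine ⟨⟨fun e x => if x ∈ e.1.target then a₀ e x else 0, fun e => ?_, fun e x hx => ?_,
    fun e e' x hx => ?_⟩, fun e => ?_⟩
  · exact (hA e).2.2.1.congr fun x hx => by simp [hx]
  · simp [hx]
  · have hy := overlap_subset _ _ (transition_mem_symm hx)
    obtain ⟨f, f₀, f₁, f₂⟩ := exists_density_one l hy
    have key := (A f).2.2.2 e e' x hx
    change _ = densFactor m e e' x * _ at key
    rw [(hA e).2.2.2.2 f x (overlap_subset _ _ hx), (hA e').2.2.2.2 f _ hy,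
      density_transition f hx] at key
    have hm : densFactor m e e' x = densFactor l e e' x * densFactor (m - l) e e' x := by
      rw [densFactor_add _ _ hx]; congr 1; ring
    change _ = densFactor (m - l) e e' x * _
    simp only [if_pos (overlap_subset _ _ hx), if_pos hy]
    refine mul_left_cancel₀ (densFactor_pos l hx).ne' ?_
    rw [hm] at key
    simp [f₀, -mul_eq_mul_left_iff] at key
    linear_combination key
  · exact (hA e).congr (fun _ _ _ _ => rfl) (fun _ _ _ => rfl) fun x hx => by simp [hx]

lemma ext_of_hasExpr_zero {A B : DiffOp₂ M l m}
    (h : ∀ e, HasExpr (A.1 + (-1 : ℝ) • B.1) e 0 0 0) : A = B := by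
  refine Subtype.ext (LinearMap.ext fun f => Subtype.ext (funext fun e => funext fun x => ?_))
  by_cases hx : x ∈ e.1.target
  · have key := (h e).2.2.2.2 f x hx
    change (A.1 f).1 e x + (-1) * (B.1 f).1 e x = _ at key
    simp at key
    linarith
  · rw [(A.1 f).2.2.1 e x hx, (B.1 f).2.2.1 e x hx]

end Coefficients

variable {l m : ℝ} {Q : Symbol M (m - l) →ₗ[ℝ] DiffOp₂ M l m}

/-- The components of P are read off in descending degree, each once the higher ones are known to
vanish; coefficients of an operator are unique because test densities exist. -/
lemma PreservesSymbol.eq_zero [T2Space M] (hQ : PreservesSymbol Q) {P : Symbol M (m - l)}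
    (h : (Q P).1 = 0) : P = 0 := by
  have hz : ∀ e, HasExpr (Q P).1 e 0 0 0 := fun e => h ▸ hasExpr_zero e
  have h₂ : P.1 = 0 := Subtype.ext (funext fun e => funext fun x => Matrix.ext fun i j => by
    by_cases hx : x ∈ e.1.target
    · obtain ⟨⟨a₁, a₀, ha⟩, -⟩ := hQ P e
      exact (ha.unique (hz e) hx).1 i j
    · exact P.1.2.2.1 e x hx i j)
  have h₁ : P.2.1 = 0 := Subtype.ext (funext fun e => funext fun x => funext fun i => by
    by_cases hx : x ∈ e.1.target
    · obtain ⟨a₀, ha⟩ := (hQ P e).2.1 h₂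
      exact (ha.unique (hz e) hx).2.1 i
    · exact P.2.1.2.2.1 e x hx i)
  have h₀ : P.2.2 = 0 := Subtype.ext (funext fun e => funext fun x => by
    by_cases hx : x ∈ e.1.target
    · exact (((hQ P e).2.2 h₂ h₁).unique (hz e) hx).2.2
    · exact P.2.2.2.2.1 e x hx)
  exact Prod.ext h₂ (Prod.ext h₁ h₀)

lemma PreservesSymbol.injective [T2Space M] (hQ : PreservesSymbol Q) : Function.Injective Q := by
  intro P P' h
  have hz : (Q (P + (-1 : ℝ) • P')).1 = 0 := by
    rw [map_add, map_smul, h]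
    refine LinearMap.ext fun f => Subtype.ext (funext fun e => funext fun x => ?_)
    change ((Q P').1 f).1 e x + (-1) * ((Q P').1 f).1 e x = 0
    ring
  calc P = P + ((-1 : ℝ) • P' + (1 : ℝ) • P') := by
        rw [← add_smul, neg_add_cancel, zero_smul, add_zero]
    _ = P' := by rw [one_smul, ← add_assoc, hQ.eq_zero hz, zero_add]

/-- The principal coefficients form a symbol; subtracting its image lowers the order, and three such
steps exhaust A. -/
lemma PreservesSymbol.surjective [T2Space M] (hQ : PreservesSymbol Q) :
    Function.Surjective Q := by
  intro A
  have hsub : ∀ (A B : DiffOp₂ M l m) f (x : Plane) (e : Chart M),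
      ((A + (-1 : ℝ) • B).1 f).1 e x = (A.1 f).1 e x - (B.1 f).1 e x := fun A B f x e => by
    change (A.1 f).1 e x + (-1) * (B.1 f).1 e x = _
    ring
  choose a₂ hA using A.2
  obtain ⟨P₂, hP₂⟩ := exists_symbol₂ a₂ hA
  have hB : ∀ e, ∃ a₁ a₀, HasExpr (A + (-1 : ℝ) • Q (P₂, 0, 0)).1 e 0 a₁ a₀ := fun e => by
    obtain ⟨a₁, a₀, h⟩ := hP₂ e
    obtain ⟨b₁, b₀, k⟩ := (hQ (P₂, 0, 0) e).1
    have := h.sub k fun f x => hsub _ _ f x e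
    rw [sub_self] at this
    exact ⟨_, _, this⟩
  choose a₁ hB using hB
  obtain ⟨P₁, hP₁⟩ := exists_symbol₁ a₁ hB
  have hC : ∀ e, ∃ a₀, HasExpr
      ((A + (-1 : ℝ) • Q (P₂, 0, 0)) + (-1 : ℝ) • Q (0, P₁, 0)).1 e 0 0 a₀ := fun e => by
    obtain ⟨a₀, h⟩ := hP₁ e
    obtain ⟨b₀, k⟩ := (hQ (0, P₁, 0) e).2.1 rfl
    have := h.sub k fun f x => hsub _ _ f x e
    rw [sub_self, sub_self] at this
    exact ⟨_, this⟩
  choose a₀ hC using hC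
  obtain ⟨P₀, hP₀⟩ := exists_symbol₀ a₀ hC
  refine ⟨(P₂, 0, 0) + (0, P₁, 0) + (0, 0, P₀), Eq.symm (ext_of_hasExpr_zero fun e => ?_)⟩
  have := (hP₀ e).sub ((hQ (0, 0, P₀) e).2.2 rfl rfl) (C := A.1 + (-1 : ℝ) •
    (Q ((P₂, 0, 0) + (0, P₁, 0) + (0, 0, P₀))).1) fun f x => by
      rw [hsub, hsub, map_add, map_add]
      change (A.1 f).1 e x + (-1) * (((Q (P₂, 0, 0)).1 f).1 e x + ((Q (0, P₁, 0)).1 f).1 e x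
        + ((Q (0, 0, P₀)).1 f).1 e x) = _
      ring
  rwa [sub_self, sub_self, sub_self] at this

theorem PreservesSymbol.bijective [T2Space M] (hQ : PreservesSymbol Q) : Function.Bijective Q :=
  ⟨hQ.injective, hQ.surjective⟩

end Bijective

end ConfQuant

end

/-! ### The theorem -/

open ConfQuant in
theorem theorem3p10 {M : Type*} [TopologicalSpace M] [T2Space M] [ChartedSpace Plane M]
    [IsManifold (𝓡 2) ∞ M]
    (ε : Fin 2 → ℝ) (hε : ∀ i, ε i = 1 ∨ ε i = -1)
    (𝒜 : Set (Chart M)) (h𝒜 : IsConfAtlas ε 𝒜)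
    (g : Metric M) (hg : ∀ φ ∈ 𝒜, ∃ F : M → ℝ, Uniformizes ε g φ F)
    (l m : ℝ) (hδ : m - l ∉ ({2 / 2, (2 + 2) / (2 * 2), 1, (2 + 1) / 2, (2 + 2) / 2} : Set ℝ)) :
    ∃ Q : Symbol M (m - l) ≃ₗ[ℝ] DiffOp₂ M l m,
      ConfEquivariant ε 𝒜 Q.toLinearMap ∧
      PreservesSymbol Q.toLinearMap ∧
      -- uniqueness
      (∀ Q' : Symbol M (m - l) →ₗ[ℝ] DiffOp₂ M l m, PreservesSymbol Q' →
        (ConfEquivariant ε 𝒜 Q' ∨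
          ∃ c ∈ 𝒜, c.1.source = Set.univ ∧ Convex ℝ c.1.target ∧
            EquivariantOn ε Q' c c.1.target) →
        Q' = Q.toLinearMap) ∧
      -- the explicit formula, in arbitrary coordinates
      (∀ φ ∈ 𝒜, ∀ F : M → ℝ, Uniformizes ε g φ F →
        ∀ (P : Symbol₂ M (m - l)) (f : Density M l) (e : Chart M), ∀ x ∈ overlap e φ,
          ((Q (P, 0, 0)).1 f).1 e x
            = surfaceFormula l m (g.comp e) (fun z => F (e.1.symm z)) (P.1 e) (f.1 e) x) := by
  -- In dimension two the first three of the five excluded values coincide.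
  have h1 : m - l ≠ 1 := fun h => hδ (by simp [h])
  have h2 : m - l ≠ 3 / 2 := fun h => hδ (by rw [h]; norm_num)
  have h3 : m - l ≠ 2 := fun h => hδ (by rw [h]; norm_num)
  have hQ := preservesSymbol_quantization (l := l) g (isCotensor_confSchwarzian hε h𝒜 hg) h1
  have hE := confEquivariant_quantization hε h𝒜 hg h1 h2 h3
  exact ⟨LinearEquiv.ofBijective _ hQ.bijective, hE, hQ,
    fun Q' hQ' hE' => eq_of_equivariant hε h𝒜 h1 h2 h3 hQ hQ' hE hE',
    fun φ hφ F hF P f e x hx => quantization_formula hε h𝒜 hg h1 hφ hF P f hx⟩
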